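/- **Computational model.** Time and space are measured on a deterministic word RAM: cells hold integers of at most $w$ bits, and each arithmetic operation ($+,-,\times$, integer division), memory access and test costs one step. Memory is initially $0$ apart from the input. **Exponent.** For real $s\ge 1$, $\omega(s)$ is the infimum of the real numbers $\tau$ such that, for every constant $d$, an $n\times\lceil n^s\rceil$ and a $\lceil n^s\rceil\times n$ integer matrix with entries of absolute value at most $n^d$ can be multiplied in $O(n^\tau)$ time (and memory) on the RAM with words of $O(\log n)$ bits. **Min-Plus-Query-Witness problem.** Two integer matrices $A$ ($n\times m$) and $B$ ($m\times n$) are given for preprocessing. Afterwards arbitrary sequences of queries are answered; a query consists of indices $i,j\in[n]$ and a set $S\subsetneq[m]$, given as a list, and has to be answered by an index $k^*\notin S$ with $A_{i,k^*}+B_{k^*,j}=\min_{k\notin S}(A_{i,k}+B_{k,j})$. **Lemma.** Let $s\ge 1$, $\varepsilon>0$ and $c>0$ be constants. There are a preprocessing algorithm, a query algorithm and constants $C,\kappa$, all depending only on $s,\varepsilon,c$, such that the following holds. Let $n\ge 1$ and $m=\lceil n^s\rceil$, and let $\Delta,W,L$ be positive integers with $1\le\Delta\le\min\{n,W\}$ and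 $L\ge c\,\Delta$. Let $A$ be an $n\times m$ and $B$ an $m\times n$ integer matrix such that for every row $k$ and all columns $j_1,j_2\in[n]$, $$|B_{k,j_1}-B_{k,j_2}|\le W\quad\text{whenever}\quad \lceil j_1/\Delta\rceil=\lceil j_2/\Delta\rceil .$$ Let $b\ge 0$ be an integer such that $W$, $L$ and the absolute values of all entries of $A$ and $B$ are at most $2^b$, and put $\lambda=b+\lfloor\log_2 n\rfloor+1$. On the RAM with words of $C\lambda$ bits, the two algorithms, given $n,m,\Delta,W,L,A,B$, solve the Min-Plus-Query-Witness problem of $A$ and $B$ for queries with $|S|<L$, with preprocessing time at most $$C\lambda^{\kappa}\Bigl(\Delta^2\,\frac{n^s}{L}\,W\,n^{\omega(s)+\varepsilon}+\frac{n^{2+s}}{\Delta}\Bigr),$$ time at most $C\lambda^{\kappa}L$ for each query, and space (number of memory words, up to a constant factor) at most $$C\lambda^{\kappa}\Bigl(\frac{\Delta^2\,W\,n^{2+s}}{L}+\frac{\Delta^2\,n^{1+2s}}{L}+\frac{n^{2+s}}{\Delta}\Bigr)$$ during the preprocessing and all queries. In particular, if all input numbers have $\mathrm{polylog}(n)$ bits,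 the preprocessing time is $\tilde O(\Delta^2\frac{n^s}{L}Wn^{\omega(s)+\varepsilon}+\frac{n^{2+s}}{\Delta})$, the query time is $\tilde O(L)$, and the space is $\tilde O(\frac{\Delta^2Wn^{2+s}}{L}+\frac{\Delta^2n^{1+2s}}{L}+\frac{n^{2+s}}{\Delta})$. -/

import Mathlib

/-!
# Random access machines, the rectangular matrix multiplication exponent, Min-Plus queries

The machine model is the word RAM.  Programs are written in structured form (sequencing,
branching, loops); every elementary instruction and every evaluation of a loop or branch test
costs one step.
-/

namespace MinPlusQuery

/-- The binary arithmetic instructions of the machine. -/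
inductive Op
  | add
  | sub
  | mul
  | div

/-- Value of an arithmetic instruction (`div` is integer division). -/
def Op.eval : Op → ℤ → ℤ → ℤ
  | .add, a, b => a + b
  | .sub, a, b => a - b
  | .mul, a, b => a * b
  | .div, a, b => a / b

/-- Programs of the machine.  A program text is finite, so it mentions finitely many registers
and finitely many arrays. -/
inductive Prog
  /-- do nothing -/
  | skip
  /-- `reg x := c` -/
  | const (x : ℕ) (c : ℤ)
  /-- `reg x := reg y ∘ reg z` -/
  | arith (x : ℕ) (o : Op) (y z : ℕ)
  /-- `reg x := arr a [reg y]` -/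
  | load (x a y : ℕ)
  /-- `arr a [reg y] := reg z` -/
  | store (a y z : ℕ)
  /-- sequential composition -/
  | seq (p q : Prog)
  /-- if `reg x > 0` then `p` else `q` -/
  | ite (x : ℕ) (p q : Prog)
  /-- while `reg x > 0` do `p` -/
  | loop (x : ℕ) (p : Prog)

/-- The content of the machine's storage: registers, and arrays of random access memory. -/
@[ext]
structure State where
  reg : ℕ → ℤ
  arr : ℕ → ℕ → ℤ

/-- Write the value `v` into register `x`. -/
def State.setReg (σ : State) (x : ℕ) (v : ℤ) : State :=
  { σ with reg := Function.update σ.reg x v }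

/-- Write the value `v` into cell `i` of array `a`. -/
def State.setArr (σ : State) (a i : ℕ) (v : ℤ) : State :=
  { σ with arr := Function.update σ.arr a (Function.update (σ.arr a) i v) }

/-- `Exec w M p σ t σ'`: on the machine with word length `w` and with `M` words of memory in each
array, the program `p` started in state `σ` halts in state `σ'` after `t` steps.  An instruction
whose result does not fit in a word, or which addresses a cell outside `0, …, M - 1`, cannot be
executed, and a program that attempts it has no run. -/
inductive Exec (w M : ℕ) : Prog → State → ℕ → State → Prop
  | skip (σ : State) : Exec w M .skip σ 1 σ
  | const (σ : State) (x : ℕ) (c : ℤ) (hc : |c| < 2 ^ w) :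
      Exec w M (.const x c) σ 1 (σ.setReg x c)
  | arith (σ : State) (x : ℕ) (o : Op) (y z : ℕ) (h : |o.eval (σ.reg y) (σ.reg z)| < 2 ^ w) :
      Exec w M (.arith x o y z) σ 1 (σ.setReg x (o.eval (σ.reg y) (σ.reg z)))
  | load (σ : State) (x a y i : ℕ) (hi : σ.reg y = i) (hM : i < M) :
      Exec w M (.load x a y) σ 1 (σ.setReg x (σ.arr a i))
  | store (σ : State) (a y z i : ℕ) (hi : σ.reg y = i) (hM : i < M) :
      Exec w M (.store a y z) σ 1 (σ.setArr a i (σ.reg z))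
  | seq {p q : Prog} {σ σ' σ'' : State} {t u : ℕ} (hp : Exec w M p σ t σ')
      (hq : Exec w M q σ' u σ'') : Exec w M (.seq p q) σ (t + u) σ''
  | ite_pos {x : ℕ} {p q : Prog} {σ σ' : State} {t : ℕ} (hx : 0 < σ.reg x)
      (hp : Exec w M p σ t σ') : Exec w M (.ite x p q) σ (t + 1) σ'
  | ite_neg {x : ℕ} {p q : Prog} {σ σ' : State} {t : ℕ} (hx : ¬ 0 < σ.reg x)
      (hq : Exec w M q σ t σ') : Exec w M (.ite x p q) σ (t + 1) σ'
  | loop_done {x : ℕ} {p : Prog} {σ : State} (hx : ¬ 0 < σ.reg x) :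
      Exec w M (.loop x p) σ 1 σ
  | loop_step {x : ℕ} {p : Prog} {σ σ' σ'' : State} {t u : ℕ} (hx : 0 < σ.reg x)
      (hp : Exec w M p σ t σ') (hl : Exec w M (.loop x p) σ' u σ'') :
      Exec w M (.loop x p) σ (t + u + 1) σ''

/-- The matrix `A`, stored row by row in consecutive cells (all further cells are `0`). -/
def rowMajor {p q : ℕ} (A : Matrix (Fin p) (Fin q) ℤ) (a : ℕ) : ℤ :=
  if h : a < p * q then
    A (Fin.divNat (⟨a, h⟩ : Fin (p * q))) (Fin.modNat (⟨a, h⟩ : Fin (p * q)))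
  else 0

/-- The initial state with the numbers of the list `l` in the registers `0, 1, …`, the matrix `A`
in array `0` and the matrix `B` in array `1`; everything else is `0`. -/
def inputState {n m : ℕ} (l : List ℤ) (A : Matrix (Fin n) (Fin m) ℤ)
    (B : Matrix (Fin m) (Fin n) ℤ) : State where
  reg x := l.getD x 0
  arr a := if a = 0 then rowMajor A else if a = 1 then rowMajor B else fun _ => 0

/-- `n × ⌈n ^ s⌉` by `⌈n ^ s⌉ × n` integer matrices with entries of `O(log n)` bits can be
multiplied in `O(n ^ τ)` time on the RAM with words of `O(log n)` bits.  The memory is as large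
as the time bound: a run of `T` steps meets at most `T` cells, which can be kept in a search tree
of size `O(T)` with logarithmic overhead per step, so this does not affect the exponent.

The program is given `n` and `m = ⌈n ^ s⌉` in registers `0`, `1` and the two matrices in arrays
`0`, `1`; it leaves the product in array `2`, row by row. -/
def MatMulInTime (s τ : ℝ) : Prop :=
  ∀ d : ℕ, ∃ (p : Prog) (C : ℕ), ∀ n m : ℕ, 1 ≤ n → m = ⌈(n : ℝ) ^ s⌉₊ →
    ∀ (A : Matrix (Fin n) (Fin m) ℤ) (B : Matrix (Fin m) (Fin n) ℤ),
      (∀ i k, |A i k| ≤ (n : ℤ) ^ d) → (∀ k j, |B k j| ≤ (n : ℤ) ^ d) →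
      ∃ (t : ℕ) (σ : State),
        Exec (C * (Nat.log 2 n + 1)) ⌊(C : ℝ) * (n : ℝ) ^ τ⌋₊ p
          (inputState [(n : ℤ), (m : ℤ)] A B) t σ ∧
        (t : ℝ) ≤ C * (n : ℝ) ^ τ ∧
        ∀ i j : Fin n, σ.arr 2 (i * n + j) = (A * B) i j

/-- The exponent `ω(s)` of multiplying an `n × n ^ s` matrix by an `n ^ s × n` matrix. -/
noncomputable def omega (s : ℝ) : ℝ :=
  sInf {τ : ℝ | MatMulInTime s τ}

/-- A query `(i, j, S)`: two outer indices and a finite set `S` of inner indices, which is handed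
over as a list of its elements, without repetition, in any order. -/
structure Query (n m : ℕ) where
  i : Fin n
  j : Fin n
  S : List (Fin m)
  nodup : S.Nodup

/-- A query reaches the machine: `i`, `j`, `|S|` are written into registers `5`, `6`, `7`, and the
elements of `S` into the first `|S|` cells of array `2`.  The rest of the storage is kept. -/
def State.putQuery {n m : ℕ} (σ : State) (q : Query n m) : State where
  reg x := if x = 5 then (q.i : ℤ) else if x = 6 then (q.j : ℤ)
    else if x = 7 then (q.S.length : ℤ) else σ.reg x
  arr a c := if a = 2 then
      if h : c < q.S.length then ((q.S[c] : ℕ) : ℤ) else σ.arr 2 c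
    else σ.arr a c

/-- `k` is a correct answer to the query `(i, j, S)`: it lies outside `S` and attains
`min_{k ∉ S} (A i k + B k j)`. -/
def IsWitness {n m : ℕ} (A : Matrix (Fin n) (Fin m) ℤ) (B : Matrix (Fin m) (Fin n) ℤ)
    (q : Query n m) (k : Fin m) : Prop :=
  k ∉ q.S ∧ ∀ k' : Fin m, k' ∉ q.S → A q.i k + B k q.j ≤ A q.i k' + B k' q.j

/-- Starting from the stored state `σ`, the query program `p` answers the queries of the list one
after the other, each correctly (answer in register `8`) and each in at most `T` steps; every
query starts from the storage that the previous one left behind. -/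
def Serves {n m : ℕ} (w M : ℕ) (p : Prog) (A : Matrix (Fin n) (Fin m) ℤ)
    (B : Matrix (Fin m) (Fin n) ℤ) (T : ℝ) : State → List (Query n m) → Prop
  | _, [] => True
  | σ, q :: qs => ∃ (t : ℕ) (σ' : State),
      Exec w M p (σ.putQuery q) t σ' ∧ (t : ℝ) ≤ T ∧
      (∃ k : Fin m, σ'.reg 8 = ((k : ℕ) : ℤ) ∧ IsWitness A B q k) ∧
      Serves w M p A B T σ' qs

/-- The pair of programs `(prep, query)` solves the Min-Plus-Query-Witness problem for the
matrices `A`, `B` and for queries with `|S| < L`, on the machine with word length `w` and `M`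
words of memory per array, with preprocessing time at most `T₀` and query time at most `T₁`.
The numbers `n, m` and the parameters in `par` are given to the preprocessing in registers
`0, 1, 2, …`.  A query has an answer only if `S` is not the whole index set. -/
def SolvesQueryWitness {n m : ℕ} (w M : ℕ) (prep query : Prog) (par : List ℤ)
    (A : Matrix (Fin n) (Fin m) ℤ) (B : Matrix (Fin m) (Fin n) ℤ) (L : ℕ) (T₀ T₁ : ℝ) : Prop :=
  ∃ (t : ℕ) (σ : State),
    Exec w M prep (inputState ((n : ℤ) :: (m : ℤ) :: par) A B) t σ ∧ (t : ℝ) ≤ T₀ ∧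
    ∀ qs : List (Query n m), (∀ q ∈ qs, q.S.length < L ∧ ∃ k : Fin m, k ∉ q.S) →
      Serves w M query A B T₁ σ qs

/-- Bounded differences: in each row, entries in the same block of `Δ` consecutive columns differ
by at most `W`.  Columns are numbered from `0` here, so that column `j` is the `(j + 1)`-st and
`⌈(j + 1) / Δ⌉ = ⌊j / Δ⌋ + 1`. -/
def BoundedDiff {n m : ℕ} (B : Matrix (Fin m) (Fin n) ℤ) (Δ W : ℕ) : Prop :=
  ∀ (k : Fin m) (j₁ j₂ : Fin n), (j₁ : ℕ) / Δ = (j₂ : ℕ) / Δ → |B k j₁ - B k j₂| ≤ W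

end MinPlusQuery

namespace MinPlusQuery

lemma abs_cast_le {x X : ℕ} (h : x ≤ X) : |(x : ℤ)| ≤ X := by
  rw [Nat.abs_cast]; exact_mod_cast h

/-! ## A small structured language on top of the machine -/

/-- Arithmetic expressions over registers and array cells. -/
inductive Ex
  | c (z : ℤ)
  | r (x : ℕ)
  | op (o : Op) (a b : Ex)
  | ld (a : ℕ) (e : Ex)

namespace Ex

instance : Add Ex := ⟨op .add⟩
instance : Sub Ex := ⟨op .sub⟩
instance : Mul Ex := ⟨op .mul⟩
instance : Div Ex := ⟨op .div⟩
instance (k : ℕ) : OfNat Ex k := ⟨c k⟩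

/-- The value of an expression. -/
def eval (σ : State) : Ex → ℤ
  | c z => z
  | r x => σ.reg x
  | op o a b => o.eval (a.eval σ) (b.eval σ)
  | ld a e => σ.arr a (e.eval σ).toNat

/-- All addresses met during the evaluation are below `M`. -/
def ok (M : ℕ) (σ : State) : Ex → Prop
  | c _ => True
  | r _ => True
  | op _ a b => a.ok M σ ∧ b.ok M σ
  | ld _ e => e.ok M σ ∧ 0 ≤ e.eval σ ∧ e.eval σ < M

/-- Number of leaves, an indexed cell counting as a leaf. -/
def leaves : Ex → ℕ
  | c _ => 1
  | r _ => 1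
  | op _ a b => a.leaves + b.leaves
  | ld _ _ => 1

/-- Small constants, program registers only, few leaves. -/
def wf : Ex → Bool
  | c z => decide (z.natAbs ≤ 16)
  | r x => decide (x < 60)
  | op _ a b => a.wf && b.wf && decide (a.leaves + b.leaves ≤ 16)
  | ld _ e => e.wf

/-- Number of machine steps needed for the evaluation. -/
def cost : Ex → ℕ
  | c _ => 1
  | r _ => 2
  | op _ a b => a.cost + b.cost + 1
  | ld _ e => e.cost + 1

/-- Evaluate into register `x` with scratch registers `t, t + 2, …`. -/
def compile : Ex → ℕ → ℕ → Prog
  | c z, x, _ => .const x z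
  | r y, x, t => .seq (.const t 0) (.arith x .add y t)
  | op o a b, x, t =>
      .seq (.seq (a.compile t (t + 2)) (b.compile (t + 2) (t + 4))) (.arith x o t (t + 2))
  | ld a e, x, t => .seq (e.compile t (t + 2)) (.load x a t)

section simp
variable (σ : State) (M : ℕ) (a b : Ex) (k x : ℕ)

@[simp] lemma eval_c (z : ℤ) : (c z).eval σ = z := rfl
@[simp] lemma eval_r : (r x).eval σ = σ.reg x := rfl
@[simp] lemma eval_add : (a + b).eval σ = a.eval σ + b.eval σ := rfl
@[simp] lemma eval_sub : (a - b).eval σ = a.eval σ - b.eval σ := rfl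
@[simp] lemma eval_mul : (a * b).eval σ = a.eval σ * b.eval σ := rfl
@[simp] lemma eval_div : (a / b).eval σ = a.eval σ / b.eval σ := rfl
@[simp] lemma eval_zero : (0 : Ex).eval σ = 0 := rfl
@[simp] lemma eval_one : (1 : Ex).eval σ = 1 := rfl
@[simp] lemma eval_ofNat [k.AtLeastTwo] : (no_index (OfNat.ofNat k) : Ex).eval σ = OfNat.ofNat k :=
  rfl
@[simp] lemma eval_ld : (ld k a).eval σ = σ.arr k (a.eval σ).toNat := rfl
@[simp] lemma ok_c (z : ℤ) : (c z).ok M σ ↔ True := Iff.rfl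
@[simp] lemma ok_r : (r x).ok M σ ↔ True := Iff.rfl
@[simp] lemma ok_add : (a + b).ok M σ ↔ a.ok M σ ∧ b.ok M σ := Iff.rfl
@[simp] lemma ok_sub : (a - b).ok M σ ↔ a.ok M σ ∧ b.ok M σ := Iff.rfl
@[simp] lemma ok_mul : (a * b).ok M σ ↔ a.ok M σ ∧ b.ok M σ := Iff.rfl
@[simp] lemma ok_div : (a / b).ok M σ ↔ a.ok M σ ∧ b.ok M σ := Iff.rfl
@[simp] lemma ok_zero : (0 : Ex).ok M σ ↔ True := Iff.rfl
@[simp] lemma ok_one : (1 : Ex).ok M σ ↔ True := Iff.rfl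
@[simp] lemma ok_ofNat [k.AtLeastTwo] : (no_index (OfNat.ofNat k) : Ex).ok M σ ↔ True := Iff.rfl
@[simp] lemma ok_ld : (ld k a).ok M σ ↔ a.ok M σ ∧ 0 ≤ a.eval σ ∧ a.eval σ < M := Iff.rfl

end simp

lemma one_le_leaves (e : Ex) : 1 ≤ e.leaves := by
  induction e <;> simp [leaves]; omega

end Ex

namespace State

@[simp] lemma reg_setReg (σ : State) (x y : ℕ) (v : ℤ) :
    (σ.setReg x v).reg y = if y = x then v else σ.reg y := by
  simp [setReg, Function.update_apply]
@[simp] lemma arr_setReg (σ : State) (x : ℕ) (v : ℤ) : (σ.setReg x v).arr = σ.arr := rfl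
@[simp] lemma reg_setArr (σ : State) (a i : ℕ) (v : ℤ) : (σ.setArr a i v).reg = σ.reg := rfl
@[simp] lemma arr_setArr (σ : State) (a i b : ℕ) (v : ℤ) :
    (σ.setArr a i v).arr b = if b = a then Function.update (σ.arr a) i v else σ.arr b := by
  simp [setArr, Function.update_apply]

end State

/-- Scratch registers of the compiler. -/
def tmp (y : ℕ) : Bool := decide (60 ≤ y) && decide (y % 2 = 0)

/-- Every number in the storage is bounded by `X`. -/
structure Good (X : ℕ) (σ : State) : Prop where
  reg : ∀ y, tmp y = false → |σ.reg y| ≤ X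
  arr : ∀ a i, |σ.arr a i| ≤ X

/-- Equality of states up to scratch registers. -/
structure Eqv (σ τ : State) : Prop where
  reg : ∀ y, tmp y = false → σ.reg y = τ.reg y
  arr : σ.arr = τ.arr

lemma Eqv.refl (σ : State) : Eqv σ σ := ⟨fun _ _ => rfl, rfl⟩
lemma Eqv.symm {σ τ : State} (h : Eqv σ τ) : Eqv τ σ := ⟨fun y hy => (h.reg y hy).symm, h.arr.symm⟩
lemma Eqv.trans {σ τ υ : State} (h : Eqv σ τ) (h' : Eqv τ υ) : Eqv σ υ :=
  ⟨fun y hy => (h.reg y hy).trans (h'.reg y hy), h.arr.trans h'.arr⟩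
lemma Eqv.good {X : ℕ} {σ τ : State} (h : Eqv σ τ) (hg : Good X σ) : Good X τ :=
  ⟨fun y hy => by rw [← h.reg y hy]; exact hg.reg y hy, fun a i => by rw [← h.arr]; exact hg.arr a i⟩

lemma tmp_of_lt {y : ℕ} (h : y < 60) : tmp y = false := by simp [tmp]; omega

lemma Eqv.eval {σ τ : State} (h : Eqv σ τ) {e : Ex} (he : e.wf = true) :
    e.eval σ = e.eval τ := by
  induction e with
  | c z => rfl
  | r x => exact h.reg x (tmp_of_lt (by simpa [Ex.wf] using he))
  | op o a b iha ihb =>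
    simp only [Ex.wf, Bool.and_eq_true] at he
    simp [Ex.eval, iha he.1.1, ihb he.1.2]
  | ld a e ih => simp only [Ex.wf] at he; simp [Ex.eval, ih he, h.arr]

lemma Eqv.ok {M : ℕ} {σ τ : State} (h : Eqv σ τ) {e : Ex} (he : e.wf = true) (ho : e.ok M σ) :
    e.ok M τ := by
  induction e with
  | c z => trivial
  | r x => trivial
  | op o a b iha ihb =>
    simp only [Ex.wf, Bool.and_eq_true] at he
    exact ⟨iha he.1.1 ho.1, ihb he.1.2 ho.2⟩
  | ld a e ih =>
    simp only [Ex.wf] at he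
    refine ⟨ih he ho.1, ?_, ?_⟩
    · rw [← h.eval he]; exact ho.2.1
    · rw [← h.eval he]; exact ho.2.2

lemma Good.abs_eval_le {X : ℕ} (hX : 16 ≤ X) {σ : State} (hg : Good X σ) {e : Ex}
    (he : e.wf = true) : |e.eval σ| ≤ (X : ℤ) ^ e.leaves := by
  have key : ∀ {u v : ℤ} {a b : ℕ}, 1 ≤ a → 1 ≤ b → |u| ≤ (X : ℤ) ^ a → |v| ≤ (X : ℤ) ^ b →
      |u| + |v| ≤ (X : ℤ) ^ (a + b) := by
    intro u v a b ha hb hu hv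
    have h2 : (2 : ℤ) ≤ X := by exact_mod_cast (by omega : 2 ≤ X)
    have h1 : (2 : ℤ) ≤ (X : ℤ) ^ a := h2.trans (le_self_pow₀ (by omega) (by omega))
    have h3 : (2 : ℤ) ≤ (X : ℤ) ^ b := h2.trans (le_self_pow₀ (by omega) (by omega))
    rw [pow_add]; nlinarith
  induction e with
  | c z =>
    simp only [Ex.wf, decide_eq_true_eq] at he
    simp only [Ex.eval, Ex.leaves, pow_one, Int.abs_eq_natAbs]; omega
  | r x => simpa [Ex.leaves] using hg.reg x (tmp_of_lt (by simpa [Ex.wf] using he))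
  | op o a b iha ihb =>
    simp only [Ex.wf, Bool.and_eq_true] at he
    have ha := iha he.1.1
    have hb := ihb he.1.2
    have hs := key a.one_le_leaves b.one_le_leaves ha hb
    cases o with
    | add => exact (abs_add_le _ _).trans hs
    | sub => exact (abs_sub _ _).trans hs
    | mul =>
      simp only [Ex.eval, Op.eval, Ex.leaves, abs_mul, pow_add]
      exact mul_le_mul ha hb (abs_nonneg _) (by positivity)
    | div =>
      simp only [Ex.eval, Op.eval, Ex.leaves]
      exact (Int.abs_ediv_le_abs _ _).trans (ha.trans
        (pow_le_pow_right₀ (by exact_mod_cast (by omega : 1 ≤ X)) (by omega)))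
  | ld a e ih => simpa [Ex.leaves] using hg.arr _ _

/-- Word length, memory size and a bound for the stored numbers. -/
structure Mach where
  w : ℕ
  M : ℕ
  X : ℕ
  hX : 16 ≤ X
  hw : X ^ 16 < 2 ^ w

lemma Ex.leaves_le {e : Ex} (he : e.wf = true) : e.leaves ≤ 16 := by
  cases e <;> simp_all [Ex.wf, Ex.leaves]

lemma Mach.abs_eval_lt (m : Mach) {σ : State} (hg : Good m.X σ) {e : Ex} (he : e.wf = true) :
    |e.eval σ| < 2 ^ m.w := by
  have h1 : (1 : ℤ) ≤ m.X := by exact_mod_cast (by have := m.hX; omega : 1 ≤ m.X)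
  calc |e.eval σ| ≤ (m.X : ℤ) ^ e.leaves := hg.abs_eval_le m.hX he
    _ ≤ (m.X : ℤ) ^ 16 := pow_le_pow_right₀ h1 (Ex.leaves_le he)
    _ < 2 ^ m.w := by exact_mod_cast m.hw

lemma Ex.compile_exec (m : Mach) {e : Ex} (he : e.wf = true) : ∀ (x t : ℕ) (τ : State),
    Good m.X τ → e.ok m.M τ → 60 ≤ t → t % 2 = 0 →
    ∃ τ', Exec m.w m.M (e.compile x t) τ e.cost τ' ∧ τ'.arr = τ.arr ∧ τ'.reg x = e.eval τ ∧
      ∀ y, y ≠ x → (y < t ∨ y % 2 = 1) → τ'.reg y = τ.reg y := by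
  have X1 := m.hX
  have hpow : (m.X : ℤ) < 2 ^ m.w := by
    have : m.X ^ 1 ≤ m.X ^ 16 := Nat.pow_le_pow_right (by omega) (by omega)
    exact_mod_cast (by simpa using this : m.X ≤ m.X ^ 16).trans_lt m.hw
  induction e with
  | c z =>
    intro x t τ hg _ _ _
    refine ⟨τ.setReg x z, .const _ _ _ ?_, rfl, by simp, fun y hy _ => by simp [hy]⟩
    exact m.abs_eval_lt hg he
  | r y =>
    intro x t τ hg _ ht _
    have hy : y < 60 := by simpa [Ex.wf] using he
    have hne : y ≠ t := by omega
    refine ⟨(τ.setReg t 0).setReg x (τ.reg y), ?_, rfl, by simp, fun y' hy' h => ?_⟩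
    · refine Exec.seq (t := 1) (u := 1) (.const _ _ _ (by simp)) ?_
      have := Exec.arith (w := m.w) (M := m.M) (τ.setReg t 0) x .add y t (by
        simpa [Op.eval, hne] using (hg.reg y (tmp_of_lt hy)).trans_lt hpow)
      simpa [Op.eval, hne] using this
    · have : y' ≠ t := by omega
      simp [hy', this]
  | op o a b iha ihb =>
    intro x t τ hg ho ht ht2
    have he' := he
    simp only [Ex.wf, Bool.and_eq_true] at he'
    obtain ⟨τ1, h1, h1a, h1x, h1y⟩ := iha he'.1.1 t (t + 2) τ hg ho.1 (by omega) (by omega)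
    have e1 : Eqv τ τ1 := ⟨fun y hy => by
      simp only [tmp, Bool.and_eq_false_imp, decide_eq_true_eq, decide_eq_false_iff_not] at hy
      refine (h1y y ?_ ?_).symm <;> by_cases h60 : 60 ≤ y
      · have := hy h60; omega
      · omega
      · have := hy h60; omega
      · omega, h1a.symm⟩
    obtain ⟨τ2, h2, h2a, h2x, h2y⟩ := ihb he'.1.2 (t + 2) (t + 4) τ1 (e1.good hg)
      (e1.ok he'.1.2 ho.2) (by omega) (by omega)
    have hv : o.eval (τ2.reg t) (τ2.reg (t + 2)) = (Ex.op o a b).eval τ := by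
      rw [h2y t (by omega) (by omega), h1x, h2x, ← e1.eval he'.1.2]; rfl
    refine ⟨τ2.setReg x ((Ex.op o a b).eval τ), ?_, ?_, by simp, fun y hy h => ?_⟩
    · refine Exec.seq (h1.seq h2) ?_
      have := Exec.arith (w := m.w) (M := m.M) τ2 x o t (t + 2) (by
        rw [hv]; exact m.abs_eval_lt hg he)
      rwa [hv] at this
    · simp [h2a, h1a]
    · have e1 : y ≠ t := by omega
      have e2 : y ≠ t + 2 := by omega
      simp [hy, h2y y e2 (by omega), h1y y e1 (by omega)]
  | ld a e ih =>
    intro x t τ hg ho ht ht2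
    simp only [Ex.wf] at he
    obtain ⟨τ1, h1, h1a, h1x, h1y⟩ := ih he t (t + 2) τ hg ho.1 (by omega) (by omega)
    refine ⟨τ1.setReg x ((Ex.ld a e).eval τ), ?_, by simp [h1a], by simp, fun y hy h => ?_⟩
    · refine Exec.seq h1 ?_
      have h0 : 0 ≤ e.eval τ := ho.2.1
      have hM : e.eval τ < m.M := ho.2.2
      have := Exec.load (w := m.w) (M := m.M) τ1 x a t (e.eval τ).toNat (by rw [h1x]; omega)
        (by omega)
      simpa [h1a, Ex.eval] using this
    · have e1 : y ≠ t := by omega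
      simp [hy, h1y y e1 (by omega)]

/-- Renaming of registers and arrays, which moves a program out of the way of the others. -/
def Prog.shift : Prog → Prog
  | .skip => .skip
  | .const x c => .const (61 + 2 * x) c
  | .arith x o y z => .arith (61 + 2 * x) o (61 + 2 * y) (61 + 2 * z)
  | .load x a y => .load (61 + 2 * x) (50 + a) (61 + 2 * y)
  | .store a y z => .store (50 + a) (61 + 2 * y) (61 + 2 * z)
  | .seq p q => .seq p.shift q.shift
  | .ite x p q => .ite (61 + 2 * x) p.shift q.shift
  | .loop x p => .loop (61 + 2 * x) p.shift

/-- Statements: assignment, assignment of an arbitrary constant, array assignment, control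
structures, and a renamed machine program. -/
inductive Stmt
  | skip
  | asg (x : ℕ) (e : Ex)
  | asgc (x : ℕ) (z : ℤ)
  | sto (a : ℕ) (e₁ e₂ : Ex)
  | seq (s t : Stmt)
  | ite (e : Ex) (s t : Stmt)
  | whl (e : Ex) (s : Stmt)
  | raw (p : Prog)

namespace Stmt

/-- Translation into a machine program. -/
def compile : Stmt → Prog
  | skip => .skip
  | asg x e => e.compile x 60
  | asgc x z => .const x z
  | sto a e₁ e₂ => .seq (.seq (e₁.compile 60 62) (e₂.compile 62 64)) (.store a 60 62)
  | seq s t => .seq s.compile t.compile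
  | ite e s t => .seq (e.compile 60 62) (.ite 60 s.compile t.compile)
  | whl e s => .seq (e.compile 60 62) (.loop 60 (.seq s.compile (e.compile 60 62)))
  | raw p => p.shift

/-- The registers a statement may change. -/
def wrR : Stmt → ℕ → Bool
  | skip, _ => false
  | asg x _, y => decide (y = x)
  | asgc x _, y => decide (y = x)
  | sto _ _ _, _ => false
  | seq s t, y => s.wrR y || t.wrR y
  | ite _ s t, y => s.wrR y || t.wrR y
  | whl _ s, y => s.wrR y
  | raw _, y => decide (60 ≤ y)

/-- The arrays a statement may change. -/
def wrA : Stmt → ℕ → Bool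
  | skip, _ => false
  | asg _ _, _ => false
  | asgc _ _, _ => false
  | sto a _ _, b => decide (b = a)
  | seq s t, y => s.wrA y || t.wrA y
  | ite _ s t, y => s.wrA y || t.wrA y
  | whl _ s, y => s.wrA y
  | raw _, b => decide (50 ≤ b)

end Stmt

infixr:55 " ;; " => Stmt.seq

/-- `σ'` differs from `σ` only where the statement may write. -/
structure Fr (s : Stmt) (σ σ' : State) : Prop where
  reg : ∀ y, tmp y = false → s.wrR y = false → σ'.reg y = σ.reg y
  arr : ∀ a, s.wrA a = false → σ'.arr a = σ.arr a

/-- A machine program leaves register `y` alone. -/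
def Prog.wrR : Prog → ℕ → Prop
  | .skip, _ => False
  | .const x _, y => y = x
  | .arith x _ _ _, y => y = x
  | .load x _ _, y => y = x
  | .store _ _ _, _ => False
  | .seq p q, y => p.wrR y ∨ q.wrR y
  | .ite _ p q, y => p.wrR y ∨ q.wrR y
  | .loop _ p, y => p.wrR y

/-- A machine program leaves array `a` alone. -/
def Prog.wrA : Prog → ℕ → Prop
  | .skip, _ => False
  | .const _ _, _ => False
  | .arith _ _ _ _, _ => False
  | .load _ _ _, _ => False
  | .store a _ _, b => b = a
  | .seq p q, y => p.wrA y ∨ q.wrA y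
  | .ite _ p q, y => p.wrA y ∨ q.wrA y
  | .loop _ p, y => p.wrA y

lemma Exec.reg_eq {w M t : ℕ} {p : Prog} {σ σ' : State} (h : Exec w M p σ t σ') {y : ℕ} :
    ¬ p.wrR y → σ'.reg y = σ.reg y := by
  induction h with
  | seq hp hq ihp ihq => intro hn; simp only [Prog.wrR, not_or] at hn; rw [ihq hn.2, ihp hn.1]
  | ite_pos _ _ ih => intro hn; simp only [Prog.wrR, not_or] at hn; exact ih hn.1
  | ite_neg _ _ ih => intro hn; simp only [Prog.wrR, not_or] at hn; exact ih hn.2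
  | loop_step _ _ _ ih1 ih2 => intro hn; rw [ih2 hn, ih1 hn]
  | _ => intro hn; simp_all [Prog.wrR]

lemma Exec.arr_eq {w M t : ℕ} {p : Prog} {σ σ' : State} (h : Exec w M p σ t σ') {a : ℕ} :
    ¬ p.wrA a → σ'.arr a = σ.arr a := by
  induction h with
  | seq hp hq ihp ihq => intro hn; simp only [Prog.wrA, not_or] at hn; rw [ihq hn.2, ihp hn.1]
  | ite_pos _ _ ih => intro hn; simp only [Prog.wrA, not_or] at hn; exact ih hn.1
  | ite_neg _ _ ih => intro hn; simp only [Prog.wrA, not_or] at hn; exact ih hn.2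
  | loop_step _ _ _ ih1 ih2 => intro hn; rw [ih2 hn, ih1 hn]
  | _ => intro hn; simp_all [Prog.wrA]

lemma Ex.wrR_compile {e : Ex} : ∀ {x t y : ℕ}, 60 ≤ t → t % 2 = 0 → tmp y = false →
    (e.compile x t).wrR y → y = x := by
  have key : ∀ {t y : ℕ}, 60 ≤ t → t % 2 = 0 → tmp y = false → y ≠ t := by
    rintro t y h1 h2 h3 rfl; simp [tmp] at h3; omega
  induction e with
  | c z => intro x t y _ _ _ h; exact h
  | r z => intro x t y h1 h2 h3 h; exact h.resolve_left (key h1 h2 h3)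
  | op o a b iha ihb =>
    intro x t y h1 h2 h3 h
    rcases h with (h | h) | h
    · exact absurd (iha (by omega) (by omega) h3 h) (key h1 h2 h3)
    · exact absurd (ihb (by omega) (by omega) h3 h) (key (by omega) (by omega) h3)
    · exact h
  | ld a e ih =>
    intro x t y h1 h2 h3 h
    rcases h with h | h
    · exact absurd (ih (by omega) (by omega) h3 h) (key h1 h2 h3)
    · exact h

lemma Ex.wrA_compile {e : Ex} : ∀ {x t a : ℕ}, ¬ (e.compile x t).wrA a := by
  induction e <;> intros <;> simp_all [Ex.compile, Prog.wrA]

lemma Prog.wrR_shift {p : Prog} {y : ℕ} (h : p.shift.wrR y) : 60 ≤ y := by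
  induction p <;> simp_all [Prog.shift, Prog.wrR] <;> first | omega | (rcases h with h | h <;> simp_all)

lemma Prog.wrA_shift {p : Prog} {y : ℕ} (h : p.shift.wrA y) : 50 ≤ y := by
  induction p <;> simp_all [Prog.shift, Prog.wrA] <;> first | omega | (rcases h with h | h <;> simp_all)

lemma Stmt.wrR_compile {s : Stmt} {y : ℕ} (hy : tmp y = false) (h : s.compile.wrR y) :
    s.wrR y = true := by
  have n60 : y ≠ 60 := by rintro rfl; simp [tmp] at hy
  have n62 : y ≠ 62 := by rintro rfl; simp [tmp] at hy
  induction s with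
  | skip => exact h.elim
  | asg x e => simpa [Stmt.wrR] using Ex.wrR_compile (by omega) (by omega) hy h
  | asgc x z => exact decide_eq_true (show y = x from h)
  | sto a e₁ e₂ =>
    rcases h with (h | h) | h
    · exact absurd (Ex.wrR_compile (by omega) (by omega) hy h) n60
    · exact absurd (Ex.wrR_compile (by omega) (by omega) hy h) n62
    · exact h.elim
  | seq s t ihs iht =>
    rcases h with h | h
    · simp [Stmt.wrR, ihs h]
    · simp [Stmt.wrR, iht h]
  | ite e s t ihs iht =>
    rcases h with h | h | h
    · exact absurd (Ex.wrR_compile (by omega) (by omega) hy h) n60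
    · simp [Stmt.wrR, ihs h]
    · simp [Stmt.wrR, iht h]
  | whl e s ih =>
    rcases h with h | h | h
    · exact absurd (Ex.wrR_compile (by omega) (by omega) hy h) n60
    · simp [Stmt.wrR, ih h]
    · exact absurd (Ex.wrR_compile (by omega) (by omega) hy h) n60
  | raw p => simpa [Stmt.wrR] using Prog.wrR_shift h

lemma Stmt.wrA_compile {s : Stmt} {y : ℕ} (h : s.compile.wrA y) : s.wrA y = true := by
  induction s with
  | skip => exact h.elim
  | asg x e => exact absurd h Ex.wrA_compile
  | asgc x z => exact h.elim
  | sto a e₁ e₂ =>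
    rcases h with (h | h) | h
    · exact absurd h Ex.wrA_compile
    · exact absurd h Ex.wrA_compile
    · exact decide_eq_true (show y = a from h)
  | seq s t ihs iht =>
    rcases h with h | h
    · simp [Stmt.wrA, ihs h]
    · simp [Stmt.wrA, iht h]
  | ite e s t ihs iht =>
    rcases h with h | h | h
    · exact absurd h Ex.wrA_compile
    · simp [Stmt.wrA, ihs h]
    · simp [Stmt.wrA, iht h]
  | whl e s ih =>
    rcases h with h | h | h
    · exact absurd h Ex.wrA_compile
    · simp [Stmt.wrA, ih h]
    · exact absurd h Ex.wrA_compile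
  | raw p => simpa [Stmt.wrA] using Prog.wrA_shift h

/-! ## Hoare triples with time bounds -/

/-- From `σ`, with numbers bounded by `X`, the statement runs for at most `T` steps and ends,
up to scratch registers, in a state satisfying `Q`. -/
def Run (m : Mach) (s : Stmt) (σ : State) (T : ℕ) (Q : State → Prop) : Prop :=
  ∀ τ, Eqv σ τ → Good m.X τ → ∃ (t : ℕ) (τ' σ' : State), Exec m.w m.M s.compile τ t τ' ∧ t ≤ T ∧
    Good m.X τ' ∧ Eqv σ' τ' ∧ Q σ'

namespace Run

variable {m : Mach} {σ : State} {T : ℕ} {Q : State → Prop}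

lemma good {s : Stmt} (h : Good m.X σ → Run m s σ T Q) : Run m s σ T Q :=
  fun τ e hg => h (e.symm.good hg) τ e hg

lemma mono {s : Stmt} {T' : ℕ} {Q' : State → Prop} (h : Run m s σ T Q) (hT : T ≤ T')
    (hQ : ∀ σ', Q σ' → Q' σ') : Run m s σ T' Q' := by
  intro τ e hg
  obtain ⟨t, τ', σ', h1, h2, h3, h4, h5⟩ := h τ e hg
  exact ⟨t, τ', σ', h1, h2.trans hT, h3, h4, hQ _ h5⟩

lemma le {s : Stmt} {T' : ℕ} (h : Run m s σ T Q) (hT : T ≤ T') : Run m s σ T' Q :=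
  h.mono hT fun _ => id

lemma post {s : Stmt} {Q' : State → Prop} (h : Run m s σ T Q) (hQ : ∀ σ', Q σ' → Q' σ') :
    Run m s σ T Q' := h.mono le_rfl hQ

lemma frame {s : Stmt} (h : Run m s σ T Q) :
    Run m s σ T (fun σ' => Q σ' ∧ Fr s σ σ' ∧ Good m.X σ') := by
  intro τ e hg
  obtain ⟨t, τ', σ', h1, h2, h3, h4, h5⟩ := h τ e hg
  refine ⟨t, τ', σ', h1, h2, h3, h4, h5, ⟨fun y hy hs => ?_, fun a ha => ?_⟩, h4.symm.good h3⟩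
  · rw [h4.reg y hy, e.reg y hy]
    exact h1.reg_eq fun hw => by simp [Stmt.wrR_compile hy hw] at hs
  · rw [h4.arr, e.arr]
    exact h1.arr_eq fun hw => by simp [Stmt.wrA_compile hw] at ha

lemma skip (h : Q σ) : Run m .skip σ 1 Q :=
  fun τ e hg => ⟨1, τ, σ, .skip _, le_rfl, hg, e, h⟩

lemma seq {s s' : Stmt} {T' : ℕ} {R : State → Prop} (h : Run m s σ T R)
    (h' : ∀ σ', R σ' → Run m s' σ' T' Q) : Run m (s ;; s') σ (T + T') Q := by
  intro τ e hg
  obtain ⟨t, τ', σ', h1, h2, h3, h4, h5⟩ := h τ e hg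
  obtain ⟨u, τ'', σ'', g1, g2, g3, g4, g5⟩ := h' σ' h5 τ' h4 h3
  exact ⟨t + u, τ'', σ'', h1.seq g1, by omega, g3, g4, g5⟩

/-- Sequencing; the second statement may use what the first leaves unchanged. -/
lemma seqF {s s' : Stmt} {T' : ℕ} {R : State → Prop} (h : Run m s σ T R)
    (h' : ∀ σ', R σ' → Fr s σ σ' → Good m.X σ' → Run m s' σ' T' Q) :
    Run m (s ;; s') σ (T + T') Q :=
  h.frame.seq fun σ' hR => h' σ' hR.1 hR.2.1 hR.2.2

lemma asg {x : ℕ} {e : Ex} (v : ℤ) (hw : e.wf = true) (ho : e.ok m.M σ)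
    (hv : e.eval σ = v) (hb : |v| ≤ m.X) (hQ : Q (σ.setReg x v)) :
    Run m (.asg x e) σ e.cost Q := by
  intro τ h hg
  obtain ⟨τ', h1, h2, h3, h4⟩ := Ex.compile_exec m hw x 60 τ hg (h.ok hw ho) le_rfl rfl
  have e' : Eqv (σ.setReg x v) τ' := by
    refine ⟨fun y hy => ?_, by simp [h2, h.arr]⟩
    by_cases hyx : y = x
    · subst hyx; simp [h3, ← h.eval hw, hv]
    · have : y < 60 ∨ y % 2 = 1 := by simp [tmp] at hy; omega
      simp [hyx, h4 y hyx this, h.reg y hy]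
  refine ⟨e.cost, τ', _, h1, le_rfl, e'.good ⟨fun y hy => ?_, fun a i => ?_⟩, e', hQ⟩
  · have := (h.symm.good hg).reg y hy
    by_cases hyx : y = x <;> simp [hyx, hb]
    simpa using this
  · exact (h.symm.good hg).arr a i

lemma asgc {x : ℕ} {z : ℤ} (hb : |z| ≤ m.X) (hQ : Q (σ.setReg x z)) :
    Run m (.asgc x z) σ 1 Q := by
  intro τ h hg
  have hpow : (m.X : ℤ) < 2 ^ m.w := by
    have := m.hX
    have : m.X ^ 1 ≤ m.X ^ 16 := Nat.pow_le_pow_right (by omega) (by omega)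
    exact_mod_cast (by simpa using this : m.X ≤ m.X ^ 16).trans_lt m.hw
  have e' : Eqv (σ.setReg x z) (τ.setReg x z) := by
    refine ⟨fun y hy => ?_, by simp [h.arr]⟩
    by_cases hyx : y = x <;> simp [hyx]
    exact h.reg y hy
  refine ⟨1, τ.setReg x z, _, .const _ _ _ (by omega), le_rfl, ⟨fun y hy => ?_, fun a i => ?_⟩,
    e', hQ⟩
  · have := hg.reg y hy
    by_cases hyx : y = x <;> simp [hyx, hb]
    simpa using this
  · exact hg.arr a i

lemma sto {a : ℕ} {e₁ e₂ : Ex} (i : ℕ) (v : ℤ) (hw₁ : e₁.wf = true) (hw₂ : e₂.wf = true)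
    (ho₁ : e₁.ok m.M σ) (ho₂ : e₂.ok m.M σ) (hi : e₁.eval σ = i) (hM : i < m.M)
    (hv : e₂.eval σ = v) (hb : |v| ≤ m.X) (hQ : Q (σ.setArr a i v)) :
    Run m (.sto a e₁ e₂) σ (e₁.cost + e₂.cost + 1) Q := by
  intro τ h hg
  obtain ⟨τ1, h1, h2, h3, h4⟩ := Ex.compile_exec m hw₁ 60 62 τ hg (h.ok hw₁ ho₁) (by omega) rfl
  have e1 : Eqv τ τ1 := ⟨fun y hy => (h4 y (by rintro rfl; simp [tmp] at hy) (by
    simp [tmp] at hy; omega)).symm, h2.symm⟩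
  obtain ⟨τ2, g1, g2, g3, g4⟩ := Ex.compile_exec m hw₂ 62 64 τ1 (e1.good hg)
    ((h.trans e1).ok hw₂ ho₂) (by omega) rfl
  have e2 : Eqv τ1 τ2 := ⟨fun y hy => (g4 y (by rintro rfl; simp [tmp] at hy) (by
    simp [tmp] at hy; omega)).symm, g2.symm⟩
  have e' := (h.trans e1).trans e2
  have e3 : Eqv (σ.setArr a i v) (τ2.setArr a i v) := by
    refine ⟨fun y hy => e'.reg y hy, ?_⟩
    funext b; simp [e'.arr]
  refine ⟨_, τ2.setArr a i v, _, (h1.seq g1).seq ?_, le_rfl, ⟨fun y hy => ?_, fun b j => ?_⟩, e3, hQ⟩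
  · have r60 : τ2.reg 60 = i := by rw [g4 60 (by omega) (by omega), h3, ← h.eval hw₁, hi]
    have r62 : τ2.reg 62 = v := by rw [g3, ← (h.trans e1).eval hw₂, hv]
    have := Exec.store (w := m.w) (M := m.M) τ2 a 60 62 i r60 hM
    rwa [r62] at this
  · exact (e1.trans e2).good hg |>.reg y hy
  · have := ((e1.trans e2).good hg).arr
    by_cases hb' : b = a
    · subst hb'
      by_cases hj : j = i
      · subst hj; simpa using hb
      · simpa [hj] using this b j
    · simpa [hb'] using this b j

lemma ite {e : Ex} {s s' : Stmt} (hw : e.wf = true) (ho : e.ok m.M σ)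
    (h₁ : 0 < e.eval σ → Run m s σ T Q) (h₂ : ¬ 0 < e.eval σ → Run m s' σ T Q) :
    Run m (.ite e s s') σ (e.cost + T + 1) Q := by
  intro τ h hg
  obtain ⟨τ1, g1, g2, g3, g4⟩ := Ex.compile_exec m hw 60 62 τ hg (h.ok hw ho) (by omega) rfl
  have e1 : Eqv τ τ1 := ⟨fun y hy => (g4 y (by rintro rfl; simp [tmp] at hy) (by
    simp [tmp] at hy; omega)).symm, g2.symm⟩
  rw [← h.eval hw] at g3
  by_cases hc : 0 < e.eval σ
  · obtain ⟨t, τ', σ', k1, k2, k3⟩ := h₁ hc τ1 (h.trans e1) (e1.good hg)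
    exact ⟨_, τ', σ', g1.seq (.ite_pos (by rwa [g3]) k1), by omega, k3⟩
  · obtain ⟨t, τ', σ', k1, k2, k3⟩ := h₂ hc τ1 (h.trans e1) (e1.good hg)
    exact ⟨_, τ', σ', g1.seq (.ite_neg (by rwa [g3]) k1), by omega, k3⟩

lemma whl_aux {e : Ex} {s : Stmt} (hw : e.wf = true) (I : ℕ → State → Prop) (c : ℕ)
    (ho : ∀ f σ, I f σ → Good m.X σ → e.ok m.M σ)
    (hs : ∀ f σ, I f σ → Good m.X σ → 0 < e.eval σ → ∃ f', f = f' + 1 ∧ Run m s σ c (I f')) :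
    ∀ (f : ℕ) (σ τ1 : State), I f σ → Eqv σ τ1 → τ1.reg 60 = e.eval σ → Good m.X τ1 →
    ∃ (t : ℕ) (τ' σ' : State),
      Exec m.w m.M (.loop 60 (.seq s.compile (e.compile 60 62))) τ1 t τ' ∧
      t ≤ f * (c + e.cost + 1) + 1 ∧ Good m.X τ' ∧ Eqv σ' τ' ∧ (∃ f, I f σ') ∧ ¬ 0 < e.eval σ' := by
  intro f
  induction f with
  | zero =>
    intro σ τ1 hI h h60 hg
    by_cases hc : 0 < e.eval σ
    · obtain ⟨f', hf, -⟩ := hs 0 σ hI (h.symm.good hg) hc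
      omega
    · exact ⟨1, τ1, σ, .loop_done (by rwa [h60]), by omega, hg, h, ⟨_, hI⟩, hc⟩
  | succ f ih =>
    intro σ τ1 hI h h60 hg
    by_cases hc : 0 < e.eval σ
    · obtain ⟨f', hf, hr⟩ := hs _ σ hI (h.symm.good hg) hc
      obtain rfl : f = f' := by omega
      obtain ⟨t, τ2, σ2, k1, k2, k3, k4, k5⟩ := hr τ1 h hg
      obtain ⟨τ3, g1, g2, g3, g4⟩ := Ex.compile_exec m hw 60 62 τ2 k3
        (k4.ok hw (ho _ _ k5 (k4.symm.good k3))) (by omega) rfl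
      have e1 : Eqv τ2 τ3 := ⟨fun y hy => (g4 y (by rintro rfl; simp [tmp] at hy) (by
        simp [tmp] at hy; omega)).symm, g2.symm⟩
      obtain ⟨u, τ', σ', l1, l2, l3⟩ := ih σ2 τ3 k5 (k4.trans e1) (by rw [g3, k4.eval hw])
        (e1.good k3)
      refine ⟨_, τ', σ', .loop_step (by rwa [h60]) (k1.seq g1) l1, ?_, l3⟩
      rw [Nat.add_mul]; omega
    · exact ⟨1, τ1, σ, .loop_done (by rwa [h60]), by omega, hg, h, ⟨_, hI⟩, hc⟩

/-- The loop rule; `I f σ` is the invariant, with at most `f` further iterations. -/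
lemma whl {e : Ex} {s : Stmt} (F : ℕ) (c : ℕ) (I : ℕ → State → Prop) (hw : e.wf = true)
    (h0 : I F σ)
    (ho : ∀ f σ', I f σ' → Fr (.whl e s) σ σ' → Good m.X σ' → e.ok m.M σ')
    (hs : ∀ f σ', I f σ' → Fr (.whl e s) σ σ' → Good m.X σ' → 0 < e.eval σ' →
      ∃ f', f = f' + 1 ∧ Run m s σ' c (I f'))
    (hQ : ∀ f σ', I f σ' → Fr (.whl e s) σ σ' → Good m.X σ' → ¬ 0 < e.eval σ' → Q σ') :
    Run m (.whl e s) σ (F * (c + e.cost + 1) + e.cost + 1) Q := by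
  intro τ h hg
  have ho0 := ho F σ h0 ⟨fun _ _ _ => rfl, fun _ _ => rfl⟩ (h.symm.good hg)
  obtain ⟨τ1, g1, g2, g3, g4⟩ := Ex.compile_exec m hw 60 62 τ hg (h.ok hw ho0) (by omega) rfl
  have e1 : Eqv τ τ1 := ⟨fun y hy => (g4 y (by rintro rfl; simp [tmp] at hy) (by
    simp [tmp] at hy; omega)).symm, g2.symm⟩
  obtain ⟨t, τ', σ', k1, k2, k3, k4, ⟨f, k5, k6⟩, k7⟩ :=
    whl_aux (m := m) (s := s) hw (fun f σ' => I f σ' ∧ Fr (.whl e s) σ σ') c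
      (fun f σ' hI hg' => ho f σ' hI.1 hI.2 hg')
      (fun f σ' hI hg' hc => by
        obtain ⟨f', hf, hr⟩ := hs f σ' hI.1 hI.2 hg' hc
        refine ⟨f', hf, hr.frame.post fun σ'' hq => ⟨hq.1, ?_, ?_⟩⟩
        · intro y hy hwr
          rw [hq.2.1.reg y hy hwr, hI.2.reg y hy hwr]
        · intro a ha
          rw [hq.2.1.arr a ha, hI.2.arr a ha])
      F σ τ1 ⟨h0, ⟨fun _ _ _ => rfl, fun _ _ => rfl⟩⟩ (h.trans e1) (by rw [g3, h.eval hw])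
      (e1.good hg)
  exact ⟨_, τ', σ', g1.seq k1, by omega, k3, k4, hQ f σ' k5 k6 (k4.symm.good k3) k7⟩

end Run

/-- `for x := 0 to (reg y) - 1 do s`. -/
def Stmt.for (x y : ℕ) (s : Stmt) : Stmt :=
  .asg x 0 ;; .whl (.r y - .r x) (s ;; .asg x (.r x + 1))

/-- The rule for counting loops, with a cost that may depend on the counter. -/
lemma Run.for {m : Mach} {σ : State} {Q : State → Prop} {x y : ℕ} {s : Stmt} (N : ℕ)
    (cost : ℕ → ℕ) (I : ℕ → State → Prop) (hx : x < 60) (hy : y < 60) (hxy : y ≠ x)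
    (hsx : s.wrR x = false) (hsy : s.wrR y = false) (hN : σ.reg y = N)
    (h0 : I 0 (σ.setReg x 0))
    (hs : ∀ k < N, ∀ σ', I k σ' → σ'.reg x = k → Fr (.for x y s) σ σ' → Good m.X σ' →
      Run m s σ' (cost k) (fun σ'' => I (k + 1) (σ''.setReg x ((k + 1 : ℕ) : ℤ))))
    (hQ : ∀ σ', I N σ' → σ'.reg x = N → Fr (.for x y s) σ σ' → Good m.X σ' → Q σ') :
    Run m (.for x y s) σ (∑ k ∈ Finset.range N, (cost k + 11) + 8) Q := by
  apply Run.good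
  intro hgσ
  have hNX : (N : ℤ) ≤ m.X := by
    have := hgσ.reg y (tmp_of_lt hy); rw [hN] at this; simpa using this
  have hw1 : (Ex.r x + 1 : Ex).wf = true := by
    change (Ex.wf (Ex.op _ _ (Ex.c _))) = true; simp [Ex.wf, Ex.leaves, hx]
  have hw2 : (Ex.r y - Ex.r x).wf = true := by
    change (Ex.wf (Ex.op _ _ _)) = true; simp [Ex.wf, Ex.leaves, hx, hy]
  set P := fun (k : ℕ) σ' => I k σ' ∧ σ'.reg x = k ∧ Fr (.for x y s) σ σ' with hP
  have body : ∀ k < N, ∀ σ', P k σ' → Good m.X σ' →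
      Run m (s ;; .asg x (.r x + 1)) σ' (cost k + 4) (P (k + 1)) := by
    intro k hk σ' hI hg'
    refine (Run.seqF (T' := 4) (hs k hk σ' hI.1 hI.2.1 hI.2.2 hg') fun σ'' h'' hfr hg'' => ?_)
    have hk'' : σ''.reg x = k := by rw [hfr.reg x (tmp_of_lt hx) hsx, hI.2.1]
    refine Run.asg ((k + 1 : ℕ) : ℤ) hw1 ⟨trivial, trivial⟩ (by simp [hk'']) ?_ ?_
    · rw [Nat.abs_cast]; omega
    · refine ⟨h'', by simp, fun y' hy' hw => ?_, fun a ha => ?_⟩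
      · have hyx : y' ≠ x := by
          rintro rfl; simp [Stmt.for, Stmt.wrR] at hw
        have : s.wrR y' = false := by
          simp only [Stmt.for, Stmt.wrR, Bool.or_eq_false_iff] at hw; exact hw.2.1
        simp only [State.reg_setReg, hyx, if_false]
        rw [hfr.reg y' hy' this, hI.2.2.reg y' hy' hw]
      · have : s.wrA a = false := by
          simp only [Stmt.for, Stmt.wrA, Bool.or_eq_false_iff] at ha; exact ha.2.1
        simp only [State.arr_setReg]
        rw [hfr.arr a this, hI.2.2.arr a ha]
  have hyv : ∀ k σ', P k σ' → σ'.reg y = N := fun k σ' hI => by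
    rw [hI.2.2.reg y (tmp_of_lt hy) (by simp [Stmt.for, Stmt.wrR, hxy, hsy]), hN]
  have loop : ∀ j k : ℕ, k + j = N → ∀ σ' τ1, P k σ' → Eqv σ' τ1 →
      τ1.reg 60 = (Ex.r y - Ex.r x).eval σ' → Good m.X τ1 →
      ∃ (t : ℕ) (τ' σ'' : State),
        Exec m.w m.M (.loop 60 (.seq (Stmt.compile (s ;; .asg x (.r x + 1)))
          ((Ex.r y - Ex.r x).compile 60 62))) τ1 t τ' ∧
        t ≤ ∑ i ∈ Finset.range j, (cost (k + i) + 11) + 1 ∧ Good m.X τ' ∧ Eqv σ'' τ' ∧ P N σ'' := by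
    intro j
    induction j with
    | zero =>
      intro k hk σ' τ1 hI h h60 hg
      obtain rfl : k = N := by omega
      refine ⟨1, τ1, σ', .loop_done ?_, by simp, hg, h, hI⟩
      rw [h60]; simp [hyv _ _ hI, hI.2.1]
    | succ j ih =>
      intro k hk σ' τ1 hI h h60 hg
      obtain ⟨t, τ2, σ2, k1, k2, k3, k4, k5⟩ := body k (by omega) σ' hI (h.symm.good hg) τ1 h hg
      obtain ⟨τ3, g1, g2, g3, g4⟩ := Ex.compile_exec m hw2 60 62 τ2 k3 ⟨trivial, trivial⟩
        (by omega) rfl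
      have e1 : Eqv τ2 τ3 := ⟨fun y hy => (g4 y (by rintro rfl; simp [tmp] at hy) (by
        simp [tmp] at hy; omega)).symm, g2.symm⟩
      obtain ⟨u, τ', σ'', l1, l2, l3⟩ := ih (k + 1) (by omega) σ2 τ3 k5 (k4.trans e1)
        (by rw [g3, k4.eval hw2]) (e1.good k3)
      refine ⟨_, τ', σ'', .loop_step ?_ (k1.seq g1) l1, ?_, l3⟩
      · rw [h60]; simp only [Ex.eval_sub, Ex.eval_r, hyv _ _ hI, hI.2.1]; omega
      · rw [Finset.sum_range_succ']
        have : (Ex.r y - Ex.r x).cost = 5 := rfl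
        have e : ∀ i, k + 1 + i = k + (i + 1) := by intros; omega
        simp only [e] at l2
        simp only [add_zero]
        omega
  refine Run.le (T := 1 + (5 + (∑ k ∈ Finset.range N, (cost k + 11) + 1))) ?_ (by omega)
  refine Run.seq (R := fun σ' => P 0 σ') (Run.asg 0 rfl trivial rfl (by simp) ?_) ?_
  · refine ⟨h0, by simp, fun y' hy' hw => ?_, fun a ha => rfl⟩
    have hyx : y' ≠ x := by
      rintro rfl; simp [Stmt.for, Stmt.wrR] at hw
    simp [hyx]
  · intro σ' hI τ h hg
    obtain ⟨τ3, g1, g2, g3, g4⟩ := Ex.compile_exec m hw2 60 62 τ hg ⟨trivial, trivial⟩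
        (by omega) rfl
    have e1 : Eqv τ τ3 := ⟨fun y hy => (g4 y (by rintro rfl; simp [tmp] at hy) (by
      simp [tmp] at hy; omega)).symm, g2.symm⟩
    obtain ⟨u, τ', σ'', l1, l2, l3, l4, l5⟩ := loop N 0 (by omega) σ' τ3 hI (h.trans e1)
      (by rw [g3, h.eval hw2]) (e1.good hg)
    refine ⟨_, τ', σ'', g1.seq l1, ?_, l3, l4, hQ σ'' l5.1 l5.2.1 l5.2.2 (l4.symm.good l3)⟩
    have : (Ex.r y - Ex.r x).cost = 5 := rfl
    simp only [zero_add] at l2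
    omega


lemma Exec.one_le {w M t : ℕ} {p : Prog} {σ σ' : State} (h : Exec w M p σ t σ') : 1 ≤ t := by
  induction h <;> omega

namespace Run

variable {m : Mach} {σ : State} {T : ℕ} {Q : State → Prop}

lemma pos {s : Stmt} (hg : Good m.X σ) (h : Run m s σ T Q) : 1 ≤ T := by
  obtain ⟨t, _, _, h1, h2, _⟩ := h σ (Eqv.refl σ) hg
  exact h1.one_le.trans h2

/-- Sequencing against a time budget. -/
lemma seqB {s s' : Stmt} {R : State → Prop} (T₁ : ℕ) (h : Run m s σ T₁ R)
    (h' : ∀ σ', R σ' → Fr s σ σ' → Good m.X σ' → Run m s' σ' (T - T₁) Q) :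
    Run m (s ;; s') σ T Q := by
  intro τ e hg
  obtain ⟨t, τ', σ', h1, h2, h3, h4, h5⟩ := h.frame τ e hg
  have hr := h' σ' h5.1 h5.2.1 h5.2.2
  have := hr.pos (h4.symm.good h3)
  obtain ⟨u, τ'', σ'', g1, g2, g3, g4, g5⟩ := hr τ' h4 h3
  exact ⟨t + u, τ'', σ'', h1.seq g1, by omega, g3, g4, g5⟩

lemma asg_last {x : ℕ} {e : Ex} (v : ℤ) (hb : |v| ≤ m.X) (hv : e.eval σ = v)
    (h : Q (σ.setReg x v)) (ho : e.ok m.M σ := by simp) (hT : 50 ≤ T := by omega)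
    (hw : e.wf = true := by rfl) (hc : e.cost ≤ 50 := by decide) :
    Run m (.asg x e) σ T Q :=
  (Run.asg v hw ho hv hb h).le (hc.trans hT)

lemma asg_seq {x : ℕ} {e : Ex} {s : Stmt} (v : ℤ) (hb : |v| ≤ m.X) (hv : e.eval σ = v)
    (h : Run m s (σ.setReg x v) (T - 50) Q) (ho : e.ok m.M σ := by simp)
    (hw : e.wf = true := by rfl) (hc : e.cost ≤ 50 := by decide) :
    Run m (.asg x e ;; s) σ T Q :=
  seqB 50 (asg_last (Q := fun σ' => σ' = σ.setReg x v) v hb hv rfl ho le_rfl hw hc)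
    fun _ hσ _ _ => hσ ▸ h

lemma sto_last {a : ℕ} {e₁ e₂ : Ex} (i : ℕ) (v : ℤ) (hM : i < m.M) (hb : |v| ≤ m.X)
    (hi : e₁.eval σ = i) (hv : e₂.eval σ = v) (h : Q (σ.setArr a i v))
    (ho₁ : e₁.ok m.M σ := by simp) (ho₂ : e₂.ok m.M σ := by simp) (hT : 100 ≤ T := by omega)
    (hw₁ : e₁.wf = true := by rfl) (hw₂ : e₂.wf = true := by rfl)
    (hc : e₁.cost + e₂.cost < 100 := by decide) :
    Run m (.sto a e₁ e₂) σ T Q :=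
  (Run.sto i v hw₁ hw₂ ho₁ ho₂ hi hM hv hb h).le (by omega)

lemma sto_seq {a : ℕ} {e₁ e₂ : Ex} {s : Stmt} (i : ℕ) (v : ℤ) (hM : i < m.M) (hb : |v| ≤ m.X)
    (hi : e₁.eval σ = i) (hv : e₂.eval σ = v) (h : Run m s (σ.setArr a i v) (T - 100) Q)
    (ho₁ : e₁.ok m.M σ := by simp) (ho₂ : e₂.ok m.M σ := by simp)
    (hw₁ : e₁.wf = true := by rfl) (hw₂ : e₂.wf = true := by rfl)
    (hc : e₁.cost + e₂.cost < 100 := by decide) :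
    Run m (.sto a e₁ e₂ ;; s) σ T Q :=
  seqB 100 (sto_last (Q := fun σ' => σ' = σ.setArr a i v) i v hM hb hi hv rfl ho₁ ho₂ le_rfl hw₁
    hw₂ hc) fun _ hσ _ _ => hσ ▸ h

lemma skip_last (h : Q σ) (hT : 1 ≤ T := by omega) : Run m .skip σ T Q := (Run.skip h).le hT

lemma iteB {e : Ex} {s s' : Stmt} (h₁ : 0 < e.eval σ → Run m s σ (T - 60) Q)
    (h₂ : ¬ 0 < e.eval σ → Run m s' σ (T - 60) Q) (ho : e.ok m.M σ := by simp)
    (hw : e.wf = true := by rfl) (hc : e.cost ≤ 50 := by decide) :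
    Run m (.ite e s s') σ T Q := by
  apply Run.good
  intro hg
  have : 1 ≤ T - 60 := by
    by_cases h : 0 < e.eval σ
    · exact (h₁ h).pos hg
    · exact (h₂ h).pos hg
  exact (Run.ite hw ho h₁ h₂).le (by omega)

lemma ite_seq {e : Ex} {s s' u : Stmt} (R : State → Prop) (T₁ : ℕ)
    (h₁ : 0 < e.eval σ → Run m s σ T₁ R)
    (h₂ : ¬ 0 < e.eval σ → Run m s' σ T₁ R)
    (h : ∀ σ', R σ' → Fr (.ite e s s') σ σ' → Good m.X σ' → Run m u σ' (T - (T₁ + 60)) Q)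
    (ho : e.ok m.M σ := by simp)
    (hw : e.wf = true := by rfl) (hc : e.cost ≤ 50 := by decide) :
    Run m (.ite e s s' ;; u) σ T Q :=
  seqB (T₁ + 60) (iteB (by simpa using h₁) (by simpa using h₂) ho hw hc) h

/-- Counting loop with a body of constant cost. -/
lemma forC {x y : ℕ} {s : Stmt} (N c : ℕ) (I : ℕ → State → Prop) (hN : σ.reg y = N)
    (h0 : I 0 (σ.setReg x 0))
    (hs : ∀ k < N, ∀ σ', I k σ' → σ'.reg x = k → Fr (.for x y s) σ σ' → Good m.X σ' →
      Run m s σ' c (fun σ'' => I (k + 1) (σ''.setReg x ((k + 1 : ℕ) : ℤ))))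
    (hQ : ∀ σ', I N σ' → σ'.reg x = N → Fr (.for x y s) σ σ' → Good m.X σ' → Q σ')
    (hT : N * (c + 11) + 8 ≤ T)
    (hx : x < 60 := by norm_num) (hy : y < 60 := by norm_num) (hxy : y ≠ x := by norm_num)
    (hsx : s.wrR x = false := by rfl) (hsy : s.wrR y = false := by rfl) :
    Run m (.for x y s) σ T Q := by
  have := Run.for (Q := Q) N (fun _ => c) I hx hy hxy hsx hsy hN h0 hs hQ
  exact this.le (by simpa using hT)

lemma forC_seq {x y : ℕ} {s u : Stmt} (N c : ℕ) (I : ℕ → State → Prop) (hN : σ.reg y = N)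
    (h0 : I 0 (σ.setReg x 0))
    (hs : ∀ k < N, ∀ σ', I k σ' → σ'.reg x = k → Fr (.for x y s) σ σ' → Good m.X σ' →
      Run m s σ' c (fun σ'' => I (k + 1) (σ''.setReg x ((k + 1 : ℕ) : ℤ))))
    (hQ : ∀ σ', I N σ' → Fr (.for x y s) σ σ' → Good m.X σ' →
      Run m u σ' (T - (N * (c + 11) + 8)) Q)
    (hx : x < 60 := by norm_num) (hy : y < 60 := by norm_num) (hxy : y ≠ x := by norm_num)
    (hsx : s.wrR x = false := by rfl) (hsy : s.wrR y = false := by rfl) :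
    Run m (.for x y s ;; u) σ T Q :=
  seqB _ (forC N c I hN h0 hs (fun _ h _ _ _ => h) le_rfl hx hy hxy hsx hsy) hQ

/-- The loop rule against a time budget. -/
lemma whlB {e : Ex} {s : Stmt} (F c : ℕ) (I : ℕ → State → Prop) (h0 : I F σ)
    (ho : ∀ f σ', I f σ' → Fr (.whl e s) σ σ' → Good m.X σ' → e.ok m.M σ')
    (hs : ∀ f σ', I f σ' → Fr (.whl e s) σ σ' → Good m.X σ' → 0 < e.eval σ' →
      ∃ f', f = f' + 1 ∧ Run m s σ' c (I f'))
    (hQ : ∀ f σ', I f σ' → Fr (.whl e s) σ σ' → Good m.X σ' → ¬ 0 < e.eval σ' → Q σ')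
    (hT : F * (c + 51) + 51 ≤ T) (hw : e.wf = true := by rfl) (hc : e.cost ≤ 50 := by decide) :
    Run m (.whl e s) σ T Q := by
  refine (Run.whl F c I hw h0 ho hs hQ).le (le_trans ?_ hT)
  have := Nat.mul_le_mul_left F (by omega : c + e.cost + 1 ≤ c + 51)
  omega

lemma whl_seq {e : Ex} {s u : Stmt} (F c : ℕ) (I : ℕ → State → Prop) (h0 : I F σ)
    (ho : ∀ f σ', I f σ' → Fr (.whl e s) σ σ' → Good m.X σ' → e.ok m.M σ')
    (hs : ∀ f σ', I f σ' → Fr (.whl e s) σ σ' → Good m.X σ' → 0 < e.eval σ' →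
      ∃ f', f = f' + 1 ∧ Run m s σ' c (I f'))
    (hQ : ∀ f σ', I f σ' → ¬ 0 < e.eval σ' → Fr (.whl e s) σ σ' → Good m.X σ' →
      Run m u σ' (T - (F * (c + 51) + 51)) Q)
    (hw : e.wf = true := by rfl) (hc : e.cost ≤ 50 := by decide) :
    Run m (.whl e s ;; u) σ T Q :=
  seqB _ (whlB (Q := fun σ' => ∃ f, I f σ' ∧ ¬ 0 < e.eval σ') F c I h0 ho hs
    (fun f _ h _ _ h' => ⟨f, h, h'⟩) le_rfl hw hc) fun σ' h => h.elim fun f h => hQ f σ' h.1 h.2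

end Run

lemma Fr.r {s : Stmt} {σ σ' : State} (h : Fr s σ σ') (y : ℕ) (hs : s.wrR y = false := by rfl)
    (hy : tmp y = false := by rfl) : σ'.reg y = σ.reg y := h.reg y hy hs

lemma Fr.a {s : Stmt} {σ σ' : State} (h : Fr s σ σ') (a : ℕ) (hs : s.wrA a = false := by rfl) :
    σ'.arr a = σ.arr a := h.arr a hs

lemma mul_add_lt {i j n N : ℕ} (hi : i < N) (hj : j < n) : i * n + j < N * n := by
  calc i * n + j < i * n + n := by omega
    _ = (i + 1) * n := by ring
    _ ≤ N * n := Nat.mul_le_mul_right _ hi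

/-- The schoolbook product of the matrices in arrays `0` and `1`. -/
def schoolbook : Stmt :=
  .for 20 0 (.for 21 0 (.asg 23 0 ;;
    .for 22 1 (.asg 23 (.r 23 + .ld 0 (.r 20 * .r 1 + .r 22) * .ld 1 (.r 22 * .r 0 + .r 21))) ;;
    .sto 2 (.r 20 * .r 0 + .r 21) (.r 23)))

/-- Entry of a product of two matrices that are stored row by row. -/
def dot (n m : ℕ) (f g : ℕ → ℤ) (i j : ℕ) : ℤ := ∑ k ∈ Finset.range m, f (i * m + k) * g (k * n + j)

lemma schoolbook_run (mc : Mach) (σ : State) (n m Y : ℕ) (f g : ℕ → ℤ)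
    (h0 : σ.reg 0 = n) (h1 : σ.reg 1 = m) (hf : σ.arr 0 = f) (hg : σ.arr 1 = g)
    (hY : ∀ a b, |f a * g b| ≤ Y) (hX : m * Y ≤ mc.X) (hM : n * m ≤ mc.M) (hM2 : n * n ≤ mc.M)
    (hm : 1 ≤ m) (hn : 1 ≤ n) :
    Run mc schoolbook σ (500 * (n * n * m)) fun σ' =>
      ∀ i < n, ∀ j < n, σ'.arr 2 (i * n + j) = dot n m f g i j := by
  have part : ∀ i j k, k ≤ m → |∑ l ∈ Finset.range k, f (i * m + l) * g (l * n + j)| ≤ mc.X := by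
    intro i j k hk
    refine (Finset.abs_sum_le_sum_abs _ _).trans ?_
    refine (Finset.sum_le_sum fun l _ => hY (i * m + l) (l * n + j)).trans ?_
    simp only [Finset.sum_const, Finset.card_range, nsmul_eq_mul]
    exact_mod_cast (Nat.mul_le_mul_right _ hk).trans hX
  refine Run.forC n (n * (m * 61 + 200) + 8) (fun i σ' => ∀ i' < i, ∀ j < n,
      σ'.arr 2 (i' * n + j) = dot n m f g i' j) h0 (by simp) ?_ ?_ ?_
  · intro i hi σ1 I1 r20 fr1 g1
    refine Run.forC n (m * 61 + 180) (fun j σ' => (∀ i' < i, ∀ j < n,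
      σ'.arr 2 (i' * n + j) = dot n m f g i' j) ∧ ∀ j' < j, σ'.arr 2 (i * n + j') = dot n m f g i j')
      (by rw [fr1.r 0, h0]) (by simpa using I1) ?_ ?_ (by lia)
    · intro j hj σ2 I2 r21 fr2 g2
      refine Run.asg_seq 0 (by simp) rfl (Run.forC_seq m 50 (fun k σ' => σ'.reg 23 =
        ∑ l ∈ Finset.range k, f (i * m + l) * g (l * n + j)) (by simp [fr2.r 1, fr1.r 1, h1])
          (by simp) ?_ ?_)
      · intro k hk σ3 I3 r22 fr3 g3
        have e1 : σ3.reg 0 = n := by simpa [fr2.r 0, fr1.r 0, h0] using fr3.r 0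
        have e2 : σ3.reg 1 = m := by simpa [fr2.r 1, fr1.r 1, h1] using fr3.r 1
        have e3 : σ3.reg 20 = i := by simpa [fr2.r 20, r20] using fr3.r 20
        have e4 : σ3.reg 21 = j := by simpa [r21] using fr3.r 21
        have e5 : σ3.arr 0 = f := by simpa [fr2.a 0, fr1.a 0, hf] using fr3.a 0
        have e6 : σ3.arr 1 = g := by simpa [fr2.a 1, fr1.a 1, hg] using fr3.a 1
        refine Run.asg_last (∑ l ∈ Finset.range (k + 1), f (i * m + l) * g (l * n + j))
          (part _ _ _ hk) ?_ ?_ ?_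
        · simp only [Ex.eval_add, Ex.eval_r, I3, Ex.eval_mul, Ex.eval_ld, e1, e2, e3, e4, r22, e5,
            e6, Finset.sum_range_succ]
          norm_cast
        · simp
        · simp only [Ex.ok_add, Ex.ok_r, Ex.ok_mul, Ex.ok_ld, Ex.eval_add, Ex.eval_mul, Ex.eval_r,
            e1, e2, e3, e4, r22, true_and]
          norm_cast
          have := mul_add_lt hi hk
          have := mul_add_lt hk hj
          have : m * n = n * m := by ring
          exact ⟨⟨by omega, by omega⟩, by omega, by omega⟩
      · intro σ3 I3 fr3 g3
        have e1 : σ3.reg 0 = n := by simpa [fr2.r 0, fr1.r 0, h0] using fr3.r 0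
        have e3 : σ3.reg 20 = i := by simpa [fr2.r 20, r20] using fr3.r 20
        have e4 : σ3.reg 21 = j := by simpa [r21] using fr3.r 21
        have e7 : σ3.arr 2 = σ2.arr 2 := by simpa using fr3.a 2
        refine Run.sto_last (i * n + j) (dot n m f g i j) ((mul_add_lt hi hj).trans_le hM2)
          (part _ _ _ le_rfl) (by simp [e1, e3, e4])
          (by simpa [dot] using I3) ⟨fun i' hi' j' hj' => ?_, fun j' hj' => ?_⟩
        · have := mul_add_lt hi' hj'
          simp only [State.arr_setReg, State.arr_setArr, if_true, e7]
          rw [Function.update_of_ne (by omega)]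
          exact I2.1 i' hi' j' hj'
        · simp only [State.arr_setReg, State.arr_setArr, if_true, e7]
          by_cases h : j' = j
          · subst h; simp
          · rw [Function.update_of_ne (by omega)]
            exact I2.2 j' (by omega)
    · intro σ2 I2 _ fr2 _ i' hi' j hj
      rcases (by omega : i' < i ∨ i' = i) with h | rfl
      · exact I2.1 i' h j hj
      · exact I2.2 j hj
  · intro σ1 I1 _ _ _; exact I1
  · nlinarith [Nat.zero_le (n * n), Nat.mul_le_mul_left (n*n) hm, Nat.mul_le_mul_left n hn,
      Nat.mul_le_mul_right m (Nat.mul_le_mul_left n hn)]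


/-! ## General properties of machine runs -/

lemma Exec.mono {w M w' M' t : ℕ} {p : Prog} {σ σ' : State} (h : Exec w M p σ t σ')
    (hw : w ≤ w') (hM : M ≤ M') : Exec w' M' p σ t σ' := by
  have hp : (2 : ℤ) ^ w ≤ 2 ^ w' := pow_le_pow_right₀ (by norm_num) hw
  induction h with
  | skip σ => exact .skip σ
  | const σ x c hc => exact .const σ x c (hc.trans_le hp)
  | arith σ x o y z h => exact .arith σ x o y z (h.trans_le hp)
  | load σ x a y i hi h => exact .load σ x a y i hi (h.trans_le hM)
  | store σ a y z i hi h => exact .store σ a y z i hi (h.trans_le hM)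
  | seq _ _ ih1 ih2 => exact .seq ih1 ih2
  | ite_pos hx _ ih => exact .ite_pos hx ih
  | ite_neg hx _ ih => exact .ite_neg hx ih
  | loop_done hx => exact .loop_done hx
  | loop_step hx _ _ ih1 ih2 => exact .loop_step hx ih1 ih2

lemma Exec.det {w M t : ℕ} {p : Prog} {σ σ' : State} (h : Exec w M p σ t σ') :
    ∀ {u : ℕ} {σ'' : State}, Exec w M p σ u σ'' → t = u ∧ σ' = σ'' := by
  induction h with
  | skip σ => rintro _ _ ⟨⟩; exact ⟨rfl, rfl⟩
  | const σ x c hc => rintro _ _ ⟨⟩; exact ⟨rfl, rfl⟩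
  | arith σ x o y z h => rintro _ _ ⟨⟩; exact ⟨rfl, rfl⟩
  | load σ x a y i hi h =>
    rintro _ _ h'
    cases h' with
    | load _ _ _ _ i' hi' => obtain rfl : i = i' := by omega
                             exact ⟨rfl, rfl⟩
  | store σ a y z i hi h =>
    rintro _ _ h'
    cases h' with
    | store _ _ _ _ i' hi' => obtain rfl : i = i' := by omega
                              exact ⟨rfl, rfl⟩
  | seq _ _ ih1 ih2 =>
    rintro _ _ (_ | _ | _ | _ | _ | ⟨h1, h2⟩)
    obtain ⟨rfl, rfl⟩ := ih1 h1
    obtain ⟨rfl, rfl⟩ := ih2 h2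
    exact ⟨rfl, rfl⟩
  | ite_pos hx _ ih =>
    intro _ _ h'
    cases h' with
    | ite_pos _ h => obtain ⟨rfl, rfl⟩ := ih h; exact ⟨rfl, rfl⟩
    | ite_neg hn _ => exact absurd hx hn
  | ite_neg hx _ ih =>
    intro _ _ h'
    cases h' with
    | ite_neg _ h => obtain ⟨rfl, rfl⟩ := ih h; exact ⟨rfl, rfl⟩
    | ite_pos hn _ => exact absurd hn hx
  | loop_done hx =>
    intro _ _ h'
    cases h' with
    | loop_done _ => exact ⟨rfl, rfl⟩
    | loop_step hn _ _ => exact absurd hn hx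
  | loop_step hx _ _ ih1 ih2 =>
    intro _ _ h'
    cases h' with
    | loop_done hn => exact absurd hx hn
    | loop_step _ h1 h2 =>
      obtain ⟨rfl, rfl⟩ := ih1 h1
      obtain ⟨rfl, rfl⟩ := ih2 h2
      exact ⟨rfl, rfl⟩

lemma Exec.arr_of_le {w M t : ℕ} {p : Prog} {σ σ' : State} (h : Exec w M p σ t σ') {a i : ℕ}
    (hi : M ≤ i) : σ'.arr a i = σ.arr a i := by
  induction h with
  | store σ b y z j hj h =>
    by_cases hab : a = b
    · subst hab; simp [Function.update_of_ne (by omega : i ≠ j)]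
    · simp [hab]
  | seq _ _ ih1 ih2 => rw [ih2, ih1]
  | loop_step _ _ _ ih1 ih2 => rw [ih2, ih1]
  | ite_pos _ _ ih => exact ih
  | ite_neg _ _ ih => exact ih
  | _ => simp

lemma Exec.abs_le {w M t : ℕ} {p : Prog} {σ σ' : State} {X : ℤ} (hX : 2 ^ w ≤ X)
    (h : Exec w M p σ t σ') : (∀ y, |σ.reg y| ≤ X) → (∀ a i, |σ.arr a i| ≤ X) →
    (∀ y, |σ'.reg y| ≤ X) ∧ ∀ a i, |σ'.arr a i| ≤ X := by
  induction h with
  | skip σ => exact fun h1 h2 => ⟨h1, h2⟩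
  | const σ x c hc =>
    refine fun h1 h2 => ⟨fun y => ?_, h2⟩
    rw [State.reg_setReg]; split_ifs
    · exact hc.le.trans hX
    · exact h1 y
  | arith σ x o y z h =>
    refine fun h1 h2 => ⟨fun y => ?_, h2⟩
    rw [State.reg_setReg]; split_ifs
    · exact h.le.trans hX
    · exact h1 y
  | load σ x a y i hi h =>
    refine fun h1 h2 => ⟨fun y => ?_, h2⟩
    rw [State.reg_setReg]; split_ifs
    · exact h2 _ _
    · exact h1 y
  | store σ a y z i hi h =>
    refine fun h1 h2 => ⟨h1, fun b j => ?_⟩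
    rw [State.arr_setArr]; split_ifs with hb
    · by_cases hj : j = i
      · subst hj; simpa using h1 z
      · simpa [hj] using h2 a j
    · exact h2 b j
  | seq _ _ ih1 ih2 => exact fun h1 h2 => ih2 (ih1 h1 h2).1 (ih1 h1 h2).2
  | loop_step _ _ _ ih1 ih2 => exact fun h1 h2 => ih2 (ih1 h1 h2).1 (ih1 h1 h2).2
  | ite_pos _ _ ih => exact ih
  | ite_neg _ _ ih => exact ih
  | loop_done _ => exact fun h1 h2 => ⟨h1, h2⟩

/-- A run of `t` steps touches at most `t` cells; the others do not matter. -/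
lemma Exec.touched {w M t : ℕ} {p : Prog} {σ σ' : State} (h : Exec w M p σ t σ') :
    ∃ R : Finset (ℕ × ℕ), R.card ≤ t ∧ ∀ a i, (a, i) ∉ R → ∀ v,
      Exec w M p (σ.setArr a i v) t (σ'.setArr a i v) := by
  induction h with
  | skip σ => exact ⟨∅, by simp, fun a i _ v => .skip _⟩
  | const σ x c hc => exact ⟨∅, by simp, fun a i _ v => .const _ _ _ hc⟩
  | arith σ x o y z h => exact ⟨∅, by simp, fun a i _ v => .arith _ _ _ _ _ h⟩
  | load σ x b y j hj h =>
    refine ⟨{(b, j)}, by simp, fun a i hn v => ?_⟩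
    have e : (σ.setArr a i v).arr b j = σ.arr b j := by
      rw [State.arr_setArr]; split_ifs with hb
      · subst hb
        rw [Function.update_of_ne]; rintro rfl; simp at hn
      · rfl
    have := Exec.load (w := w) (M := M) (σ.setArr a i v) x b y j hj h
    rw [e] at this
    exact this
  | store σ b y z j hj h =>
    refine ⟨{(b, j)}, by simp, fun a i hn v => ?_⟩
    have := Exec.store (w := w) (M := M) (σ.setArr a i v) b y z j hj h
    have e : (σ.setArr a i v).setArr b j (σ.reg z) = (σ.setArr b j (σ.reg z)).setArr a i v := by
      ext c k
      · rfl
      · simp only [State.arr_setArr]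
        by_cases h1 : c = a <;> by_cases h2 : c = b <;> simp only [h1, h2, if_true, if_false]
        · subst h1; subst h2
          have : i ≠ j := by rintro rfl; simp at hn
          simp only [if_true]
          rw [Function.update_comm this]
        · subst h1; simp [h2]
        · subst h2; simp [h1]
    rw [← e]; exact this
  | @seq p q σ σ' σ'' t u _ _ ih1 ih2 =>
    obtain ⟨R1, c1, h1⟩ := ih1
    obtain ⟨R2, c2, h2⟩ := ih2
    refine ⟨R1 ∪ R2, (Finset.card_union_le _ _).trans (by omega), fun a i hn v => ?_⟩
    rw [Finset.mem_union, not_or] at hn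
    exact .seq (h1 a i hn.1 v) (h2 a i hn.2 v)
  | ite_pos hx _ ih =>
    obtain ⟨R, c, h⟩ := ih
    exact ⟨R, by omega, fun a i hn v => .ite_pos hx (h a i hn v)⟩
  | ite_neg hx _ ih =>
    obtain ⟨R, c, h⟩ := ih
    exact ⟨R, by omega, fun a i hn v => .ite_neg hx (h a i hn v)⟩
  | loop_done hx => exact ⟨∅, by simp, fun a i _ v => .loop_done hx⟩
  | loop_step hx _ _ ih1 ih2 =>
    obtain ⟨R1, c1, h1⟩ := ih1
    obtain ⟨R2, c2, h2⟩ := ih2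
    refine ⟨R1 ∪ R2, (Finset.card_union_le _ _).trans (by omega), fun a i hn v => ?_⟩
    rw [Finset.mem_union, not_or] at hn
    exact .loop_step hx (h1 a i hn.1 v) (h2 a i hn.2 v)

/-- The renamed registers and arrays of `τ` show the state `σ`. -/
structure Sim (σ τ : State) : Prop where
  reg : ∀ x, τ.reg (61 + 2 * x) = σ.reg x
  arr : ∀ a, τ.arr (50 + a) = σ.arr a

lemma Sim.setReg {σ τ : State} (h : Sim σ τ) (x : ℕ) (v : ℤ) :
    Sim (σ.setReg x v) (τ.setReg (61 + 2 * x) v) :=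
  ⟨fun y => by simp [h.reg], h.arr⟩

lemma Sim.setArr {σ τ : State} (h : Sim σ τ) (a i : ℕ) (v : ℤ) :
    Sim (σ.setArr a i v) (τ.setArr (50 + a) i v) :=
  ⟨h.reg, fun b => by simp [h.arr]⟩

lemma Exec.shift {w M t : ℕ} {p : Prog} {σ σ' : State} (h : Exec w M p σ t σ') :
    ∀ τ, Sim σ τ → ∃ τ', Exec w M p.shift τ t τ' ∧ Sim σ' τ' := by
  induction h with
  | skip σ => exact fun τ hs => ⟨τ, .skip _, hs⟩
  | const σ x c hc => exact fun τ hs => ⟨_, .const _ _ _ hc, hs.setReg x c⟩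
  | arith σ x o y z h =>
    intro τ hs
    have := Exec.arith (w := w) (M := M) τ (61 + 2 * x) o (61 + 2 * y) (61 + 2 * z)
      (by rw [hs.reg, hs.reg]; exact h)
    rw [hs.reg, hs.reg] at this
    exact ⟨_, this, hs.setReg _ _⟩
  | load σ x a y i hi h =>
    intro τ hs
    have := Exec.load (w := w) (M := M) τ (61 + 2 * x) (50 + a) (61 + 2 * y) i
      (by rw [hs.reg]; exact hi) h
    rw [hs.arr] at this
    exact ⟨_, this, hs.setReg _ _⟩
  | store σ a y z i hi h =>
    intro τ hs
    have := Exec.store (w := w) (M := M) τ (50 + a) (61 + 2 * y) (61 + 2 * z) i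
      (by rw [hs.reg]; exact hi) h
    rw [hs.reg] at this
    exact ⟨_, this, hs.setArr _ _ _⟩
  | seq _ _ ih1 ih2 =>
    intro τ hs
    obtain ⟨τ1, h1, s1⟩ := ih1 τ hs
    obtain ⟨τ2, h2, s2⟩ := ih2 τ1 s1
    exact ⟨τ2, .seq h1 h2, s2⟩
  | ite_pos hx _ ih =>
    intro τ hs
    obtain ⟨τ1, h1, s1⟩ := ih τ hs
    exact ⟨τ1, .ite_pos (by rw [hs.reg]; exact hx) h1, s1⟩
  | ite_neg hx _ ih =>
    intro τ hs
    obtain ⟨τ1, h1, s1⟩ := ih τ hs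
    exact ⟨τ1, .ite_neg (by rw [hs.reg]; exact hx) h1, s1⟩
  | loop_done hx => exact fun τ hs => ⟨τ, .loop_done (by rw [hs.reg]; exact hx), hs⟩
  | loop_step hx _ _ ih1 ih2 =>
    intro τ hs
    obtain ⟨τ1, h1, s1⟩ := ih1 τ hs
    obtain ⟨τ2, h2, s2⟩ := ih2 τ1 s1
    exact ⟨τ2, .loop_step (by rw [hs.reg]; exact hx) h1 h2, s2⟩

lemma exists_forall_not_wrR (p : Prog) : ∃ R, ∀ y, R ≤ y → ¬ p.wrR y := by
  induction p with
  | skip | store => exact ⟨0, fun _ _ h => h⟩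
  | const x | arith x | load x =>
    exact ⟨x + 1, fun y hy h => by have : y = x := h; omega⟩
  | seq _ _ ih1 ih2 | ite _ _ _ ih1 ih2 =>
    obtain ⟨R, hR⟩ := ih1
    obtain ⟨S, hS⟩ := ih2
    exact ⟨max R S, fun y hy h => h.elim (hR y (by omega)) (hS y (by omega))⟩
  | loop _ _ ih => exact ih

lemma exists_forall_not_wrA (p : Prog) : ∃ R, ∀ y, R ≤ y → ¬ p.wrA y := by
  induction p with
  | skip | const | arith | load => exact ⟨0, fun _ _ h => h⟩
  | store a => exact ⟨a + 1, fun y hy h => by have : y = a := h; omega⟩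
  | seq _ _ ih1 ih2 | ite _ _ _ ih1 ih2 =>
    obtain ⟨R, hR⟩ := ih1
    obtain ⟨S, hS⟩ := ih2
    exact ⟨max R S, fun y hy h => h.elim (hR y (by omega)) (hS y (by omega))⟩
  | loop _ _ ih => exact ih

/-! ## Matrices stored row by row -/

lemma rowMajor_apply {p q : ℕ} (A : Matrix (Fin p) (Fin q) ℤ) (i : Fin p) (j : Fin q) :
    rowMajor A (i * q + j) = A i j := by
  have h := mul_add_lt i.2 j.2
  have hq : 0 < q := j.pos
  rw [rowMajor, dif_pos h]
  congr 1
  · ext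
    simp only [Fin.coe_divNat]
    rw [add_comm, Nat.add_mul_div_right _ _ hq, Nat.div_eq_of_lt j.2, zero_add]
  · ext
    simp only [Fin.coe_modNat]
    rw [add_comm, Nat.add_mul_mod_self_right, Nat.mod_eq_of_lt j.2]

lemma abs_rowMajor_le {p q : ℕ} {A : Matrix (Fin p) (Fin q) ℤ} {Y : ℤ} (hY : 0 ≤ Y)
    (h : ∀ i j, |A i j| ≤ Y) (a : ℕ) : |rowMajor A a| ≤ Y := by
  rw [rowMajor]; split_ifs
  · exact h _ _
  · simpa using hY

lemma rowMajor_of_le {p q : ℕ} {A : Matrix (Fin p) (Fin q) ℤ} {a : ℕ} (h : p * q ≤ a) :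
    rowMajor A a = 0 := by rw [rowMajor, dif_neg (by omega)]

lemma dot_rowMajor {n m : ℕ} (A : Matrix (Fin n) (Fin m) ℤ) (B : Matrix (Fin m) (Fin n) ℤ)
    (i j : Fin n) : dot n m (rowMajor A) (rowMajor B) i j = (A * B) i j := by
  rw [dot, Finset.sum_range, Matrix.mul_apply]
  exact Finset.sum_congr rfl fun k _ => by rw [rowMajor_apply, rowMajor_apply]

/-- The program `p` multiplies matrices within the bounds given by `τ`, `d` and `C`. -/
def Multiplies (s τ : ℝ) (d : ℕ) (p : Prog) (C : ℕ) : Prop :=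
  ∀ n m : ℕ, 1 ≤ n → m = ⌈(n : ℝ) ^ s⌉₊ →
    ∀ (A : Matrix (Fin n) (Fin m) ℤ) (B : Matrix (Fin m) (Fin n) ℤ),
      (∀ i k, |A i k| ≤ (n : ℤ) ^ d) → (∀ k j, |B k j| ≤ (n : ℤ) ^ d) →
      ∃ (t : ℕ) (σ : State),
        Exec (C * (Nat.log 2 n + 1)) ⌊(C : ℝ) * (n : ℝ) ^ τ⌋₊ p
          (inputState [(n : ℤ), (m : ℤ)] A B) t σ ∧
        (t : ℝ) ≤ C * (n : ℝ) ^ τ ∧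
        ∀ i j : Fin n, σ.arr 2 (i * n + j) = (A * B) i j

/-- A multiplication program has to look at its input. -/
lemma Multiplies.mul_le {s τ : ℝ} {d : ℕ} {p : Prog} {C : ℕ} (h : Multiplies s τ d p C)
    {n m : ℕ} (hn : 1 ≤ n) (hm : m = ⌈(n : ℝ) ^ s⌉₊) : (n * m : ℝ) ≤ C * (n : ℝ) ^ τ := by
  by_contra hlt
  push Not at hlt
  have hn1 : (1 : ℤ) ≤ (n : ℤ) ^ d := one_le_pow₀ (by exact_mod_cast hn)
  set B : Matrix (Fin m) (Fin n) ℤ := fun _ _ => 1 with hB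
  obtain ⟨t, σ, hE, ht, hσ⟩ := h n m hn hm 0 B (by simp) (by simp [hB]; omega)
  obtain ⟨R, hR, hv⟩ := hE.touched
  have htn : t < n * m := by exact_mod_cast ht.trans_lt hlt
  obtain ⟨c, hc, hcR⟩ : ∃ c ∈ Finset.range (n * m), (0, c) ∉ R := by
    by_contra hall
    push Not at hall
    have : (Finset.range (n * m)).image (fun c => (0, c)) ⊆ R := by
      intro x hx
      obtain ⟨c, hc, rfl⟩ := Finset.mem_image.1 hx
      exact hall c hc
    have := Finset.card_le_card this
    rw [Finset.card_image_of_injective _ (fun a b hab => by simpa using hab),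
      Finset.card_range] at this
    omega
  rw [Finset.mem_range] at hc
  set i : Fin n := Fin.divNat ⟨c, hc⟩ with hi
  set k : Fin m := Fin.modNat ⟨c, hc⟩ with hk
  have hik : (i : ℕ) * m + k = c := by
    simp only [hi, hk, Fin.coe_divNat, Fin.coe_modNat]; exact Nat.div_add_mod' c m
  set A : Matrix (Fin n) (Fin m) ℤ := fun i' k' => if i' = i ∧ k' = k then 1 else 0 with hA
  have hstate : inputState [(n : ℤ), (m : ℤ)] A B
      = (inputState [(n : ℤ), (m : ℤ)] (0 : Matrix (Fin n) (Fin m) ℤ) B).setArr 0 c 1 := by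
    ext a e
    · rfl
    · rw [State.arr_setArr]
      by_cases ha : a = 0
      · subst ha
        simp only [inputState, if_true]
        by_cases hec : e = c
        · subst hec
          rw [Function.update_self, ← hik, rowMajor_apply]
          simp [hA]
        · rw [Function.update_of_ne hec]
          by_cases hen : e < n * m
          · simp only [rowMajor, dif_pos hen, hA, Matrix.zero_apply]
            rw [if_neg]
            rintro ⟨h1, h2⟩
            apply hec
            have e1 : e / m = i := congrArg Fin.val h1
            have e2 : e % m = k := congrArg Fin.val h2
            rw [← hik, ← e1, ← e2]; exact (Nat.div_add_mod' e m).symm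
          · simp [rowMajor, dif_neg hen]
      · simp [inputState, ha]
  obtain ⟨t', σ', hE', -, hσ'⟩ := h n m hn hm A B (by
      intro i' k'; simp only [hA]; split_ifs
      · simpa using hn1
      · simp)
    (by simp [hB]; omega)
  rw [hstate] at hE'
  obtain ⟨-, rfl⟩ := hE'.det (hv 0 c hcR 1)
  have e1 := hσ' i i
  have e2 := hσ i i
  rw [State.arr_setArr, if_neg (by norm_num), e2] at e1
  rw [Matrix.zero_mul, Matrix.mul_apply] at e1
  simp [hA, hB] at e1

lemma ceil_rpow_le {n : ℕ} (hn : 1 ≤ n) (s : ℝ) : ⌈(n : ℝ) ^ s⌉₊ ≤ n ^ ⌈s⌉₊ := by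
  apply Nat.ceil_le.2
  rw [Nat.cast_pow, ← Real.rpow_natCast]
  exact Real.rpow_le_rpow_of_exponent_le (by exact_mod_cast hn) (Nat.le_ceil s)

lemma ceil_rpow_le_two_mul {n : ℕ} (hn : 1 ≤ n) {s : ℝ} (hs : 0 ≤ s) :
    (⌈(n : ℝ) ^ s⌉₊ : ℝ) ≤ 2 * (n : ℝ) ^ s := by
  have h1 : (1 : ℝ) ≤ (n : ℝ) ^ s := Real.one_le_rpow (by exact_mod_cast hn) hs
  have := Nat.ceil_lt_add_one (a := (n : ℝ) ^ s) (by linarith)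
  linarith

lemma one_le_ceil_rpow {n : ℕ} (hn : 1 ≤ n) (s : ℝ) : 1 ≤ ⌈(n : ℝ) ^ s⌉₊ :=
  Nat.one_le_ceil_iff.2 (Real.rpow_pos_of_pos (by exact_mod_cast hn) _)

lemma inputState_good {n m X : ℕ} {l : List ℤ} {A : Matrix (Fin n) (Fin m) ℤ}
    {B : Matrix (Fin m) (Fin n) ℤ} (hl : ∀ z ∈ l, |z| ≤ X) (hA : ∀ i k, |A i k| ≤ X)
    (hB : ∀ k j, |B k j| ≤ X) :
    (∀ y, |(inputState l A B).reg y| ≤ X) ∧ ∀ a i, |(inputState l A B).arr a i| ≤ X := by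
  refine ⟨fun y => ?_, fun a i => ?_⟩
  · simp only [inputState, List.getD_eq_getElem?_getD]
    rcases h : l[y]? with _ | z
    · simp
    · exact hl z (List.mem_of_getElem? h)
  · simp only [inputState]
    split_ifs
    · exact abs_rowMajor_le (by positivity) hA i
    · exact abs_rowMajor_le (by positivity) hB i
    · simp

lemma matMulInTime_two_add {s : ℝ} (hs : 1 ≤ s) : MatMulInTime s (2 + s) := by
  intro d
  obtain ⟨c, hc⟩ : ∃ c, c = 2 * d + ⌈s⌉₊ + 4 := ⟨_, rfl⟩
  obtain ⟨C, hC⟩ : ∃ C, C = 17 * c + 1000 := ⟨_, rfl⟩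
  refine ⟨schoolbook.compile, C, fun n m hn hm A B hA hB => ?_⟩
  set Z := 2 ^ (Nat.log 2 n + 1) with hZ
  have hnZ : n ≤ Z := (Nat.lt_pow_succ_log_self (by norm_num) n).le
  have hZ1 : 2 ≤ Z := by
    rw [hZ, pow_succ]; have := Nat.one_le_two_pow (n := Nat.log 2 n); omega
  have hn0 : (0 : ℝ) < n := by exact_mod_cast hn
  have hn1 : (1 : ℝ) ≤ n := by exact_mod_cast hn
  have hm1 : 1 ≤ m := hm ▸ one_le_ceil_rpow hn s
  have hmn : m ≤ n ^ ⌈s⌉₊ := hm ▸ ceil_rpow_le hn s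
  have hm2 : (m : ℝ) ≤ 2 * (n : ℝ) ^ s := hm ▸ ceil_rpow_le_two_mul hn (by linarith)
  have hns : (n : ℝ) ≤ (n : ℝ) ^ s := by
    simpa using Real.rpow_le_rpow_of_exponent_le hn1 hs
  have hpow : (n : ℝ) ^ (2 + s) = n * n * (n : ℝ) ^ s := by
    rw [Real.rpow_add hn0, Real.rpow_two]; ring
  have hXp : Z ^ c = 2 ^ (c * (Nat.log 2 n + 1)) := by rw [hZ, ← pow_mul, mul_comm]
  have hpows : ∀ e, e ≤ c → n ^ e ≤ Z ^ c := fun e he =>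
    (Nat.pow_le_pow_left hnZ e).trans (Nat.pow_le_pow_right (by omega) he)
  let mc : Mach :=
    { w := C * (Nat.log 2 n + 1)
      M := ⌊(C : ℝ) * (n : ℝ) ^ (2 + s)⌋₊
      X := Z ^ c
      hX := by
        calc 16 = 2 ^ 4 := by norm_num
          _ ≤ Z ^ 4 := Nat.pow_le_pow_left hZ1 4
          _ ≤ Z ^ c := Nat.pow_le_pow_right (by omega) (by omega)
      hw := by
        rw [hXp, ← pow_mul]
        apply Nat.pow_lt_pow_right (by norm_num)
        have h1 : 17 * c * (Nat.log 2 n + 1) = c * (Nat.log 2 n + 1) * 16 + c * (Nat.log 2 n + 1) := by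
          ring
        rw [hC, add_mul (17 * c), h1]; omega }
  have hM : n * m ≤ mc.M := by
    apply Nat.le_floor
    push_cast
    rw [hpow, hC]; push_cast
    have : (n : ℝ) * m ≤ n * (2 * (n : ℝ) ^ s) := by gcongr
    have h3 : (n : ℝ) * (n : ℝ) ^ s ≤ n * n * (n : ℝ) ^ s := by
      rw [mul_assoc]; apply le_mul_of_one_le_left (by positivity) hn1
    have : (0 : ℝ) ≤ c * (n * n * (n : ℝ) ^ s) := by positivity
    nlinarith
  have hnm : n ≤ m := by
    rw [hm]; exact_mod_cast hns.trans (Nat.le_ceil _)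
  have hgood := inputState_good (X := Z ^ c) (l := [(n : ℤ), (m : ℤ)]) (A := A) (B := B) (by
      intro z hz
      simp only [List.mem_cons, List.not_mem_nil, or_false] at hz
      have := hpows 1 (by omega)
      have := hpows ⌈s⌉₊ (by omega)
      rcases hz with rfl | rfl
      · exact abs_cast_le (by omega)
      · exact abs_cast_le (by omega))
    (fun i k => (hA i k).trans (by exact_mod_cast hpows d (by omega)))
    (fun i k => (hB i k).trans (by exact_mod_cast hpows d (by omega)))
  have hrun := schoolbook_run mc (inputState [(n : ℤ), (m : ℤ)] A B) n m (n ^ (2 * d))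
    (rowMajor A) (rowMajor B) rfl rfl rfl rfl (by
      intro a b
      rw [abs_mul, two_mul, pow_add]
      push_cast
      exact mul_le_mul (abs_rowMajor_le (by positivity) hA a) (abs_rowMajor_le (by positivity) hB b)
        (abs_nonneg _) (by positivity)) (by
      refine (Nat.mul_le_mul_right _ hmn).trans ?_
      rw [← pow_add]; exact hpows _ (by omega))
    hM ((Nat.mul_le_mul_left _ hnm).trans hM) hm1 hn
  obtain ⟨t, τ', σ', h1, h2, -, h4, h5⟩ := hrun _ (Eqv.refl _)
    ⟨fun y _ => hgood.1 y, hgood.2⟩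
  refine ⟨t, τ', h1, ?_, fun i j => ?_⟩
  · have : (t : ℝ) ≤ (500 * (n * n * m) : ℕ) := by exact_mod_cast h2
    refine this.trans ?_
    rw [hpow, hC]; push_cast
    have : (n : ℝ) * n * m ≤ n * n * (2 * (n : ℝ) ^ s) := by gcongr
    have : (0 : ℝ) ≤ c * (n * n * (n : ℝ) ^ s) := by positivity
    nlinarith
  · rw [← h4.arr, h5 i i.2 j j.2, dot_rowMajor]

lemma MatMulInTime.mono {s τ τ' : ℝ} (h : MatMulInTime s τ) (hτ : τ ≤ τ') :
    MatMulInTime s τ' := by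
  intro d
  obtain ⟨p, C, hp⟩ := h d
  refine ⟨p, C, fun n m hn hm A B hA hB => ?_⟩
  obtain ⟨t, σ, h1, h2, h3⟩ := hp n m hn hm A B hA hB
  have : (n : ℝ) ^ τ ≤ (n : ℝ) ^ τ' :=
    Real.rpow_le_rpow_of_exponent_le (by exact_mod_cast hn) hτ
  exact ⟨t, σ, h1.mono le_rfl (Nat.floor_mono (by gcongr)), h2.trans (by gcongr), h3⟩

lemma MatMulInTime.one_add_le {s τ : ℝ} (h : MatMulInTime s τ) : 1 + s ≤ τ := by
  obtain ⟨p, C, hp⟩ := h 0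
  by_contra hlt
  push Not at hlt
  have key : ∀ n : ℕ, 1 ≤ n → (n : ℝ) ^ (1 + s - τ) ≤ C := by
    intro n hn
    have hn0 : (0 : ℝ) < n := by exact_mod_cast hn
    have := Multiplies.mul_le hp hn rfl
    rw [Real.rpow_sub hn0, div_le_iff₀ (by positivity), Real.rpow_add hn0, Real.rpow_one]
    exact le_trans (by gcongr; exact Nat.le_ceil _) this
  have ht := (tendsto_rpow_atTop (by linarith : 0 < 1 + s - τ)).comp
    (tendsto_natCast_atTop_atTop (R := ℝ))
  obtain ⟨n, hn, hn1⟩ := ((ht.eventually_gt_atTop (C : ℝ)).and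
    (Filter.eventually_ge_atTop 1)).exists
  exact absurd (key n hn1) (not_le.2 hn)

lemma one_add_le_omega {s : ℝ} (hs : 1 ≤ s) : 1 + s ≤ omega s :=
  le_csInf ⟨_, matMulInTime_two_add hs⟩ fun _ h => MatMulInTime.one_add_le h

lemma exists_matMulInTime {s ε : ℝ} (hs : 1 ≤ s) (hε : 0 < ε) :
    ∃ q : ℚ, (q : ℝ) < omega s + ε ∧ MatMulInTime s q := by
  obtain ⟨τ, h1, h2⟩ := exists_lt_of_csInf_lt (s := {τ : ℝ | MatMulInTime s τ})
    ⟨_, matMulInTime_two_add hs⟩ (show omega s < omega s + ε by linarith)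
  obtain ⟨q, hq1, hq2⟩ := exists_rat_btwn h2
  exact ⟨q, hq2, h1.mono hq1.le⟩


/-- The parameters of an instance: dimensions, block length, weight bound, query size, and the
two matrices as flat arrays. -/
structure Inst where
  n : ℕ
  m : ℕ
  Δ : ℕ
  W : ℕ
  L : ℕ
  f : ℕ → ℤ
  g : ℕ → ℤ
  Y : ℕ
  hn : 1 ≤ n
  hm : 1 ≤ m
  hnm : n ≤ m
  hΔ : 1 ≤ Δ
  hΔn : Δ ≤ n
  hΔW : Δ ≤ W
  hL : 1 ≤ L
  hf : ∀ a, |f a| ≤ Y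
  hg : ∀ a, |g a| ≤ Y

namespace Inst

variable (I : Inst)

def nb : ℕ := (I.n - 1) / I.Δ + 1
/-- Number of chunks of `L` inner indices. -/
def P : ℕ := (I.m - 1) / I.L + 1
def tot (i j k : ℕ) : ℤ := I.f (i * I.m + k) + I.g (k * I.n + j)
/-- The value at the first column of block `J`. -/
def val (i J k : ℕ) : ℤ := I.tot i (J * I.Δ) k

lemma mul_lt_of_lt_nb {J : ℕ} (h : J < I.nb) : J * I.Δ < I.n := by
  have h1 : J ≤ (I.n - 1) / I.Δ := by unfold nb at h; omega
  have := (Nat.le_div_iff_mul_le I.hΔ).1 h1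
  have := I.hn
  omega

lemma div_lt_nb {j : ℕ} (h : j < I.n) : j / I.Δ < I.nb := by
  have := Nat.div_le_div_right (c := I.Δ) (by omega : j ≤ I.n - 1)
  unfold nb; omega

lemma one_le_nb : 1 ≤ I.nb := Nat.le_add_left _ _

lemma one_le_P : 1 ≤ I.P := Nat.le_add_left _ _

lemma nb_le : I.nb ≤ I.n := by
  have := I.hn
  have : (I.n - 1) / I.Δ ≤ I.n - 1 := Nat.div_le_self _ _
  unfold nb; omega

lemma div_lt_P {k : ℕ} (h : k < I.m) : k / I.L < I.P := by
  have := Nat.div_le_div_right (c := I.L) (by omega : k ≤ I.m - 1)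
  unfold P; omega

lemma P_le : I.P ≤ I.m := by
  have := I.hm
  have : (I.m - 1) / I.L ≤ I.m - 1 := Nat.div_le_self _ _
  unfold P; omega

lemma abs_tot_le (i j k : ℕ) : |I.tot i j k| ≤ 2 * I.Y :=
  (abs_add_le _ _).trans (by have := I.hf (i * I.m + k); have := I.hg (k * I.n + j); omega)

lemma abs_val_le (i J k : ℕ) : |I.val i J k| ≤ 2 * I.Y := I.abs_tot_le _ _ _

end Inst

/-- The storage contains the instance. -/
structure Env (I : Inst) (σ : State) : Prop where
  r0 : σ.reg 0 = I.n
  r1 : σ.reg 1 = I.m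
  r2 : σ.reg 2 = I.Δ
  r3 : σ.reg 3 = I.W
  r4 : σ.reg 4 = I.L
  r9 : σ.reg 9 = I.nb
  a0 : σ.arr 0 = I.f
  a1 : σ.arr 1 = I.g

/-- The statement does not overwrite the instance. -/
def Stmt.safe (s : Stmt) : Bool :=
  !(s.wrR 0 || s.wrR 1 || s.wrR 2 || s.wrR 3 || s.wrR 4 || s.wrR 9 || s.wrA 0 || s.wrA 1)

lemma Env.fr {I : Inst} {s : Stmt} {σ σ' : State} (h : Env I σ) (hf : Fr s σ σ')
    (hs : s.safe = true := by rfl) : Env I σ' := by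
  simp only [Stmt.safe, Bool.not_eq_true', Bool.or_eq_false_iff] at hs
  obtain ⟨⟨⟨⟨⟨⟨⟨s0, s1⟩, s2⟩, s3⟩, s4⟩, s9⟩, b0⟩, b1⟩ := hs
  exact ⟨by rw [hf.r 0 s0, h.r0], by rw [hf.r 1 s1, h.r1], by rw [hf.r 2 s2, h.r2],
    by rw [hf.r 3 s3, h.r3], by rw [hf.r 4 s4, h.r4], by rw [hf.r 9 s9, h.r9],
    by rw [hf.a 0 b0, h.a0], by rw [hf.a 1 b1, h.a1]⟩

lemma Env.set {I : Inst} {σ : State} (h : Env I σ) (x : ℕ) (v : ℤ)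
    (hx : x ∉ [0, 1, 2, 3, 4, 9] := by decide) : Env I (σ.setReg x v) := by
  simp only [List.mem_cons, List.not_mem_nil, or_false, not_or] at hx
  obtain ⟨h0, h1, h2, h3, h4, h9⟩ := hx
  constructor <;> simp only [State.reg_setReg, State.arr_setReg]
  · rw [if_neg (Ne.symm h0), h.r0]
  · rw [if_neg (Ne.symm h1), h.r1]
  · rw [if_neg (Ne.symm h2), h.r2]
  · rw [if_neg (Ne.symm h3), h.r3]
  · rw [if_neg (Ne.symm h4), h.r4]
  · rw [if_neg (Ne.symm h9), h.r9]
  · exact h.a0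
  · exact h.a1

lemma Env.setA {I : Inst} {σ : State} (h : Env I σ) (a i : ℕ) (v : ℤ)
    (ha : 2 ≤ a := by norm_num) : Env I (σ.setArr a i v) :=
  ⟨h.r0, h.r1, h.r2, h.r3, h.r4, h.r9, by simp [h.a0]; omega, by simp [h.a1]; omega⟩

lemma Run.count_seq {mc : Mach} {σ : State} {T : ℕ} {Q : State → Prop} {x y c : ℕ} {e : Ex}
    {u : Stmt} (N : ℕ) (p : ℕ → Prop) [DecidablePred p] (c₀ : ℕ)
    (hN : σ.reg y = N) (hc₀ : σ.reg c = c₀) (hX : c₀ + N ≤ mc.X)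
    (hp : ∀ k < N, ∀ σ' : State, σ'.reg x = k → Fr (.for x y (.ite e (.asg c (.r c + 1)) .skip)) σ σ' →
      Good mc.X σ' → e.ok mc.M σ' ∧ (0 < e.eval σ' ↔ p k))
    (hQ : ∀ σ' : State, σ'.reg c = (c₀ + ((Finset.range N).filter p).card : ℕ) →
      Fr (.for x y (.ite e (.asg c (.r c + 1)) .skip)) σ σ' → Good mc.X σ' →
      Run mc u σ' (T - (N * 121 + 8)) Q)
    (hx : x < 60 := by norm_num) (hy : y < 60 := by norm_num) (hxy : y ≠ x := by norm_num)
    (hc : c < 60 := by norm_num) (hcx : x ≠ c := by norm_num) (hcy : y ≠ c := by norm_num)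
    (hw : e.wf = true := by rfl) (hco : e.cost ≤ 50 := by decide) :
    Run mc (.for x y (.ite e (.asg c (.r c + 1)) .skip) ;; u) σ T Q := by
  have hwc : (Ex.r c + 1 : Ex).wf = true := by
    change (Ex.wf (Ex.op _ _ (Ex.c _))) = true; simp [Ex.wf, Ex.leaves, hc]
  refine Run.forC_seq N 110 (fun k σ' => σ'.reg c = (c₀ + ((Finset.range k).filter p).card : ℕ))
    hN (by simp [hc₀, hcx.symm]) (fun k hk σ' hI hxk hfr hg => ?_) hQ hx hy hxy
    (by simp [Stmt.wrR, hcx]) (by simp [Stmt.wrR, hcy])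
  obtain ⟨h1, h2⟩ := hp k hk σ' hxk hfr hg
  have hcard : ((Finset.range k).filter p).card ≤ k := by
    simpa using Finset.card_filter_le (Finset.range k) p
  refine Run.iteB (fun h => ?_) (fun h => ?_) h1 hw hco
  · refine Run.asg_last ((c₀ + ((Finset.range k).filter p).card + 1 : ℕ) : ℤ)
      (abs_cast_le (by omega)) (by simp [hI]) ?_ (by simp) (by omega) hwc
      (by change 4 ≤ 50; norm_num)
    simp [Finset.range_add_one, Finset.filter_insert, h2.1 h, hcx.symm, add_assoc]
  · refine Run.skip_last ?_
    have : ¬ p k := fun hh => h (h2.2 hh)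
    simpa [Finset.range_add_one, Finset.filter_insert, this, hcx.symm] using hI

/-- Value of the current triple `(reg 20, reg 21, reg 22)` (row, column block, inner index). -/
def exVal : Ex := .ld 0 (.r 20 * .r 1 + .r 22) + .ld 1 (.r 22 * .r 0 + .r 21 * .r 2)

lemma Env.eval_exVal {I : Inst} {σ : State} (h : Env I σ) {i J k : ℕ} (h20 : σ.reg 20 = i)
    (h21 : σ.reg 21 = J) (h22 : σ.reg 22 = k) : exVal.eval σ = I.val i J k := by
  simp only [MinPlusQuery.exVal, Ex.eval_add, Ex.eval_ld, Ex.eval_mul, Ex.eval_r, h20, h21, h22,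
    h.r0, h.r1, h.r2, h.a0, h.a1, Inst.val, Inst.tot]
  norm_cast

lemma Env.ok_exVal {I : Inst} {σ : State} {M : ℕ} (h : Env I σ) {i J k : ℕ} (h20 : σ.reg 20 = i)
    (h21 : σ.reg 21 = J) (h22 : σ.reg 22 = k) (hi : i < I.n) (hJ : J < I.nb) (hk : k < I.m)
    (hM : I.n * I.m ≤ M) : exVal.ok M σ := by
  simp only [MinPlusQuery.exVal, Ex.ok_add, Ex.ok_ld, Ex.ok_mul, Ex.ok_r, Ex.eval_add, Ex.eval_mul,
    Ex.eval_r, h20, h21, h22, h.r0, h.r1, h.r2, true_and]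
  norm_cast
  have := mul_add_lt hi hk
  have := mul_add_lt hk (I.mul_lt_of_lt_nb hJ)
  have : I.m * I.n = I.n * I.m := by ring
  exact ⟨⟨by omega, by omega⟩, by omega, by omega⟩

/-! ## Thresholds -/

/-- Binary search for the threshold of every row and column block, and the list of the inner
indices below it. -/
def thresholds : Stmt :=
  .for 20 0 (.for 21 9 (
    .asg 24 0 ;; .asg 25 0 ;;
    .for 22 1 (.asg 26 exVal ;; .ite (.r 26 - .r 25 + 1) (.asg 25 (.r 26 + 1)) .skip ;;
      .ite (.r 24 - .r 26) (.asg 24 (.r 26)) .skip) ;;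
    .whl (.r 25 - .r 24) (
      .asg 27 ((.r 24 + .r 25) / 2) ;; .asg 28 0 ;;
      .for 22 1 (.ite (.r 27 - exVal + 1) (.asg 28 (.r 28 + 1)) .skip) ;;
      .ite (.r 28 - .r 4 + 1) (.asg 25 (.r 27)) (.asg 24 (.r 27 + 1))) ;;
    .asg 28 0 ;;
    .for 22 1 (.ite (.r 24 - exVal)
      (.sto 5 ((.r 20 * .r 9 + .r 21) * .r 1 + .r 28) (.r 22) ;; .asg 28 (.r 28 + 1)) .skip) ;;
    .sto 3 (.r 20 * .r 9 + .r 21) (.r 24) ;;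
    .sto 4 (.r 20 * .r 9 + .r 21) (.r 28)))

/-- `v` is a threshold for the values `a k`, `k < m`, and `E 0, …, E (e - 1)` lists the indices
below it. -/
structure IsThreshold (m L : ℕ) (a : ℕ → ℤ) (v : ℤ) (e : ℕ) (E : ℕ → ℤ) : Prop where
  lt : e < L
  le : e ≤ m
  entry : ∀ t < e, ∃ k < m, E t = (k : ℕ)
  mem : ∀ k < m, a k < v → ∃ t < e, E t = (k : ℕ)
  cov : (∀ k < m, a k < v) ∨ L ≤ ((Finset.range m).filter fun k => a k ≤ v).card

/-- What the threshold phase leaves in the arrays `3`, `4`, `5`. -/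
def ThrAt (I : Inst) (σ : State) (i J : ℕ) : Prop :=
  |σ.arr 3 (i * I.nb + J)| ≤ 2 * I.Y + 1 ∧
  ∃ e : ℕ, σ.arr 4 (i * I.nb + J) = e ∧
    IsThreshold I.m I.L (I.val i J) (σ.arr 3 (i * I.nb + J)) e
      (fun t => σ.arr 5 ((i * I.nb + J) * I.m + t))

lemma ThrAt.congr {I : Inst} {σ σ' : State} {i J : ℕ} (h : ThrAt I σ i J)
    (h3 : σ'.arr 3 (i * I.nb + J) = σ.arr 3 (i * I.nb + J))
    (h4 : σ'.arr 4 (i * I.nb + J) = σ.arr 4 (i * I.nb + J))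
    (h5 : ∀ t < I.m, σ'.arr 5 ((i * I.nb + J) * I.m + t) = σ.arr 5 ((i * I.nb + J) * I.m + t)) :
    ThrAt I σ' i J := by
  obtain ⟨h1, e, he, ht⟩ := h
  have hlm := ht.le
  refine ⟨by rw [h3]; exact h1, e, by rw [h4]; exact he, ht.lt, ht.le, fun t hte => ?_,
    fun k hk hv => ?_, by rw [h3]; exact ht.cov⟩
  · show ∃ k < I.m, σ'.arr 5 _ = _
    rw [h5 t (by omega)]; exact ht.entry t hte
  · rw [h3] at hv
    obtain ⟨t, hte, hh⟩ := ht.mem k hk hv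
    exact ⟨t, hte, by show σ'.arr 5 _ = _; rw [h5 t (by omega)]; exact hh⟩

lemma thresholds_run (mc : Mach) (I : Inst) (b : ℕ) (hb : 4 * I.Y + 4 ≤ 2 ^ b) (σ : State)
    (hE : Env I σ) (hM : I.n * I.m ≤ mc.M) (hM5 : I.n * I.nb * I.m ≤ mc.M)
    (hX : 4 * I.Y + 2 * I.m + 2 ≤ mc.X) :
    Run mc thresholds σ (2100 * (b + 1) * (I.n * I.nb * I.m)) fun σ' =>
      ∀ i < I.n, ∀ J < I.nb, ThrAt I σ' i J := by
  have hm := I.hm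
  have hcell : ∀ {i J}, i < I.n → J < I.nb → i * I.nb + J < mc.M := by
    intro i J hi hJ
    have := mul_add_lt hi hJ
    have := Nat.mul_le_mul_left (I.n * I.nb) hm
    omega
  obtain ⟨c, hc⟩ : ∃ c, c = b * (I.m * 121 + 500) + 1000 * I.m := ⟨_, rfl⟩
  refine Run.forC I.n (I.nb * (c + 1000) + 8) (fun i σ' => ∀ i' < i, ∀ J < I.nb, ThrAt I σ' i' J)
    hE.r0 (by simp) ?_ (fun _ h _ _ _ => h) ?_
  swap
  · have h1 : I.n * (I.nb * (c + 1000) + 8 + 11) + 8 ≤ I.n * I.nb * (c + 1030) := by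
      have hnb := I.one_le_nb
      have := I.hn
      have : I.n ≤ I.n * I.nb := Nat.le_mul_of_pos_right _ hnb
      nlinarith
    refine h1.trans ?_
    have h2 : c + 1030 ≤ 2100 * (b + 1) * I.m := by
      rw [hc]; nlinarith [Nat.mul_le_mul_left b hm]
    calc _ ≤ I.n * I.nb * (2100 * (b + 1) * I.m) := Nat.mul_le_mul_left _ h2
      _ = _ := by ring
  intro i hi σ1 I1 r20 fr1 g1
  have E1 := hE.fr fr1
  refine Run.forC I.nb (c + 980) (fun J σ' => (∀ i' < i, ∀ J < I.nb, ThrAt I σ' i' J) ∧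
    ∀ J' < J, ThrAt I σ' i J') E1.r9 ⟨by simpa [ThrAt] using I1, fun _ h => absurd h (by omega)⟩ ?_ ?_
    (by nlinarith [Nat.zero_le I.nb])
  swap
  · intro σ' h _ _ _ i' hi'
    rcases (by omega : i' < i ∨ i' = i) with h' | rfl
    · exact h.1 i' h'
    · exact h.2
  intro J hJ σ2 I2 r21 fr2 g2
  have E2 := E1.fr fr2
  have r20' : σ2.reg 20 = i := by rw [fr2.r 20, r20]
  refine Run.asg_seq 0 (by simp) rfl (Run.asg_seq 0 (by simp) rfl ?_)
  refine Run.forC_seq I.m 400 (fun k σ' => ∃ lo hi : ℤ, σ'.reg 24 = lo ∧ σ'.reg 25 = hi ∧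
    -(2 * I.Y) ≤ lo ∧ lo ≤ 0 ∧ 0 ≤ hi ∧ hi ≤ 2 * I.Y + 1 ∧ ∀ l < k, lo ≤ I.val i J l ∧ I.val i J l < hi)
    E2.r1 ⟨0, 0, by simp, by simp, by simp, le_rfl, le_rfl, by positivity, by simp⟩ ?_ ?_
  · rintro k hk σ3 ⟨lo, hi', l1, l2, l3, l4, l5, l6, l7⟩ r22 fr3 g3
    have E3 := ((E2.set 24 0).set 25 0).fr fr3
    have e20 : σ3.reg 20 = i := by rw [fr3.r 20]; simp [r20']
    have e21 : σ3.reg 21 = J := by rw [fr3.r 21]; simp [r21]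
    have hv := I.abs_val_le i J k
    rw [abs_le] at hv
    refine Run.asg_seq (I.val i J k) (by rw [abs_le]; constructor <;> omega)
      (E3.eval_exVal e20 e21 r22) ?_ (E3.ok_exVal e20 e21 r22 hi hJ hk hM)
    refine Run.ite_seq (fun σ' => σ'.reg 26 = I.val i J k ∧ σ'.reg 24 = lo ∧
      ∃ hi'' : ℤ, σ'.reg 25 = hi'' ∧ hi' ≤ hi'' ∧ I.val i J k < hi'' ∧ hi'' ≤ 2 * I.Y + 1) 50
      (fun h => ?_) (fun h => ?_) ?_
    · refine Run.asg_last (I.val i J k + 1) (by rw [abs_le]; constructor <;> omega) (by simp) ?_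
      simp only [State.reg_setReg, Ex.eval_add, Ex.eval_sub, Ex.eval_r, Ex.eval_one] at h
      norm_num [l2] at h
      simp only [State.reg_setReg]
      norm_num [l1]
      omega
    · refine Run.skip_last ?_
      simp only [State.reg_setReg, Ex.eval_add, Ex.eval_sub, Ex.eval_r, Ex.eval_one] at h
      norm_num [l2] at h
      simp only [State.reg_setReg]
      norm_num [l1, l2]
      omega
    · rintro σ4 ⟨q1, q2, hi'', q3, q4, q5, q6⟩ fr4 g4
      refine Run.iteB (fun h => ?_) (fun h => ?_)
      · simp only [Ex.eval_sub, Ex.eval_r, q1, q2] at h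
        refine Run.asg_last (I.val i J k) (by rw [abs_le]; constructor <;> omega) (by simp [q1]) ?_
        refine ⟨I.val i J k, hi'', by simp, by simp [q3], by omega, by omega, by omega, q6,
          fun l hl => ?_⟩
        rcases (by omega : l < k ∨ l = k) with h' | rfl
        · have := l7 l h'; omega
        · omega
      · simp only [Ex.eval_sub, Ex.eval_r, q1, q2] at h
        refine Run.skip_last ⟨lo, hi'', by simp [q2], by simp [q3], by omega, by omega, by omega,
          q6, fun l hl => ?_⟩
        rcases (by omega : l < k ∨ l = k) with h' | rfl
        · have := l7 l h'; omega
        · omega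
  rintro σ3 ⟨lo₀, hi₀, l1, l2, l3, l4, l5, l6, l7⟩ fr3 g3
  have E3 := ((E2.set 24 0).set 25 0).fr fr3
  have e20 : σ3.reg 20 = i := by rw [fr3.r 20]; simp [r20']
  have e21 : σ3.reg 21 = J := by rw [fr3.r 21]; simp [r21]
  refine Run.whl_seq b (I.m * 121 + 400) (fun f' σ' => ∃ lo hi : ℤ, σ'.reg 24 = lo ∧
    σ'.reg 25 = hi ∧ lo₀ ≤ lo ∧ lo ≤ hi ∧ hi ≤ hi₀ ∧ hi - lo < 2 ^ f' ∧
    (((Finset.range I.m).filter fun k => I.val i J k < lo).card < I.L) ∧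
    (hi = hi₀ ∨ I.L ≤ ((Finset.range I.m).filter fun k => I.val i J k ≤ hi).card)) ?_
    (fun _ _ _ _ _ => by simp) ?_ ?_
  · refine ⟨lo₀, hi₀, l1, l2, le_rfl, by omega, le_rfl, ?_, ?_, Or.inl rfl⟩
    · have : (4 * I.Y + 4 : ℤ) ≤ 2 ^ b := by exact_mod_cast hb
      omega
    · rw [Finset.filter_false_of_mem]
      · simpa using Nat.lt_of_lt_of_le Nat.zero_lt_one I.hL
      · intro k hk; have := l7 k (Finset.mem_range.1 hk); omega
  · rintro f' σ4 ⟨lo, hi', t1, t2, t3, t4, t5, t6, t7, t8⟩ fr4 g4 hpos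
    have E4 := E3.fr fr4
    have e20 : σ4.reg 20 = i := by rw [fr4.r 20, e20]
    have e21 : σ4.reg 21 = J := by rw [fr4.r 21, e21]
    simp only [Ex.eval_sub, Ex.eval_r, t1, t2] at hpos
    obtain ⟨f'', rfl⟩ : ∃ f'', f' = f'' + 1 := by
      cases f' with
      | zero => simp at t6; omega
      | succ f'' => exact ⟨f'', rfl⟩
    refine ⟨f'', rfl, ?_⟩
    obtain ⟨mid, hmid⟩ : ∃ mid, mid = (lo + hi') / 2 := ⟨_, rfl⟩
    rw [pow_succ] at t6
    refine Run.asg_seq mid (by rw [abs_le]; constructor <;> omega) (by simp [t1, t2, hmid]) ?_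
    refine Run.asg_seq 0 (by simp) rfl ?_
    refine Run.count_seq I.m (fun k => I.val i J k ≤ mid) 0 (by simp [E4.r1]) (by simp)
      (by omega) ?_ ?_
    · intro k hk σ5 r22 fr5 g5
      have E5 := ((E4.set 27 mid).set 28 0).fr fr5
      have e20' : σ5.reg 20 = i := by rw [fr5.r 20]; simp [e20]
      have e21' : σ5.reg 21 = J := by rw [fr5.r 21]; simp [e21]
      have e27 : σ5.reg 27 = mid := by rw [fr5.r 27]; simp
      refine ⟨by simpa using E5.ok_exVal e20' e21' r22 hi hJ hk hM, ?_⟩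
      simp only [Ex.eval_add, Ex.eval_sub, Ex.eval_r, e27, E5.eval_exVal e20' e21' r22, Ex.eval_one]
      omega
    · intro σ5 r28 fr5 g5
      have E5 := ((E4.set 27 mid).set 28 0).fr fr5
      have e24 : σ5.reg 24 = lo := by rw [fr5.r 24]; simp [t1]
      have e25 : σ5.reg 25 = hi' := by rw [fr5.r 25]; simp [t2]
      have e27 : σ5.reg 27 = mid := by rw [fr5.r 27]; simp
      rw [zero_add] at r28
      refine Run.iteB (fun h => ?_) (fun h => ?_)
      · simp only [Ex.eval_add, Ex.eval_sub, Ex.eval_r, Ex.eval_one, r28, E5.r4] at h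
        refine Run.asg_last mid (by rw [abs_le]; constructor <;> omega) (by simp [e27])
          ⟨lo, mid, by simp [e24], by simp, t3, by omega, by omega, by omega, t7, Or.inr (by omega)⟩
      · simp only [Ex.eval_add, Ex.eval_sub, Ex.eval_r, Ex.eval_one, r28, E5.r4] at h
        refine Run.asg_last (mid + 1) (by rw [abs_le]; constructor <;> omega) (by simp [e27])
          ⟨mid + 1, hi', by simp, by simp [e25], by omega, by omega, t5, by omega, ?_, t8⟩
        simp only [Int.lt_add_one_iff]
        omega
  rintro f' σ4 ⟨v, hi', t1, t2, t3, t4, t5, t6, t7, t8⟩ hnp fr4 g4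
  simp only [Ex.eval_sub, Ex.eval_r, t1, t2] at hnp
  obtain rfl : hi' = v := by omega
  have E4 := E3.fr fr4
  have e20 : σ4.reg 20 = i := by rw [fr4.r 20, e20]
  have e21 : σ4.reg 21 = J := by rw [fr4.r 21, e21]
  refine Run.asg_seq 0 (by simp) rfl ?_
  have hrow : ∀ {t}, t < I.m → (i * I.nb + J) * I.m + t < mc.M := fun ht =>
    (mul_add_lt (mul_add_lt hi hJ) ht).trans_le hM5
  refine Run.forC_seq I.m 250 (fun k σ' => ∃ e : ℕ, σ'.reg 28 = e ∧
    e = ((Finset.range k).filter fun k => I.val i J k < hi').card ∧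
    (∀ t < e, ∃ l < k, σ'.arr 5 ((i * I.nb + J) * I.m + t) = (l : ℕ)) ∧
    (∀ l < k, I.val i J l < hi' → ∃ t < e, σ'.arr 5 ((i * I.nb + J) * I.m + t) = (l : ℕ)) ∧
    ∀ t < (i * I.nb + J) * I.m, σ'.arr 5 t = σ2.arr 5 t) E4.r1 ?_ ?_ ?_
  · refine ⟨0, by simp, by simp, by simp, by simp, fun t _ => ?_⟩
    simp only [State.arr_setReg]
    rw [fr4.a 5, fr3.a 5]; rfl
  · rintro k hk σ5 ⟨e, u1, u2, u3, u4, u5⟩ r22 fr5 g5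
    have E5 := (E4.set 28 0).fr fr5
    have e20 : σ5.reg 20 = i := by rw [fr5.r 20]; simp [e20]
    have e21 : σ5.reg 21 = J := by rw [fr5.r 21]; simp [e21]
    have e24 : σ5.reg 24 = hi' := by rw [fr5.r 24]; simp [t1]
    have hek : e ≤ k := by rw [u2]; simpa using Finset.card_filter_le (Finset.range k) _
    refine Run.iteB (fun h => ?_) (fun h => ?_)
      (by simpa using E5.ok_exVal e20 e21 r22 hi hJ hk hM)
    · simp only [Ex.eval_sub, Ex.eval_r, e24, E5.eval_exVal e20 e21 r22] at h
      have hlt : I.val i J k < hi' := by omega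
      refine Run.sto_seq ((i * I.nb + J) * I.m + e) k (hrow (by omega)) (by
        exact abs_cast_le (by omega)) (by simp [e20, e21, u1, E5.r1, E5.r9]) (by simp [r22]) ?_
      refine Run.asg_last ((e + 1 : ℕ) : ℤ) (abs_cast_le (by omega))
        (by simp [u1]) ⟨e + 1, by simp, ?_, fun t ht => ?_, fun l hl hv => ?_, fun t ht => ?_⟩
      · simp [Finset.range_add_one, Finset.filter_insert, hlt, ← u2]
      · simp only [State.arr_setReg, State.arr_setArr, if_true]
        rcases (by omega : t < e ∨ t = e) with h' | rfl
        · obtain ⟨l, hl, hh⟩ := u3 t h'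
          exact ⟨l, by omega, by rw [Function.update_of_ne (by omega), hh]⟩
        · exact ⟨k, by omega, by simp⟩
      · simp only [State.arr_setReg, State.arr_setArr, if_true]
        rcases (by omega : l < k ∨ l = k) with h' | rfl
        · obtain ⟨t, ht, hh⟩ := u4 l h' hv
          exact ⟨t, by omega, by rw [Function.update_of_ne (by omega), hh]⟩
        · exact ⟨e, by omega, by simp⟩
      · simp only [State.arr_setReg, State.arr_setArr, if_true]
        rw [Function.update_of_ne (by omega), u5 t ht]
    · simp only [Ex.eval_sub, Ex.eval_r, e24, E5.eval_exVal e20 e21 r22] at h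
      have hlt : ¬ I.val i J k < hi' := by omega
      refine Run.skip_last ⟨e, by simp [u1], ?_, fun t ht => ?_, fun l hl hv => ?_, u5⟩
      · simp [Finset.range_add_one, Finset.filter_insert, hlt, ← u2]
      · obtain ⟨l, hl, hh⟩ := u3 t ht
        exact ⟨l, by omega, hh⟩
      · rcases (by omega : l < k ∨ l = k) with h' | rfl
        · exact u4 l h' hv
        · omega
  rintro σ5 ⟨e, u1, u2, u3, u4, u5⟩ fr5 g5
  have E5 := (E4.set 28 0).fr fr5
  have e20 : σ5.reg 20 = i := by rw [fr5.r 20]; simp [e20]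
  have e21 : σ5.reg 21 = J := by rw [fr5.r 21]; simp [e21]
  have e24 : σ5.reg 24 = hi' := by rw [fr5.r 24]; simp [t1]
  have hem : e ≤ I.m := by rw [u2]; simpa using Finset.card_filter_le (Finset.range I.m) _
  have old3 : σ5.arr 3 = σ2.arr 3 := by rw [fr5.a 3]; simp [fr4.a 3, fr3.a 3]
  have old4 : σ5.arr 4 = σ2.arr 4 := by rw [fr5.a 4]; simp [fr4.a 4, fr3.a 4]
  refine Run.sto_seq (i * I.nb + J) hi' (hcell hi hJ) (by rw [abs_le]; constructor <;> omega)
    (by simp [e20, e21, E5.r9]) (by simp [e24]) ?_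
  refine Run.sto_last (i * I.nb + J) e (hcell hi hJ) (abs_cast_le (by omega))
    (by simp [e20, e21, E5.r9]) (by simp [u1]) ⟨fun i' hi' J' hJ' => ?_, fun J' hJ' => ?_⟩
    (hT := ?_)
  · have h1 := mul_add_lt hi' hJ'
    refine (I2.1 i' hi' J' hJ').congr ?_ ?_ fun t ht => ?_
    · simp; rw [Function.update_of_ne (by omega), old3]
    · simp; rw [Function.update_of_ne (by omega), old4]
    · have := mul_add_lt (show i' * I.nb + J' < i * I.nb + J by omega) ht
      simp only [State.arr_setReg, State.arr_setArr]
      norm_num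
      exact u5 _ this
  · rcases (by omega : J' < J ∨ J' = J) with h' | rfl
    · refine (I2.2 J' h').congr ?_ ?_ fun t ht => ?_
      · simp; rw [Function.update_of_ne (by omega), old3]
      · simp; rw [Function.update_of_ne (by omega), old4]
      · have := mul_add_lt (show i * I.nb + J' < i * I.nb + J by omega) ht
        simp only [State.arr_setReg, State.arr_setArr]
        norm_num
        exact u5 _ this
    · refine ⟨?_, e, by simp, ?_⟩
      · simp only [State.arr_setReg, State.arr_setArr]
        norm_num
        rw [abs_le]; constructor <;> omega
      · simp only [State.arr_setReg, State.arr_setArr]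
        norm_num
        refine ⟨by omega, hem, u3, u4, ?_⟩
        rcases t8 with rfl | h
        · exact Or.inl fun k hk => (l7 k hk).2
        · exact Or.inr h
  · rw [hc]
    have : b * (I.m * 121 + 500) = b * (I.m * 121 + 400 + 51) + b * 49 := by ring
    omega


/-! ## The modulus -/

namespace Inst

variable (I : Inst) (h : ℕ → ℤ)

/-- Distance of the value of a triple from the threshold, in units of `8 W`; it is `0` for the
triples close to the threshold. -/
def far (i J k : ℕ) : ℤ := (I.val i J k - h (i * I.nb + J) + 2 * I.W) / (8 * I.W)

/-- The triple is not close to the threshold, but looks so modulo `8 W p`. -/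
def Bad (p i J k : ℕ) : Prop := I.far h i J k ≠ 0 ∧ (p : ℤ) ∣ I.far h i J k

instance (p i J : ℕ) : DecidablePred (I.Bad h p i J) :=
  fun _ => inferInstanceAs (Decidable (_ ∧ _))

def numBad (p : ℕ) : ℕ :=
  ∑ i ∈ Finset.range I.n, ∑ J ∈ Finset.range I.nb, ((Finset.range I.m).filter (I.Bad h p i J)).card

lemma sum_card_le (p N : ℕ) (i : ℕ) :
    ∑ J ∈ Finset.range N, ((Finset.range I.m).filter (I.Bad h p i J)).card ≤ N * I.m := by
  refine (Finset.sum_le_sum fun J _ => Finset.card_filter_le (Finset.range I.m) _).trans ?_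
  simp

lemma sum_sum_card_le (p N : ℕ) :
    ∑ i ∈ Finset.range N, ∑ J ∈ Finset.range I.nb,
      ((Finset.range I.m).filter (I.Bad h p i J)).card ≤ N * I.nb * I.m := by
  refine (Finset.sum_le_sum fun i _ => I.sum_card_le h p I.nb i).trans ?_
  simp [mul_assoc]

lemma numBad_le (p : ℕ) : I.numBad h p ≤ I.n * I.nb * I.m := I.sum_sum_card_le h p I.n

end Inst

/-- `reg 26` holds `far`, `reg 30` a modulus. -/
def exFar : Ex := (exVal - .r 24 + 2 * .r 3) / (8 * .r 3)

/-- Positive iff the number in `reg 26` is a nonzero multiple of `reg 30`. -/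
def exBad : Ex := (1 - (.r 26 - .r 26 / .r 30 * .r 30)) * (.r 26 * .r 26)

lemma exBad_pos {σ : State} {y : ℤ} {p : ℕ} (hp : 1 ≤ p) (h26 : σ.reg 26 = y)
    (h30 : σ.reg 30 = p) : 0 < exBad.eval σ ↔ y ≠ 0 ∧ (p : ℤ) ∣ y := by
  simp only [exBad, Ex.eval_mul, Ex.eval_sub, Ex.eval_div, Ex.eval_r, Ex.eval_one, h26, h30]
  have h1 : y - y / p * p = y % p := by
    have := Int.emod_add_mul_ediv y p; linarith [mul_comm (y / p) (p : ℤ)]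
  rw [h1, Int.dvd_iff_emod_eq_zero]
  have h2 : 0 ≤ y % p := Int.emod_nonneg _ (by positivity)
  constructor
  · intro h
    have hy : y ≠ 0 := by rintro rfl; simp at h
    have : 0 < y * y := mul_self_pos.2 hy
    have := (pos_iff_pos_of_mul_pos h).2 this
    exact ⟨hy, by omega⟩
  · rintro ⟨hy, hm⟩
    rw [hm]
    have : 0 < y * y := mul_self_pos.2 hy
    linarith

/-- Count the bad triples for the modulus in `reg 30`; the result is in `reg 31`. -/
def countBad : Stmt :=
  .asg 31 0 ;; .for 20 0 (.for 21 9 (.asg 24 (.ld 3 (.r 20 * .r 9 + .r 21)) ;;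
    .for 22 1 (.asg 26 exFar ;; .ite exBad (.asg 31 (.r 31 + 1)) .skip)))

lemma Inst.abs_far_le (I : Inst) (h : ℕ → ℤ) {i J : ℕ} (hh : |h (i * I.nb + J)| ≤ 2 * I.Y + 1)
    (k : ℕ) : |I.far h i J k| ≤ 4 * I.Y + 2 * I.W + 1 := by
  refine (Int.abs_ediv_le_abs _ _).trans ?_
  have := I.abs_val_le i J k
  rw [abs_le] at *
  constructor <;> omega

lemma countBad_run (mc : Mach) (I : Inst) (h : ℕ → ℤ) (p : ℕ) (hp : 1 ≤ p)
    (hh : ∀ i < I.n, ∀ J < I.nb, |h (i * I.nb + J)| ≤ 2 * I.Y + 1) (σ : State)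
    (hE : Env I σ) (h3 : σ.arr 3 = h) (h30 : σ.reg 30 = p)
    (hM : I.n * I.nb * I.m ≤ mc.M) (hM' : I.n * I.m ≤ mc.M)
    (hX : 4 * I.Y + 2 * I.W + 1 + I.n * I.nb * I.m ≤ mc.X) :
    Run mc countBad σ (500 * (I.n * I.nb * I.m)) fun σ' => σ'.reg 31 = I.numBad h p := by
  have hm := I.hm
  have hn := I.hn
  have hnb := I.one_le_nb
  have hnn : I.n ≤ I.n * I.nb := Nat.le_mul_of_pos_right _ hnb
  have hnm : I.n * I.nb ≤ I.n * I.nb * I.m := Nat.le_mul_of_pos_right _ hm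
  have hT : I.n * (I.nb * (I.m * 200 + 120) + 8 + 11) + 8 + 50 ≤ 500 * (I.n * I.nb * I.m) := by
    have e : I.n * (I.nb * (I.m * 200 + 120) + 8 + 11) + 8 + 50 =
      200 * (I.n * I.nb * I.m) + 120 * (I.n * I.nb) + 19 * I.n + 58 := by ring
    omega
  refine Run.asg_seq 0 (by simp) rfl ?_
  refine Run.forC I.n (I.nb * (I.m * 200 + 120) + 8) (fun i σ' => σ'.reg 31 =
    (∑ i ∈ Finset.range i, ∑ J ∈ Finset.range I.nb,
      ((Finset.range I.m).filter (I.Bad h p i J)).card : ℕ)) (by simp [hE.r0]) (by simp) ?_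
    (fun _ h _ _ _ => h) (Nat.le_sub_of_add_le hT)
  intro i hi σ1 I1 r20 fr1 g1
  have E1 := (hE.set 31 0).fr fr1
  have a3 : σ1.arr 3 = h := by rw [fr1.a 3]; exact h3
  have e30 : σ1.reg 30 = p := by rw [fr1.r 30]; simp [h30]
  refine Run.forC I.nb (I.m * 200 + 105) (fun J σ' => σ'.reg 31 =
    ((∑ i ∈ Finset.range i, ∑ J ∈ Finset.range I.nb,
      ((Finset.range I.m).filter (I.Bad h p i J)).card) +
      ∑ J ∈ Finset.range J, ((Finset.range I.m).filter (I.Bad h p i J)).card : ℕ)) E1.r9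
    (by simp [I1]) ?_ (fun σ' h' _ _ _ => by simp [Finset.sum_range_succ, h'])
    (Nat.add_le_add_right (Nat.mul_le_mul_left _ (by omega)) _)
  intro J hJ σ2 I2 r21 fr2 g2
  have E2 := E1.fr fr2
  have a3' : σ2.arr 3 = h := by rw [fr2.a 3, a3]
  have e30' : σ2.reg 30 = p := by rw [fr2.r 30, e30]
  have e20 : σ2.reg 20 = i := by rw [fr2.r 20, r20]
  have hcell := mul_add_lt hi hJ
  have hb := hh i hi J hJ
  refine Run.asg_seq (h (i * I.nb + J)) (hb.trans (by omega)) ?_ ?_ ?_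
  · simp [e20, r21, E2.r9, a3']; norm_cast
  · have hN1 := I.sum_sum_card_le h p i
    have hN2 := I.sum_card_le h p J i
    have hN3 : i * I.nb * I.m + J * I.m + I.m ≤ I.n * I.nb * I.m := by
      have : i * I.nb * I.m + J * I.m + I.m = (i * I.nb + J + 1) * I.m := by ring
      rw [this]; exact Nat.mul_le_mul_right _ hcell
    refine Run.forC I.m 180 (fun k σ' => σ'.reg 31 =
      ((∑ i ∈ Finset.range i, ∑ J ∈ Finset.range I.nb,
        ((Finset.range I.m).filter (I.Bad h p i J)).card) +
        ∑ J ∈ Finset.range J, ((Finset.range I.m).filter (I.Bad h p i J)).card +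
        ((Finset.range k).filter (I.Bad h p i J)).card : ℕ)) (by simp [E2.r1]) (by simp [I2]) ?_
      (fun σ' h' _ _ _ => by simp [Finset.sum_range_succ, h', add_assoc]) (by omega)
    intro k hk σ3 I3 r22 fr3 g3
    have E3 := (E2.set 24 (h (i * I.nb + J))).fr fr3
    have e20 : σ3.reg 20 = i := by rw [fr3.r 20]; simp [e20]
    have e21 : σ3.reg 21 = J := by rw [fr3.r 21]; simp [r21]
    have e24 : σ3.reg 24 = h (i * I.nb + J) := by rw [fr3.r 24]; simp
    have e30 : σ3.reg 30 = p := by rw [fr3.r 30]; simp [e30']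
    have hF := I.abs_far_le h hb k
    refine Run.asg_seq (I.far h i J k) (by omega) ?_ ?_ ?_
    · simp only [exFar, Ex.eval_div, Ex.eval_add, Ex.eval_sub, Ex.eval_mul, Ex.eval_r, e24,
        E3.eval_exVal e20 e21 r22, E3.r3, Ex.eval_ofNat, Inst.far]
    · have hcard : ((Finset.range k).filter (I.Bad h p i J)).card ≤ k := by
        simpa using Finset.card_filter_le (Finset.range k) (I.Bad h p i J)
      refine Run.iteB (fun hc => ?_) (fun hc => ?_) (by simp [exBad])
      · rw [exBad_pos hp (y := I.far h i J k) (by simp) (by simp [e30])] at hc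
        refine Run.asg_last _ ?_ (by simp [I3]; rfl) ?_
        · rw [abs_le]; constructor <;> norm_cast <;> omega
        · have hB : I.Bad h p i J k := hc
          simp [Finset.range_add_one, Finset.filter_insert, hB, add_assoc]
      · rw [exBad_pos hp (y := I.far h i J k) (by simp) (by simp [e30])] at hc
        refine Run.skip_last ?_
        have hB : ¬ I.Bad h p i J k := hc
        simpa [Finset.range_add_one, Finset.filter_insert, hB] using I3
    · simpa [exFar] using E3.ok_exVal e20 e21 r22 hi hJ hk hM'
  · simp [e20, r21, E2.r9]; norm_cast; exact ⟨by omega, by omega⟩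

/-- `dst := src ^ k`. -/
def powS (dst src : ℕ) : ℕ → Stmt
  | 0 => .asg dst 1
  | k + 1 => powS dst src k ;; .asg dst (.r dst * .r src)

@[simp] lemma wrR_powS (dst src k y : ℕ) : (powS dst src k).wrR y = decide (y = dst) := by
  induction k <;> simp_all [powS, Stmt.wrR]

@[simp] lemma wrA_powS (dst src k y : ℕ) : (powS dst src k).wrA y = false := by
  induction k <;> simp_all [powS, Stmt.wrA]

lemma powS_run (mc : Mach) {σ : State} {dst src : ℕ} (b : ℕ) (hb : σ.reg src = b) (k : ℕ)
    (hX : b ^ k ≤ mc.X) (hb1 : b ≤ mc.X) (hd : dst < 60 := by norm_num)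
    (hs : src < 60 := by norm_num) (hds : src ≠ dst := by norm_num) :
    Run mc (powS dst src k) σ (50 * (k + 1)) fun σ' => σ'.reg dst = (b ^ k : ℕ) := by
  have hw : (Ex.r dst * Ex.r src : Ex).wf = true := by
    change (Ex.wf (Ex.op _ _ _)) = true; simp [Ex.wf, Ex.leaves, hd, hs]
  have hX16 := mc.hX
  induction k with
  | zero => exact Run.asg_last 1 (by simp; omega) rfl (by simp) (by simp) (by omega)
  | succ k ih =>
    have hk : b ^ k ≤ mc.X := by
      rcases Nat.eq_zero_or_pos b with rfl | h
      · rcases k with _ | k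
        · simp; omega
        · simp
      · exact (Nat.pow_le_pow_right h (by omega)).trans hX
    refine Run.seqB _ (ih hk) fun σ' h1 fr g => ?_
    refine Run.asg_last ((b ^ (k + 1) : ℕ) : ℤ) (abs_cast_le hX) ?_
      (by simp) (by simp) (by omega) hw (by change 5 ≤ 50; norm_num)
    have : σ'.reg src = b := by
      rw [fr.r src (by simp [hds]) (tmp_of_lt hs), hb]
    simp [h1, this, pow_succ]

lemma powS_seq (mc : Mach) {σ : State} {dst src T : ℕ} {u : Stmt} {Q : State → Prop} (b : ℕ)
    (hb : σ.reg src = b) (k : ℕ) (hX : b ^ k ≤ mc.X) (hb1 : b ≤ mc.X)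
    (hQ : ∀ σ' : State, σ'.reg dst = (b ^ k : ℕ) → Fr (.asg dst 1) σ σ' → Good mc.X σ' →
      Run mc u σ' (T - 50 * (k + 1)) Q) (hd : dst < 60 := by norm_num)
    (hs : src < 60 := by norm_num) (hds : src ≠ dst := by norm_num) :
    Run mc (powS dst src k ;; u) σ T Q :=
  Run.seqB _ (powS_run mc b hb k hX hb1 hd hs hds) fun σ' h fr g =>
    hQ σ' h ⟨fun y h1 h2 => fr.reg y h1 (by simpa [Stmt.wrR] using h2), fun a _ => fr.a a (by simp)⟩ g

/-- Compare `(reg 31 * reg 17) ^ E * reg 31` with `reg 16 ^ (E + 1)`. -/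
def compareBad (E : ℕ) : Stmt :=
  .asg 32 (.r 31 * .r 17) ;; powS 33 32 E ;; powS 34 16 (E + 1) ;; .asg 18 (.r 33 * .r 31 - .r 34)

/-- The factor `d` is good enough for passing from the modulus `p` to `p * d`. -/
def Inst.Step (I : Inst) (h : ℕ → ℤ) (E p d : ℕ) : Prop :=
  (I.numBad h (p * d) * d) ^ E * I.numBad h (p * d) ≤ I.numBad h p ^ (E + 1)

lemma compareBad_run (mc : Mach) (I : Inst) (h : ℕ → ℤ) (E p d K : ℕ) (σ : State)
    (h31 : σ.reg 31 = I.numBad h (p * d)) (h17 : σ.reg 17 = d) (h16 : σ.reg 16 = I.numBad h p)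
    (hd : d ≤ K) (hd1 : 1 ≤ d) (hX : (I.n * I.nb * I.m * K) ^ (E + 1) ≤ mc.X) :
    Run mc (compareBad E) σ (50 * (2 * E + 5)) fun σ' => (0 < σ'.reg 18 ↔ ¬ I.Step h E p d) := by
  have hu := I.numBad_le h (p * d)
  have hu' := I.numBad_le h p
  have hKK : I.n * I.nb * I.m ≤ I.n * I.nb * I.m * K := Nat.le_mul_of_pos_right _ (by omega)
  have hud : I.numBad h (p * d) * d ≤ I.n * I.nb * I.m * K := Nat.mul_le_mul hu hd
  have huN := hu.trans hKK
  have huN' := hu'.trans hKK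
  have hN0 : 0 < I.n * I.nb * I.m * K :=
    Nat.mul_pos (Nat.mul_pos (Nat.mul_pos I.hn I.one_le_nb) I.hm) (by omega)
  clear hu hu' hKK
  generalize I.n * I.nb * I.m * K = N at *
  have hN1 : 1 ≤ N := hN0
  have hNX : N ≤ mc.X := (Nat.le_self_pow (by omega) N).trans hX
  have hpow : ∀ x k, x ≤ N → k ≤ E + 1 → x ^ k ≤ mc.X := fun x k hx hk =>
    (Nat.pow_le_pow_left hx k).trans ((Nat.pow_le_pow_right hN1 hk).trans hX)
  obtain ⟨u, hu0⟩ : ∃ u, u = I.numBad h (p * d) := ⟨_, rfl⟩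
  obtain ⟨u', hu1⟩ : ∃ u', u' = I.numBad h p := ⟨_, rfl⟩
  rw [Inst.Step, ← hu0, ← hu1]
  rw [← hu0] at hud huN h31
  rw [← hu1] at huN' h16
  refine Run.asg_seq ((u * d : ℕ) : ℤ) (abs_cast_le (hud.trans hNX))
    (by simp [h31, h17]) ?_
  refine powS_seq mc (u * d) (by simp) E (hpow _ _ hud (by omega)) (hud.trans hNX) ?_
  intro σ1 s33 fr1 g1
  refine powS_seq mc u' (by rw [fr1.r 16]; simp [h16]) (E + 1) (hpow _ _ (by omega) le_rfl)
    (by omega) ?_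
  intro σ2 s34 fr2 g2
  have s33' : σ2.reg 33 = ((u * d) ^ E : ℕ) := by rw [fr2.r 33, s33]
  have s31' : σ2.reg 31 = u := by rw [fr2.r 31, fr1.r 31]; simp [h31]
  have hb1 : (u * d) ^ E * u ≤ mc.X := by
    refine le_trans ?_ hX
    rw [pow_succ]; exact Nat.mul_le_mul (Nat.pow_le_pow_left hud _) (by omega)
  have hb2 : u' ^ (E + 1) ≤ mc.X := hpow _ _ (by omega) le_rfl
  refine Run.asg_last ((((u * d) ^ E * u : ℕ) : ℤ) - ((u' ^ (E + 1) : ℕ) : ℤ)) ?_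
    (by simp [s33', s34, s31']) ?_ (hT := by omega)
  · rw [abs_le]; constructor <;> omega
  · simp only [State.reg_setReg, if_true]
    omega

/-- Find the modulus factor `reg 15`. -/
def modulus (E : ℕ) : Stmt :=
  .asg 14 (.r 0 * .r 9 * .r 1) ;; .asg 30 1 ;; countBad ;; .asg 15 1 ;; .asg 16 (.r 31) ;;
  .whl (.r 16 * .r 2 - .r 14) (
    .asg 17 2 ;; .asg 30 (.r 15 * .r 17) ;; countBad ;; compareBad E ;;
    .whl (.r 18) (.asg 17 (.r 17 + 1) ;; .asg 30 (.r 15 * .r 17) ;; countBad ;; compareBad E) ;;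
    .asg 15 (.r 30) ;; .asg 16 (.r 31))

@[simp] lemma wrR_compareBad (E y : ℕ) : (compareBad E).wrR y =
    (decide (y = 32) || (decide (y = 33) || (decide (y = 34) || decide (y = 18)))) := by
  simp [compareBad, Stmt.wrR]

@[simp] lemma wrA_compareBad (E y : ℕ) : (compareBad E).wrA y = false := by
  simp [compareBad, Stmt.wrA]

lemma Inst.Step.invariant {I : Inst} {h : ℕ → ℤ} {E p d N : ℕ} (hs : I.Step h E p d)
    (hp : I.numBad h p ^ (E + 1) * p ^ E ≤ N) :
    I.numBad h (p * d) ^ (E + 1) * (p * d) ^ E ≤ N := by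
  refine le_trans ?_ hp
  calc _ = (I.numBad h (p * d) * d) ^ E * I.numBad h (p * d) * p ^ E := by ring
    _ ≤ _ := Nat.mul_le_mul_right _ hs

lemma Inst.lt_of_guard {I : Inst} {h : ℕ → ℤ} {E p N : ℕ}
    (hp : I.numBad h p ^ (E + 1) * p ^ E ≤ N ^ (E + 1)) (hg : N < I.numBad h p * I.Δ) :
    p ^ E < I.Δ ^ (E + 1) := by
  by_contra hle
  push Not at hle
  have h1 : N ^ (E + 1) < (I.numBad h p * I.Δ) ^ (E + 1) := Nat.pow_lt_pow_left hg (by omega)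
  rw [mul_pow] at h1
  exact absurd (h1.trans_le (Nat.mul_le_mul_left _ hle)) (not_lt.2 hp)

lemma modulus_run (mc : Mach) (I : Inst) (h : ℕ → ℤ) (E K F : ℕ) (hE1 : 1 ≤ E) (hK : 1 ≤ K)
    (hF : I.Δ ^ 2 ≤ 2 ^ F)
    (hstep : ∀ p, 1 ≤ p → ∃ d, 2 ≤ d ∧ d ≤ K ∧ I.Step h E p d)
    (hh : ∀ i < I.n, ∀ J < I.nb, |h (i * I.nb + J)| ≤ 2 * I.Y + 1) (σ : State)
    (hE : Env I σ) (h3 : σ.arr 3 = h)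
    (hM : I.n * I.nb * I.m ≤ mc.M) (hM' : I.n * I.m ≤ mc.M)
    (hX : 4 * I.Y + 2 * I.W + 1 + I.n * I.nb * I.m ≤ mc.X)
    (hX2 : (I.n * I.nb * I.m * K) ^ (E + 1) ≤ mc.X) (hX3 : I.Δ ^ 2 * K ≤ mc.X) :
    Run mc (modulus E) σ ((F + 1) * (K + 2) * (600 * (I.n * I.nb * I.m) + 100 * E + 2000))
      fun σ' => ∃ p p₀ d : ℕ, σ'.reg 15 = p ∧ 1 ≤ p ∧ p = p₀ * d ∧ d ≤ K ∧
        p₀ ^ E ≤ I.Δ ^ (E + 1) ∧ I.numBad h p * I.Δ ≤ I.n * I.nb * I.m := by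
  obtain ⟨N, hN⟩ : ∃ N, N = I.n * I.nb * I.m := ⟨_, rfl⟩
  have hN1 : 1 ≤ N := by
    rw [hN]; exact Nat.mul_pos (Nat.mul_pos I.hn I.one_le_nb) I.hm
  have hΔ := I.hΔ
  rw [← hN]
  obtain ⟨c, hc⟩ : ∃ c, c = 600 * N + 100 * E + 500 := ⟨_, rfl⟩
  have hcK : F * (K * (c + 51) + c + 1000 + 51) + c + 1000 ≤
      (F + 1) * (K + 2) * (600 * N + 100 * E + 2000) := by
    rw [show 600 * N + 100 * E + 2000 = c + 1500 by omega]
    exact Nat.le.intro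
      (k := 1449 * (F * K) + F * c + 1949 * F + K * c + 1500 * K + c + 2000) (by ring)
  have hUN : ∀ p, I.numBad h p ≤ N := fun p => hN ▸ I.numBad_le h p
  have hNX : N ≤ mc.X := (hN ▸ Nat.le_add_left _ _ : N ≤ _).trans hX
  refine Run.le ?_ hcK
  clear hcK
  refine Run.asg_seq (N : ℤ) (abs_cast_le hNX)
    (by simp [hE.r0, hE.r1, hE.r9, hN]) ?_
  refine Run.asg_seq 1 (by simp; omega) (by simp) ?_
  refine Run.seqB _ (countBad_run mc I h 1 le_rfl hh _ ((hE.set 14 _).set 30 _) (by simp [h3])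
    (by simp) hM hM' hX) ?_
  intro σ1 s31 fr1 g1
  have E1 : Env I σ1 := ((hE.set 14 _).set 30 _).fr fr1
  have hU1 := hUN 1
  refine Run.asg_seq 1 (by simp; omega) (by simp) ?_
  refine Run.asg_seq (I.numBad h 1 : ℤ) (abs_cast_le (by omega))
    (by simp [s31]) ?_
  refine Run.whlB F (K * (c + 51) + c + 1000) (fun f (σ' : State) => f ≤ F ∧ ∃ p p₀ d : ℕ,
    σ'.reg 15 = p ∧ 1 ≤ p ∧
    p = p₀ * d ∧ d ≤ K ∧ p₀ ^ E ≤ I.Δ ^ (E + 1) ∧ σ'.reg 16 = I.numBad h p ∧ σ'.reg 14 = N ∧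
    I.numBad h p ^ (E + 1) * p ^ E ≤ N ^ (E + 1) ∧ 2 ^ (F - f) ≤ p ∧ Env I σ' ∧ σ'.arr 3 = h)
    ⟨le_rfl, 1, 1, 1, by simp, le_rfl, rfl, hK, ?_, by simp, ?_, ?_, by simp, ?_, ?_⟩ ?_ ?_ ?_ (by
      omega)
  · simpa using Nat.one_le_pow _ _ hΔ
  · simp [fr1.r 14]
  · simpa using Nat.pow_le_pow_left hU1 _
  · exact (E1.set 15 _).set 16 _
  · simp [fr1.a 3, h3]
  · intro f σ' _ _ _; simp
  · rintro f σ2 ⟨hf, p, p₀, d, s15, hp, hpd, hd, hp₀, s16, s14, hinv, hpow, E2, a3⟩ fr2 g2 hgd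
    have hgd' : N < I.numBad h p * I.Δ := by
      simp only [Ex.eval_sub, Ex.eval_mul, Ex.eval_r, s16, s14, E2.r2, sub_pos] at hgd
      exact_mod_cast hgd
    have hpE := Inst.lt_of_guard hinv hgd'
    have hpΔ : p < I.Δ ^ 2 := by
      by_contra hle
      push Not at hle
      have h1 : (I.Δ ^ 2) ^ E ≤ p ^ E := Nat.pow_le_pow_left hle E
      have h2 : I.Δ ^ (E + 1) ≤ (I.Δ ^ 2) ^ E := by
        rw [← pow_mul]; exact Nat.pow_le_pow_right hΔ (by omega)
      omega
    have hpX : ∀ d ≤ K, p * d ≤ mc.X := fun d hd => (Nat.mul_le_mul hpΔ.le hd).trans hX3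
    have hf0 : 1 ≤ f := by
      by_contra h0
      have : f = 0 := by omega
      subst this
      simp only [Nat.sub_zero] at hpow
      omega
    refine ⟨f - 1, by omega, ?_⟩
    obtain ⟨ds, hds2, hdsK, hds⟩ := hstep p hp
    have test : ∀ (σ3 : State) (d : ℕ) (Q : State → Prop), 2 ≤ d → d ≤ K → σ3.reg 15 = p →
        σ3.reg 17 = d →
        σ3.reg 16 = I.numBad h p → Env I σ3 → σ3.arr 3 = h →
        (∀ σ' : State, σ'.reg 17 = d → σ'.reg 30 = (p * d : ℕ) → σ'.reg 31 = I.numBad h (p * d) →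
          (0 < σ'.reg 18 ↔ ¬ I.Step h E p d) → Env I σ' → σ'.arr 3 = h → σ'.reg 15 = p →
          σ'.reg 16 = I.numBad h p → σ'.reg 14 = σ3.reg 14 → Q σ') →
        Run mc (.asg 30 (.r 15 * .r 17) ;; countBad ;; compareBad E) σ3 (c - 50) Q := by
      intro σ3 d Q hd2 hdK t15 t17 t16 E3 t3 hQ
      refine Run.asg_seq ((p * d : ℕ) : ℤ) (abs_cast_le (hpX d hdK))
        (by simp [t15, t17]) ?_
      refine Run.seqB _ (countBad_run mc I h (p * d) (Nat.mul_pos hp (by omega)) hh _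
        (E3.set 30 _) (by simp [t3]) (by simp) hM hM' hX) ?_
      intro σ4 t31 fr4 g4
      refine Run.mono (T := 50 * (2 * E + 5)) (Run.frame (compareBad_run mc I h E p d K σ4 t31
        (by rw [fr4.r 17]; simp [t17]) (by rw [fr4.r 16]; simp [t16]) hdK (by omega) hX2)) (by omega) ?_
      rintro σ5 ⟨u18, fr5, g5⟩
      have E4 := (E3.set 30 ((p * d : ℕ) : ℤ)).fr fr4
      refine hQ σ5 ?_ ?_ ?_ u18 (E4.fr fr5 (by simp [Stmt.safe])) ?_ ?_ ?_ ?_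
      · rw [fr5.r 17 (by simp), fr4.r 17]; simp [t17]
      · rw [fr5.r 30 (by simp), fr4.r 30]; simp
      · rw [fr5.r 31 (by simp), t31]
      · rw [fr5.a 3 (by simp), fr4.a 3]; simp [t3]
      · rw [fr5.r 15 (by simp), fr4.r 15]; simp [t15]
      · rw [fr5.r 16 (by simp), fr4.r 16]; simp [t16]
      · rw [fr5.r 14 (by simp), fr4.r 14]; simp
    refine Run.asg_seq 2 (by simp; omega) (by simp) ?_
    have assoc : ∀ (s1 s2 s3 u : Stmt) (σ3 : State) (T₁ T : ℕ) (Q : State → Prop),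
        Run mc (s1 ;; s2 ;; s3) σ3 T₁ (fun σ' => Run mc u σ' (T - T₁) Q) → T₁ < T →
        Run mc (s1 ;; s2 ;; s3 ;; u) σ3 T Q := by
      intro s1 s2 s3 u σ3 T₁ T Q hr hT τ e hg
      obtain ⟨t, τ', σ', h1, h2, h3, h4, h5⟩ := hr τ e hg
      cases h1 with
      | seq a1 a2 =>
        cases a2 with
        | seq a2 a3 =>
          obtain ⟨t', τ'', σ'', b1, b2, b3⟩ := h5 τ' h4 h3
          exact ⟨_, τ'', σ'', a1.seq (a2.seq (a3.seq b1)), by omega, b3⟩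
    refine assoc _ _ _ _ _ (c - 50) _ _ ?_ (by omega)
    refine test _ 2 _ le_rfl (by omega) (by simp [s15]) (by simp) (by simp [s16]) (E2.set 17 _)
      (by simp [a3]) ?_
    intro σ3 t17 t30 t31 t18 E3 t3 t15 t16 t14
    refine Run.whl_seq K c (fun f (σ' : State) => ∃ d : ℕ, 2 ≤ d ∧ d ≤ ds ∧ d + f = K + 2 ∧
      σ'.reg 17 = d ∧
      σ'.reg 30 = (p * d : ℕ) ∧ σ'.reg 31 = I.numBad h (p * d) ∧ (0 < σ'.reg 18 ↔ ¬ I.Step h E p d) ∧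
      Env I σ' ∧ σ'.arr 3 = h ∧ σ'.reg 15 = p ∧ σ'.reg 16 = I.numBad h p ∧ σ'.reg 14 = N)
      ⟨2, le_rfl, hds2, by omega, t17, t30, t31, t18, E3, t3, t15, t16, by simpa [s14] using t14⟩
      (fun _ _ _ _ _ => by simp) ?_ ?_
    · rintro f' σ4 ⟨d', hd'2, hd's, hdf, u17, u30, u31, u18, E4, u3, u15, u16, u14⟩ fr4 g4 hgd4
      have hns : ¬ I.Step h E p d' := u18.1 (by simpa using hgd4)
      have hlt : d' < ds := lt_of_le_of_ne hd's (by rintro rfl; exact hns hds)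
      refine ⟨f' - 1, by omega, ?_⟩
      refine Run.asg_seq ((d' + 1 : ℕ) : ℤ) (by
        rw [Nat.abs_cast]
        have := Nat.mul_le_mul (Nat.one_le_pow 2 _ hΔ) (show d' + 1 ≤ K by omega)
        norm_cast; omega) (by simp [u17]) ?_
      refine test _ (d' + 1) _ (by omega) (by omega) (by simp [u15]) (by simp) (by simp [u16])
        (E4.set 17 _) (by simp [u3]) ?_
      intro σ5 v17 v30 v31 v18 E5 v3 v15 v16 v14
      exact ⟨d' + 1, by omega, by omega, by omega, v17, v30, v31, v18, E5, v3, v15, v16, by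
        simpa [u14] using v14⟩
    · rintro f' σ4 ⟨d', hd'2, hd's, hdf, u17, u30, u31, u18, E4, u3, u15, u16, u14⟩ hgd4 fr4 g4
      have hs : I.Step h E p d' := by
        by_contra hns
        exact hgd4 (by simpa using u18.2 hns)
      have hd'K : d' ≤ K := by omega
      refine Run.asg_seq ((p * d' : ℕ) : ℤ) (abs_cast_le (hpX d' hd'K))
        (by simp [u30]) ?_
      refine Run.asg_last (I.numBad h (p * d') : ℤ) (by
        have := hUN (p * d'); exact abs_cast_le (by omega)) (by simp [u31]) ?_
        (hT := ?_)
      · refine ⟨by omega, p * d', p, d', by simp, Nat.mul_pos hp (by omega), rfl, hd'K, hpE.le,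
          by simp, by simp [u14], hs.invariant hinv, ?_, (E4.set 15 _).set 16 _, by simp [u3]⟩
        calc 2 ^ (F - (f - 1)) = 2 ^ (F - f) * 2 := by
              rw [← pow_succ]; congr 1; omega
          _ ≤ p * d' := Nat.mul_le_mul hpow hd'2
      · omega
  · rintro f σ2 ⟨hf, p, p₀, d, s15, hp, hpd, hd, hp₀, s16, s14, hinv, hpow, E2, a3⟩ fr2 g2 hgd
    refine ⟨p, p₀, d, s15, hp, hpd, hd, hp₀, ?_⟩
    simp only [Ex.eval_sub, Ex.eval_mul, Ex.eval_r, s16, s14, E2.r2, sub_pos, not_lt] at hgd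
    exact_mod_cast hgd


/-! ## Existence of a good factor -/

lemma lcmUpto_le_pow (n : ℕ) : Nat.lcmUpto n ≤ n ^ Nat.primeCounting n := by
  rcases Nat.eq_zero_or_pos n with rfl | hn
  · simp [Nat.lcmUpto]
  rw [Nat.lcmUpto_eq_prod_pow_log, ← Nat.primesLE_card_eq_primeCounting]
  exact Finset.prod_le_pow_card _ _ _ fun p _ => Nat.pow_log_le_self p (by omega)

lemma card_primeFactors_le {y l : ℕ} (hy : y ≠ 0) (hl : y < 2 ^ l) : y.primeFactors.card ≤ l := by
  have h1 : 2 ^ y.primeFactors.card ≤ ∏ p ∈ y.primeFactors, p :=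
    Finset.pow_card_le_prod _ _ _ fun p hp => (Nat.prime_of_mem_primeFactors hp).two_le
  have h2 := Nat.le_of_dvd (Nat.pos_of_ne_zero hy) (Nat.prod_primeFactors_dvd y)
  exact ((Nat.pow_lt_pow_iff_right (by norm_num)).1 ((h1.trans h2).trans_lt hl)).le

/-- The side of the search space for the factors. -/
def factorBase (E l : ℕ) : ℕ := 2 ^ (2 * Nat.clog 2 ((E + 1) * (l + 2)) + 2)

lemma factorBase_le (E l : ℕ) : factorBase E l ≤ 16 * ((E + 1) * (l + 2)) ^ 2 := by
  obtain ⟨x, hx⟩ : ∃ x, x = (E + 1) * (l + 2) := ⟨_, rfl⟩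
  have hx2 : 2 ≤ x := by rw [hx]; nlinarith
  have h : 2 ^ Nat.clog 2 x ≤ 2 * x := by
    have := Nat.pow_pred_clog_lt_self (b := 2) (by norm_num) (by omega : 1 < x)
    have hc : Nat.clog 2 x = (Nat.clog 2 x).pred + 1 := by
      have := Nat.clog_pos (b := 2) (by norm_num) hx2
      rw [Nat.pred_eq_sub_one]; omega
    rw [hc, pow_succ]; omega
  rw [factorBase, ← hx, pow_add, pow_mul', pow_two]
  nlinarith [Nat.mul_le_mul h h]

lemma mul_le_primeCounting (E l : ℕ) :
    l * factorBase E l ^ E ≤ Nat.primeCounting (factorBase E l ^ (E + 1)) := by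
  obtain ⟨c, hc⟩ : ∃ c, c = Nat.clog 2 ((E + 1) * (l + 2)) := ⟨_, rfl⟩
  have hle : (E + 1) * (l + 2) ≤ 2 ^ c := hc ▸ Nat.le_pow_clog (by norm_num) _
  obtain ⟨k, hk⟩ : ∃ k, k = factorBase E l := ⟨_, rfl⟩
  have hkc : k = 2 ^ (2 * c + 2) := by rw [hk, factorBase, hc]
  rw [← hk]
  obtain ⟨n, hn⟩ : ∃ n, n = k ^ (E + 1) := ⟨_, rfl⟩
  rw [← hn]
  obtain ⟨a, ha⟩ : ∃ a, a = (2 * c + 2) * (E + 1) := ⟨_, rfl⟩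
  have hna : n = 2 ^ a := by rw [hn, hkc, ← pow_mul, ha]
  have hn1 : n + 1 ≤ n ^ 2 := by
    have : 2 ≤ n := by rw [hna]; exact Nat.le_self_pow (by rw [ha]; positivity) 2
    nlinarith
  have h1 : 2 ^ n ≤ 2 ^ (a * (Nat.primeCounting n + 2)) := by
    calc 2 ^ n ≤ (n + 1) * Nat.lcmUpto n := Chebyshev.two_pow_le_mul_lcmUpto n
      _ ≤ n ^ 2 * n ^ Nat.primeCounting n := Nat.mul_le_mul hn1 (lcmUpto_le_pow n)
      _ = 2 ^ (a * (Nat.primeCounting n + 2)) := by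
        rw [← pow_add, pow_mul, ← hna, add_comm 2]
  have h2 : n ≤ a * (Nat.primeCounting n + 2) := (Nat.pow_le_pow_iff_right (by norm_num)).1 h1
  have h3 : a * (l + 2) ≤ k := by
    have hc2 : 2 * c + 2 ≤ 2 ^ (c + 2) := by
      have := Nat.lt_two_pow_self (n := c)
      rw [pow_add]; omega
    calc a * (l + 2) = (2 * c + 2) * ((E + 1) * (l + 2)) := by rw [ha]; ring
      _ ≤ 2 ^ (c + 2) * 2 ^ c := Nat.mul_le_mul hc2 hle
      _ = k := by rw [hkc, ← pow_add]; congr 1; ring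
  have hkE : 1 ≤ k ^ E := Nat.one_le_pow _ _ (by rw [hkc]; positivity)
  have ha0 : 0 < a := by rw [ha]; positivity
  have h4 : a * ((l + 2) * k ^ E) ≤ a * (Nat.primeCounting n + 2) := by
    refine le_trans ?_ h2
    rw [hn, pow_succ', ← mul_assoc]; exact Nat.mul_le_mul_right _ h3
  nlinarith

lemma Inst.exists_step (I : Inst) (h : ℕ → ℤ) (E l : ℕ)
    (hh : ∀ i < I.n, ∀ J < I.nb, |h (i * I.nb + J)| ≤ 2 * I.Y + 1)
    (hl : 4 * I.Y + 2 * I.W + 1 < 2 ^ l) {p : ℕ} :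
    ∃ d, 2 ≤ d ∧ d ≤ factorBase E l ^ (E + 1) ∧ I.Step h E p d := by
  obtain ⟨k, hk⟩ : ∃ k, k = factorBase E l := ⟨_, rfl⟩
  have hk4 : 4 ≤ k := by
    rw [hk, factorBase, pow_add]; have := Nat.one_le_two_pow (n := 2 * Nat.clog 2 ((E + 1) * (l + 2)))
    omega
  have hpi := mul_le_primeCounting E l
  rw [← hk] at hpi ⊢
  by_contra hno
  push Not at hno
  have hstep : ∀ ℓ ∈ Nat.primesLE (k ^ (E + 1)), I.numBad h p < I.numBad h (p * ℓ) * k ^ E := by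
    intro ℓ hℓ
    have hpr := Nat.prime_of_mem_primesLE hℓ
    have hle := Nat.le_of_mem_primesLE hℓ
    have hs := hno ℓ hpr.two_le hle
    rw [Inst.Step, not_le] at hs
    by_contra hc
    push Not at hc
    have h1 : (I.numBad h (p * ℓ) * k ^ E) ^ (E + 1) ≤ I.numBad h p ^ (E + 1) :=
      Nat.pow_le_pow_left hc _
    refine absurd (hs.trans_le ?_) (not_lt.2 h1)
    calc (I.numBad h (p * ℓ) * ℓ) ^ E * I.numBad h (p * ℓ)
        = I.numBad h (p * ℓ) ^ (E + 1) * ℓ ^ E := by ring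
      _ ≤ I.numBad h (p * ℓ) ^ (E + 1) * (k ^ (E + 1)) ^ E :=
        Nat.mul_le_mul_left _ (Nat.pow_le_pow_left hle _)
      _ = (I.numBad h (p * ℓ) * k ^ E) ^ (E + 1) := by
        rw [mul_pow, ← pow_mul, ← pow_mul, mul_comm E]
  have hsum : ∑ ℓ ∈ Nat.primesLE (k ^ (E + 1)), I.numBad h (p * ℓ) ≤ l * I.numBad h p := by
    unfold Inst.numBad
    rw [Finset.sum_comm, Finset.mul_sum]
    refine Finset.sum_le_sum fun i hi => ?_
    rw [Finset.sum_comm, Finset.mul_sum]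
    refine Finset.sum_le_sum fun J hJ => ?_
    rw [Finset.mem_range] at hi hJ
    simp only [Finset.card_filter]
    rw [Finset.sum_comm, Finset.mul_sum]
    refine Finset.sum_le_sum fun x _ => ?_
    by_cases hB : I.Bad h p i J x
    · rw [if_pos hB, mul_one, ← Finset.card_filter]
      have hy0 : (I.far h i J x).natAbs ≠ 0 := by simpa using hB.1
      have hyl : (I.far h i J x).natAbs < 2 ^ l := by
        have := I.abs_far_le h (hh i hi J hJ) x
        rw [Int.abs_eq_natAbs] at this; omega
      refine le_trans (Finset.card_le_card fun ℓ hℓ => ?_) (card_primeFactors_le hy0 hyl)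
      rw [Finset.mem_filter] at hℓ
      refine Nat.mem_primeFactors.2 ⟨Nat.prime_of_mem_primesLE hℓ.1, ?_, hy0⟩
      have := hℓ.2.2
      rw [← Int.natCast_dvd]
      exact (Dvd.intro_left (p : ℤ) (by push_cast; rfl)).trans this
    · refine le_of_eq_of_le (Finset.sum_eq_zero fun ℓ _ => ?_) (Nat.zero_le _)
      rw [if_neg]
      rintro ⟨h1, h2⟩
      exact hB ⟨h1, (Dvd.intro (ℓ : ℤ) (by push_cast; rfl)).trans h2⟩
  have hcard := Nat.primesLE_card_eq_primeCounting (k ^ (E + 1))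
  have hne : (Nat.primesLE (k ^ (E + 1))).Nonempty := by
    refine ⟨2, Nat.mem_primesLE.2 ⟨?_, Nat.prime_two⟩⟩
    calc 2 ≤ k := by omega
      _ ≤ k ^ (E + 1) := Nat.le_self_pow (by omega) k
  have hlt : ∑ _ℓ ∈ Nat.primesLE (k ^ (E + 1)), I.numBad h p <
      ∑ ℓ ∈ Nat.primesLE (k ^ (E + 1)), I.numBad h (p * ℓ) * k ^ E :=
    Finset.sum_lt_sum_of_nonempty hne hstep
  rw [Finset.sum_const, hcard, smul_eq_mul, ← Finset.sum_mul] at hlt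
  have h1 := Nat.mul_le_mul_right (k ^ E) hsum
  have h2 := Nat.mul_le_mul_right (I.numBad h p) hpi
  have : l * k ^ E * I.numBad h p = l * I.numBad h p * k ^ E := by ring
  omega

/-! ## Correction of the counts -/

/-- A value that is congruent to `u` without being equal to it belongs to a bad triple. -/
lemma eq_iff_modEq_and_not_bad {W p val tot v u : ℤ} (hW : 1 ≤ W) (hp : 1 ≤ p)
    (h : |tot - val| ≤ W) (h1 : v - W ≤ u) (h2 : u ≤ v + 3 * W) :
    tot = u ↔ tot % (8 * W * p) = u % (8 * W * p) ∧
      ¬ ((val - v + 2 * W) / (8 * W) ≠ 0 ∧ p ∣ (val - v + 2 * W) / (8 * W)) := by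
  rw [abs_le] at h
  have key : ∀ t : ℤ, tot = u + 8 * W * p * t → (val - v + 2 * W) / (8 * W) = p * t := by
    intro t ht
    have e : val - v + 2 * W = (val - tot + (u - v) + 2 * W) + p * t * (8 * W) := by rw [ht]; ring
    rw [e, Int.add_mul_ediv_right _ _ (by omega), Int.ediv_eq_zero_of_lt (by omega) (by omega),
      zero_add]
  constructor
  · intro he
    refine ⟨by rw [he], fun hb => hb.1 ?_⟩
    simpa using key 0 (by simpa using he)
  · rintro ⟨hm, hb⟩
    obtain ⟨t, ht⟩ := (show u ≡ tot [ZMOD 8 * W * p] from hm.symm).dvd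
    have hk := key t (by linarith)
    rcases eq_or_ne t 0 with rfl | ht0
    · linarith
    · exact absurd ⟨by rw [hk]; exact mul_ne_zero (by omega) ht0, by rw [hk]; exact Dvd.intro _ rfl⟩ hb

/-- Address of a counter: chunk, row, column, residue. -/
def adr (n q g i j r : ℕ) : ℕ := ((g * n + i) * n + j) * q + r

lemma mul_add_inj {q a b r s : ℕ} (hr : r < q) (hs : s < q) :
    a * q + r = b * q + s ↔ a = b ∧ r = s := by
  refine ⟨fun h => ?_, fun h => by rw [h.1, h.2]⟩
  have h1 : (a * q + r) / q = a := by
    rw [add_comm, Nat.add_mul_div_right _ _ (by omega), Nat.div_eq_of_lt hr, zero_add]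
  have h2 : (b * q + s) / q = b := by
    rw [add_comm, Nat.add_mul_div_right _ _ (by omega), Nat.div_eq_of_lt hs, zero_add]
  have hab : a = b := by rw [← h1, ← h2, h]
  subst hab; exact ⟨rfl, by omega⟩

lemma adr_inj {n q g i j r g' i' j' r' : ℕ} (hi : i < n) (hj : j < n) (hr : r < q) (hi' : i' < n)
    (hj' : j' < n) (hr' : r' < q) :
    adr n q g i j r = adr n q g' i' j' r' ↔ g = g' ∧ i = i' ∧ j = j' ∧ r = r' := by
  rw [adr, adr, mul_add_inj hr hr', mul_add_inj hj hj', mul_add_inj hi hi']; tauto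

lemma adr_lt {n q g i j r P : ℕ} (hg : g < P) (hi : i < n) (hj : j < n) (hr : r < q) :
    adr n q g i j r < P * n * n * q :=
  mul_add_lt (mul_add_lt (mul_add_lt hg hi) hj) hr

def res (q : ℕ) (z : ℤ) : ℕ := (z % q).toNat

lemma res_lt {q : ℕ} (hq : 1 ≤ q) (z : ℤ) : res q z < q := by
  have := Int.emod_lt_of_pos z (by omega : (0 : ℤ) < q)
  have := Int.emod_nonneg z (by omega : (q : ℤ) ≠ 0)
  unfold res; omega

lemma cast_res {q : ℕ} (hq : 1 ≤ q) (z : ℤ) : (res q z : ℤ) = z % q :=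
  Int.toNat_of_nonneg (Int.emod_nonneg z (by omega))

lemma sub_div_mul (z q : ℤ) : z - z / q * q = z % q := by
  have := Int.emod_add_mul_ediv z q; linarith [mul_comm (z / q) q]


/-! ## Counting residues directly, and correcting the counts -/

/-- Number of inner indices of chunk `g` whose value has residue `r` modulo `q`. -/
def Inst.cnt (I : Inst) (q g i j r : ℕ) : ℕ :=
  ((Finset.range I.m).filter fun k => k / I.L = g ∧ res q (I.tot i j k) = r).card

lemma Inst.cnt_le (I : Inst) (q g i j r : ℕ) : I.cnt q g i j r ≤ I.m := by
  unfold Inst.cnt; simpa using Finset.card_filter_le (Finset.range I.m) _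

/-- Value for the row in `reg 20`, the column in `reg 25`, the inner index in `reg 22`. -/
def exTot : Ex := .ld 0 (.r 20 * .r 1 + .r 22) + .ld 1 (.r 22 * .r 0 + .r 25)

/-- Address of the counter for the value in `reg 27`. -/
def exAdr : Ex :=
  (((.r 22 / .r 4) * .r 0 + .r 20) * .r 0 + .r 25) * .r 13 + (.r 27 - .r 27 / .r 13 * .r 13)

/-- Change the counter of the current triple by `z`. -/
def bump (z : ℤ) : Stmt :=
  .asg 27 exTot ;; .asg 28 exAdr ;; .sto 6 (.r 28) (.ld 6 (.r 28) + .c z)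

/-- The contribution of a triple to the cell `a`. -/
def Inst.hit (I : Inst) (q i j k a : ℕ) : ℤ :=
  if adr I.n q (k / I.L) i j (res q (I.tot i j k)) = a then 1 else 0

lemma Inst.abs_hit_le (I : Inst) (q i j k a : ℕ) : |I.hit q i j k a| ≤ 1 := by
  unfold Inst.hit; split_ifs <;> simp

lemma Env.eval_exTot {I : Inst} {σ : State} (h : Env I σ) {i j k : ℕ} (h20 : σ.reg 20 = i)
    (h25 : σ.reg 25 = j) (h22 : σ.reg 22 = k) : exTot.eval σ = I.tot i j k := by
  simp only [MinPlusQuery.exTot, Ex.eval_add, Ex.eval_ld, Ex.eval_mul, Ex.eval_r, h20, h25, h22,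
    h.r0, h.r1, h.a0, h.a1, Inst.tot]
  norm_cast

lemma Env.ok_exTot {I : Inst} {σ : State} {M : ℕ} (h : Env I σ) {i j k : ℕ} (h20 : σ.reg 20 = i)
    (h25 : σ.reg 25 = j) (h22 : σ.reg 22 = k) (hi : i < I.n) (hj : j < I.n) (hk : k < I.m)
    (hM : I.n * I.m ≤ M) : exTot.ok M σ := by
  simp only [MinPlusQuery.exTot, Ex.ok_add, Ex.ok_ld, Ex.ok_mul, Ex.ok_r, Ex.eval_add, Ex.eval_mul,
    Ex.eval_r, h20, h25, h22, h.r0, h.r1, true_and]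
  norm_cast
  have := mul_add_lt hi hk
  have := mul_add_lt hk hj
  have : I.m * I.n = I.n * I.m := by ring
  exact ⟨⟨by omega, by omega⟩, by omega, by omega⟩

lemma bump_run (mc : Mach) (I : Inst) (q : ℕ) (hq : 1 ≤ q) (z : ℤ) (σ : State) (hE : Env I σ)
    {i j k : ℕ}
    (h20 : σ.reg 20 = i) (h25 : σ.reg 25 = j) (h22 : σ.reg 22 = k) (hi : i < I.n) (hj : j < I.n)
    (hk : k < I.m) (h13 : σ.reg 13 = q) (hM : I.n * I.m ≤ mc.M)
    (hM6 : I.P * I.n * I.n * q ≤ mc.M) (hX6 : I.P * I.n * I.n * q ≤ mc.X) (hX : 2 * I.Y ≤ mc.X)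
    (hz : (Ex.c z).wf = true) {V : ℕ} (hV : ∀ a, |σ.arr 6 a| ≤ V) (hVX : V + z.natAbs ≤ mc.X) :
    Run mc (bump z) σ 250 fun σ' => ∀ a, σ'.arr 6 a = σ.arr 6 a + z * I.hit q i j k a := by
  have hadr : adr I.n q (k / I.L) i j (res q (I.tot i j k)) < I.P * I.n * I.n * q :=
    adr_lt (I.div_lt_P hk) hi hj (res_lt hq _)
  obtain ⟨c, hc⟩ : ∃ c, c = adr I.n q (k / I.L) i j (res q (I.tot i j k)) := ⟨_, rfl⟩
  rw [← hc] at hadr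
  have hVc := hV c
  refine Run.asg_seq (I.tot i j k) (by have := I.abs_tot_le i j k; omega)
    (hE.eval_exTot h20 h25 h22) ?_ (hE.ok_exTot h20 h25 h22 hi hj hk hM)
  refine Run.asg_seq (c : ℤ) (abs_cast_le (by omega)) ?_ ?_ (by simp [exAdr])
  · simp only [exAdr, Ex.eval_add, Ex.eval_mul, Ex.eval_sub, Ex.eval_div, Ex.eval_r,
      State.reg_setReg]
    norm_num [h20, h25, h22, h13, hE.r0, hE.r4]
    rw [sub_div_mul, hc, adr]
    push_cast
    rw [cast_res hq]
  · refine Run.sto_last c (σ.arr 6 c + z) (by omega) ?_ (by simp) (by simp) (fun a => ?_)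
      (by simp) ⟨by simp; omega, trivial⟩ (hw₂ := ?_) (hc := ?_)
    · rw [abs_le] at *; constructor <;> omega
    · simp only [State.arr_setArr, State.arr_setReg, if_true, Inst.hit, ← hc]
      by_cases h : c = a
      · subst h; simp
      · rw [if_neg h, Function.update_of_ne (Ne.symm h)]; simp
    · simp only [Ex.wf, decide_eq_true_eq] at hz
      change Ex.wf (Ex.op _ (Ex.ld 6 (Ex.r 28)) (Ex.c z)) = true
      simp [Ex.wf, Ex.leaves, hz]
    · change 2 + (2 + 1 + 1 + 1) < 100; norm_num

def countAll : Stmt := .for 20 0 (.for 25 0 (.for 22 1 (bump 1)))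

lemma Inst.sum_hit (I : Inst) {q g i j r : ℕ} (hi : i < I.n) (hj : j < I.n) (hr : r < q) :
    ∑ i' ∈ Finset.range I.n, ∑ j' ∈ Finset.range I.n, ∑ k ∈ Finset.range I.m,
      I.hit q i' j' k (adr I.n q g i j r) = I.cnt q g i j r := by
  have hq : 1 ≤ q := by omega
  rw [Finset.sum_eq_single_of_mem i (by simpa), Finset.sum_eq_single_of_mem j (by simpa), Inst.cnt,
    Finset.card_filter]
  · push_cast
    refine Finset.sum_congr rfl fun k _ => ?_
    rw [Inst.hit]
    simp only [adr_inj hi hj (res_lt hq _) hi hj hr, true_and]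
  · intro j' hj' hne
    rw [Finset.mem_range] at hj'
    refine Finset.sum_eq_zero fun k _ => if_neg ?_
    rw [adr_inj hi hj' (res_lt hq _) hi hj hr]; tauto
  · intro i' hi' hne
    rw [Finset.mem_range] at hi'
    refine Finset.sum_eq_zero fun j' hj' => Finset.sum_eq_zero fun k _ => if_neg ?_
    rw [Finset.mem_range] at hj'
    rw [adr_inj hi' hj' (res_lt hq _) hi hj hr]; tauto

/-- The counters show the numbers of triples with the given residues. -/
def Counted (I : Inst) (q : ℕ) (σ : State) : Prop :=
  (∀ a, |σ.arr 6 a| ≤ (I.n * I.n * I.m : ℕ)) ∧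
  ∀ g < I.P, ∀ i < I.n, ∀ j < I.n, ∀ r < q, σ.arr 6 (adr I.n q g i j r) = I.cnt q g i j r

lemma countAll_run (mc : Mach) (I : Inst) (q : ℕ) (hq : 1 ≤ q) (σ : State) (hE : Env I σ)
    (h13 : σ.reg 13 = q) (h6 : ∀ a, σ.arr 6 a = 0) (hM : I.n * I.m ≤ mc.M)
    (hM6 : I.P * I.n * I.n * q ≤ mc.M) (hX6 : I.P * I.n * I.n * q ≤ mc.X) (hX : 2 * I.Y ≤ mc.X)
    (hX' : I.n * I.n * I.m + 1 ≤ mc.X) :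
    Run mc countAll σ (400 * (I.n * I.n * I.m)) (Counted I q) := by
  have hn := I.hn
  have hm := I.hm
  have step : ∀ {h : ℕ → ℤ} {V : ℕ} {c : ℕ → ℤ}, (∀ a, |h a| ≤ V) → (∀ a, |c a| ≤ 1) →
      ∀ a, |h a + c a| ≤ (V + 1 : ℕ) := fun h1 h2 a =>
    (abs_add_le _ _).trans (by have := h1 a; have := h2 a; push_cast; omega)
  have hT : I.n * (I.n * (I.m * 261 + 8 + 11) + 8 + 11) + 8 ≤ 400 * (I.n * I.n * I.m) := by
    have e : I.n * (I.n * (I.m * 261 + 8 + 11) + 8 + 11) + 8 =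
      261 * (I.n * I.n * I.m) + 19 * (I.n * I.n) + 19 * I.n + 8 := by ring
    have h1 : I.n * I.n ≤ I.n * I.n * I.m := Nat.le_mul_of_pos_right _ hm
    have h2 : I.n ≤ I.n * I.n := Nat.le_mul_of_pos_right _ hn
    omega
  refine Run.forC I.n (I.n * (I.m * 261 + 8 + 11) + 8) (fun i (σ' : State) =>
    (∀ a, |σ'.arr 6 a| ≤ (i * (I.n * I.m) : ℕ)) ∧
    ∀ a, σ'.arr 6 a = ∑ i' ∈ Finset.range i, ∑ j' ∈ Finset.range I.n, ∑ k ∈ Finset.range I.m,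
      I.hit q i' j' k a) hE.r0 (by simp [h6]) ?_ ?_ hT
  · intro i hi σ1 I1 r20 fr1 g1
    have E1 := hE.fr fr1
    refine Run.forC I.n (I.m * 261 + 8) (fun j (σ' : State) =>
      (∀ a, |σ'.arr 6 a| ≤ (i * (I.n * I.m) + j * I.m : ℕ)) ∧
      ∀ a, σ'.arr 6 a = σ1.arr 6 a + ∑ j' ∈ Finset.range j, ∑ k ∈ Finset.range I.m,
        I.hit q i j' k a) E1.r0 (by simpa using I1.1) ?_ ?_ le_rfl
    · intro j hj σ2 I2 r25 fr2 g2
      have E2 := E1.fr fr2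
      have r20' : σ2.reg 20 = i := by rw [fr2.r 20, r20]
      refine Run.forC I.m 250 (fun k (σ' : State) =>
        (∀ a, |σ'.arr 6 a| ≤ (i * (I.n * I.m) + j * I.m + k : ℕ)) ∧
        ∀ a, σ'.arr 6 a = σ2.arr 6 a + ∑ k ∈ Finset.range k, I.hit q i j k a) E2.r1
        (by simpa using I2.1) ?_ ?_ le_rfl
      · intro k hk σ3 I3 r22 fr3 g3
        have E3 := E2.fr fr3
        have hb : i * (I.n * I.m) + j * I.m + k < I.n * I.n * I.m := by
          have := mul_add_lt (mul_add_lt hi hj) hk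
          calc _ = (i * I.n + j) * I.m + k := by ring
            _ < _ := this
        refine Run.mono (bump_run mc I q hq 1 σ3 E3 (by rw [fr3.r 20, r20'])
          (by rw [fr3.r 25, r25]) r22 hi hj hk (by rw [fr3.r 13, fr2.r 13, fr1.r 13, h13]) hM hM6 hX6
          hX rfl I3.1 (by simp; omega)) le_rfl fun σ4 h4 => ?_
        simp only [State.arr_setReg, h4, one_mul]
        refine ⟨step I3.1 (I.abs_hit_le q i j k), fun a => ?_⟩
        rw [I3.2, Finset.sum_range_succ, add_assoc]
      · intro σ3 I3 _ _ _
        simp only [State.arr_setReg]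
        refine ⟨fun a => (I3.1 a).trans (by push_cast; linarith), fun a => ?_⟩
        rw [I3.2, I2.2, Finset.sum_range_succ, add_assoc]
    · intro σ2 I2 _ _ _
      simp only [State.arr_setReg]
      refine ⟨fun a => (I2.1 a).trans (by push_cast; linarith), fun a => ?_⟩
      rw [I2.2, I1.2, Finset.sum_range_succ]
  · rintro σ1 ⟨I1, I2⟩ _ _ _
    refine ⟨fun a => (I1 a).trans (by rw [mul_assoc]), fun g hg i hi j hj r hr => ?_⟩
    rw [I2, I.sum_hit hi hj hr]

/-- Remove the bad triples from the counts. -/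
def correct : Stmt :=
  .asg 30 (.r 15) ;; .for 20 0 (.for 21 9 (.asg 24 (.ld 3 (.r 20 * .r 9 + .r 21)) ;;
    .for 22 1 (.asg 26 exFar ;; .ite exBad
      (.for 23 2 (.asg 25 (.r 21 * .r 2 + .r 23) ;; .ite (.r 0 - .r 25) (bump (-1)) .skip)) .skip)))

/-- Number of inner indices of chunk `g` with residue `r` that are not bad. -/
def Inst.good (I : Inst) (h : ℕ → ℤ) (p q g i j r : ℕ) : ℕ :=
  ((Finset.range I.m).filter fun k => (k / I.L = g ∧ res q (I.tot i j k) = r) ∧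
    ¬ I.Bad h p i (j / I.Δ) k).card

/-- What a bad triple contributes to the cell `a`. -/
def Inst.badHit (I : Inst) (h : ℕ → ℤ) (p q i J k a : ℕ) : ℤ :=
  if I.Bad h p i J k then
    ∑ jj ∈ Finset.range I.Δ, if J * I.Δ + jj < I.n then I.hit q i (J * I.Δ + jj) k a else 0
  else 0

lemma Inst.sum_badHit (I : Inst) (h : ℕ → ℤ) (p : ℕ) {q g i j r : ℕ} (hi : i < I.n) (hj : j < I.n)
    (hr : r < q) :
    (I.cnt q g i j r : ℤ) - ∑ i' ∈ Finset.range I.n, ∑ J ∈ Finset.range I.nb,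
      ∑ k ∈ Finset.range I.m, I.badHit h p q i' J k (adr I.n q g i j r) = I.good h p q g i j r := by
  have hq : 1 ≤ q := by omega
  have hΔ := I.hΔ
  rw [Finset.sum_eq_single_of_mem i (by simpa),
    Finset.sum_eq_single_of_mem (j / I.Δ) (by simpa using I.div_lt_nb hj), Inst.cnt, Inst.good]
  · have e : ∀ k ∈ Finset.range I.m, I.badHit h p q i (j / I.Δ) k (adr I.n q g i j r) =
        if (k / I.L = g ∧ res q (I.tot i j k) = r) ∧ I.Bad h p i (j / I.Δ) k then 1 else 0 := by
      intro k _
      rw [Inst.badHit]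
      by_cases hB : I.Bad h p i (j / I.Δ) k
      · rw [if_pos hB, Finset.sum_eq_single_of_mem (j % I.Δ) (by simpa using Nat.mod_lt _ hΔ)]
        · rw [Nat.div_add_mod', if_pos hj, Inst.hit]
          simp only [adr_inj hi hj (res_lt hq _) hi hj hr, true_and, hB, and_true]
        · intro jj hjj hne
          rw [Finset.mem_range] at hjj
          split_ifs with hlt
          · refine if_neg ?_
            rw [adr_inj hi hlt (res_lt hq _) hi hj hr]
            rintro ⟨-, -, hh, -⟩
            apply hne
            rw [← hh, add_comm, Nat.add_mul_mod_self_right, Nat.mod_eq_of_lt hjj]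
          · rfl
      · rw [if_neg hB, if_neg (fun hh => hB hh.2)]
    rw [Finset.sum_congr rfl e, ← Finset.natCast_card_filter, sub_eq_iff_eq_add, ← Nat.cast_add,
      add_comm, ← Finset.filter_filter _ (fun k => ¬ I.Bad h p i (j / I.Δ) k),
      ← Finset.filter_filter _ (fun k => I.Bad h p i (j / I.Δ) k)]
    exact congrArg _ (Finset.card_filter_add_card_filter_not _).symm
  · intro J hJ hne
    refine Finset.sum_eq_zero fun k _ => ?_
    rw [Inst.badHit]
    split_ifs with hB
    · refine Finset.sum_eq_zero fun jj hjj => ?_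
      rw [Finset.mem_range] at hjj
      split_ifs with hlt
      · refine if_neg ?_
        rw [adr_inj hi hlt (res_lt hq _) hi hj hr]
        rintro ⟨-, -, hh, -⟩
        apply hne
        rw [← hh, add_comm, Nat.add_mul_div_right _ _ hΔ, Nat.div_eq_of_lt hjj, zero_add]
      · rfl
    · rfl
  · intro i' hi' hne
    rw [Finset.mem_range] at hi'
    refine Finset.sum_eq_zero fun J _ => Finset.sum_eq_zero fun k _ => ?_
    rw [Inst.badHit]
    split_ifs with hB
    · refine Finset.sum_eq_zero fun jj hjj => ?_
      split_ifs with hlt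
      · refine if_neg ?_
        rw [adr_inj hi' hlt (res_lt hq _) hi hj hr]; tauto
      · rfl
    · rfl

lemma sum_add_mul (N a c : ℕ) (f : ℕ → ℕ) :
    ∑ x ∈ Finset.range N, (a + f x * c) = N * a + (∑ x ∈ Finset.range N, f x) * c := by
  simp [Finset.sum_add_distrib, Finset.sum_mul]

/-- The counters show the numbers of triples that are not bad. -/
def Fixed (I : Inst) (h : ℕ → ℤ) (p q : ℕ) (σ : State) : Prop :=
  ∀ g < I.P, ∀ i < I.n, ∀ j < I.n, ∀ r < q, σ.arr 6 (adr I.n q g i j r) = I.good h p q g i j r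

lemma correct_run (mc : Mach) (I : Inst) (h : ℕ → ℤ) (p q : ℕ) (hp : 1 ≤ p) (hq : 1 ≤ q)
    (hh : ∀ i < I.n, ∀ J < I.nb, |h (i * I.nb + J)| ≤ 2 * I.Y + 1) (σ : State)
    (hE : Env I σ) (h3 : σ.arr 3 = h) (h15 : σ.reg 15 = p) (h13 : σ.reg 13 = q)
    (hcnt : Counted I q σ) (hU : I.numBad h p * I.Δ ≤ I.n * I.nb * I.m)
    (hM : I.n * I.nb * I.m ≤ mc.M) (hM' : I.n * I.m ≤ mc.M) (hpX : p ≤ mc.X)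
    (hM6 : I.P * I.n * I.n * q ≤ mc.M) (hX6 : I.P * I.n * I.n * q ≤ mc.X)
    (hX : 4 * I.Y + 2 * I.W + 1 ≤ mc.X)
    (hX' : I.n * I.n * I.m + I.n * (I.nb * (I.m * I.Δ)) + 1 ≤ mc.X) :
    Run mc correct σ (1100 * (I.n * I.nb * I.m)) (Fixed I h p q) := by
  have hn := I.hn
  have hm := I.hm
  have hnb := I.one_le_nb
  have step : ∀ {h : ℕ → ℤ} {V : ℕ} {c : ℕ → ℤ}, (∀ a, |h a| ≤ V) → (∀ a, |c a| ≤ 1) →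
      ∀ a, |h a + -1 * c a| ≤ (V + 1 : ℕ) := fun h1 h2 a =>
    (abs_add_le _ _).trans (by
      have := h1 a; have := h2 a; rw [abs_mul]; push_cast; simp only [abs_neg, abs_one]; omega)
  obtain ⟨V, hV⟩ : ∃ V, V = I.n * I.n * I.m := ⟨_, rfl⟩
  rw [← hV] at hX'
  refine Run.asg_seq (p : ℤ) (abs_cast_le hpX) (by simp [h15]) ?_
  refine Run.le (T := ∑ i ∈ Finset.range I.n, ((∑ J ∈ Finset.range I.nb, (50 +
    (∑ k ∈ Finset.range I.m, (120 + (if I.Bad h p i J k then I.Δ * 381 + 8 else 0) + 11) + 8) +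
      11) + 8) + 11) + 8) ?_ ?_
  · refine Run.for I.n _ (fun i (σ' : State) =>
      (∀ a, |σ'.arr 6 a| ≤ (V + i * (I.nb * (I.m * I.Δ)) : ℕ)) ∧
      ∀ a, σ'.arr 6 a = σ.arr 6 a - ∑ i' ∈ Finset.range i, ∑ J ∈ Finset.range I.nb,
        ∑ k ∈ Finset.range I.m, I.badHit h p q i' J k a) (by norm_num) (by norm_num) (by norm_num)
      rfl rfl (by simp [hE.r0]) (by simpa [hV] using hcnt.1) ?_ ?_
    · intro i hi σ1 I1 r20 fr1 g1
      have E1 := (hE.set 30 p).fr fr1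
      refine Run.for I.nb _ (fun J (σ' : State) =>
        (∀ a, |σ'.arr 6 a| ≤ (V + i * (I.nb * (I.m * I.Δ)) + J * (I.m * I.Δ) : ℕ)) ∧
        ∀ a, σ'.arr 6 a = σ1.arr 6 a - ∑ J ∈ Finset.range J,
          ∑ k ∈ Finset.range I.m, I.badHit h p q i J k a) (by norm_num) (by norm_num) (by norm_num)
        rfl rfl E1.r9 (by simpa using I1.1) ?_ ?_
      · intro J hJ σ2 I2 r21 fr2 g2
        have E2 := E1.fr fr2
        have r20' : σ2.reg 20 = i := by rw [fr2.r 20, r20]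
        have a3 : σ2.arr 3 = h := by rw [fr2.a 3, fr1.a 3]; simp [h3]
        have hcell := mul_add_lt hi hJ
        have hb := hh i hi J hJ
        have hnm : I.n * I.nb ≤ I.n * I.nb * I.m := Nat.le_mul_of_pos_right _ hm
        refine Run.asg_seq (h (i * I.nb + J)) (hb.trans (by omega)) ?_ ?_ ?_
        · simp [r20', r21, E2.r9, a3]; norm_cast
        swap
        · simp [r20', r21, E2.r9]; norm_cast; exact ⟨by omega, by omega⟩
        rw [Nat.add_sub_cancel_left]
        refine Run.for I.m _ (fun k (σ' : State) =>
          (∀ a, |σ'.arr 6 a| ≤ (V + i * (I.nb * (I.m * I.Δ)) + J * (I.m * I.Δ) + k * I.Δ : ℕ)) ∧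
          ∀ a, σ'.arr 6 a = σ2.arr 6 a - ∑ k ∈ Finset.range k, I.badHit h p q i J k a)
          (by norm_num) (by norm_num) (by norm_num)
          rfl rfl (by simp [E2.r1]) (by simpa using I2.1) ?_ ?_
        · intro k hk σ3 I3 r22 fr3 g3
          have E3 := (E2.set 24 (h (i * I.nb + J))).fr fr3
          have e20 : σ3.reg 20 = i := by rw [fr3.r 20]; simp [r20']
          have e21 : σ3.reg 21 = J := by rw [fr3.r 21]; simp [r21]
          have e24 : σ3.reg 24 = h (i * I.nb + J) := by rw [fr3.r 24]; simp
          have e30 : σ3.reg 30 = p := by rw [fr3.r 30]; simp [fr2.r 30, fr1.r 30]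
          have e13 : σ3.reg 13 = q := by rw [fr3.r 13]; simp [fr2.r 13, fr1.r 13, h13]
          have hF := I.abs_far_le h hb k
          have hbnd : V + i * (I.nb * (I.m * I.Δ)) + J * (I.m * I.Δ) + k * I.Δ + I.Δ ≤
              V + I.n * (I.nb * (I.m * I.Δ)) := by
            have := Nat.mul_le_mul_right I.Δ (Nat.succ_le_of_lt (mul_add_lt hcell hk))
            have e1 : (i * I.nb + J) * I.m * I.Δ = i * (I.nb * (I.m * I.Δ)) + J * (I.m * I.Δ) := by
              ring
            have e2 : I.n * I.nb * I.m * I.Δ = I.n * (I.nb * (I.m * I.Δ)) := by ring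
            have e3 : ((i * I.nb + J) * I.m + k + 1) * I.Δ =
              (i * I.nb + J) * I.m * I.Δ + k * I.Δ + I.Δ := by ring
            simp only [Nat.succ_eq_add_one] at this
            omega
          refine Run.asg_seq (I.far h i J k) (by omega) ?_ ?_ ?_
          · simp only [exFar, Ex.eval_div, Ex.eval_add, Ex.eval_sub, Ex.eval_mul, Ex.eval_r, e24,
              E3.eval_exVal e20 e21 r22, E3.r3, Ex.eval_ofNat, Inst.far]
          swap
          · simpa [exFar] using E3.ok_exVal e20 e21 r22 hi hJ hk hM'
          have E4 := E3.set 26 (I.far h i J k)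
          refine Run.iteB (fun hc => ?_) (fun hc => ?_) (by simp [exBad])
          · rw [exBad_pos hp (y := I.far h i J k) (by simp) (by simp [e30])] at hc
            have hB : I.Bad h p i J k := hc
            refine Run.forC I.Δ 370 (fun jj (σ' : State) =>
              (∀ a, |σ'.arr 6 a| ≤ (V + i * (I.nb * (I.m * I.Δ)) + J * (I.m * I.Δ) + k * I.Δ + jj
                : ℕ)) ∧
              ∀ a, σ'.arr 6 a = σ3.arr 6 a - ∑ jj ∈ Finset.range jj,
                if J * I.Δ + jj < I.n then I.hit q i (J * I.Δ + jj) k a else 0) E4.r2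
              (by simpa using I3.1) ?_ ?_ (by rw [if_pos hB]; omega)
            · intro jj hjj σ5 I5 r23 fr5 g5
              have E5 := E4.fr fr5
              have hjX : J * I.Δ + jj ≤ I.n + I.Δ := by
                have := I.mul_lt_of_lt_nb hJ; omega
              have hnX : I.n + I.Δ ≤ mc.X := by
                have h1 : I.n ≤ V := by
                  rw [hV]; exact (Nat.le_mul_of_pos_right _ hn).trans (Nat.le_mul_of_pos_right _ hm)
                have h2 : 1 * (1 * (1 * I.Δ)) ≤ I.n * (I.nb * (I.m * I.Δ)) :=
                  Nat.mul_le_mul hn (Nat.mul_le_mul hnb (Nat.mul_le_mul_right _ hm))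
                omega
              refine Run.asg_seq ((J * I.Δ + jj : ℕ) : ℤ) (abs_cast_le (by omega))
                (by simp [fr5.r 21, e21, E5.r2, r23]) ?_
              have E6 := E5.set 25 ((J * I.Δ + jj : ℕ) : ℤ)
              refine Run.iteB (fun hlt => ?_) (fun hlt => ?_)
              · have hlt' : J * I.Δ + jj < I.n := by
                  simp only [Ex.eval_sub, Ex.eval_r, E6.r0, State.reg_setReg, if_true] at hlt
                  omega
                refine Run.mono (bump_run mc I q hq (-1) _ E6 (by simp [fr5.r 20, e20]) (by simp)
                  (by simp [fr5.r 22, r22]) hi hlt' hk (by simp [fr5.r 13, e13]) hM' hM6 hX6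
                  (by omega) rfl (V := V + i * (I.nb * (I.m * I.Δ)) + J * (I.m * I.Δ) + k * I.Δ + jj)
                  (by simpa using I5.1) (by simp; omega)) (by omega) fun σ6 h6 => ?_
                simp only [State.arr_setReg, h6]
                refine ⟨step I5.1 (I.abs_hit_le q i _ k), fun a => ?_⟩
                rw [I5.2, Finset.sum_range_succ, if_pos hlt']; ring
              · have hlt' : ¬ J * I.Δ + jj < I.n := by
                  simp only [Ex.eval_sub, Ex.eval_r, E6.r0, State.reg_setReg, if_true] at hlt
                  omega
                refine Run.skip_last ?_
                simp only [State.arr_setReg]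
                refine ⟨fun a => (I5.1 a).trans (by push_cast; linarith), fun a => ?_⟩
                rw [I5.2, Finset.sum_range_succ, if_neg hlt']; ring
            · intro σ5 I5 _ _ _
              simp only [State.arr_setReg]
              refine ⟨fun a => (I5.1 a).trans (by push_cast; linarith), fun a => ?_⟩
              rw [I5.2, I3.2, Finset.sum_range_succ, Inst.badHit, if_pos hB]; ring
          · rw [exBad_pos hp (y := I.far h i J k) (by simp) (by simp [e30])] at hc
            have hB : ¬ I.Bad h p i J k := hc
            refine Run.skip_last ?_ (by omega)
            simp only [State.arr_setReg]
            refine ⟨fun a => (I3.1 a).trans (by push_cast; nlinarith), fun a => ?_⟩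
            rw [I3.2, Finset.sum_range_succ, Inst.badHit, if_neg hB, add_zero]
        · intro σ3 I3 _ _ _
          simp only [State.arr_setReg]
          refine ⟨fun a => (I3.1 a).trans (by push_cast; linarith), fun a => ?_⟩
          rw [I3.2, I2.2, Finset.sum_range_succ]; ring
      · intro σ2 I2 _ _ _
        simp only [State.arr_setReg]
        refine ⟨fun a => (I2.1 a).trans (by push_cast; linarith), fun a => ?_⟩
        rw [I2.2, I1.2, Finset.sum_range_succ]; ring
    · rintro σ1 ⟨I1, I2⟩ _ _ _ g hg i hi j hj r hr
      rw [I2, hcnt.2 g hg i hi j hj r hr, I.sum_badHit h p hi hj hr]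
  · have e : ∀ i J, ∑ k ∈ Finset.range I.m,
        (120 + (if I.Bad h p i J k then I.Δ * 381 + 8 else 0) + 11) =
        131 * I.m + ((Finset.range I.m).filter (I.Bad h p i J)).card * (I.Δ * 381 + 8) := by
      intro i J
      rw [Finset.sum_add_distrib, Finset.sum_add_distrib, ← Finset.sum_filter]
      simp only [Finset.sum_const, Finset.card_range, smul_eq_mul]; ring
    simp only [e]
    have e2 : ∀ i, ∑ J ∈ Finset.range I.nb, (50 + (131 * I.m +
        ((Finset.range I.m).filter (I.Bad h p i J)).card * (I.Δ * 381 + 8) + 8) + 11) =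
        I.nb * (131 * I.m + 69) + (∑ J ∈ Finset.range I.nb,
          ((Finset.range I.m).filter (I.Bad h p i J)).card) * (I.Δ * 381 + 8) := by
      intro i
      rw [← sum_add_mul]
      exact Finset.sum_congr rfl fun J _ => by ring
    simp only [e2]
    have e3 : ∑ i ∈ Finset.range I.n, (I.nb * (131 * I.m + 69) + (∑ J ∈ Finset.range I.nb,
          ((Finset.range I.m).filter (I.Bad h p i J)).card) * (I.Δ * 381 + 8) + 8 + 11) =
        I.n * (I.nb * (131 * I.m + 69) + 19) + I.numBad h p * (I.Δ * 381 + 8) := by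
      rw [Inst.numBad, ← sum_add_mul]
      exact Finset.sum_congr rfl fun J _ => by ring
    rw [e3]
    refine Nat.le_sub_of_add_le ?_
    have h1 : I.numBad h p ≤ I.n * I.nb * I.m := I.numBad_le h p
    have h2 : I.n * I.nb ≤ I.n * I.nb * I.m := Nat.le_mul_of_pos_right _ hm
    have h3 : I.n ≤ I.n * I.nb := Nat.le_mul_of_pos_right _ hnb
    have h4 : I.n * (I.nb * (131 * I.m + 69) + 19) + I.numBad h p * (I.Δ * 381 + 8) + 8 + 50 =
      131 * (I.n * I.nb * I.m) + 69 * (I.n * I.nb) + 19 * I.n + 381 * (I.numBad h p * I.Δ) +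
      8 * I.numBad h p + 58 := by ring
    omega


/-! ## Lists of the values near the threshold -/

/-- Offset of the value of a triple in the window that starts at `v - W`. -/
def Inst.off (I : Inst) (v : ℤ) (i j k : ℕ) : ℤ := I.tot i j k - v + I.W

/-- Place of a triple in the order by value and chunk. -/
def Inst.slot (I : Inst) (P : ℕ) (v : ℤ) (i j k : ℕ) : ℕ := (I.off v i j k).toNat * P + k / I.L

/-- The triple `(i, j, k)` lies in the window and has the slot `s`. -/
def Inst.At (I : Inst) (P : ℕ) (win v : ℤ) (i j s k : ℕ) : Prop :=
  (0 ≤ I.off v i j k ∧ I.off v i j k ≤ win) ∧ I.slot P v i j k = s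

instance (I : Inst) (P : ℕ) (win v : ℤ) (i j s : ℕ) : DecidablePred (I.At P win v i j s) :=
  fun _ => inferInstanceAs (Decidable (_ ∧ _))

def Inst.num (I : Inst) (P : ℕ) (win v : ℤ) (i j s : ℕ) : ℕ :=
  ((Finset.range I.m).filter (I.At P win v i j s)).card

/-- The cells of the arrays `7` and `8` from `base` on list the slots that occur, in increasing
order, with their multiplicities. -/
def ListAt (I : Inst) (P : ℕ) (win v : ℤ) (base : ℕ) (c d : ℕ → ℤ) (i j : ℕ) (ls : List ℕ) : Prop :=
  (∀ a (h : a < ls.length), c (base + a) = ls[a] + 1) ∧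
  (∀ a (h : a < ls.length), d (base + a) = I.num P win v i j ls[a]) ∧
  c (base + ls.length) = 0 ∧ ls.Pairwise (· < ·) ∧ ∀ s, s ∈ ls ↔ 0 < I.num P win v i j s

lemma Inst.num_pos (I : Inst) {P : ℕ} {win v : ℤ} {i j s : ℕ} :
    0 < I.num P win v i j s ↔ ∃ k < I.m, I.At P win v i j s k := by
  rw [Inst.num, Finset.card_pos]
  constructor
  · rintro ⟨k, hk⟩; rw [Finset.mem_filter, Finset.mem_range] at hk; exact ⟨k, hk⟩
  · rintro ⟨k, hk⟩; exact ⟨k, by rwa [Finset.mem_filter, Finset.mem_range]⟩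

lemma Inst.At.lt {I : Inst} {P : ℕ} {win v : ℤ} {i j s k : ℕ} (h : I.At P win v i j s k)
    (hk : k / I.L < P) : (s : ℤ) < (win + 1) * P := by
  obtain ⟨⟨h1, h2⟩, rfl⟩ := h
  rw [Inst.slot]
  have := mul_add_lt (show (I.off v i j k).toNat < (win + 1).toNat by omega) hk
  have h3 : ((win + 1).toNat : ℤ) = win + 1 := Int.toNat_of_nonneg (by omega)
  rw [← h3]; exact_mod_cast this

/-- Bounded differences within the blocks of columns. -/
def Inst.Smooth (I : Inst) : Prop :=
  ∀ i < I.n, ∀ j < I.n, ∀ k < I.m, |I.tot i j k - I.val i (j / I.Δ) k| ≤ I.W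

lemma Inst.good_eq_num (I : Inst) (hs : I.Smooth) (h : ℕ → ℤ) {p i j s : ℕ} (hp : 1 ≤ p)
    (hi : i < I.n) (hj : j < I.n) (hsl : s < (4 * I.W + 1) * I.P) :
    I.good h p (8 * I.W * p) (s % I.P) i j
      (res (8 * I.W * p) (h (i * I.nb + j / I.Δ) - I.W + (s / I.P : ℕ))) =
    I.num I.P (4 * I.W : ℕ) (h (i * I.nb + j / I.Δ)) i j s := by
  have hW : 1 ≤ I.W := I.hΔ.trans I.hΔW
  have hP := I.one_le_P
  have hdiv : s / I.P ≤ 4 * I.W := by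
    have := (Nat.div_lt_iff_lt_mul hP).2 hsl; omega
  have h4 := Nat.div_add_mod' s I.P
  have hq : 1 ≤ 8 * I.W * p := Nat.mul_pos (by omega) hp
  have hr := Nat.mod_lt s hP
  generalize s / I.P = δ at *
  generalize s % I.P = ρ at *
  rw [Inst.good, Inst.num]
  congr 1
  refine Finset.filter_congr fun k hk => ?_
  rw [Finset.mem_range] at hk
  obtain ⟨v, hv⟩ : ∃ v, v = h (i * I.nb + j / I.Δ) := ⟨_, rfl⟩
  have key := eq_iff_modEq_and_not_bad (W := I.W) (p := p) (v := v)
    (u := v - I.W + δ) (by exact_mod_cast hW) (by exact_mod_cast hp)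
    (hs i hi j hj k hk) (by omega) (by omega)
  have e1 : res (8 * I.W * p) (I.tot i j k) = res (8 * I.W * p) (v - I.W + δ) ↔
      I.tot i j k % (8 * I.W * p) = (v - I.W + δ) % (8 * I.W * p) := by
    rw [← Nat.cast_inj (R := ℤ), cast_res hq, cast_res hq]; push_cast; rfl
  have e2 : I.Bad h p i (j / I.Δ) k ↔ ((I.val i (j / I.Δ) k - v + 2 * I.W) / (8 * I.W) ≠ 0 ∧
      (p : ℤ) ∣ (I.val i (j / I.Δ) k - v + 2 * I.W) / (8 * I.W)) := by
    rw [Inst.Bad, Inst.far, hv]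
  rw [← hv, e1, e2, and_assoc, ← key, Inst.At, Inst.slot, Inst.off]
  have hkP := I.div_lt_P hk
  constructor
  · rintro ⟨h1, h2⟩
    have h3 : I.tot i j k - v + I.W = δ := by omega
    rw [h3, Int.toNat_natCast, h1]
    exact ⟨⟨by omega, by omega⟩, h4⟩
  · rintro ⟨⟨h1, h2⟩, h3⟩
    have := (mul_add_inj hr hkP).1 (h4.trans h3.symm)
    exact ⟨this.2.symm, by omega⟩

/-- The slots below `s` that occur. -/
def Inst.occ (I : Inst) (P : ℕ) (win v : ℤ) (i j s : ℕ) : List ℕ :=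
  (List.range s).filter fun s => 0 < I.num P win v i j s

lemma Inst.length_occ_le (I : Inst) (P : ℕ) (win v : ℤ) (i j s : ℕ) :
    (I.occ P win v i j s).length ≤ s :=
  (List.length_filter_le _ _).trans (by simp)

def lists : Stmt :=
  .asg 11 (4 * .r 3) ;; .asg 12 ((4 * .r 3 + 1) * .r 10 + 1) ;; .asg 33 (.r 12 - 1) ;;
  .for 20 0 (.for 25 0 (
    .asg 24 (.ld 3 (.r 20 * .r 9 + .r 25 / .r 2)) ;; .asg 29 ((.r 20 * .r 0 + .r 25) * .r 12) ;;
    .for 23 33 (.asg 27 (.r 24 - .r 3 + .r 23 / .r 10) ;;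
      .asg 28 ((((.r 23 - .r 23 / .r 10 * .r 10) * .r 0 + .r 20) * .r 0 + .r 25) * .r 13 +
        (.r 27 - .r 27 / .r 13 * .r 13)) ;;
      .asg 28 (.ld 6 (.r 28)) ;;
      .ite (.r 28) (.sto 7 (.r 29) (.r 23 + 1) ;; .sto 8 (.r 29) (.r 28) ;; .asg 29 (.r 29 + 1))
        .skip) ;;
    .sto 7 (.r 29) 0))

lemma ListAt.congr {I : Inst} {P : ℕ} {win v : ℤ} {base N : ℕ} {c d c' d' : ℕ → ℤ} {i j : ℕ}
    {ls : List ℕ} (h : ListAt I P win v base c d i j ls) (hl : base + ls.length < N)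
    (hc : ∀ a < N, c' a = c a) (hd : ∀ a < N, d' a = d a) :
    ListAt I P win v base c' d' i j ls := by
  obtain ⟨h1, h2, h3, h4⟩ := h
  exact ⟨fun a ha => by rw [hc _ (by omega), h1], fun a ha => by rw [hd _ (by omega), h2],
    by rw [hc _ hl, h3], h4⟩

lemma lists_run (mc : Mach) (I : Inst) (hsm : I.Smooth) (h : ℕ → ℤ) (p q : ℕ) (hp : 1 ≤ p)
    (hpq : q = 8 * I.W * p)
    (hh : ∀ i < I.n, ∀ J < I.nb, |h (i * I.nb + J)| ≤ 2 * I.Y + 1) (σ : State)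
    (hE : Env I σ) (h3 : σ.arr 3 = h) (h13 : σ.reg 13 = q) (h10 : σ.reg 10 = I.P)
    (hfix : Fixed I h p q σ)
    (hM : I.n * I.nb ≤ mc.M)
    (hM6 : I.P * I.n * I.n * q ≤ mc.M) (hX6 : I.P * I.n * I.n * q ≤ mc.X)
    (hX : 2 * I.Y + 6 * I.W + 1 ≤ mc.X)
    (hM7 : I.n * I.n * ((4 * I.W + 1) * I.P + 1) ≤ mc.M)
    (hX7 : I.n * I.n * ((4 * I.W + 1) * I.P + 1) ≤ mc.X) :
    Run mc lists σ (800 * (I.n * I.n * ((4 * I.W + 1) * I.P + 1))) fun σ' =>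
      σ'.reg 11 = (4 * I.W : ℕ) ∧ σ'.reg 12 = ((4 * I.W + 1) * I.P + 1 : ℕ) ∧
      ∀ i < I.n, ∀ j < I.n, ∃ ls, ls.length ≤ (4 * I.W + 1) * I.P ∧
        ListAt I I.P (4 * I.W : ℕ) (h (i * I.nb + j / I.Δ))
        ((i * I.n + j) * ((4 * I.W + 1) * I.P + 1)) (σ'.arr 7) (σ'.arr 8) i j ls := by
  have hW : 1 ≤ I.W := I.hΔ.trans I.hΔW
  have hP := I.one_le_P
  have hn := I.hn
  have hq : 1 ≤ q := by rw [hpq]; exact Nat.mul_pos (by omega) hp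
  generalize hN' : (4 * I.W + 1) * I.P = N at *
  have hN := hN'.symm
  generalize hLS' : N + 1 = LS at *
  have hLS := hLS'.symm
  have hLS1 : LS ≤ I.n * I.n * LS := Nat.le_mul_of_pos_left _ (Nat.mul_pos hn hn)
  refine Run.asg_seq ((4 * I.W : ℕ) : ℤ) (abs_cast_le (by omega))
    (by simp [hE.r3]) ?_
  refine Run.asg_seq (LS : ℤ) (abs_cast_le (by omega))
    (by simp [hE.r3, h10, hLS, hN]) ?_
  refine Run.asg_seq (N : ℤ) (abs_cast_le (by omega))
    (by simp [hLS]) ?_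
  have hT : I.n * (I.n * (N * 500 + 250) + 20) + 8 + 150 ≤ 800 * (I.n * I.n * LS) := by
    have e : I.n * (I.n * (N * 500 + 250) + 20) + 8 + 150 =
      500 * (I.n * I.n * N) + 250 * (I.n * I.n) + 20 * I.n + 158 := by ring
    have e2 : I.n * I.n * LS = I.n * I.n * N + I.n * I.n := by rw [hLS]; ring
    have h2 : I.n ≤ I.n * I.n := Nat.le_mul_of_pos_right _ hn
    omega
  refine Run.le ?_ (Nat.le_sub_of_add_le (Nat.le_sub_of_add_le (Nat.le_sub_of_add_le hT)))
  clear hT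
  obtain ⟨c, hc⟩ : ∃ c, c = N * 500 + 230 := ⟨_, rfl⟩
  refine Run.forC I.n (I.n * (c + 11) + 8) (fun i (σ' : State) => ∀ i' < i, ∀ j < I.n,
    ∃ ls, ls.length ≤ N ∧ ListAt I I.P (4 * I.W : ℕ) (h (i' * I.nb + j / I.Δ))
        ((i' * I.n + j) * LS) (σ'.arr 7) (σ'.arr 8) i' j ls) (by simp [hE.r0]) (by simp) ?_
    (fun σ' I1 _ fr1 _ => ⟨by rw [fr1.r 11]; simp, by rw [fr1.r 12]; simp, I1⟩) (by
      have : I.n * (c + 11) + 8 + 11 ≤ I.n * (N * 500 + 250) + 20 := by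
        have := Nat.mul_le_mul_left I.n (show c + 11 ≤ N * 500 + 250 by omega); omega
      have := Nat.mul_le_mul_left I.n this
      omega)
  intro i hi σ1 I1 r20 fr1 g1
  have E1 := (((hE.set 11 _).set 12 _).set 33 _).fr fr1
  refine Run.forC I.n c (fun j (σ' : State) =>
    (∀ i' < i, ∀ j < I.n, ∃ ls, ls.length ≤ N ∧ ListAt I I.P (4 * I.W : ℕ)
      (h (i' * I.nb + j / I.Δ)) ((i' * I.n + j) * LS) (σ'.arr 7) (σ'.arr 8) i' j ls) ∧
    (∀ j' < j, ∃ ls, ls.length ≤ N ∧ ListAt I I.P (4 * I.W : ℕ)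
      (h (i * I.nb + j' / I.Δ)) ((i * I.n + j') * LS) (σ'.arr 7) (σ'.arr 8) i j' ls))
    E1.r0 ⟨by simpa using I1, by simp⟩ ?_ ?_ le_rfl
  swap
  · intro σ2 I2 _ _ _ i' hi' j hj
    simp only [State.arr_setReg]
    rcases (by omega : i' < i ∨ i' = i) with h' | rfl
    · exact I2.1 i' h' j hj
    · exact I2.2 j hj
  intro j hj σ2 I2 r25 fr2 g2
  have E2 := E1.fr fr2
  have r20' : σ2.reg 20 = i := by rw [fr2.r 20, r20]
  have a3 : σ2.arr 3 = h := by rw [fr2.a 3, fr1.a 3]; simp [h3]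
  have a6 : σ2.arr 6 = σ.arr 6 := by rw [fr2.a 6, fr1.a 6]; simp
  have r12 : σ2.reg 12 = LS := by rw [fr2.r 12, fr1.r 12]; simp
  have r33 : σ2.reg 33 = N := by rw [fr2.r 33, fr1.r 33]; simp
  have r10 : σ2.reg 10 = I.P := by rw [fr2.r 10, fr1.r 10]; simp [h10]
  have r13 : σ2.reg 13 = q := by rw [fr2.r 13, fr1.r 13]; simp [h13]
  have hJ := I.div_lt_nb hj
  have hcell := mul_add_lt hi hJ
  have hb := hh i hi _ hJ
  obtain ⟨v, hv⟩ : ∃ v, v = h (i * I.nb + j / I.Δ) := ⟨_, rfl⟩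
  rw [← hv] at hb
  refine Run.asg_seq v (by omega) ?_ ?_ ?_
  · simp [r20', r25, E2.r9, E2.r2, a3, hv]; norm_cast
  swap
  · simp only [Ex.ok_ld, Ex.ok_add, Ex.ok_mul, Ex.ok_div, Ex.ok_r, Ex.eval_add, Ex.eval_mul,
      Ex.eval_div, Ex.eval_r, r20', r25, E2.r9, E2.r2, true_and]
    exact ⟨by positivity, by exact_mod_cast hcell.trans_le hM⟩
  obtain ⟨base, hbase⟩ : ∃ base, base = (i * I.n + j) * LS := ⟨_, rfl⟩
  have hbaseM : base + LS ≤ I.n * I.n * LS := by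
    have := Nat.mul_le_mul_right LS (Nat.succ_le_of_lt (mul_add_lt hi hj))
    rw [Nat.succ_eq_add_one, add_mul, ← hbase] at this; omega
  refine Run.asg_seq (base : ℤ) (abs_cast_le (by omega))
    (by simp [r20', r25, E2.r0, r12, hbase]) ?_
  refine Run.forC_seq N 480 (fun s (σ' : State) =>
    σ'.reg 29 = (base + (I.occ I.P (4 * I.W : ℕ) v i j s).length : ℕ) ∧
    (∀ a (h : a < (I.occ I.P (4 * I.W : ℕ) v i j s).length),
      σ'.arr 7 (base + a) = (I.occ I.P (4 * I.W : ℕ) v i j s)[a] + 1) ∧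
    (∀ a (h : a < (I.occ I.P (4 * I.W : ℕ) v i j s).length),
      σ'.arr 8 (base + a) = I.num I.P (4 * I.W : ℕ) v i j (I.occ I.P (4 * I.W : ℕ) v i j s)[a]) ∧
    (∀ a < base, σ'.arr 7 a = σ2.arr 7 a) ∧ ∀ a < base, σ'.arr 8 a = σ2.arr 8 a)
    (by simp [r33]) (by simp [Inst.occ]) ?_ ?_
  · rintro s hs σ3 ⟨s29, s7, s8, o7, o8⟩ r23 fr3 g3
    have E3 := ((E2.set 24 _).set 29 _).fr fr3
    have e24 : σ3.reg 24 = v := by rw [fr3.r 24]; simp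
    have e20 : σ3.reg 20 = i := by rw [fr3.r 20]; simp [r20']
    have e25 : σ3.reg 25 = j := by rw [fr3.r 25]; simp [r25]
    have e10 : σ3.reg 10 = I.P := by rw [fr3.r 10]; simp [r10]
    have e13 : σ3.reg 13 = q := by rw [fr3.r 13]; simp [r13]
    have e6 : σ3.arr 6 = σ.arr 6 := by rw [fr3.a 6]; simp [a6]
    have hdiv : s / I.P ≤ 4 * I.W := by
      have := (Nat.div_lt_iff_lt_mul hP).2 (hN ▸ hs); omega
    obtain ⟨u, hu⟩ : ∃ u, u = v - I.W + (s / I.P : ℕ) := ⟨_, rfl⟩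
    have hlt := adr_lt (n := I.n) (Nat.mod_lt s hP) hi hj (res_lt hq u)
    have hadr := hfix (s % I.P) (Nat.mod_lt s hP) i hi j hj (res q u) (res_lt hq u)
    rw [hu, hv, hpq, I.good_eq_num hsm h hp hi hj (hN ▸ hs), ← hv, ← hpq, ← hu] at hadr
    obtain ⟨l, hl⟩ : ∃ l, l = adr I.n q (s % I.P) i j (res q u) := ⟨_, rfl⟩
    rw [← hl] at hadr hlt
    have hub : |u| ≤ mc.X := by
      generalize s / I.P = δ at *
      rw [abs_le] at *
      constructor <;> omega
    have hlen := I.length_occ_le I.P (4 * I.W : ℕ) v i j s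
    obtain ⟨x, hx⟩ : ∃ x, x = I.num I.P (4 * I.W : ℕ) v i j s := ⟨_, rfl⟩
    rw [← hx] at hadr
    have hocc : I.occ I.P (4 * I.W : ℕ) v i j (s + 1) =
        I.occ I.P (4 * I.W : ℕ) v i j s ++ if 0 < x then [s] else [] := by
      rw [Inst.occ, List.range_succ, List.filter_append, Inst.occ, hx]
      congr 1
      by_cases h0 : 0 < I.num I.P (4 * I.W : ℕ) v i j s
      · rw [if_pos h0, List.filter_cons_of_pos (by simpa using h0)]; rfl
      · rw [if_neg h0, List.filter_cons_of_neg (by simpa using h0)]; rfl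
    obtain ⟨oc, hoc⟩ : ∃ oc, oc = I.occ I.P (4 * I.W : ℕ) v i j s := ⟨_, rfl⟩
    rw [hocc, ← hoc]
    rw [← hoc] at s29 s7 s8 hlen
    have hxX : (x : ℤ) ≤ mc.X := by
      have := g3.arr 6 l; rw [e6, hadr, Nat.abs_cast] at this; exact this
    refine Run.asg_seq u hub
      (by simp [e24, E3.r3, r23, e10, hu]) ?_
    refine Run.asg_seq (l : ℤ) (abs_cast_le (by omega)) ?_ ?_
    · simp only [Ex.eval_add, Ex.eval_mul, Ex.eval_sub, Ex.eval_div, Ex.eval_r, State.reg_setReg]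
      norm_num [r23, e10, E3.r0, e20, e25, e13]
      rw [sub_div_mul, sub_div_mul, hl, adr]
      push_cast
      rw [cast_res hq]
    refine Run.asg_seq (x : ℤ) (by rw [Nat.abs_cast]; exact hxX) (by simp [e6, hadr]) ?_
      (by simp; omega)
    refine Run.iteB (fun hc => ?_) (fun hc => ?_)
    · have hx0 : 0 < x := by simpa using hc
      rw [if_pos hx0]
      refine Run.sto_seq (base + oc.length) ((s + 1 : ℕ) : ℤ) (by omega)
        (abs_cast_le (by omega)) (by simp [s29]) (by simp [r23]) ?_
      refine Run.sto_seq (base + oc.length) (x : ℤ) (by omega)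
        (by rw [Nat.abs_cast]; exact hxX) (by simp [s29]) (by simp) ?_
      refine Run.asg_last ((base + oc.length + 1 : ℕ) : ℤ)
        (abs_cast_le (by omega)) (by simp [s29]) ?_
      refine ⟨by simp [add_assoc], fun a ha => ?_, fun a ha => ?_, fun a ha => ?_, fun a ha => ?_⟩
      · simp only [List.length_append, List.length_singleton] at ha
        simp only [State.arr_setReg, State.arr_setArr]
        norm_num
        by_cases h' : a = oc.length
        · subst h'; simp
        · rw [Function.update_of_ne (by omega), List.getElem_append_left (by omega)]
          exact s7 a (by omega)
      · simp only [List.length_append, List.length_singleton] at ha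
        simp only [State.arr_setReg, State.arr_setArr]
        norm_num
        by_cases h' : a = oc.length
        · subst h'; simp [hx]
        · rw [Function.update_of_ne (by omega), List.getElem_append_left (by omega)]
          exact s8 a (by omega)
      · simp only [State.arr_setReg, State.arr_setArr]
        norm_num
        rw [Function.update_of_ne (by omega)]; exact o7 a ha
      · simp only [State.arr_setReg, State.arr_setArr]
        norm_num
        rw [Function.update_of_ne (by omega)]; exact o8 a ha
    · have hx0 : ¬ 0 < x := by simpa using hc
      rw [if_neg hx0, List.append_nil]
      refine Run.skip_last ?_
      simpa using ⟨s29, s7, s8, o7, o8⟩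
  · rintro σ3 ⟨s29, s7, s8, o7, o8⟩ fr3 g3
    have hlen := I.length_occ_le I.P (4 * I.W : ℕ) v i j N
    have hmem : ∀ s, s ∈ I.occ I.P (4 * I.W : ℕ) v i j N ↔ 0 < I.num I.P (4 * I.W : ℕ) v i j s := by
      intro s
      rw [Inst.occ, List.mem_filter, List.mem_range]
      simp only [decide_eq_true_eq]
      refine and_iff_right_of_imp fun h0 => ?_
      obtain ⟨k, hk, hat⟩ := I.num_pos.1 h0
      have := hat.lt (I.div_lt_P hk)
      rw [hN]; exact_mod_cast this
    have hsort : (I.occ I.P (4 * I.W : ℕ) v i j N).Pairwise (· < ·) :=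
      List.pairwise_lt_range.filter _
    generalize I.occ I.P (4 * I.W : ℕ) v i j N = oc at *
    refine Run.sto_last (base + oc.length) 0 (by omega) (by simp) (by simp [s29]) (by simp) ?_
      (hT := by omega)
    have old : ∀ i' j', i' * I.n + j' < i * I.n + j → (i' * I.n + j') * LS + N < base := by
      intro i' j' hlt
      have := Nat.mul_le_mul_right LS (Nat.succ_le_of_lt hlt)
      rw [Nat.succ_eq_add_one, add_mul, ← hbase] at this; omega
    have n7 : ∀ a < base, (((σ3.setArr 7 (base + oc.length) 0).setReg 25 ((j + 1 : ℕ) : ℤ)).arr 7 a)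
        = σ2.arr 7 a := fun a ha => by
      simp only [State.arr_setReg, State.arr_setArr, if_true]
      rw [Function.update_of_ne (by omega)]; exact o7 a ha
    have n8 : ∀ a < base, (((σ3.setArr 7 (base + oc.length) 0).setReg 25 ((j + 1 : ℕ) : ℤ)).arr 8 a)
        = σ2.arr 8 a := fun a ha => by
      simp only [State.arr_setReg, State.arr_setArr]
      norm_num; exact o8 a ha
    refine ⟨fun i' hi' j' hj' => ?_, fun j' hj' => ?_⟩
    · obtain ⟨ls, hl, hL⟩ := I2.1 i' hi' j' hj'
      have hlt : i' * I.n + j' < i * I.n + j := by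
        have := mul_add_lt hi' hj'; omega
      exact ⟨ls, hl, hL.congr (lt_of_le_of_lt (by omega) (old i' j' hlt)) n7 n8⟩
    · rcases (by omega : j' < j ∨ j' = j) with h' | rfl
      · obtain ⟨ls, hl, hL⟩ := I2.2 j' h'
        exact ⟨ls, hl, hL.congr (lt_of_le_of_lt (by omega) (old i j' (by omega))) n7 n8⟩
      · refine ⟨oc, hlen, ?_⟩
        rw [← hv, ← hbase]
        refine ⟨fun a ha => ?_, fun a ha => ?_, ?_, hsort, hmem⟩
        · simp only [State.arr_setReg, State.arr_setArr, if_true]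
          rw [Function.update_of_ne (by omega)]; exact s7 a ha
        · simp only [State.arr_setReg, State.arr_setArr]
          norm_num; exact s8 a ha
        · simp


/-! ## Queries -/

def exOff : Ex := exTot - .r 24 + .r 3

def exInWin : Ex := (.r 26 + 1) * (.r 11 + 1 - .r 26)

def exSlot : Ex := .r 26 * .r 10 + .r 22 / .r 4

/-- Mark the elements of the query set and count them by slots. -/
def mark : Stmt :=
  .for 23 7 (.asg 22 (.ld 2 (.r 23)) ;; .sto 9 (.r 22) 1 ;; .asg 26 exOff ;;
    .ite exInWin (.asg 27 exSlot ;; .sto 10 (.r 27) (.ld 10 (.r 27) + 1)) .skip)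

/-- Undo `mark`. -/
def unmark : Stmt :=
  .for 23 7 (.asg 22 (.ld 2 (.r 23)) ;; .sto 9 (.r 22) 0 ;; .asg 26 exOff ;;
    .ite exInWin (.asg 27 exSlot ;; .sto 10 (.r 27) 0) .skip)

/-- Take the index in `reg 22` into account as a possible answer. -/
def candidate : Stmt :=
  .ite (1 - .ld 9 (.r 22)) (.asg 26 exTot ;; .ite (.r 41 * (.r 42 - .r 26) + (1 - .r 41))
    (.asg 41 1 ;; .asg 42 (.r 26) ;; .asg 8 (.r 22)) .skip) .skip

/-- The storage is ready for queries. -/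
structure Ready (I : Inst) (P LS : ℕ) (win : ℤ) (σ : State) : Prop where
  env : Env I σ
  r10 : σ.reg 10 = P
  r11 : σ.reg 11 = win
  r12 : σ.reg 12 = LS
  z9 : ∀ a, σ.arr 9 a = 0
  z10 : ∀ a, σ.arr 10 a = 0
  thr : ∀ i < I.n, ∀ J < I.nb, ThrAt I σ i J
  lst : ∀ i < I.n, ∀ j < I.n, ∃ ls : List ℕ, ls.length < LS ∧
    ListAt I P win (σ.arr 3 (i * I.nb + j / I.Δ)) ((i * I.n + j) * LS) (σ.arr 7) (σ.arr 8) i j ls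
  mode : win = (4 * I.W : ℕ) ∨
    ∀ i < I.n, ∀ J < I.nb, ∀ k < I.m, I.val i J k < σ.arr 3 (i * I.nb + J)

/-- The registers of a query `(i, j)`, with its threshold `v`. -/
structure Loc (I : Inst) (P : ℕ) (win v : ℤ) (i j : ℕ) (σ : State) : Prop where
  env : Env I σ
  r10 : σ.reg 10 = P
  r11 : σ.reg 11 = win
  r20 : σ.reg 20 = i
  r25 : σ.reg 25 = j
  r24 : σ.reg 24 = v

lemma Loc.set {I : Inst} {P : ℕ} {win v : ℤ} {i j : ℕ} {σ : State} (h : Loc I P win v i j σ)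
    (x : ℕ) (z : ℤ) (hx : x ∉ [0, 1, 2, 3, 4, 9, 10, 11, 20, 25, 24] := by decide) :
    Loc I P win v i j (σ.setReg x z) := by
  simp only [List.mem_cons, List.not_mem_nil, or_false, not_or] at hx
  have e : ∀ y, y ≠ x → (σ.setReg x z).reg y = σ.reg y := fun y hy => by
    rw [State.reg_setReg, if_neg hy]
  exact ⟨h.env.set x z (by simp; tauto), by rw [e _ (by tauto), h.r10], by rw [e _ (by tauto), h.r11],
    by rw [e _ (by tauto), h.r20], by rw [e _ (by tauto), h.r25], by rw [e _ (by tauto), h.r24]⟩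

lemma Loc.setA {I : Inst} {P : ℕ} {win v : ℤ} {i j : ℕ} {σ : State} (h : Loc I P win v i j σ)
    (a c : ℕ) (z : ℤ) (ha : 2 ≤ a := by norm_num) : Loc I P win v i j (σ.setArr a c z) :=
  ⟨h.env.setA a c z ha, h.r10, h.r11, h.r20, h.r25, h.r24⟩

lemma Loc.fr {I : Inst} {P : ℕ} {win v : ℤ} {i j : ℕ} {σ σ' : State} {s : Stmt}
    (h : Loc I P win v i j σ) (hf : Fr s σ σ') (hs : s.safe = true := by rfl)
    (h10 : s.wrR 10 = false := by rfl) (h11 : s.wrR 11 = false := by rfl)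
    (h20 : s.wrR 20 = false := by rfl) (h25 : s.wrR 25 = false := by rfl)
    (h24 : s.wrR 24 = false := by rfl) : Loc I P win v i j σ' :=
  ⟨h.env.fr hf hs, by rw [hf.r 10 h10, h.r10], by rw [hf.r 11 h11, h.r11],
    by rw [hf.r 20 h20, h.r20], by rw [hf.r 25 h25, h.r25], by rw [hf.r 24 h24, h.r24]⟩

section
variable {mc : Mach} {I : Inst} {P : ℕ} {win v : ℤ} {i j : ℕ}

/-- The common part of `mark` and `unmark` for one element `k`. -/
lemma slot_run {σ : State} {e₁ e₂ : Ex} {k z : ℕ} {T : ℕ} {Q : State → Prop}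
    (h : Loc I P win v i j σ)
    (hi : i < I.n) (hj : j < I.n) (hk : k < I.m) (hP : ∀ k < I.m, k / I.L < P) (hwin : -1 ≤ win)
    (hv : |v| ≤ 2 * I.Y + 1) (hM : I.n * I.m ≤ mc.M) (hX : 4 * I.Y + I.W + 1 ≤ mc.X)
    (hmM : I.m ≤ mc.M) (hmX : I.m ≤ mc.X)
    (hwM : (win + 1) * P ≤ mc.M) (hwX : (win + 1) * P ≤ mc.X)
    {t : ℕ} (h23 : σ.reg 23 = t) (htM : t < mc.M) (h2 : σ.arr 2 t = k)
    (he₁ : ∀ σ' : State, e₁.eval σ' = z) (hok : ∀ σ' : State, e₁.ok mc.M σ') (hz : z ≤ 1)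
    (u : ℕ → ℕ) (hu : ∀ c (σ' : State), σ'.reg 27 = (c : ℕ) → σ'.arr 10 = σ.arr 10 → e₂.eval σ' = u c)
    (hok₂ : ∀ c (σ' : State), σ'.reg 27 = (c : ℕ) → c < mc.M → e₂.ok mc.M σ')
    (huX : ∀ s, I.At P win v i j s k → u s ≤ mc.X)
    (hw₁ : e₁.wf = true) (hw₂ : e₂.wf = true) (hc₁ : e₁.cost ≤ 50) (hc₂ : e₂.cost ≤ 50)
    (hQ : ∀ σ' : State, (∀ a, σ'.arr 9 a = if a = k then (z : ℤ) else σ.arr 9 a) →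
      (∀ s, σ'.arr 10 s = if I.At P win v i j s k then (u s : ℤ) else σ.arr 10 s) → Q σ')
    (hT : 450 ≤ T) :
    Run mc (.asg 22 (.ld 2 (.r 23)) ;; .sto 9 (.r 22) e₁ ;; .asg 26 exOff ;;
      .ite exInWin (.asg 27 exSlot ;; .sto 10 (.r 27) e₂) .skip) σ T Q := by
  refine Run.asg_seq (k : ℤ) (abs_cast_le (by omega)) (by simp [h23, h2]) ?_
    (by simp [h23]; omega)
  refine Run.sto_seq k (z : ℤ) (by omega) (abs_cast_le (by omega)) (by simp)
    (he₁ _) ?_ (by simp) (hok _) rfl hw₁ (by change 2 + _ < 100; omega)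
  have h' := (h.set 22 k).setA 9 k z
  have ht := I.abs_tot_le i j k
  refine Run.asg_seq (I.off v i j k) (by rw [Inst.off]; rw [abs_le] at *; constructor <;> omega) ?_ ?_
    ?_
  · rw [exOff, Ex.eval_add, Ex.eval_sub, h'.env.eval_exTot (k := k) h'.r20 h'.r25 (by simp), Ex.eval_r,
      Ex.eval_r, h'.r24, h'.env.r3, Inst.off]
  swap
  · simpa [exOff] using h'.env.ok_exTot (k := k) h'.r20 h'.r25 (by simp) hi hj hk hM
  have h'' := h'.set 26 (I.off v i j k)
  have hwinIff : 0 < exInWin.eval (((σ.setReg 22 k).setArr 9 k z).setReg 26 (I.off v i j k)) ↔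
      0 ≤ I.off v i j k ∧ I.off v i j k ≤ win := by
    simp only [exInWin, Ex.eval_mul, Ex.eval_add, Ex.eval_sub, Ex.eval_r, Ex.eval_one, h''.r11]
    simp only [State.reg_setReg, if_true]
    constructor
    · intro hp
      rcases pos_and_pos_or_neg_and_neg_of_mul_pos hp with ⟨h1, h2⟩ | ⟨h1, h2⟩ <;>
        constructor <;> omega
    · rintro ⟨h1, h2⟩; exact mul_pos (by omega) (by omega)
  refine Run.iteB (fun hc => ?_) (fun hc => ?_) (by simp [exInWin])
  · rw [hwinIff] at hc
    obtain ⟨s, hs⟩ : ∃ s, s = I.slot P v i j k := ⟨_, rfl⟩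
    have hat : I.At P win v i j s k := ⟨hc, hs.symm⟩
    have hlt := hat.lt (hP k hk)
    have hsM : s < mc.M := by exact_mod_cast hlt.trans_le hwM
    refine Run.asg_seq (s : ℤ) (by rw [Nat.abs_cast]; exact (hlt.trans_le hwX).le) ?_ ?_
      (by simp [exSlot])
    · simp only [exSlot, Ex.eval_add, Ex.eval_mul, Ex.eval_div, Ex.eval_r, h''.r10, h''.env.r4, hs,
        Inst.slot]
      simp only [State.reg_setReg, State.reg_setArr]
      norm_num
      exact Or.inl hc.1
    refine Run.sto_last s (u s : ℤ) hsM (abs_cast_le (huX s hat)) (by simp)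
      (hu s _ (by simp) (by simp)) ?_ (by simp) (hok₂ s _ (by simp) hsM) (by omega) rfl hw₂
      (by change 2 + _ < 100; omega)
    refine hQ _ (fun a => ?_) fun a => ?_
    · simp only [State.arr_setReg, State.arr_setArr]
      norm_num [Function.update_apply]
    · simp only [State.arr_setReg, State.arr_setArr]
      norm_num
      rw [Function.update_apply]
      have : I.At P win v i j a k ↔ a = s := by
        constructor
        · rintro ⟨-, h1⟩; rw [hs, h1]
        · rintro rfl; exact hat
      simp only [this]
      split_ifs with hh
      · rw [hh]
      · rfl
  · rw [hwinIff] at hc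
    refine Run.skip_last (hQ _ (fun a => ?_) fun a => ?_)
    · simp only [State.arr_setReg, State.arr_setArr]
      norm_num [Function.update_apply]
    · have : ¬ I.At P win v i j a k := fun hh => hc hh.1
      simp [this]

lemma mem_of_num_le_countP {S : List ℕ} (hS : S.Nodup) (hSm : ∀ k ∈ S, k < I.m) {s : ℕ}
    (h : I.num P win v i j s ≤ S.countP (fun k => decide (I.At P win v i j s k))) {k : ℕ}
    (hk : k < I.m) (hat : I.At P win v i j s k) : k ∈ S := by
  rw [List.countP_eq_length_filter, ← List.toFinset_card_of_nodup (hS.filter _), Inst.num] at h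
  have hsub : (S.filter (fun k => decide (I.At P win v i j s k))).toFinset ⊆
      (Finset.range I.m).filter (I.At P win v i j s) := by
    intro k hk
    simp only [List.mem_toFinset, List.mem_filter, decide_eq_true_eq] at hk
    exact Finset.mem_filter.2 ⟨Finset.mem_range.2 (hSm k hk.1), hk.2⟩
  have he := Finset.eq_of_subset_of_card_le hsub h
  have : k ∈ (Finset.range I.m).filter (I.At P win v i j s) :=
    Finset.mem_filter.2 ⟨Finset.mem_range.2 hk, hat⟩
  rw [← he, List.mem_toFinset, List.mem_filter] at this
  exact this.1

/-- Marks and counters for the set `S`. -/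
def Marked (I : Inst) (P : ℕ) (win v : ℤ) (i j : ℕ) (S : List ℕ) (σ : State) : Prop :=
  (∀ k, σ.arr 9 k = if k ∈ S then 1 else 0) ∧
  ∀ s, σ.arr 10 s = S.countP (fun k => decide (I.At P win v i j s k))

lemma mark_run {σ : State} (h : Loc I P win v i j σ)
    (hi : i < I.n) (hj : j < I.n) (hP : ∀ k < I.m, k / I.L < P) (hwin : -1 ≤ win)
    (hv : |v| ≤ 2 * I.Y + 1) (hM : I.n * I.m ≤ mc.M) (hX : 4 * I.Y + I.W + 1 ≤ mc.X)
    (hmM : I.m ≤ mc.M) (hmX : I.m + 1 ≤ mc.X)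
    (hwM : (win + 1) * P ≤ mc.M) (hwX : (win + 1) * P ≤ mc.X) {S : List ℕ}
    (hSm : ∀ k ∈ S, k < I.m) (h7 : σ.reg 7 = S.length)
    (h2 : ∀ t (ht : t < S.length), σ.arr 2 t = S[t]) (z9 : ∀ a, σ.arr 9 a = 0)
    (z10 : ∀ a, σ.arr 10 a = 0) (hlen : S.length ≤ I.m) :
    Run mc mark σ (S.length * 461 + 8) (Marked I P win v i j S) := by
  refine Run.forC S.length 450 (fun t => Marked I P win v i j (S.take t)) h7
    (by simp [Marked, z9, z10]) ?_ ?_ le_rfl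
  · intro t ht σ1 I1 r23 fr1 g1
    have hkS : S[t] ∈ S := List.getElem_mem ht
    have hk := hSm _ hkS
    have htake : S.take (t + 1) = S.take t ++ [S[t]] := by
      rw [List.take_append_getElem]
    refine slot_run (h.fr fr1) hi hj hk hP hwin hv hM hX hmM (by omega) hwM hwX
      (z := 1) r23 (by omega) (by rw [fr1.a 2, h2 t ht]) (fun _ => by simp) (fun _ => by simp) le_rfl
      (fun s => (S.take t).countP (fun k => decide (I.At P win v i j s k)) + 1) (fun c σ' hc ha => ?_)
      (fun c σ' hc hcM => ?_) (fun s hs => ?_) rfl rfl (by decide) (by decide) (fun σ' h9 h10 => ?_) le_rfl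
    · simp only [Ex.eval_add, Ex.eval_ld, Ex.eval_r, Ex.eval_one, hc, ha, Int.toNat_natCast, I1.2]
      push_cast; rfl
    · simp [hc, hcM]
    · have h1 : (S.take t).countP (fun k => decide (I.At P win v i j s k)) ≤ (S.take t).length :=
        List.countP_le_length
      rw [List.length_take] at h1; omega
    · rw [Marked, htake]
      simp only [State.arr_setReg, h9, h10, I1.1, I1.2]
      refine ⟨fun k => ?_, fun s => ?_⟩
      · have hm : k ∈ S.take t ++ [S[t]] ↔ k = S[t] ∨ k ∈ S.take t := by
          rw [List.mem_append, List.mem_singleton, or_comm]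
        simp only [hm]
        by_cases hkk : k = S[t]
        · rw [if_pos hkk, if_pos (Or.inl hkk)]; rfl
        · simp [hkk]
      · rw [List.countP_append, List.countP_singleton]
        by_cases hh : I.At P win v i j s S[t] <;> simp [hh]
  · intro σ1 I1 _ _ _
    rwa [List.take_length] at I1

lemma unmark_run {σ : State} (h : Loc I P win v i j σ)
    (hi : i < I.n) (hj : j < I.n) (hP : ∀ k < I.m, k / I.L < P) (hwin : -1 ≤ win)
    (hv : |v| ≤ 2 * I.Y + 1) (hM : I.n * I.m ≤ mc.M) (hX : 4 * I.Y + I.W + 1 ≤ mc.X)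
    (hmM : I.m ≤ mc.M) (hmX : I.m ≤ mc.X)
    (hwM : (win + 1) * P ≤ mc.M) (hwX : (win + 1) * P ≤ mc.X) {S : List ℕ}
    (hSm : ∀ k ∈ S, k < I.m) (h7 : σ.reg 7 = S.length)
    (h2 : ∀ t (ht : t < S.length), σ.arr 2 t = S[t]) (hmk : Marked I P win v i j S σ)
    (hlen : S.length ≤ I.m) :
    Run mc unmark σ (S.length * 461 + 8) fun σ' =>
      (∀ a, σ'.arr 9 a = 0) ∧ ∀ a, σ'.arr 10 a = 0 := by
  refine Run.forC S.length 450 (fun t (σ' : State) =>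
    (∀ k, k ∉ S.drop t → σ'.arr 9 k = 0) ∧
    ∀ s, (∀ k ∈ S.drop t, ¬ I.At P win v i j s k) → σ'.arr 10 s = 0) h7 ?_ ?_ ?_ le_rfl
  · refine ⟨fun k hk => ?_, fun s hs => ?_⟩
    · simp only [List.drop_zero] at hk
      simp [hmk.1, hk]
    · simp only [List.drop_zero] at hs
      simp only [State.arr_setReg, hmk.2, Nat.cast_eq_zero, List.countP_eq_zero, decide_eq_true_eq]
      exact hs
  · intro t ht σ1 I1 r23 fr1 g1
    have hkS : S[t] ∈ S := List.getElem_mem ht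
    have hk := hSm _ hkS
    have hdrop : S.drop t = S[t] :: S.drop (t + 1) := List.drop_eq_getElem_cons ht
    refine slot_run (h.fr fr1) hi hj hk hP hwin hv hM hX hmM (by omega) hwM hwX
      (z := 0) r23 (by omega) (by rw [fr1.a 2, h2 t ht]) (fun _ => by simp) (fun _ => by simp) (by omega)
      (fun s => 0) (fun c σ' hc ha => by simp)
      (fun c σ' hc hcM => by simp) (fun s hs => by omega) rfl rfl (by decide) (by decide)
      (fun σ' h9 h10 => ?_) le_rfl
    simp only [State.arr_setReg, h9, h10]
    rw [hdrop] at I1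
    refine ⟨fun k hk => ?_, fun s hs => ?_⟩
    · split_ifs with hh
      · simp
      · exact I1.1 k fun hc => (List.mem_cons.1 hc).elim hh hk
    · split_ifs with hh
      · simp
      · exact I1.2 s fun k hc hat => (List.mem_cons.1 hc).elim (fun e => hh (e ▸ hat))
          fun hc => hs k hc hat
  · rintro σ1 ⟨I1, I2⟩ _ _ _
    simp only [List.drop_length] at I1 I2
    exact ⟨fun a => I1 a (by simp), fun a => I2 a (by simp)⟩

/-- The best index among those seen so far. -/
def Best (I : Inst) (i j : ℕ) (S : List ℕ) (seen : ℕ → Prop) (σ : State) : Prop :=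
  (σ.reg 41 = 0 ∧ ∀ k, seen k → k ∈ S) ∨
  (σ.reg 41 = 1 ∧ ∃ k < I.m, σ.reg 8 = k ∧ σ.reg 42 = I.tot i j k ∧ k ∉ S ∧
    ∀ k', seen k' → k' ∉ S → I.tot i j k ≤ I.tot i j k')

lemma Best.congr {S : List ℕ} {seen seen' : ℕ → Prop} {σ σ' : State} (h : Best I i j S seen σ)
    (h41 : σ'.reg 41 = σ.reg 41) (h42 : σ'.reg 42 = σ.reg 42) (h8 : σ'.reg 8 = σ.reg 8)
    (hs : ∀ k, seen' k → seen k) : Best I i j S seen' σ' := by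
  rw [Best, h41, h42, h8]
  rcases h with ⟨h1, h2⟩ | ⟨h1, k, hk, h2, h3, h4, h5⟩
  · exact Or.inl ⟨h1, fun k hk => h2 k (hs k hk)⟩
  · exact Or.inr ⟨h1, k, hk, h2, h3, h4, fun k' hk' => h5 k' (hs k' hk')⟩

lemma candidate_run {σ : State} (h : Loc I P win v i j σ) (hi : i < I.n) (hj : j < I.n) {k : ℕ}
    (hk : k < I.m) (h22 : σ.reg 22 = k) {S : List ℕ} (hM : I.n * I.m ≤ mc.M)
    (hX : 4 * I.Y + I.W + 1 ≤ mc.X) (hmM : I.m ≤ mc.M) (hmX : I.m ≤ mc.X)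
    (hmk : ∀ k, σ.arr 9 k = if k ∈ S then 1 else 0) {seen : ℕ → Prop} (hb : Best I i j S seen σ) :
    Run mc candidate σ 350 (Best I i j S fun k' => seen k' ∨ k' = k) := by
  have ht := I.abs_tot_le i j k
  have he : Ex.eval σ (1 - .ld 9 (.r 22)) = 1 - if k ∈ S then 1 else 0 := by
    simp [h22, hmk]
  refine Run.iteB (fun hc => ?_) (fun hc => ?_) (by simp [h22]; omega)
  · have hkS : k ∉ S := by intro hh; rw [he, if_pos hh] at hc; simp at hc
    refine Run.asg_seq (I.tot i j k) (by omega) (h.env.eval_exTot h.r20 h.r25 h22) ?_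
      (h.env.ok_exTot h.r20 h.r25 h22 hi hj hk hM)
    have hupd : ∀ T, 150 ≤ T → (∀ k', seen k' → k' ∉ S → I.tot i j k ≤ I.tot i j k') →
        Run mc (.asg 41 1 ;; .asg 42 (.r 26) ;; .asg 8 (.r 22)) (σ.setReg 26 (I.tot i j k)) T
          (Best I i j S fun k' => seen k' ∨ k' = k) := by
      intro T hT hle
      refine Run.asg_seq 1 (by simp; omega) (by simp) ?_
      refine Run.asg_seq (I.tot i j k) (by omega) (by simp) ?_
      refine Run.asg_last (k : ℤ) (abs_cast_le (by omega)) (by simp [h22]) ?_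
      refine Or.inr ⟨by simp, k, hk, by simp, by simp, hkS, ?_⟩
      rintro k' (h1 | rfl) h2
      · exact hle k' h1 h2
      · exact le_rfl
    rcases hb with ⟨h1, h2⟩ | ⟨h1, k0, hk0, h2, h3, h4, h5⟩
    · refine Run.iteB (fun _ => hupd _ (by omega) fun k' hk' hn => absurd (h2 k' hk') hn)
        fun hc => ?_
      simp [h1] at hc
    · refine Run.iteB (fun hc => hupd _ (by omega) fun k' hk' hn => ?_) fun hc => ?_
      · simp [h1, h3] at hc
        have := h5 k' hk' hn; omega
      · simp [h1, h3] at hc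
        refine Run.skip_last (Or.inr ⟨by simp [h1], k0, hk0, by simp [h2], by simp [h3], h4, ?_⟩)
        rintro k' (h1 | rfl) hn
        · exact h5 k' h1 hn
        · exact hc
  · have hkS : k ∈ S := by by_contra hh; rw [he, if_neg hh] at hc; simp at hc
    refine Run.skip_last ?_
    rcases hb with ⟨h1, h2⟩ | ⟨h1, k0, hk0, h2, h3, h4, h5⟩
    · exact Or.inl ⟨h1, by rintro k' (hh | rfl); exacts [h2 k' hh, hkS]⟩
    · exact Or.inr ⟨h1, k0, hk0, h2, h3, h4, by
        rintro k' (hh | rfl) hn; exacts [h5 k' hh hn, absurd hkS hn]⟩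

lemma passed_le {S ls : List ℕ} (hls : ls.Pairwise (· < ·))
    (hpos : ∀ s ∈ ls, 0 < I.num P win v i j s) {a : ℕ} (ha : a ≤ ls.length)
    (hp : ∀ b (h : b < ls.length), b < a →
      I.num P win v i j ls[b] ≤ S.countP (fun k => decide (I.At P win v i j ls[b] k))) :
    a ≤ S.length := by
  have hnd : (ls.take a).Nodup := (hls.imp (fun h => ne_of_lt h)).sublist (List.take_sublist _ _)
  have hsub : (ls.take a).toFinset ⊆ (S.map (I.slot P v i j)).toFinset := by
    intro s hs
    rw [List.mem_toFinset, List.mem_take_iff_getElem] at hs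
    obtain ⟨b, hb, rfl⟩ := hs
    have h1 := hp b (by omega) (by omega)
    have h2 := hpos _ (List.getElem_mem (by omega : b < ls.length))
    obtain ⟨k, hk, hat⟩ := List.countP_pos_iff.1 (h2.trans_le h1)
    rw [List.mem_toFinset, List.mem_map]
    exact ⟨k, hk, (of_decide_eq_true hat).2⟩
  have h1 := Finset.card_le_card hsub
  rw [List.toFinset_card_of_nodup hnd, List.length_take] at h1
  have h2 := List.toFinset_card_le (S.map (I.slot P v i j))
  rw [List.length_map] at h2
  omega

/-- The answer lies in the exceptional list or in the first chunk that is not exhausted. -/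
lemma exists_seen (hsm : I.Smooth) (hi : i < I.n) (hj : j < I.n)
    (hP : ∀ k < I.m, k / I.L < P) {e : ℕ} {E : ℕ → ℤ}
    (hthr : IsThreshold I.m I.L (I.val i (j / I.Δ)) v e E)
    (hmode : win = (4 * I.W : ℕ) ∨ ∀ k < I.m, I.val i (j / I.Δ) k < v)
    {S ls : List ℕ} (hS : S.Nodup) (hSm : ∀ k ∈ S, k < I.m) (hSL : S.length < I.L)
    (hls : ls.Pairwise (· < ·)) (hmem : ∀ s, s ∈ ls ↔ 0 < I.num P win v i j s) {a : ℕ}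
    (hp : ∀ b (h : b < ls.length), b < a →
      I.num P win v i j ls[b] ≤ S.countP (fun k => decide (I.At P win v i j ls[b] k)))
    (hlast : ∀ h : a < ls.length,
      S.countP (fun k => decide (I.At P win v i j ls[a] k)) < I.num P win v i j ls[a])
    {seen : ℕ → Prop} (hE : ∀ t < e, ∀ k : ℕ, E t = k → seen k)
    (hseen : ∀ (h : a < ls.length), ∀ k < I.m, k / I.L = ls[a] % P → seen k)
    {k' : ℕ} (hk' : k' < I.m) (hkS : k' ∉ S) :
    ∃ k, seen k ∧ k ∉ S ∧ I.tot i j k ≤ I.tot i j k' := by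
  have hlow : ∀ k < I.m, I.val i (j / I.Δ) k < v → seen k := fun k hk hv => by
    obtain ⟨t, ht, hh⟩ := hthr.mem k hk hv
    exact hE t ht k hh
  by_cases hv : I.val i (j / I.Δ) k' < v
  · exact ⟨k', hlow k' hk' hv, hkS, le_rfl⟩
  have hwin : win = (4 * I.W : ℕ) := hmode.resolve_right fun hh => hv (hh k' hk')
  have window : ∀ k < I.m, k ∉ S → 0 ≤ I.off v i j k → I.off v i j k ≤ win →
      ∃ k2, seen k2 ∧ k2 ∉ S ∧ I.tot i j k2 ≤ I.tot i j k := by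
    intro k hk hkS h1 h2
    have hat : I.At P win v i j (I.slot P v i j k) k := ⟨⟨h1, h2⟩, rfl⟩
    have hin := (hmem _).2 (I.num_pos.2 ⟨k, hk, hat⟩)
    obtain ⟨b, hb, hbs⟩ := List.getElem_of_mem hin
    have hab : a ≤ b := by
      by_contra hlt
      push Not at hlt
      have := hp b hb hlt
      rw [hbs] at this
      exact hkS (mem_of_num_le_countP hS hSm this hk hat)
    have ha : a < ls.length := by omega
    obtain ⟨k2, hk2, hat2, hk2S⟩ : ∃ k2 < I.m, I.At P win v i j ls[a] k2 ∧ k2 ∉ S := by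
      by_contra hno
      push Not at hno
      refine absurd (hlast ha) (not_lt.2 ?_)
      rw [List.countP_eq_length_filter, Inst.num, ← List.toFinset_card_of_nodup (hS.filter _)]
      refine Finset.card_le_card fun k hk => ?_
      rw [Finset.mem_filter, Finset.mem_range] at hk
      rw [List.mem_toFinset, List.mem_filter]
      exact ⟨hno k hk.1 hk.2, decide_eq_true hk.2⟩
    refine ⟨k2, hseen ha k2 hk2 ?_, hk2S, ?_⟩
    · rw [← hat2.2, Inst.slot, add_comm, Nat.add_mul_mod_self_right, Nat.mod_eq_of_lt (hP k2 hk2)]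
    · have hle : ls[a] ≤ I.slot P v i j k := by
        rw [← hbs]
        rcases hab.eq_or_lt with rfl | hlt
        · exact le_rfl
        · exact (List.pairwise_iff_getElem.1 hls a b ha hb hlt).le
      rw [← hat2.2, Inst.slot, Inst.slot] at hle
      have h3 := hP k hk
      have h4 : (I.off v i j k2).toNat ≤ (I.off v i j k).toNat := by
        by_contra hlt
        push Not at hlt
        have := Nat.mul_le_mul_right P (Nat.succ_le_of_lt hlt)
        rw [Nat.succ_eq_add_one, add_mul] at this
        generalize k / I.L = c at *
        generalize k2 / I.L = d at *
        omega
      have h6 : I.off v i j k2 ≤ I.off v i j k := by omega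
      simp only [Inst.off] at h6; omega
  have hb := hsm i hi j hj
  have hk1 := hb k' hk'
  rw [abs_le] at hk1
  by_cases hhi : I.off v i j k' ≤ win
  · exact window k' hk' hkS (by simp only [Inst.off]; omega) hhi
  obtain ⟨k0, hk0, hk0v, hk0S⟩ : ∃ k0 < I.m, I.val i (j / I.Δ) k0 ≤ v ∧ k0 ∉ S := by
    by_contra hno
    push Not at hno
    have hc := hthr.cov.resolve_left fun hh => hv (hh k' hk')
    have : ((Finset.range I.m).filter fun k => I.val i (j / I.Δ) k ≤ v).card ≤ S.toFinset.card := by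
      refine Finset.card_le_card fun k hk => ?_
      rw [Finset.mem_filter, Finset.mem_range] at hk
      exact List.mem_toFinset.2 (hno k hk.1 hk.2)
    have h2 := List.toFinset_card_le S
    omega
  have hk2 := hb k0 hk0
  rw [abs_le] at hk2
  have hle : I.tot i j k0 ≤ I.tot i j k' := by
    simp only [Inst.off, hwin] at hhi; push_cast at hhi; omega
  by_cases hlt : I.val i (j / I.Δ) k0 < v
  · exact ⟨k0, hlow k0 hk0 hlt, hk0S, hle⟩
  · obtain ⟨k2, h1, h2, h3⟩ := window k0 hk0 hk0S (by simp only [Inst.off]; omega)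
      (by simp only [Inst.off, hwin]; push_cast; omega)
    exact ⟨k2, h1, h2, h3.trans hle⟩

end

/-- Look at the current entry of the list. -/
def testEntry : Stmt :=
  .asg 45 (.ld 7 (.r 44)) ;;
  .ite (.r 45) (.asg 46 (.ld 10 (.r 45 - 1) - .ld 8 (.r 44) + 1)) (.asg 46 0)

/-- Examine all members of the chunk of the current entry. -/
def scanChunk : Stmt :=
  .asg 48 ((.r 45 - 1 - (.r 45 - 1) / .r 10 * .r 10) * .r 4) ;;
  .for 23 4 (.asg 22 (.r 48 + .r 23) ;; .ite (.r 1 - .r 22) candidate .skip)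

def query : Stmt :=
  .asg 20 (.r 5) ;; .asg 25 (.r 6) ;; .asg 40 (.r 5 * .r 9 + .r 6 / .r 2) ;;
  .asg 24 (.ld 3 (.r 40)) ;; mark ;; .asg 41 0 ;; .asg 43 (.ld 4 (.r 40)) ;;
  .for 23 43 (.asg 22 (.ld 5 (.r 40 * .r 1 + .r 23)) ;; candidate) ;;
  .asg 44 ((.r 5 * .r 0 + .r 6) * .r 12) ;; testEntry ;;
  .whl (.r 46) (.asg 44 (.r 44 + 1) ;; testEntry) ;;
  .ite (.r 45) scanChunk .skip ;; unmark

section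
variable {mc : Mach} {I : Inst} {P : ℕ} {win v : ℤ} {i j : ℕ}

lemma testEntry_run {σ : State} {S ls : List ℕ} {base a T : ℕ} {Q : State → Prop}
    (hls : ListAt I P win v base (σ.arr 7) (σ.arr 8) i j ls) (ha : a ≤ ls.length)
    (h44 : σ.reg 44 = (base + a : ℕ)) (hmk : Marked I P win v i j S σ)
    (hbM : base + ls.length < mc.M) (hP : ∀ k < I.m, k / I.L < P)
    (hwM : (win + 1) * P ≤ mc.M) (hX : 2 * I.m + S.length + 1 ≤ mc.X) (hT : 160 ≤ T)
    (hg : Good mc.X σ)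
    (hQ : ∀ σ' : State, (∀ h : a < ls.length, σ'.reg 45 = ls[a] + 1) →
      (a = ls.length → σ'.reg 45 = 0) →
      (0 < σ'.reg 46 ↔ ∃ h : a < ls.length, I.num P win v i j ls[a] ≤
        S.countP (fun k => decide (I.At P win v i j ls[a] k))) → Q σ') :
    Run mc testEntry σ T Q := by
  obtain ⟨l7, l8, lf, ls1, lm⟩ := hls
  have hb : |σ.arr 7 (base + a)| ≤ mc.X := hg.arr _ _
  refine Run.asg_seq (σ.arr 7 (base + a)) hb (by simp [h44]; norm_cast) ?_
    (by simp [h44]; norm_cast; omega)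
  rcases ha.eq_or_lt with rfl | hlt
  · rw [lf]
    refine Run.iteB (fun hc => by simp at hc) fun _ => ?_
    exact Run.asg_last 0 (by simp) (by simp) (hQ _ (fun h => by omega) (fun _ => by simp) (by simp))
  · have hpos := (lm _).1 (List.getElem_mem hlt)
    obtain ⟨k, hk, hat⟩ := I.num_pos.1 hpos
    have hslt := hat.lt (hP k hk)
    have hnum : I.num P win v i j ls[a] ≤ I.m := by
      simpa [Inst.num] using Finset.card_filter_le (Finset.range I.m) (I.At P win v i j ls[a])
    have hcnt : S.countP (fun k => decide (I.At P win v i j ls[a] k)) ≤ S.length :=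
      List.countP_le_length
    rw [l7 a hlt]
    refine Run.iteB (fun _ => ?_) fun hc => by simp at hc
    refine Run.asg_last (((S.countP (fun k => decide (I.At P win v i j ls[a] k)) : ℕ) : ℤ) -
      (I.num P win v i j ls[a] : ℕ) + 1) (by rw [abs_le]; constructor <;> omega) ?_
      (hQ _ (fun h => by simp) (fun h => by omega) ?_) ?_
    · have e8 : (((base : ℤ) + (a : ℤ)).toNat) = base + a := by omega
      simp [h44, hmk.2, e8, l8 a hlt]
    · simp only [State.reg_setReg, if_true]
      constructor
      · intro h; exact ⟨hlt, by omega⟩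
      · rintro ⟨_, h⟩; omega
    · have : ((base + a : ℕ) : ℤ) < mc.M := by exact_mod_cast (by omega : base + a < mc.M)
      simp [h44]
      refine ⟨by omega, by omega, by omega⟩

lemma scanChunk_run {σ : State} (h : Loc I P win v i j σ) (hi : i < I.n) (hj : j < I.n)
    {S : List ℕ} (hM : I.n * I.m ≤ mc.M) (hX : 4 * I.Y + I.W + 1 ≤ mc.X) (hmM : I.m ≤ mc.M)
    (hmX : I.m ≤ mc.X) {c : ℕ} (h45 : σ.reg 45 = c + 1) (hcP : c % P * I.L + I.L ≤ mc.X)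
    (hmk : ∀ k, σ.arr 9 k = if k ∈ S then 1 else 0) {seen : ℕ → Prop} (hb : Best I i j S seen σ) :
    Run mc scanChunk σ (I.L * 521 + 58)
      (Best I i j S fun k => seen k ∨ k < I.m ∧ k / I.L = c % P) := by
  have hL := I.hL
  obtain ⟨x, hx⟩ : ∃ x, x = c % P * I.L := ⟨_, rfl⟩
  rw [← hx] at hcP
  refine Run.asg_seq (x : ℤ) (abs_cast_le (by omega)) ?_ ?_
  · simp only [Ex.eval_mul, Ex.eval_sub, Ex.eval_div, Ex.eval_r, Ex.eval_one, h45, h.r10, h.env.r4,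
      add_sub_cancel_right, sub_div_mul, hx]
    push_cast; rfl
  refine Run.forC I.L 510 (fun t => Best I i j S fun k => seen k ∨ k < I.m ∧ x ≤ k ∧ k < x + t)
    (by simp [h.env.r4]) (hb.congr (by simp) (by simp) (by simp) (by
      rintro k (hh | hh); exacts [hh, by omega])) ?_ ?_ (by omega)
  · intro t ht σ1 I1 r23 fr1 g1
    have h1 := (h.set 48 x).fr fr1
    refine Run.asg_seq ((x + t : ℕ) : ℤ) (abs_cast_le (by omega))
      (by simp [fr1.r 48, r23]) ?_
    refine Run.iteB (fun hc => ?_) (fun hc => ?_)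
    · have hlt : x + t < I.m := by
        simp [h1.env.r1] at hc; omega
      refine Run.mono (candidate_run (mc := mc) (h1.set 22 _) hi hj hlt (by simp) hM hX hmM hmX
        (S := S) (by simpa [fr1.a 9] using hmk) (I1.congr (by simp) (by simp) (by simp)
          (fun _ => id))) (by omega) fun σ2 h2 => ?_
      refine h2.congr (by simp) (by simp) (by simp) fun k hk => ?_
      by_cases hkx : k = x + t
      · exact Or.inr hkx
      · exact Or.inl (hk.imp id fun hh => by omega)
    · have hlt : ¬ x + t < I.m := by
        simp [h1.env.r1] at hc; omega
      refine Run.skip_last (I1.congr (by simp) (by simp) (by simp) fun k hk => ?_)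
      exact hk.imp id fun hh => by omega
  · intro σ1 I1 _ _ _
    refine I1.congr rfl rfl rfl fun k hk => hk.imp id fun hh => ⟨hh.1, ?_, ?_⟩
    · have := Nat.div_mul_le_self k I.L
      rw [hh.2, ← hx] at this; exact this
    · have := Nat.lt_div_mul_add (a := k) hL
      rw [hh.2, ← hx] at this; exact this

lemma Ready.fr {LS : ℕ} {σ σ' : State} {s : Stmt} (h : Ready I P LS win σ) (hf : Fr s σ σ')
    (z9 : ∀ a, σ'.arr 9 a = 0) (z10 : ∀ a, σ'.arr 10 a = 0) (hs : s.safe = true := by rfl)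
    (h10 : s.wrR 10 = false := by rfl) (h11 : s.wrR 11 = false := by rfl)
    (h12 : s.wrR 12 = false := by rfl) (a3 : s.wrA 3 = false := by rfl)
    (a4 : s.wrA 4 = false := by rfl) (a5 : s.wrA 5 = false := by rfl)
    (a7 : s.wrA 7 = false := by rfl) (a8 : s.wrA 8 = false := by rfl) : Ready I P LS win σ' := by
  refine ⟨h.env.fr hf hs, by rw [hf.r 10 h10, h.r10], by rw [hf.r 11 h11, h.r11],
    by rw [hf.r 12 h12, h.r12], z9, z10, fun i hi J hJ => (h.thr i hi J hJ).congr ?_ ?_ ?_, ?_, ?_⟩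
  · rw [hf.a 3 a3]
  · rw [hf.a 4 a4]
  · intro t _; rw [hf.a 5 a5]
  · rw [hf.a 3 a3, hf.a 7 a7, hf.a 8 a8]; exact h.lst
  · rw [hf.a 3 a3]; exact h.mode

lemma query_run {LS : ℕ} {σ : State} (hR : Ready I P LS win σ) (hi : i < I.n) (hj : j < I.n)
    (hsm : I.Smooth)
    (hP : ∀ k < I.m, k / I.L < P) (hwin : -1 ≤ win) {S : List ℕ} (hS : S.Nodup)
    (hSm : ∀ k ∈ S, k < I.m) (hSL : S.length < I.L) (hex : ∃ k < I.m, k ∉ S)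
    (h5 : σ.reg 5 = i) (h6 : σ.reg 6 = j) (h7 : σ.reg 7 = S.length)
    (h2 : ∀ t (ht : t < S.length), σ.arr 2 t = S[t])
    (hM : I.n * I.nb * I.m ≤ mc.M) (hM' : I.n * I.m ≤ mc.M) (hM7 : I.n * I.n * LS ≤ mc.M)
    (hX7 : I.n * I.n * LS ≤ mc.X) (hX : 4 * I.Y + I.W + 1 ≤ mc.X) (hmX : 3 * I.m + 1 ≤ mc.X)
    (hnX : I.n * I.nb ≤ mc.X) (hPX : P * I.L ≤ mc.X)
    (hwM : (win + 1) * P ≤ mc.M) (hwX : (win + 1) * P ≤ mc.X) :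
    Run mc query σ (3500 * I.L) fun σ' => Ready I P LS win σ' ∧
      ∃ k < I.m, σ'.reg 8 = k ∧ k ∉ S ∧ ∀ k' < I.m, k' ∉ S → I.tot i j k ≤ I.tot i j k' := by
  have hn := I.hn
  have hm := I.hm
  have hnb := I.one_le_nb
  have hJ := I.div_lt_nb hj
  have hcell := mul_add_lt hi hJ
  have hnn : I.n ≤ I.n * I.nb := Nat.le_mul_of_pos_right _ hnb
  have hnm : I.n * I.nb ≤ I.n * I.nb * I.m := Nat.le_mul_of_pos_right _ hm
  have hmM : I.m ≤ mc.M := (Nat.le_mul_of_pos_left _ hn).trans hM'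
  have hlenm : S.length ≤ I.m := by
    rw [← List.toFinset_card_of_nodup hS]
    refine (Finset.card_le_card (t := Finset.range I.m) fun k hk => ?_).trans (by simp)
    exact Finset.mem_range.2 (hSm k (List.mem_toFinset.1 hk))
  obtain ⟨vb, e, he, hthr⟩ := hR.thr i hi _ hJ
  obtain ⟨ls, hlsl, hls⟩ := hR.lst i hi j hj
  have hmode := hR.mode.imp id fun hh => hh i hi _ hJ
  obtain ⟨x, hx⟩ : ∃ x, x = i * I.nb + j / I.Δ := ⟨_, rfl⟩
  rw [← hx] at vb he hthr hls hmode hcell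
  obtain ⟨v, hv⟩ : ∃ v, v = σ.arr 3 x := ⟨_, rfl⟩
  rw [← hv] at vb hthr hls hmode
  obtain ⟨base, hbase⟩ : ∃ base, base = (i * I.n + j) * LS := ⟨_, rfl⟩
  rw [← hbase] at hls
  have hbLS : base + LS ≤ I.n * I.n * LS := by
    have := Nat.mul_le_mul_right LS (Nat.succ_le_of_lt (mul_add_lt hi hj))
    rw [Nat.succ_eq_add_one, add_mul, ← hbase] at this; omega
  have hEm := hthr.le
  have hEL := hthr.lt
  refine Run.frame (Q := fun σ' => ((∀ a, σ'.arr 9 a = 0) ∧ ∀ a, σ'.arr 10 a = 0) ∧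
    ∃ k < I.m, σ'.reg 8 = k ∧ k ∉ S ∧ ∀ k' < I.m, k' ∉ S → I.tot i j k ≤ I.tot i j k') ?_ |>.post
    fun σ' hh => ⟨hR.fr hh.2.1 hh.1.1.1 hh.1.1.2, hh.1.2⟩
  refine Run.asg_seq (i : ℤ) (abs_cast_le (by omega)) (by simp [h5]) ?_
  refine Run.asg_seq (j : ℤ) (abs_cast_le (by omega)) (by simp [h6]) ?_
  refine Run.asg_seq (x : ℤ) (abs_cast_le (by omega))
    (by simp [h5, h6, hR.env.r9, hR.env.r2, hx]) ?_
  refine Run.asg_seq v (by omega) (by simp [hv]) ?_ (by simp; omega)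
  obtain ⟨σ0, hσ0⟩ : ∃ σ0, σ0 = (((σ.setReg 20 i).setReg 25 j).setReg 40 x).setReg 24 v := ⟨_, rfl⟩
  rw [← hσ0]
  have loc0 : Loc I P win v i j σ0 := by
    rw [hσ0]
    exact ⟨(((hR.env.set 20 _).set 25 _).set 40 _).set 24 _, by simp [hR.r10], by simp [hR.r11],
      by simp, by simp, by simp⟩
  have arr0 : σ0.arr = σ.arr := by rw [hσ0]; rfl
  have reg0 : ∀ y, y < 20 → σ0.reg y = σ.reg y := by
    intro y hy
    rw [hσ0]; simp only [State.reg_setReg]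
    rw [if_neg (by omega), if_neg (by omega), if_neg (by omega), if_neg (by omega)]
  have r40 : σ0.reg 40 = x := by rw [hσ0]; simp
  clear hσ0
  refine Run.seqB _ (mark_run loc0 hi hj hP hwin vb hM' hX hmM (by omega) hwM hwX
    hSm (by rw [reg0 7 (by norm_num), h7]) (by rw [arr0]; exact h2) (by rw [arr0]; exact hR.z9)
    (by rw [arr0]; exact hR.z10) hlenm) ?_
  intro σ1 mk1 fr1 g1
  have loc1 := loc0.fr fr1
  refine Run.asg_seq 0 (by simp) rfl ?_
  refine Run.asg_seq (e : ℤ) (abs_cast_le (by omega))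
    (by simp [fr1.r 40, r40, fr1.a 4, arr0, he]) ?_ (by simp [fr1.r 40, r40]; omega)
  refine Run.forC_seq e 400 (fun t => Best I i j S fun k => ∃ t' < t, σ.arr 5 (x * I.m + t') = k)
    (by simp) (Or.inl ⟨by simp, by simp⟩) ?_ ?_
  · intro t ht σ2 I2 r23 fr2 g2
    have loc2 := ((loc1.set 41 0).set 43 e).fr fr2
    obtain ⟨k, hk, hEk⟩ := hthr.entry t ht
    have r40' : σ2.reg 40 = x := by rw [fr2.r 40]; simp [fr1.r 40, r40]
    have a5 : σ2.arr 5 = σ.arr 5 := by rw [fr2.a 5]; simp [fr1.a 5, arr0]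
    have hlt5 := mul_add_lt hcell (show t < I.m by omega)
    refine Run.asg_seq (k : ℤ) (abs_cast_le (by omega)) ?_ ?_ ?_
    · simp only [Ex.eval_ld, Ex.eval_add, Ex.eval_mul, Ex.eval_r, r40', loc2.env.r1, r23, a5]
      rw [← hEk]; norm_cast
    swap
    · simp only [Ex.ok_ld, Ex.ok_add, Ex.ok_mul, Ex.ok_r, Ex.eval_add, Ex.eval_mul, Ex.eval_r, r40',
        loc2.env.r1, r23, true_and]
      exact ⟨by positivity, by exact_mod_cast hlt5.trans_le hM⟩
    refine Run.mono (candidate_run (mc := mc) (loc2.set 22 _) hi hj hk (by simp) hM' hX hmM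
      (by omega) (S := S) (by simpa [fr2.a 9] using mk1.1) (I2.congr (by simp) (by simp) (by simp)
          (fun _ => id))) (by omega) fun σ3 h3 => ?_
    refine h3.congr (by simp) (by simp) (by simp) ?_
    rintro k' ⟨t', ht', hk'⟩
    rcases (by omega : t' < t ∨ t' = t) with hh | rfl
    · exact Or.inl ⟨t', hh, hk'⟩
    · right
      have : (k' : ℤ) = k := by rw [← hk', ← hEk]
      exact_mod_cast this
  intro σ2 best2 fr2 g2
  have loc2 := ((loc1.set 41 0).set 43 e).fr fr2
  have mk2 : Marked I P win v i j S σ2 := by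
    refine ⟨?_, ?_⟩
    · rw [fr2.a 9]; simpa using mk1.1
    · rw [fr2.a 10]; simpa using mk1.2
  have q2 : ∀ y ∈ [5, 6, 7, 12], σ2.reg y = σ.reg y := by
    intro y hy
    have e0 := reg0 y (by fin_cases hy <;> norm_num)
    rw [← e0]
    fin_cases hy
    · rw [fr2.r 5]; simp [fr1.r 5]
    · rw [fr2.r 6]; simp [fr1.r 6]
    · rw [fr2.r 7]; simp [fr1.r 7]
    · rw [fr2.r 12]; simp [fr1.r 12]
  have b2 : ∀ y ∈ [2, 7, 8], σ2.arr y = σ.arr y := by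
    intro y hy
    rw [← arr0]
    fin_cases hy
    · rw [fr2.a 2]; simp [fr1.a 2]
    · rw [fr2.a 7]; simp [fr1.a 7]
    · rw [fr2.a 8]; simp [fr1.a 8]
  refine Run.asg_seq (base : ℤ) (abs_cast_le (by omega)) (by
    simp [q2 5 (by simp), q2 6 (by simp), q2 12 (by simp), h5, h6, hR.r12, loc2.env.r0, hbase]) ?_
  have mk2' : Marked I P win v i j S (σ2.setReg 44 base) := mk2
  have hls2 : ListAt I P win v base ((σ2.setReg 44 base).arr 7) ((σ2.setReg 44 base).arr 8) i j ls := by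
    rw [State.arr_setReg, b2 7 (by simp), b2 8 (by simp)]; exact hls
  have hslX : 2 * I.m + S.length + 1 ≤ mc.X := by omega
  refine Run.seqB 160 (R := fun σ' : State => (∀ h : 0 < ls.length, σ'.reg 45 = ls[0] + 1) ∧
      (0 = ls.length → σ'.reg 45 = 0) ∧
      (0 < σ'.reg 46 ↔ ∃ h : 0 < ls.length, I.num P win v i j ls[0] ≤
        S.countP (fun k => decide (I.At P win v i j ls[0] k)))) (Run.good fun hg =>
    testEntry_run hls2 (Nat.zero_le _) (by simp) mk2' (by omega) hP hwM hslX le_rfl hg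
      fun σ' t1 t2 t3 => ⟨t1, t2, t3⟩) ?_
  rintro σ3 ⟨t1, t2, t3⟩ fr3 g3
  have r44 : σ3.reg 44 = base := by rw [fr3.r 44]; simp
  have pass : ∀ {a}, a ≤ ls.length → (∀ b (h : b < ls.length), b < a →
      I.num P win v i j ls[b] ≤ S.countP (fun k => decide (I.At P win v i j ls[b] k))) →
      a ≤ S.length := passed_le hls.2.2.2.1 fun s hs => (hls.2.2.2.2 s).1 hs
  refine Run.whl_seq S.length 210 (fun f (σ' : State) => ∃ a ≤ ls.length, a + f = S.length ∧
    σ'.reg 44 = (base + a : ℕ) ∧ (∀ b (h : b < ls.length), b < a →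
      I.num P win v i j ls[b] ≤ S.countP (fun k => decide (I.At P win v i j ls[b] k))) ∧
    (∀ h : a < ls.length, σ'.reg 45 = ls[a] + 1) ∧ (a = ls.length → σ'.reg 45 = 0) ∧
    (0 < σ'.reg 46 ↔ ∃ h : a < ls.length, I.num P win v i j ls[a] ≤
        S.countP (fun k => decide (I.At P win v i j ls[a] k))))
    ⟨0, Nat.zero_le _, by simp, by simp [r44], by simp, t1, t2, t3⟩
    (fun _ _ _ _ _ => by simp) ?_ ?_
  · rintro f σ4 ⟨a, ha, haf, s44, hp, u1, u2, u3⟩ fr4 g4 hc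
    obtain ⟨hlt, hle⟩ := u3.1 (by simpa using hc)
    have hp' : ∀ b (h : b < ls.length), b < a + 1 →
      I.num P win v i j ls[b] ≤ S.countP (fun k => decide (I.At P win v i j ls[b] k)) := by
      intro b hb hba
      rcases (by omega : b < a ∨ b = a) with hh | rfl
      · exact hp b hb hh
      · exact hle
    have haS := pass hlt hp'
    refine ⟨f - 1, by omega, ?_⟩
    refine Run.asg_seq ((base + (a + 1) : ℕ) : ℤ) (abs_cast_le (by omega))
      (by simp [s44]; ring) ?_
    have hls4 : ListAt I P win v base ((σ4.setReg 44 ((base + (a + 1) : ℕ) : ℤ)).arr 7)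
        ((σ4.setReg 44 ((base + (a + 1) : ℕ) : ℤ)).arr 8) i j ls := by
      rw [State.arr_setReg, fr4.a 7, fr4.a 8, fr3.a 7, fr3.a 8]; exact hls2
    have mk4 : Marked I P win v i j S (σ4.setReg 44 ((base + (a + 1) : ℕ) : ℤ)) := by
      refine ⟨?_, ?_⟩
      · rw [State.arr_setReg, fr4.a 9, fr3.a 9]; exact mk2'.1
      · rw [State.arr_setReg, fr4.a 10, fr3.a 10]; exact mk2'.2
    refine Run.good fun hg => (Run.frame (testEntry_run (T := 160) hls4 hlt (by simp) mk4 (by omega)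
      hP hwM hslX le_rfl hg fun σ' t1 t2 t3 => And.intro t1 (And.intro t2 t3))).mono (by omega) ?_
    rintro σ5 ⟨⟨v1, v2, v3⟩, fr5, g5⟩
    exact ⟨a + 1, hlt, by omega, by rw [fr5.r 44]; simp, hp', v1, v2, v3⟩
  · rintro f σ4 ⟨a, ha, haf, s44, hp, u1, u2, u3⟩ hc fr4 g4
    have loc4 : Loc I P win v i j σ4 := ((loc2.set 44 _).fr fr3).fr fr4
    have mk4 : Marked I P win v i j S σ4 := by
      refine ⟨?_, ?_⟩
      · rw [fr4.a 9, fr3.a 9]; exact mk2'.1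
      · rw [fr4.a 10, fr3.a 10]; exact mk2'.2
    have best4 := best2.congr (σ' := σ4) (by rw [fr4.r 41, fr3.r 41]; simp)
      (by rw [fr4.r 42, fr3.r 42]; simp) (by rw [fr4.r 8, fr3.r 8]; simp) (fun k => id)
    have hlast : ∀ h : a < ls.length,
      S.countP (fun k => decide (I.At P win v i j ls[a] k)) < I.num P win v i j ls[a] := by
      intro h
      by_contra hle
      exact hc (by simpa using u3.2 ⟨h, by omega⟩)
    obtain ⟨seen, hseen⟩ : ∃ seen : ℕ → Prop, seen = fun (k : ℕ) =>
      (∃ t' < e, σ.arr 5 (x * I.m + t') = (k : ℤ)) ∨ ∃ h : a < ls.length, k < I.m ∧ k / I.L = ls[a] % P :=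
      ⟨_, rfl⟩
    refine Run.ite_seq (Best I i j S seen) (I.L * 521 + 58) (fun hc => ?_) (fun hc => ?_) ?_
    · have hlt : a < ls.length := by
        by_contra hh
        have := u2 (by omega)
        simp [this] at hc
      have hcP : ls[a] % P * I.L + I.L ≤ mc.X := by
        have hP1 : 0 < P := by
          obtain ⟨k, hk, -⟩ := hex
          exact (Nat.zero_le _).trans_lt (hP k hk)
        have := Nat.mul_le_mul_right I.L (Nat.succ_le_of_lt (Nat.mod_lt ls[a] hP1))
        rw [Nat.succ_eq_add_one, add_mul, one_mul] at this
        omega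
      refine (scanChunk_run loc4 hi hj hM' hX hmM (by omega) (u1 hlt) hcP mk4.1 best4).post
        fun σ' hb => hb.congr rfl rfl rfl fun k hk => ?_
      rw [hseen] at hk
      rcases hk with hk | ⟨_, hk⟩
      · exact Or.inl hk
      · exact Or.inr hk
    · refine Run.skip_last (best4.congr rfl rfl rfl fun k hk => ?_)
      rw [hseen] at hk
      rcases hk with hk | ⟨h, hk⟩
      · exact hk
      · rw [Ex.eval_r, u1 h] at hc; omega
    · intro σ5 best5 fr5 g5
      have q5 : σ5.reg 7 = S.length := by
        rw [fr5.r 7, fr4.r 7, fr3.r 7]; simp [q2 7 (by simp), h7]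
      have b5 : σ5.arr 2 = σ.arr 2 := by
        rw [fr5.a 2, fr4.a 2, fr3.a 2]; simp [b2 2 (by simp)]
      refine Run.mono (Run.frame (unmark_run (loc4.fr fr5) hi hj hP hwin vb hM' hX hmM (by omega)
        hwM hwX hSm q5 (by rw [b5]; exact h2) ⟨by rw [fr5.a 9]; exact mk4.1,
          by rw [fr5.a 10]; exact mk4.2⟩ hlenm)) ?_ ?_
      · have := hSL.le
        omega
      · rintro σ6 ⟨hz, fr6, g6⟩
        refine ⟨hz, ?_⟩
        have best6 := best5.congr (σ' := σ6) (fr6.r 41) (fr6.r 42) (fr6.r 8) fun k => id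
        have ex : ∀ k' < I.m, k' ∉ S → ∃ k, seen k ∧ k ∉ S ∧ I.tot i j k ≤ I.tot i j k' :=
          fun k' hk' hkS' => exists_seen hsm hi hj hP hthr hmode hS hSm hSL hls.2.2.2.1
            hls.2.2.2.2 hp hlast (fun t ht k hk => by rw [hseen]; exact Or.inl ⟨t, ht, hk⟩)
            (fun h k hk hkP => by rw [hseen]; exact Or.inr ⟨h, hk, hkP⟩) hk' hkS'
        obtain ⟨k0, hk0, hk0S⟩ := hex
        rcases best6 with ⟨-, hall⟩ | ⟨-, k, hk, h8, -, hkS, hmin⟩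
        · obtain ⟨k, h1, h2, -⟩ := ex k0 hk0 hk0S
          exact absurd (hall k h1) h2
        · refine ⟨k, hk, h8, hkS, fun k' hk' hkS' => ?_⟩
          obtain ⟨k2, h1, h2, h3⟩ := ex k' hk' hkS'
          exact (hmin k2 h1 h2).trans h3

end


/-! ## Counting by evaluation and interpolation -/

/-- The monomial whose exponents are the digits of `a` at the point whose coordinates are the
digits of `x`. -/
def monom (B D : ℕ) : ℕ → ℕ → ℕ → ℕ
  | 0, _, _ => 1
  | r + 1, x, a => (x % B) ^ (a % D) * monom B D r (x / B) (a / D)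

/-- The number whose digits to base `B` are the digitwise sums of `a` and `b`. -/
def enc (B D : ℕ) : ℕ → ℕ → ℕ → ℕ
  | 0, _, _ => 0
  | r + 1, a, b => (a % D + b % D) + B * enc B D r (a / D) (b / D)

/-- Reading digits to base `B` as digits to base `D`. -/
def dec (B D : ℕ) : ℕ → ℕ → ℕ
  | 0, _ => 0
  | r + 1, y => y % B + D * dec B D r (y / B)

section digits

variable {B D : ℕ}

lemma monom_le (hB : 1 ≤ B) (hD : 1 ≤ D) (r : ℕ) : ∀ x a, monom B D r x a ≤ (B ^ r) ^ D := by
  induction r with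
  | zero => intro x a; simp [monom]
  | succ r ih =>
    intro x a
    have h1 : (x % B) ^ (a % D) ≤ B ^ D :=
      (Nat.pow_le_pow_left (Nat.mod_lt _ hB).le _).trans
        (Nat.pow_le_pow_right hB (Nat.mod_lt _ hD).le)
    calc monom B D (r + 1) x a ≤ B ^ D * (B ^ r) ^ D := Nat.mul_le_mul h1 (ih _ _)
      _ = (B ^ (r + 1)) ^ D := by rw [← mul_pow, pow_succ, mul_comm]

lemma monom_add_mul (hB : 1 ≤ B) (t : ℕ) : ∀ {r : ℕ}, t ≤ r → ∀ c z a,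
    monom B D t (c * B ^ r + z) a = monom B D t z a := by
  induction t with
  | zero => intros; rfl
  | succ t ih =>
    intro r hr c z a
    obtain ⟨r, rfl⟩ : ∃ r', r = r' + 1 := ⟨r - 1, by omega⟩
    have e : c * B ^ (r + 1) + z = z + (c * B ^ r) * B := by rw [pow_succ]; ring
    rw [monom, monom, e, Nat.add_mul_mod_self_right, Nat.add_mul_div_right _ _ hB,
      add_comm (z / B), ih (by omega)]

lemma enc_succ (t : ℕ) : ∀ a b, enc B D (t + 1) a b =
    B ^ t * ((a / D ^ t) % D + (b / D ^ t) % D) + enc B D t a b := by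
  induction t with
  | zero => intro a b; simp [enc]
  | succ t ih =>
    intro a b
    rw [enc, ih, enc, Nat.div_div_eq_div_mul, Nat.div_div_eq_div_mul, ← pow_succ']
    ring

lemma enc_lt (hBD : 2 * D ≤ B + 1) (hD : 1 ≤ D) (t : ℕ) (a b : ℕ) : enc B D t a b < B ^ t := by
  induction t with
  | zero => simp [enc]
  | succ t ih =>
    rw [enc_succ]
    have h1 := Nat.mod_lt (a / D ^ t) hD
    have h2 := Nat.mod_lt (b / D ^ t) hD
    calc _ < B ^ t * ((a / D ^ t) % D + (b / D ^ t) % D) + B ^ t := by omega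
      _ = B ^ t * ((a / D ^ t) % D + (b / D ^ t) % D + 1) := by ring
      _ ≤ B ^ t * B := Nat.mul_le_mul_left _ (by omega)
      _ = B ^ (t + 1) := (pow_succ _ _).symm

lemma dec_enc (hBD : 2 * D ≤ B + 1) (hD : 1 ≤ D) (r : ℕ) : ∀ a b, a < D ^ r → b < D ^ r →
    dec B D r (enc B D r a b) = a + b := by
  induction r with
  | zero => intro a b ha hb; simp at ha hb; simp [dec, ha, hb]
  | succ r ih =>
    intro a b ha hb
    have h1 := Nat.mod_lt a hD
    have h2 := Nat.mod_lt b hD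
    have hB : 0 < B := by omega
    rw [pow_succ] at ha hb
    rw [dec, enc, Nat.add_mul_mod_self_left, Nat.mod_eq_of_lt (by omega),
      Nat.add_mul_div_left _ _ hB, Nat.div_eq_of_lt (by omega : a % D + b % D < B), zero_add,
      ih _ _ (Nat.div_lt_of_lt_mul (by rwa [mul_comm])) (Nat.div_lt_of_lt_mul (by rwa [mul_comm]))]
    have := Nat.mod_add_div a D
    have := Nat.mod_add_div b D
    rw [mul_add]; omega

/-- The data during the interpolation, after `t` of `r` variables have been treated: the first `t`
digits of the code are exponents, the remaining ones still are coordinates of points. -/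
def stage (B D r : ℕ) (S : Finset ℕ) (a b : ℕ → ℕ) (t y : ℕ) : ℤ :=
  ∑ k ∈ S, if y / B ^ (r - t) = enc B D t (a k) (b k) then
    ((monom B D (r - t) y (a k / D ^ t) * monom B D (r - t) y (b k / D ^ t) : ℕ) : ℤ) else 0

variable {r : ℕ} {S : Finset ℕ} {a b : ℕ → ℕ}

lemma stage_zero {y : ℕ} (hy : y < B ^ r) :
    stage B D r S a b 0 y = ∑ k ∈ S, ((monom B D r y (a k) * monom B D r y (b k) : ℕ) : ℤ) := by
  simp [stage, enc, Nat.div_eq_of_lt hy]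

lemma abs_stage_le (hB : 1 ≤ B) (hD : 1 ≤ D) (t y : ℕ) :
    |stage B D r S a b t y| ≤ (S.card * ((B ^ r) ^ D * (B ^ r) ^ D) : ℕ) := by
  refine (Finset.abs_sum_le_sum_abs _ _).trans ?_
  have hp : (B ^ (r - t)) ^ D ≤ (B ^ r) ^ D :=
    Nat.pow_le_pow_left (Nat.pow_le_pow_right hB (by omega)) _
  refine (Finset.sum_le_card_nsmul S _ (((B ^ r) ^ D * (B ^ r) ^ D : ℕ) : ℤ) fun k _ => ?_).trans
    (by simp)
  split_ifs
  · rw [Nat.abs_cast]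
    exact_mod_cast Nat.mul_le_mul ((monom_le hB hD _ _ _).trans hp) ((monom_le hB hD _ _ _).trans hp)
  · rw [abs_zero]; positivity

lemma stage_succ (hBD : 2 * D ≤ B + 1) (hD : 1 ≤ D) {V : ℕ → ℕ → ℤ} {d : ℤ}
    (hV : ∀ c < B, ∀ e < B, ∑ x ∈ Finset.range B, V c x * (x : ℤ) ^ e = if c = e then d else 0)
    {t c z : ℕ} (ht : t < r) (hc : c < B)
    (hz : z < B ^ (r - 1)) : ∑ x ∈ Finset.range B, V c x * stage B D r S a b t (z * B + x) =
      d * stage B D r S a b (t + 1) (c * B ^ (r - 1) + z) := by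
  have hB : 0 < B := by omega
  simp only [stage, Finset.mul_sum]
  rw [Finset.sum_comm]
  refine Finset.sum_congr rfl fun k _ => ?_
  obtain ⟨u, hu⟩ : ∃ u, r = t + u + 1 := ⟨r - t - 1, by omega⟩
  subst hu
  have e1 : t + u + 1 - t = u + 1 := by omega
  have e2 : t + u + 1 - (t + 1) = u := by omega
  have e3 : t + u + 1 - 1 = t + u := by omega
  rw [e2, e3]
  have h1 : ∀ x ∈ Finset.range B, (z * B + x) / B ^ (t + u + 1 - t) = z / B ^ u := by
    intro x hx
    rw [e1, pow_succ', ← Nat.div_div_eq_div_mul, add_comm, Nat.add_mul_div_right _ _ hB,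
      Nat.div_eq_of_lt (Finset.mem_range.1 hx), zero_add]
  have h2 : ∀ x ∈ Finset.range B, ∀ α, monom B D (t + u + 1 - t) (z * B + x) α =
      x ^ (α % D) * monom B D u z (α / D) := by
    intro x hx α
    rw [e1, monom, add_comm, Nat.add_mul_mod_self_right, Nat.add_mul_div_right _ _ hB,
      Nat.div_eq_of_lt (Finset.mem_range.1 hx), zero_add, Nat.mod_eq_of_lt (Finset.mem_range.1 hx)]
  have h3 : (c * B ^ (t + u) + z) / B ^ u = c * B ^ t + z / B ^ u := by
    rw [pow_add, ← mul_assoc, add_comm, Nat.add_mul_div_right _ _ (by positivity), add_comm]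
  have h4 : ∀ α, α / D ^ t / D = α / D ^ (t + 1) := fun α => by
    rw [Nat.div_div_eq_div_mul, ← pow_succ]
  rw [h3, monom_add_mul hB u (by omega), monom_add_mul hB u (by omega), enc_succ]
  set α := a k / D ^ t
  set β := b k / D ^ t
  have hα := Nat.mod_lt α hD
  have hβ := Nat.mod_lt β hD
  have hL : ∀ x ∈ Finset.range B, (V c x * if (z * B + x) / B ^ (t + u + 1 - t) =
      enc B D t (a k) (b k) then ((monom B D (t + u + 1 - t) (z * B + x) α *
        monom B D (t + u + 1 - t) (z * B + x) β : ℕ) : ℤ) else 0) =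
      (V c x * (x : ℤ) ^ (α % D + β % D)) * if z / B ^ u = enc B D t (a k) (b k) then
        ((monom B D u z (a k / D ^ (t + 1)) * monom B D u z (b k / D ^ (t + 1)) : ℕ) : ℤ)
        else 0 := by
    intro x hx
    rw [h1 x hx, h2 x hx, h2 x hx, h4, h4]
    split_ifs
    · push_cast; ring
    · ring
  rw [Finset.sum_congr rfl hL, ← Finset.sum_mul, hV c hc _ (by omega)]
  have hEt := enc_lt hBD hD t (a k) (b k)
  have hz' : z / B ^ u < B ^ t := by
    rw [e3, pow_add] at hz
    exact Nat.div_lt_of_lt_mul (by rwa [mul_comm])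
  by_cases hce : c = α % D + β % D
  · rw [if_pos hce]
    congr 1
    have : (c * B ^ t + z / B ^ u = B ^ t * (α % D + β % D) + enc B D t (a k) (b k)) ↔
        z / B ^ u = enc B D t (a k) (b k) := by
      rw [← hce, mul_comm]; omega
    simp only [this]
  · rw [if_neg hce, zero_mul, if_neg, mul_zero]
    rw [mul_comm (B ^ t), mul_add_inj hz' hEt]
    exact fun h => hce h.1

lemma sum_stage (hBD : 2 * D ≤ B + 1) (hD : 1 ≤ D) (ha : ∀ k ∈ S, a k < D ^ r)
    (hb : ∀ k ∈ S, b k < D ^ r) (q u : ℕ) :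
    ∑ y ∈ Finset.range (B ^ r), (if dec B D r y % q = u then stage B D r S a b r y else 0) =
      (S.filter fun k => (a k + b k) % q = u).card := by
  simp only [stage, Nat.sub_self, pow_zero, Nat.div_one, monom, mul_one, Nat.cast_one]
  rw [Finset.card_filter]
  push_cast
  have : ∀ y ∈ Finset.range (B ^ r), (if dec B D r y % q = u then
      ∑ k ∈ S, (if y = enc B D r (a k) (b k) then (1 : ℤ) else 0) else 0) =
      ∑ k ∈ S, if y = enc B D r (a k) (b k) then
        (if (a k + b k) % q = u then (1 : ℤ) else 0) else 0 := by
    intro y _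
    split_ifs with h
    · refine Finset.sum_congr rfl fun k hk => ?_
      split_ifs with h1 h2
      · rfl
      · rw [h1, dec_enc hBD hD r _ _ (ha k hk) (hb k hk)] at h; exact absurd h h2
      · rfl
    · refine (Finset.sum_eq_zero fun k hk => ?_).symm
      split_ifs with h1 h2
      · rw [h1, dec_enc hBD hD r _ _ (ha k hk) (hb k hk)] at h; exact absurd h2 h
      · rfl
      · rfl
  rw [Finset.sum_congr rfl this, Finset.sum_comm]
  refine Finset.sum_congr rfl fun k hk => ?_
  rw [Finset.sum_ite_eq', if_pos (Finset.mem_range.2 (enc_lt hBD hD r _ _))]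

/-- Interpolation at the points `0, …, B - 1` with integer coefficients and a common
denominator. -/
lemma exists_interpolation (B : ℕ) : ∃ (V : ℕ → ℕ → ℤ) (d : ℤ), d ≠ 0 ∧
    ∀ c < B, ∀ e < B, ∑ x ∈ Finset.range B, V c x * (x : ℤ) ^ e = if c = e then d else 0 := by
  set M : Matrix (Fin B) (Fin B) ℤ := Matrix.vandermonde fun x : Fin B => ((x : ℕ) : ℤ) with hM
  refine ⟨fun c x => if h : c < B ∧ x < B then M.adjugate ⟨c, h.1⟩ ⟨x, h.2⟩ else 0, M.det, ?_, ?_⟩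
  · rw [hM, Matrix.det_vandermonde_ne_zero_iff]
    intro x y h
    simpa [Fin.ext_iff] using h
  · intro c hc e he
    have := congrFun (congrFun (Matrix.adjugate_mul M) ⟨c, hc⟩) ⟨e, he⟩
    rw [Matrix.mul_apply, Matrix.smul_apply, Matrix.one_apply, smul_eq_mul] at this
    rw [Finset.sum_range]
    simpa [hc, hM, Matrix.vandermonde_apply, Fin.ext_iff] using this

end digits


/-- The storage contains the data for evaluation and interpolation on a grid: base `D` of the
exponents, base `B` of the points, `r` digits, memory size `Z` for the multiplication program, the
modulus, and tables of interpolation coefficients and of powers. -/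
structure Grid (I : Inst) (B D r Z q : ℕ) (V : ℕ → ℕ → ℤ) (d : ℤ) (σ : State) : Prop where
  env : Env I σ
  r10 : σ.reg 10 = I.P
  r13 : σ.reg 13 = q
  r40 : σ.reg 40 = D
  r41 : σ.reg 41 = B
  r42 : σ.reg 42 = d
  r43 : σ.reg 43 = r
  r44 : σ.reg 44 = (B ^ r : ℕ)
  r45 : σ.reg 45 = (B ^ (r - 1) : ℕ)
  r46 : σ.reg 46 = Z
  r47 : σ.reg 47 = (I.n * I.m : ℕ)
  r48 : σ.reg 48 = (I.n * I.n : ℕ)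
  a13 : ∀ c < B, ∀ x < B, σ.arr 13 (c * B + x) = V c x
  a14 : ∀ x < B, ∀ e < D, σ.arr 14 (x * D + e) = (x ^ e : ℕ)

/-- The statement does not overwrite the grid data. -/
def Stmt.safeG (s : Stmt) : Bool :=
  s.safe && !(s.wrR 10 || s.wrR 13 || s.wrR 40 || s.wrR 41 || s.wrR 42 || s.wrR 43 || s.wrR 44 ||
    s.wrR 45 || s.wrR 46 || s.wrR 47 || s.wrR 48 || s.wrA 13 || s.wrA 14)

section
variable {I : Inst} {B D r Z q : ℕ} {V : ℕ → ℕ → ℤ} {d : ℤ} {σ : State}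

lemma Grid.fr {s : Stmt} {σ' : State} (h : Grid I B D r Z q V d σ) (hf : Fr s σ σ')
    (hs : s.safeG = true := by rfl) : Grid I B D r Z q V d σ' := by
  simp only [Stmt.safeG, Bool.and_eq_true, Bool.not_eq_true', Bool.or_eq_false_iff] at hs
  obtain ⟨h0, ⟨⟨⟨⟨⟨⟨⟨⟨⟨⟨⟨⟨h10, h13⟩, h40⟩, h41⟩, h42⟩, h43⟩, h44⟩, h45⟩, h46⟩, h47⟩, h48⟩, b13⟩, b14⟩⟩ := hs
  exact ⟨h.env.fr hf h0, by rw [hf.r 10 h10, h.r10], by rw [hf.r 13 h13, h.r13],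
    by rw [hf.r 40 h40, h.r40], by rw [hf.r 41 h41, h.r41], by rw [hf.r 42 h42, h.r42],
    by rw [hf.r 43 h43, h.r43], by rw [hf.r 44 h44, h.r44], by rw [hf.r 45 h45, h.r45],
    by rw [hf.r 46 h46, h.r46], by rw [hf.r 47 h47, h.r47], by rw [hf.r 48 h48, h.r48],
    by rw [hf.a 13 b13]; exact h.a13, by rw [hf.a 14 b14]; exact h.a14⟩

lemma Grid.set (h : Grid I B D r Z q V d σ) (x : ℕ) (v : ℤ)
    (hx : ¬ (x ≤ 4 ∨ x = 9 ∨ x = 10 ∨ x = 13 ∨ 40 ≤ x ∧ x ≤ 48) := by norm_num) :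
    Grid I B D r Z q V d (σ.setReg x v) := by
  refine h.fr (s := .asgc x v) ⟨fun y _ hy => ?_, fun a _ => rfl⟩ ?_
  · simp only [Stmt.wrR, decide_eq_false_iff_not] at hy; simp [hy]
  · simp [Stmt.safeG, Stmt.safe, Stmt.wrR, Stmt.wrA]; omega

/-- `reg 28 :=` the monomial with exponent digits from `reg 26` at the point in `reg 50`. -/
def monomS : Stmt :=
  .asg 27 (.r 50) ;; .asg 28 1 ;; .for 29 43 (
    .asg 28 (.r 28 * .ld 14 ((.r 27 - .r 27 / .r 41 * .r 41) * .r 40 + (.r 26 - .r 26 / .r 40 * .r 40))) ;;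
    .asg 27 (.r 27 / .r 41) ;; .asg 26 (.r 26 / .r 40))

lemma Grid.monomS_run (mc : Mach) (h : Grid I B D r Z q V d σ) (hB : 1 ≤ B) (hD : 1 ≤ D) (x a : ℕ)
    (h50 : σ.reg 50 = x) (h26 : σ.reg 26 = a) (hx : x ≤ mc.X) (ha : a ≤ mc.X)
    (hM : B * D ≤ mc.M) (hX : (B ^ r) ^ D ≤ mc.X) :
    Run mc monomS σ (161 * r + 150) fun σ' => σ'.reg 28 = monom B D r x a := by
  have hX16 := mc.hX
  refine Run.asg_seq (x : ℤ) (by simpa using hx) (by simp [h50]) (Run.asg_seq 1 (by simp; omega) rfl ?_)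
  refine Run.forC r 150 (fun t (σ' : State) => ∃ x' a' c : ℕ, x' ≤ x ∧ a' ≤ a ∧ c ≤ (B ^ t) ^ D ∧
    σ'.reg 27 = x' ∧ σ'.reg 26 = a' ∧ σ'.reg 28 = c ∧ c * monom B D (r - t) x' a' = monom B D r x a)
    (by simp [h.r43]) ⟨x, a, 1, le_rfl, le_rfl, by simp, by simp, by simp [h26], by simp, by simp⟩
    ?_ ?_ (by omega)
  · rintro t ht σ1 ⟨x', a', c, hx', ha', hc, s27, s26, s28, hm⟩ - fr g1
    have e40 : σ1.reg 40 = D := by rw [fr.r 40]; simp [h.r40]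
    have e41 : σ1.reg 41 = B := by rw [fr.r 41]; simp [h.r41]
    have e14 : σ1.arr 14 = σ.arr 14 := by rw [fr.a 14]; simp
    have h1 := Nat.mod_lt x' hB
    have h2 := Nat.mod_lt a' hD
    have had := mul_add_lt h1 h2
    have hidx : ((x' : ℤ) - x' / B * B) * D + ((a' : ℤ) - a' / D * D) =
        ((x' % B * D + a' % D : ℕ) : ℤ) := by
      rw [sub_div_mul, sub_div_mul]; push_cast; rfl
    have hle : (x' % B) ^ (a' % D) ≤ B ^ D :=
      (Nat.pow_le_pow_left h1.le _).trans (Nat.pow_le_pow_right hB h2.le)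
    have hcc : c * (x' % B) ^ (a' % D) ≤ (B ^ (t + 1)) ^ D := by
      rw [pow_succ, mul_pow]; exact Nat.mul_le_mul hc hle
    have hcX : c * (x' % B) ^ (a' % D) ≤ mc.X :=
      hcc.trans ((Nat.pow_le_pow_left (Nat.pow_le_pow_right hB ht) _).trans hX)
    refine Run.asg_seq ((c * (x' % B) ^ (a' % D) : ℕ) : ℤ) (abs_cast_le hcX)
      ?_ ?_ ?_
    · simp only [Ex.eval_mul, Ex.eval_ld, Ex.eval_add, Ex.eval_sub, Ex.eval_div, Ex.eval_r, s27, s26,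
        s28, e40, e41, e14]
      rw [hidx, Int.toNat_natCast, h.a14 _ h1 _ h2]; push_cast; rfl
    · refine Run.asg_seq ((x' / B : ℕ) : ℤ) ?_ (by simp [s27, e41]) ?_
      · rw [Nat.abs_cast]; have := Nat.div_le_self x' B; norm_cast; omega
      refine Run.asg_last ((a' / D : ℕ) : ℤ) ?_ (by simp [s26, e40]) ?_
      · rw [Nat.abs_cast]; have := Nat.div_le_self a' D; norm_cast; omega
      refine ⟨x' / B, a' / D, _, (Nat.div_le_self _ _).trans hx', (Nat.div_le_self _ _).trans ha',
        hcc, by simp, by simp, by simp, ?_⟩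
      obtain ⟨u, hu⟩ : ∃ u, r - t = u + 1 := ⟨r - t - 1, by omega⟩
      rw [hu, monom] at hm
      rw [show r - (t + 1) = u by omega, ← hm]; ring
    · simp only [Ex.ok_mul, Ex.ok_ld, Ex.ok_add, Ex.ok_sub, Ex.ok_div, Ex.ok_r, Ex.eval_mul,
        Ex.eval_add, Ex.eval_sub, Ex.eval_div, Ex.eval_r, s27, s26, e40, e41, hidx, true_and, and_true]
      norm_cast; omega
  · rintro σ1 ⟨x', a', c, -, -, -, -, -, s28, hm⟩ _ _ _
    rw [Nat.sub_self, monom, mul_one] at hm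
    rw [s28, hm]

/-- Fill array `a` with the evaluated entries of array `src`; `ek` gives the inner index, of which
only those in the chunk `reg 49` are used. -/
def fill (a src : ℕ) (ek : Ex) : Stmt :=
  .for 20 47 (.asg 23 (ek / .r 4 - .r 49) ;; .ite (1 - .r 23 * .r 23)
    (.asg 26 (.ld src (.r 20)) ;; .asg 26 (.r 26 - .r 26 / .r 13 * .r 13) ;; monomS ;;
      .sto a (.r 20) (.r 28))
    (.sto a (.r 20) 0))

lemma Grid.fill_run (mc : Mach) (h : Grid I B D r Z q V d σ) (hB : 1 ≤ B) (hD : 1 ≤ D) (hq : 1 ≤ q)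
    (x g : ℕ) (h50 : σ.reg 50 = x) (h49 : σ.reg 49 = g) (hx : x ≤ mc.X) (hg : g ≤ mc.X)
    (hqX : q ≤ mc.X) (hM : B * D ≤ mc.M)
    (hX : (B ^ r) ^ D ≤ mc.X) {a src : ℕ} {ek : Ex} (κ : ℕ → ℕ) (f : ℕ → ℤ)
    (ha : 15 ≤ a) (hsrc : σ.arr src = f) (hsa : src < 15) (hf : ∀ c, |f c| ≤ mc.X)
    (hMnm : I.n * I.m ≤ mc.M) (hκX : ∀ c < I.n * I.m, κ c ≤ mc.X)
    (hκ : ∀ c < I.n * I.m, ∀ σ' : State, σ'.reg 20 = c → σ'.reg 0 = I.n → σ'.reg 1 = I.m →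
      ek.eval σ' = κ c ∧ ek.ok mc.M σ')
    (hw : (ek / .r 4 - .r 49).wf = true) (hc : (ek / .r 4 - .r 49).cost ≤ 50) :
    Run mc (fill a src ek) σ (I.n * I.m * (161 * r + 600) + 8) fun σ' =>
      (∀ c < I.n * I.m, σ'.arr a c = if κ c / I.L = g then (monom B D r x (res q (f c)) : ℤ) else 0) ∧
      ∀ c, I.n * I.m ≤ c → σ'.arr a c = σ.arr a c := by
  have hsafe : Stmt.safeG (.for 20 47 (.asg 23 (ek / .r 4 - .r 49) ;; .ite (1 - .r 23 * .r 23)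
    (.asg 26 (.ld src (.r 20)) ;; .asg 26 (.r 26 - .r 26 / .r 13 * .r 13) ;; monomS ;;
      .sto a (.r 20) (.r 28))
    (.sto a (.r 20) 0))) = true := by
    simp [Stmt.safeG, Stmt.safe, Stmt.for, Stmt.wrR, Stmt.wrA, monomS]; omega
  refine Run.forC (I.n * I.m) (161 * r + 580) (fun C (σ' : State) =>
      (∀ c < C, σ'.arr a c = if κ c / I.L = g then (monom B D r x (res q (f c)) : ℤ) else 0) ∧
      ∀ c, C ≤ c → σ'.arr a c = σ.arr a c) h.r47 (by simp) ?_ (fun σ' I _ _ _ => I) (by lia)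
  intro c hcl σ1 I1 r20 fr g1
  have G1 := h.fr fr hsafe
  have e50 : σ1.reg 50 = x := by rw [fr.r 50, h50]
  have e49 : σ1.reg 49 = g := by rw [fr.r 49, h49]
  have esrc : σ1.arr src = f := by
    rw [fr.a src (by simp [Stmt.for, Stmt.wrA, monomS]; omega), hsrc]
  obtain ⟨k1, k2⟩ := hκ c hcl σ1 r20 G1.env.r0 G1.env.r1
  have hupd : ∀ (σ2 : State) (v : ℤ), σ2.arr a = σ1.arr a →
      v = (if κ c / I.L = g then (monom B D r x (res q (f c)) : ℤ) else 0) →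
      (∀ c' < c + 1, ((σ2.setArr a c v).setReg 20 ((c + 1 : ℕ) : ℤ)).arr a c' =
        if κ c' / I.L = g then (monom B D r x (res q (f c')) : ℤ) else 0) ∧
      ∀ c', c + 1 ≤ c' → ((σ2.setArr a c v).setReg 20 ((c + 1 : ℕ) : ℤ)).arr a c' = σ.arr a c' := by
    intro σ2 v e hv
    simp only [State.arr_setReg, State.arr_setArr, if_true, e]
    refine ⟨fun c' hc' => ?_, fun c' hc' => ?_⟩
    · by_cases hcc : c' = c
      · subst hcc; rw [Function.update_self, hv]
      · rw [Function.update_of_ne hcc]; exact I1.1 c' (by omega)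
    · rw [Function.update_of_ne (by omega)]; exact I1.2 c' (by omega)
  have hdiv : κ c / I.L ≤ mc.X := (Nat.div_le_self _ _).trans (hκX c hcl)
  refine Run.asg_seq (((κ c / I.L : ℕ) : ℤ) - g) ?_ (by simp [k1, G1.env.r4, e49]) ?_
    ⟨⟨k2, trivial⟩, trivial⟩ hw hc
  · generalize κ c / I.L = u at *; rw [abs_le]; constructor <;> omega
  have htest : 0 < (1 - Ex.r 23 * Ex.r 23 : Ex).eval (σ1.setReg 23 (((κ c / I.L : ℕ) : ℤ) - g)) ↔
      κ c / I.L = g := by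
    simp only [Ex.eval_sub, Ex.eval_mul, Ex.eval_r, Ex.eval_one, State.reg_setReg, if_true]
    generalize κ c / I.L = u
    constructor
    · intro hh
      have : ((u : ℤ) - g) * (u - g) = 0 := by nlinarith [mul_self_nonneg ((u : ℤ) - g)]
      have := mul_self_eq_zero.1 this
      omega
    · intro hh; subst hh; simp
  refine Run.iteB (fun hh => ?_) (fun hh => ?_)
  · rw [htest] at hh
    have hr := res_lt hq (f c)
    refine Run.asg_seq (f c) (hf c) (by simp [r20, esrc]) ?_ ?_
      (hc := by change 3 ≤ 50; norm_num)
    · refine Run.asg_seq (res q (f c) : ℤ) (abs_cast_le (by omega)) ?_ ?_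
      · simp only [Ex.eval_sub, Ex.eval_mul, Ex.eval_div, Ex.eval_r]
        norm_num [G1.r13]
        rw [sub_div_mul, cast_res hq]
      · refine Run.seqB (161 * r + 150) (Grid.monomS_run mc (((G1.set 23 _).set 26 _).set 26 _) hB hD x
          (res q (f c)) (by simp [e50]) (by simp) hx (by omega) hM hX) fun σ2 h28 fr2 g2 => ?_
        have hm := (monom_le hB hD r x (res q (f c))).trans hX
        have e20 : σ2.reg 20 = c := by rw [fr2.r 20]; simp [r20]
        refine Run.sto_last c (monom B D r x (res q (f c)) : ℤ) (by omega)
          (abs_cast_le hm) (by simp [e20]) (by simp [h28])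
          (hupd σ2 _ ?_ (by rw [if_pos hh]))
        rw [fr2.a a (by simp [monomS, Stmt.for, Stmt.wrA])]; simp
    · simp only [Ex.ok_ld, Ex.ok_r, Ex.eval_r]; norm_num [r20]; omega
  · rw [htest] at hh
    exact Run.sto_last c 0 (by omega) (by simp) (by simp [r20]) rfl
      (hupd _ _ rfl (by rw [if_neg hh]))

end


/-! ## Calling a renamed machine program -/

lemma Run.raw {mc : Mach} {σ σb σb' : State} {p : Prog} {w M t T : ℕ} {Q : State → Prop}
    (hsim : Sim σb σ) (hE : Exec w M p σb t σb') (hw : w ≤ mc.w) (hM : M ≤ mc.M)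
    (hX : 2 ^ w ≤ mc.X) (hT : t ≤ T) (hQ : ∀ σ', Sim σb' σ' → Q σ') : Run mc (.raw p) σ T Q := by
  intro τ e hg
  have htmp : ∀ x, tmp (61 + 2 * x) = false := fun x => by simp [tmp]
  have hsim' : Sim σb τ := ⟨fun x => by rw [← e.reg _ (htmp x), hsim.reg], fun a => by
    rw [← e.arr, hsim.arr]⟩
  obtain ⟨τ', h1, h2⟩ := (hE.mono hw hM).shift τ hsim'
  have hb := hE.abs_le (X := mc.X) (by exact_mod_cast hX)
    (fun y => by rw [← hsim'.reg]; exact hg.reg _ (htmp y))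
    (fun a i => by rw [← hsim'.arr]; exact hg.arr _ _)
  refine ⟨t, τ', τ', h1, hT, ⟨fun y hy => ?_, fun a i => ?_⟩, Eqv.refl _, hQ _ h2⟩
  · by_cases h : 60 ≤ y
    · obtain ⟨x, rfl⟩ : ∃ x, y = 61 + 2 * x := ⟨(y - 61) / 2, by simp [tmp] at hy; omega⟩
      rw [h2.reg]; exact hb.1 x
    · rw [h1.reg_eq fun hw => h (Prog.wrR_shift hw)]; exact hg.reg y hy
  · by_cases h : 50 ≤ a
    · obtain ⟨x, rfl⟩ : ∃ x, a = 50 + x := ⟨a - 50, by omega⟩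
      rw [h2.arr]; exact hb.2 x i
    · rw [h1.arr_eq fun hw => h (Prog.wrA_shift hw)]; exact hg.arr a i

/-- Clear the arrays of the renamed program. -/
def zeroA : ℕ → Stmt
  | 0 => .skip
  | a + 1 => zeroA a ;; .for 20 46 (.sto (50 + a) (.r 20) 0)

/-- Clear the registers of the renamed program. -/
def zeroR : ℕ → Stmt
  | 0 => .skip
  | y + 1 => zeroR y ;; .asgc (61 + 2 * y) 0

lemma wrR_zeroA {k y : ℕ} (hy : y ≠ 20) : (zeroA k).wrR y = false := by
  induction k <;> simp_all [zeroA, Stmt.wrR, Stmt.for]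

lemma wrA_zeroA {k a : ℕ} (ha : a < 50) : (zeroA k).wrA a = false := by
  induction k <;> simp_all [zeroA, Stmt.wrA, Stmt.for]; omega

lemma wrR_zeroR {k y : ℕ} (hy : y < 60) : (zeroR k).wrR y = false := by
  induction k <;> simp_all [zeroR, Stmt.wrR]; omega

lemma wrA_zeroR {k a : ℕ} : (zeroR k).wrA a = false := by
  induction k <;> simp_all [zeroR, Stmt.wrA]

lemma zeroA_run (mc : Mach) {Z : ℕ} (hM : Z ≤ mc.M) (k : ℕ) {σ : State} (h46 : σ.reg 46 = Z) :
    Run mc (zeroA k) σ (k * (Z * 111 + 8) + 1) fun σ' => ∀ a i,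
      σ'.arr (50 + a) i = if a < k ∧ i < Z then 0 else σ.arr (50 + a) i := by
  induction k with
  | zero => exact Run.skip_last (by simp)
  | succ k ih =>
    refine Run.seqB _ ih fun σ1 I1 fr1 g1 => ?_
    refine Run.forC Z 100 (fun z (σ' : State) => ∀ a i, σ'.arr (50 + a) i =
      if a = k ∧ i < z then 0 else σ1.arr (50 + a) i)
      (by rw [fr1.r 46 (wrR_zeroA (by norm_num)), h46]) (by simp) ?_ ?_ (by lia)
    · intro z hz σ2 I2 r20 fr2 g2
      refine Run.sto_last z 0 (by omega) (by simp) (by simp [r20]) rfl fun a i => ?_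
      rw [State.arr_setReg, State.arr_setArr]
      by_cases ha : a = k
      · subst ha
        by_cases hi : i = z
        · subst hi; simp
        · simp only [if_true, Function.update_of_ne hi, I2, true_and]
          exact if_congr (by omega) rfl rfl
      · simp [I2, ha]
    · intro σ2 I2 _ _ _ a i
      rw [I2, I1]
      by_cases h1 : a = k <;> by_cases h2 : i < Z <;> by_cases h3 : a < k <;>
        simp [h1, h2, h3] <;> omega

lemma zeroR_run (mc : Mach) (k : ℕ) {σ : State} :
    Run mc (zeroR k) σ (k + 1) fun σ' => ∀ y,
      σ'.reg (61 + 2 * y) = if y < k then 0 else σ.reg (61 + 2 * y) := by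
  induction k with
  | zero => exact Run.skip_last (by simp)
  | succ k ih =>
    refine Run.seqB _ ih fun σ1 I1 fr1 g1 => ?_
    refine (Run.asgc (by simp) fun y => ?_).le (by omega)
    rw [State.reg_setReg, I1]
    by_cases h : y = k
    · simp [h]
    · rw [if_neg (by omega)]; exact if_congr (by omega) rfl rfl

/-- The storage of the renamed program is blank outside `R` registers, `A` arrays, `Z` cells. -/
structure Outer (R A Z : ℕ) (σ : State) : Prop where
  reg : ∀ y, R ≤ y → σ.reg (61 + 2 * y) = 0
  arr : ∀ a, A ≤ a → ∀ i, σ.arr (50 + a) i = 0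
  cell : ∀ a i, Z ≤ i → σ.arr (50 + a) i = 0

lemma Outer.fr {R A Z : ℕ} {s : Stmt} {σ σ' : State} (h : Outer R A Z σ) (hf : Fr s σ σ')
    (hr : ∀ y, s.wrR (61 + 2 * y) = false) (ha : ∀ a, s.wrA (50 + a) = false) : Outer R A Z σ' :=
  ⟨fun y hy => by rw [hf.reg _ (by simp [tmp]) (hr y), h.reg y hy],
   fun a hy i => by rw [hf.arr _ (ha a), h.arr a hy],
   fun a i hi => by rw [hf.arr _ (ha a), h.cell a i hi]⟩

def Inst.resA (I : Inst) (q i k : ℕ) : ℕ := res q (I.f (i * I.m + k))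
def Inst.resB (I : Inst) (q j k : ℕ) : ℕ := res q (I.g (k * I.n + j))
def Inst.chunk (I : Inst) (g : ℕ) : Finset ℕ := (Finset.range I.m).filter fun k => k / I.L = g

/-- Multiply the evaluated matrices for the chunk `reg 49` and the point `reg 50`. -/
def evalAt (p : Prog) (R A : ℕ) : Stmt :=
  zeroA A ;; zeroR R ;; fill 50 0 (.r 20 - .r 20 / .r 1 * .r 1) ;; fill 51 1 (.r 20 / .r 0) ;;
    .asg 61 (.r 0) ;; .asg 63 (.r 1) ;; .raw p

/-- What is needed of the multiplication program. -/
structure Box (mc : Mach) (I : Inst) (p : Prog) (R A Z Y : ℕ) : Prop where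
  hR : ∀ y, R ≤ y → ¬ p.wrR y
  hA : ∀ a, A ≤ a → ¬ p.wrA a
  R2 : 2 ≤ R
  A3 : 3 ≤ A
  nm_le : I.n * I.m ≤ Z
  M_le : Z ≤ mc.M
  run : ∀ (A : Matrix (Fin I.n) (Fin I.m) ℤ) (B : Matrix (Fin I.m) (Fin I.n) ℤ),
    (∀ i k, |A i k| ≤ Y) → (∀ k j, |B k j| ≤ Y) → ∃ (w M t : ℕ) (σ : State),
      Exec w M p (inputState [(I.n : ℤ), (I.m : ℤ)] A B) t σ ∧ w ≤ mc.w ∧ M ≤ Z ∧ 2 ^ w ≤ mc.X ∧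
      t ≤ Z ∧ ∀ i j : Fin I.n, σ.arr 2 (i * I.n + j) = (A * B) i j

lemma rowMajor_eq {p q : ℕ} {F : ℕ → ℕ → ℤ} {c : ℕ} (hc : c < p * q) :
    rowMajor (fun (i : Fin p) (k : Fin q) => F i k) c = F (c / q) (c % q) := by
  unfold rowMajor; rw [dif_pos hc]; rfl

lemma Grid.evalAt_run (mc : Mach) {I : Inst} {B D r Z q : ℕ} {V : ℕ → ℕ → ℤ} {d : ℤ} {σ : State}
    (h : Grid I B D r Z q V d σ) {p : Prog} {R A Y : ℕ} (hbox : Box mc I p R A Z Y)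
    (hO : Outer R A Z σ) (hB : 1 ≤ B) (hD : 1 ≤ D)
    (hq : 1 ≤ q) {x g : ℕ} (h50 : σ.reg 50 = x) (h49 : σ.reg 49 = g) (hx : x < B ^ r)
    (hxX : x ≤ mc.X) (hg : g ≤ mc.X) (hqX : q ≤ mc.X) (hM : B * D ≤ mc.M) (hY : (B ^ r) ^ D ≤ Y)
    (hX : (B ^ r) ^ D ≤ mc.X) (hIY : I.Y ≤ mc.X) (hnmX : I.n * I.m ≤ mc.X) :
    Run mc (evalAt p R A) σ ((111 * A + 322 * r + 1500) * Z + (10 * A + R)) fun σ' =>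
      Outer R A Z σ' ∧ ∀ i < I.n, ∀ j < I.n, σ'.arr 52 (i * I.n + j) =
        stage B D r (I.chunk g) (I.resA q i) (I.resB q j) 0 x := by
  have hn := I.hn
  have hm := I.hm
  have hnm := hbox.nm_le
  have hZM := hbox.M_le
  have hZ1 : 1 ≤ Z := le_trans (Nat.mul_pos hn hm) hnm
  have hT : A * (Z * 111 + 8) + 1 + (R + 1) + (I.n * I.m * (161 * r + 600) + 8) * 2 + 100 + Z ≤
      (111 * A + 322 * r + 1500) * Z + (10 * A + R) := by
    have := Nat.mul_le_mul_right (161 * r + 600) hnm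
    have e : (111 * A + 322 * r + 1500) * Z = A * Z * 111 + 2 * (Z * (161 * r + 600)) + 300 * Z := by
      ring
    have e2 : A * (Z * 111 + 8) = A * Z * 111 + 8 * A := by ring
    omega
  refine Run.le ?_ hT
  clear hT
  refine Run.seqB _ (zeroA_run mc hZM A h.r46) fun σ1 I1 fr1 g1 => ?_
  have G1 := h.fr fr1 (by simp [Stmt.safeG, Stmt.safe, wrR_zeroA, wrA_zeroA])
  refine Run.seqB _ (zeroR_run mc R) fun σ2 I2 fr2 g2 => ?_
  have G2 := G1.fr fr2 (by simp [Stmt.safeG, Stmt.safe, wrR_zeroR, wrA_zeroR])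
  have z50 : ∀ a i, σ2.arr (50 + a) i = 0 := by
    intro a i
    rw [fr2.a _ wrA_zeroR, I1]
    split_ifs with hh
    · rfl
    · by_cases ha : a < A
      · exact hO.cell a i (by omega)
      · exact hO.arr a (by omega) i
  have z61 : ∀ y, σ2.reg (61 + 2 * y) = 0 := by
    intro y
    rw [I2]
    split_ifs with hh
    · rfl
    · rw [fr1.reg _ (by simp [tmp]) (wrR_zeroA (by omega)), hO.reg y (by omega)]
  have t50 : σ2.reg 50 = x := by
    rw [fr2.r 50 (wrR_zeroR (by norm_num)), fr1.r 50 (wrR_zeroA (by norm_num)), h50]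
  have t49 : σ2.reg 49 = g := by
    rw [fr2.r 49 (wrR_zeroR (by norm_num)), fr1.r 49 (wrR_zeroA (by norm_num)), h49]
  have hle : ∀ c, c < I.n * I.m → ∀ k, k ≤ c → k ≤ mc.X := fun c hc k hk => by omega
  refine Run.seqB _ (G2.fill_run mc hB hD hq x g t50 t49 hxX hg hqX hM hX (fun c => c % I.m) I.f
    (by norm_num) G2.env.a0 (by norm_num) (fun c => (I.hf c).trans (by exact_mod_cast hIY))
    (hnm.trans hZM) (fun c hc => hle c hc _ (Nat.mod_le _ _)) ?_ rfl (by decide)) fun σ3 I3 fr3 g3 => ?_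
  · intro c hc σ' r20 r0 r1
    refine ⟨?_, by simp⟩
    simp only [Ex.eval_sub, Ex.eval_mul, Ex.eval_div, Ex.eval_r, r20, r1]
    rw [sub_div_mul]; norm_cast
  have G3 := G2.fr fr3
  have t50' : σ3.reg 50 = x := by rw [fr3.r 50, t50]
  have t49' : σ3.reg 49 = g := by rw [fr3.r 49, t49]
  refine Run.seqB _ (G3.fill_run mc hB hD hq x g t50' t49' hxX hg hqX hM hX (fun c => c / I.n) I.g
    (by norm_num) G3.env.a1 (by norm_num) (fun c => (I.hg c).trans (by exact_mod_cast hIY))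
    (hnm.trans hZM) (fun c hc => hle c hc _ (Nat.div_le_self _ _)) ?_ rfl (by decide))
    fun σ4 I4 fr4 g4 => ?_
  · intro c hc σ' r20 r0 r1
    exact ⟨by simp [r20, r0], by simp⟩
  have G4 := G3.fr fr4
  have hMA := fun a => (monom_le hB hD r x a)
  let FA : ℕ → ℕ → ℤ := fun i k => if k / I.L = g then (monom B D r x (I.resA q i k) : ℤ) else 0
  let FB : ℕ → ℕ → ℤ := fun k j => if k / I.L = g then (monom B D r x (I.resB q j k) : ℤ) else 0
  let MA : Matrix (Fin I.n) (Fin I.m) ℤ := fun i k => FA i k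
  let MB : Matrix (Fin I.m) (Fin I.n) ℤ := fun k j => FB k j
  have hite : ∀ (P : Prop) [Decidable P] (a : ℕ), |(if P then (monom B D r x a : ℤ) else 0)| ≤ Y := by
    intro P _ a
    split_ifs
    · rw [Nat.abs_cast]; exact_mod_cast (hMA a).trans hY
    · simp
  obtain ⟨w, M, t, σb, hE, b1, b2, b3, b4, hprod⟩ :=
    hbox.run MA MB (fun i k => hite _ _) (fun k j => hite _ _)
  refine Run.seqB 10 ((Run.asg (Q := fun σ' => σ' = σ4.setReg 61 I.n) (I.n : ℤ) rfl (by simp)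
    (by simp [G4.env.r0]) ?_ rfl).le (by decide)) ?_
  · have := Nat.le_mul_of_pos_right I.n hm
    exact abs_cast_le (by omega)
  rintro _ rfl - -
  refine Run.seqB 10 ((Run.asg (Q := fun σ' => σ' = (σ4.setReg 61 I.n).setReg 63 I.m) (I.m : ℤ) rfl
    (by simp) (by simp [G4.env.r1]) ?_ rfl).le (by decide)) ?_
  · have := Nat.le_mul_of_pos_left I.m hn
    exact abs_cast_le (by omega)
  rintro _ rfl - -
  refine Run.raw (σb := inputState [(I.n : ℤ), (I.m : ℤ)] MA MB) (t := t) ⟨?_, ?_⟩ hE b1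
    (b2.trans hZM) b3 (by omega) ?_
  · intro y
    rcases y with _ | _ | y
    · simp [inputState]
    · simp [inputState]
    · simp only [State.reg_setReg]
      rw [if_neg (by omega), if_neg (by omega), fr4.reg _ (by simp [tmp])
        (by simp [fill, Stmt.for, Stmt.wrR, monomS]; omega), fr3.reg _ (by simp [tmp])
        (by simp [fill, Stmt.for, Stmt.wrR, monomS]; omega), z61]
      simp [inputState]
  · intro a
    simp only [State.arr_setReg, inputState]
    funext c
    by_cases ha : a = 0
    · subst ha
      rw [if_pos rfl, fr4.a 50]
      by_cases hc : c < I.n * I.m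
      · rw [I3.1 c hc]
        refine Eq.trans ?_ (rowMajor_eq (F := FA) hc).symm
        dsimp only [FA]
        rw [Inst.resA, Nat.div_add_mod']
      · rw [I3.2 c (by omega), rowMajor_of_le (by omega)]; exact z50 0 c
    · by_cases ha1 : a = 1
      · subst ha1
        rw [if_neg ha, if_pos rfl]
        by_cases hc : c < I.n * I.m
        · rw [I4.1 c hc]
          refine Eq.trans ?_ (rowMajor_eq (F := FB) (by rwa [mul_comm])).symm
          dsimp only [FB]
          rw [Inst.resB, Nat.div_add_mod']
        · rw [I4.2 c (by omega), rowMajor_of_le (by rw [mul_comm]; omega), fr3.a 51]; exact z50 1 c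
      · rw [if_neg ha, if_neg ha1, fr4.arr _ (by simp [fill, Stmt.for, Stmt.wrA, monomS]; omega),
          fr3.arr _ (by simp [fill, Stmt.for, Stmt.wrA, monomS]; omega)]
        exact z50 a c
  · intro σ' hs
    have hR2 := hbox.R2
    have hA3 := hbox.A3
    refine ⟨⟨fun y hy => ?_, fun a ha i => ?_, fun a i hi => ?_⟩, fun i hi j hj => ?_⟩
    · rw [hs.reg, hE.reg_eq (hbox.hR y hy)]
      obtain ⟨y, rfl⟩ : ∃ y', y = y' + 2 := ⟨y - 2, by omega⟩
      simp [inputState]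
    · rw [hs.arr, hE.arr_eq (hbox.hA a ha)]
      simp only [inputState]
      rw [if_neg (by omega), if_neg (by omega)]
    · rw [hs.arr, hE.arr_of_le (b2.trans hi)]
      simp only [inputState]
      split_ifs
      · exact rowMajor_of_le (by omega)
      · exact rowMajor_of_le (by rw [mul_comm]; omega)
      · rfl
    · have := hprod ⟨i, hi⟩ ⟨j, hj⟩
      rw [hs.arr 2, this, Matrix.mul_apply, stage_zero hx, Inst.chunk, Finset.sum_filter,
        Finset.sum_range]
      refine Finset.sum_congr rfl fun k _ => ?_
      dsimp only [MA, MB, FA, FB]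
      split_ifs
      · push_cast; rfl
      · simp


lemma dec_le {B D : ℕ} (hDB : D ≤ B) (r : ℕ) : ∀ y, dec B D r y ≤ y := by
  induction r with
  | zero => intro y; simp [dec]
  | succ r ih =>
    intro y
    calc dec B D (r + 1) y ≤ y % B + B * (y / B) :=
          Nat.add_le_add_left (Nat.mul_le_mul hDB (ih _)) _
      _ = y := Nat.mod_add_div y B

/-- The data for the pair of outer indices with number `c` during the interpolation. -/
def Inst.data (I : Inst) (B D r q g c t y : ℕ) : ℤ :=
  stage B D r (I.chunk g) (I.resA q (c / I.n)) (I.resB q (c % I.n)) t y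

/-- Bound for the data during the interpolation. -/
def Inst.dataBound (I : Inst) (B D r : ℕ) : ℕ := I.m * ((B ^ r) ^ D * (B ^ r) ^ D)

lemma Inst.abs_data_le (I : Inst) {B D r q g c t y : ℕ} (hB : 1 ≤ B) (hD : 1 ≤ D) :
    |I.data B D r q g c t y| ≤ I.dataBound B D r := by
  refine (abs_stage_le hB hD t y).trans ?_
  have : (I.chunk g).card ≤ I.m := by
    simpa [chunk] using Finset.card_filter_le (Finset.range I.m) _
  exact_mod_cast Nat.mul_le_mul_right _ this

/-- Evaluate at all points of the grid for the chunk `reg 49`. -/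
def evalAll (p : Prog) (R A : ℕ) : Stmt :=
  .for 50 44 (evalAt p R A ;; .for 20 48 (.sto 11 (.r 20 * .r 44 + .r 50) (.ld 52 (.r 20))))

section
variable {I : Inst} {B D r Z q : ℕ} {V : ℕ → ℕ → ℤ} {d : ℤ} {σ : State}

lemma safeG_evalAll {p : Prog} {R A : ℕ} : (evalAll p R A).safeG = true := by
  simp [Stmt.safeG, Stmt.safe, evalAll, evalAt, Stmt.for, Stmt.wrR, Stmt.wrA, fill, monomS,
    wrR_zeroA, wrA_zeroA, wrR_zeroR, wrA_zeroR]

lemma wr_evalAll {p : Prog} {R A : ℕ} : (evalAll p R A).wrR 49 = false ∧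
    (evalAll p R A).wrA 6 = false := by
  simp [evalAll, evalAt, Stmt.for, Stmt.wrR, Stmt.wrA, fill, monomS,
    wrR_zeroA, wrA_zeroA, wrR_zeroR, wrA_zeroR]

lemma Grid.evalAll_run (mc : Mach) (h : Grid I B D r Z q V d σ) {p : Prog} {R A Y : ℕ}
    (hbox : Box mc I p R A Z Y) (hO : Outer R A Z σ) (hB : 1 ≤ B) (hD : 1 ≤ D)
    (hq : 1 ≤ q) {g : ℕ} (h49 : σ.reg 49 = g) (hNX : B ^ r ≤ mc.X) (hg : g ≤ mc.X) (hqX : q ≤ mc.X)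
    (hM : B * D ≤ mc.M) (hY : (B ^ r) ^ D ≤ Y)
    (hX : (B ^ r) ^ D ≤ mc.X) (hIY : I.Y ≤ mc.X) (hnmX : I.n * I.m ≤ mc.X)
    (hNM : I.n * I.n * B ^ r ≤ mc.M) (hDX : I.dataBound B D r ≤ mc.X) :
    Run mc (evalAll p R A) σ (B ^ r * ((111 * A + 322 * r + 1700) * Z + (10 * A + R)) + 8)
      fun σ' => Outer R A Z σ' ∧ ∀ c < I.n * I.n, ∀ x < B ^ r, σ'.arr 11 (c * B ^ r + x) =
        I.data B D r q g c 0 x := by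
  have hnm := hbox.nm_le
  have hn := I.hn
  have hnn : I.n * I.n ≤ I.n * I.m := Nat.mul_le_mul_left _ I.hnm
  have hZM := hbox.M_le
  have hn1 : 1 ≤ I.n * I.n := Nat.mul_pos hn hn
  refine Run.forC (B ^ r) ((111 * A + 322 * r + 1500) * Z + (10 * A + R) + (I.n * I.n * 111 + 8))
    (fun x (σ' : State) => Outer R A Z σ' ∧ ∀ c < I.n * I.n, ∀ x' < x, σ'.arr 11 (c * B ^ r + x') =
        I.data B D r q g c 0 x') h.r44
    ⟨hO.fr (s := .asg 50 0) ⟨fun y _ hy => by simp [Stmt.wrR] at hy; simp [hy], fun _ _ => rfl⟩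
      (fun y => by simp [Stmt.wrR]; omega) (fun _ => rfl), by simp⟩ ?_ (fun σ' I _ _ _ => I) ?_
    (hsx := ?_) (hsy := ?_)
  · intro x hx σ1 I1 r50 fr1 g1
    have G1 := h.fr fr1 safeG_evalAll
    have e49 : σ1.reg 49 = g := by rw [fr1.r 49 wr_evalAll.1, h49]
    refine Run.seqB _ (G1.evalAt_run mc hbox I1.1 hB hD hq r50 e49 hx (by omega) hg hqX hM hY hX hIY
      hnmX) fun σ2 I2 fr2 g2 => ?_
    have G2 := G1.fr fr2 (by simp [Stmt.safeG, Stmt.safe, evalAt, Stmt.for, Stmt.wrR, Stmt.wrA,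
      fill, monomS, wrR_zeroA, wrA_zeroA, wrR_zeroR, wrA_zeroR])
    have e50 : σ2.reg 50 = x := by
      rw [fr2.r 50 (by simp [evalAt, Stmt.for, Stmt.wrR, fill, monomS, wrR_zeroA, wrR_zeroR]), r50]
    have e11 : σ2.arr 11 = σ1.arr 11 :=
      fr2.a 11 (by simp [evalAt, Stmt.for, Stmt.wrA, fill, monomS, wrA_zeroA, wrA_zeroR])
    have hval : ∀ c < I.n * I.n, σ2.arr 52 c = I.data B D r q g c 0 x := by
      intro c hc
      have h1 : c / I.n < I.n := Nat.div_lt_of_lt_mul hc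
      have := I2.2 _ h1 _ (Nat.mod_lt c hn)
      rwa [Nat.div_add_mod'] at this
    refine Run.forC (I.n * I.n) 100 (fun C (σ' : State) => Outer R A Z σ' ∧
      (∀ c < C, ∀ x' < x + 1, σ'.arr 11 (c * B ^ r + x') = I.data B D r q g c 0 x') ∧
      ∀ c < I.n * I.n, C ≤ c → ∀ x' < x, σ'.arr 11 (c * B ^ r + x') = I.data B D r q g c 0 x') G2.r48
      ⟨I2.1.fr (s := .asg 20 0) ⟨fun y _ hy => by simp [Stmt.wrR] at hy; simp [hy], fun _ _ => rfl⟩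
      (fun y => by simp [Stmt.wrR]; omega) (fun _ => rfl), by simp, fun c hc _ x' hx' => by
        rw [State.arr_setReg, e11]; exact I1.2 c hc x' hx'⟩ ?_ ?_ (by omega)
    · intro c hc σ3 I3 r20 fr3 g3
      have G3 := G2.fr fr3
      have e50' : σ3.reg 50 = x := by rw [fr3.r 50, e50]
      have e52 : σ3.arr 52 c = I.data B D r q g c 0 x := by rw [fr3.a 52, hval c hc]
      have had := (mul_add_lt hc hx).trans_le hNM
      refine Run.sto_last (c * B ^ r + x) (I.data B D r q g c 0 x) had
        ((I.abs_data_le hB hD).trans (by exact_mod_cast hDX)) ?_ (by simp [r20, e52]) ?_ (by simp) ?_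
      · simp only [Ex.eval_add, Ex.eval_mul, Ex.eval_r, r20, e50', G3.r44]; push_cast; rfl
      · refine ⟨I3.1.fr (s := .seq (.asg 20 0) (.sto 11 0 0)) ⟨fun y _ hy => ?_, fun a ha => ?_⟩
          (fun y => by simp [Stmt.wrR]; omega) (fun a => by simp [Stmt.wrA]; omega), ?_, ?_⟩
        · simp [Stmt.wrR] at hy; simp [hy]
        · simp [Stmt.wrA] at ha; simp [ha]
        · intro c' hc' x' hx'
          simp only [State.arr_setReg, State.arr_setArr, if_true]
          by_cases hcc : c' = c ∧ x' = x
          · rw [hcc.1, hcc.2, Function.update_self]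
          · have : c' * B ^ r + x' ≠ c * B ^ r + x := by
              rw [Ne, mul_add_inj (by omega) hx]; exact hcc
            rw [Function.update_of_ne this]
            by_cases hc2 : c' < c
            · exact I3.2.1 c' hc2 x' hx'
            · exact I3.2.2 c' (by omega) (by omega) x' (by omega)
        · intro c' hc' hcc x' hx'
          simp only [State.arr_setReg, State.arr_setArr, if_true]
          have : c' * B ^ r + x' ≠ c * B ^ r + x := by
            rw [Ne, mul_add_inj (by omega) hx]; omega
          rw [Function.update_of_ne this]
          exact I3.2.2 c' hc' (by omega) x' hx'
      · simp only [Ex.ok_ld, Ex.ok_r, Ex.eval_r, r20, true_and]; norm_cast; omega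
    · intro σ3 I3 _ _ _
      exact ⟨I3.1.fr (s := .asg 50 0) ⟨fun y _ hy => by simp [Stmt.wrR] at hy; simp [hy], fun _ _ => rfl⟩
        (fun y => by simp [Stmt.wrR]; omega) (fun _ => rfl), by simpa using I3.2.1⟩
  · have e : (111 * A + 322 * r + 1700) * Z = (111 * A + 322 * r + 1500) * Z + 200 * Z := by ring
    refine Nat.add_le_add_right (Nat.mul_le_mul_left _ ?_) _
    omega
  · simp [evalAt, Stmt.for, Stmt.wrR, fill, monomS, wrR_zeroA, wrR_zeroR]
  · simp [evalAt, Stmt.for, Stmt.wrR, fill, monomS, wrR_zeroA, wrR_zeroR]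

/-- Interpolate with respect to one variable, for the data from cell `reg 51` on. -/
def pass : Stmt :=
  .for 20 45 (.for 21 41 (.asg 23 0 ;;
    .for 22 41 (.asg 23 (.r 23 + .ld 13 (.r 21 * .r 41 + .r 22) * .ld 11 (.r 51 + (.r 20 * .r 41 + .r 22)))) ;;
    .sto 12 (.r 21 * .r 45 + .r 20) (.r 23 / .r 42))) ;;
  .for 20 44 (.sto 11 (.r 51 + .r 20) (.ld 12 (.r 20)))

lemma Grid.pass_run (mc : Mach) (h : Grid I B D r Z q V d σ) (hBD : 2 * D ≤ B + 1) (hD : 1 ≤ D)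
    (hd : d ≠ 0)
    (hV : ∀ c < B, ∀ e < B, ∑ x ∈ Finset.range B, V c x * (x : ℤ) ^ e = if c = e then d else 0)
    {v : ℕ} (hv : ∀ c < B, ∀ x < B, |V c x| ≤ v) {g c t b : ℕ} (ht : t < r)
    (hX : B * (v * I.dataBound B D r) ≤ mc.X) (hDX : I.dataBound B D r ≤ mc.X)
    (hM : b + B ^ r ≤ mc.M) (hBM : B * B ≤ mc.M) (h51 : σ.reg 51 = b)
    (hF : ∀ y < B ^ r, σ.arr 11 (b + y) = I.data B D r q g c t y) :
    Run mc pass σ (B ^ r * (61 * B + 400)) fun σ' =>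
      (∀ y < B ^ r, σ'.arr 11 (b + y) = I.data B D r q g c (t + 1) y) ∧
      ∀ a, a < b ∨ b + B ^ r ≤ a → σ'.arr 11 a = σ.arr 11 a := by
  have hB : 1 ≤ B := by omega
  obtain ⟨N', hN'⟩ : ∃ N', N' = B ^ (r - 1) := ⟨_, rfl⟩
  have hN : B ^ r = B * N' := by rw [hN', ← pow_succ']; congr 1; omega
  have hN1 : 1 ≤ N' := by rw [hN']; exact Nat.one_le_pow _ _ hB
  have hNN : N' ≤ B * N' := Nat.le_mul_of_pos_left _ hB
  have part : ∀ c' < B, ∀ z, ∀ k ≤ B,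
      |∑ x ∈ Finset.range k, V c' x * I.data B D r q g c t (z * B + x)| ≤ mc.X := by
    intro c' hc' z k hk
    refine (Finset.abs_sum_le_sum_abs _ _).trans ((Finset.sum_le_card_nsmul _ _
      ((v * I.dataBound B D r : ℕ) : ℤ) fun x hx => ?_).trans ?_)
    · rw [abs_mul]; push_cast
      exact mul_le_mul (hv c' hc' x (by rw [Finset.mem_range] at hx; omega)) (I.abs_data_le hB hD)
        (abs_nonneg _) (by positivity)
    · rw [Finset.card_range, nsmul_eq_mul]
      exact_mod_cast (Nat.mul_le_mul_right _ hk).trans hX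
  have hT : N' * (B * (B * 61 + 160 + 11) + 8 + 11) + 8 + (B * N' * 111 + 8) ≤
      B ^ r * (61 * B + 400) := by
    rw [hN]
    have e1 : N' * (B * (B * 61 + 160 + 11) + 8 + 11) = 61 * (B * N' * B) + 171 * (B * N') + 19 * N' := by
      ring
    have e2 : B * N' * (61 * B + 400) = 61 * (B * N' * B) + 400 * (B * N') := by ring
    omega
  refine Run.le ?_ hT
  clear hT
  refine Run.forC_seq N' (B * (B * 61 + 160 + 11) + 8) (fun z (σ' : State) => ∀ z' < z, ∀ c' < B,
    σ'.arr 12 (c' * N' + z') = I.data B D r q g c (t + 1) (c' * N' + z'))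
    (by rw [h.r45, hN']) (by simp) ?_ ?_
  · intro z hz σ1 I1 r20 fr1 g1
    have G1 := h.fr fr1
    refine Run.forC B (B * 61 + 160) (fun C (σ' : State) =>
      (∀ z' < z, ∀ c' < B, σ'.arr 12 (c' * N' + z') = I.data B D r q g c (t + 1) (c' * N' + z')) ∧
      ∀ c' < C, σ'.arr 12 (c' * N' + z) = I.data B D r q g c (t + 1) (c' * N' + z))
      G1.r41 (by simpa using I1) ?_ ?_ le_rfl
    · intro c' hc' σ2 I2 r21 fr2 g2
      have G2 := G1.fr fr2
      have s20 : σ2.reg 20 = z := by rw [fr2.r 20, r20]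
      have s11 : σ2.arr 11 = σ.arr 11 := by rw [fr2.a 11, fr1.a 11]
      have s51 : σ2.reg 51 = b := by rw [fr2.r 51, fr1.r 51, h51]
      refine Run.asg_seq 0 (by simp) rfl (Run.forC_seq B 50 (fun k (σ' : State) => σ'.reg 23 =
        ∑ x ∈ Finset.range k, V c' x * I.data B D r q g c t (z * B + x)) (by simp [G2.r41])
        (by simp) ?_ ?_)
      · intro k hk σ3 I3 r22 fr3 g3
        have G3 := (G2.set 23 0).fr fr3
        have t21 : σ3.reg 21 = c' := by rw [fr3.r 21]; simp [r21]
        have t20 : σ3.reg 20 = z := by rw [fr3.r 20]; simp [s20]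
        have t51 : σ3.reg 51 = b := by rw [fr3.r 51]; simp [s51]
        have t11 : σ3.arr 11 = σ.arr 11 := by rw [fr3.a 11]; simp [s11]
        have hzk : z * B + k < B ^ r := by
          rw [hN, mul_comm B]; exact mul_add_lt hz hk
        have hck := mul_add_lt hc' hk
        refine Run.asg_last (∑ x ∈ Finset.range (k + 1), V c' x * I.data B D r q g c t (z * B + x))
          (part c' hc' z _ hk) ?_ (by simp) ?_
        · simp only [Ex.eval_add, Ex.eval_mul, Ex.eval_ld, Ex.eval_r, I3, t21, G3.r41, r22, t51, t20,
            t11, Finset.sum_range_succ]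
          norm_cast
          rw [G3.a13 c' hc' k hk, hF _ hzk]
        · simp only [Ex.ok_add, Ex.ok_mul, Ex.ok_ld, Ex.ok_r, Ex.eval_add, Ex.eval_mul, Ex.eval_r,
            t21, G3.r41, r22, t51, t20, true_and]
          norm_cast; omega
      · intro σ3 I3 fr3 g3
        have G3 := (G2.set 23 0).fr fr3
        have t21 : σ3.reg 21 = c' := by rw [fr3.r 21]; simp [r21]
        have t20 : σ3.reg 20 = z := by rw [fr3.r 20]; simp [s20]
        have t12 : σ3.arr 12 = σ2.arr 12 := by rw [fr3.a 12]; simp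
        have hcz : c' * N' + z < B * N' := mul_add_lt hc' hz
        have hval : σ3.reg 23 / d = I.data B D r q g c (t + 1) (c' * N' + z) := by
          rw [I3]
          unfold Inst.data
          rw [stage_succ hBD hD hV ht hc' (by rwa [← hN']), Int.mul_ediv_cancel_left _ hd, ← hN']
        refine Run.sto_last (c' * N' + z) (I.data B D r q g c (t + 1) (c' * N' + z)) (by omega)
          ((I.abs_data_le hB hD).trans (by exact_mod_cast hDX)) ?_ (by simp [G3.r42, hval]) ?_
        · simp only [Ex.eval_add, Ex.eval_mul, Ex.eval_r, t21, t20, G3.r45, ← hN']; push_cast; rfl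
        · simp only [State.arr_setReg, State.arr_setArr, if_true, t12]
          refine ⟨fun z' hz' c'' hc'' => ?_, fun c'' hc'' => ?_⟩
          · have : c'' * N' + z' ≠ c' * N' + z := by
              rw [Ne, mul_add_inj (by omega) hz]; omega
            rw [Function.update_of_ne this]; exact I2.1 z' hz' c'' hc''
          · by_cases hcc : c'' = c'
            · subst hcc; rw [Function.update_self]
            · have : c'' * N' + z ≠ c' * N' + z := by
                rw [Ne, mul_add_inj hz hz]; exact fun hh => hcc hh.1
              rw [Function.update_of_ne this]; exact I2.2 c'' (by omega)
    · intro σ2 I2 _ _ _ z' hz' c' hc'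
      rw [State.arr_setReg]
      rcases (by omega : z' < z ∨ z' = z) with hh | rfl
      · exact I2.1 z' hh c' hc'
      · exact I2.2 c' hc'
  · intro σ1 I1 fr1 g1
    have G1 := h.fr fr1
    have s51 : σ1.reg 51 = b := by rw [fr1.r 51, h51]
    have s11 : σ1.arr 11 = σ.arr 11 := by rw [fr1.a 11]
    have hall : ∀ y < B ^ r, σ1.arr 12 y = I.data B D r q g c (t + 1) y := by
      intro y hy
      have := I1 (y % N') (Nat.mod_lt _ hN1) (y / N')
        (Nat.div_lt_of_lt_mul (by rw [hN, mul_comm] at hy; exact hy))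
      rwa [Nat.div_add_mod'] at this
    refine Run.forC (B ^ r) 100 (fun C (σ' : State) =>
      (∀ y < C, σ'.arr 11 (b + y) = I.data B D r q g c (t + 1) y) ∧
      ∀ a, a < b ∨ b + C ≤ a → σ'.arr 11 a = σ.arr 11 a) G1.r44 (by simp [s11]) ?_
      (fun σ' h _ _ _ => h) ?_
    · intro y hy σ2 I2 r20 fr2 g2
      have t12 : σ2.arr 12 y = I.data B D r q g c (t + 1) y := by rw [fr2.a 12, hall y hy]
      have t51 : σ2.reg 51 = b := by rw [fr2.r 51, s51]
      refine Run.sto_last (b + y) (I.data B D r q g c (t + 1) y) (by omega)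
        ((I.abs_data_le hB hD).trans (by exact_mod_cast hDX)) (by simp [t51, r20])
        (by simp [r20, t12]) ?_ (by simp) ?_
      · simp only [State.arr_setReg, State.arr_setArr, if_true]
        refine ⟨fun y' hy' => ?_, fun a ha => ?_⟩
        · by_cases hyy : y' = y
          · subst hyy; rw [Function.update_self]
          · rw [Function.update_of_ne (by omega)]; exact I2.1 y' (by omega)
        · rw [Function.update_of_ne (by omega)]; exact I2.2 a (by omega)
      · simp only [Ex.ok_ld, Ex.ok_r, Ex.eval_r, r20, true_and]; norm_cast; omega
    · rw [hN]; omega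

end


/-- Add the interpolated counts for the pair `reg 53` and the chunk `reg 49` to the counters. -/
def addS : Stmt :=
  .for 20 44 (.asg 27 (.r 20) ;; .asg 28 0 ;; .asg 26 1 ;;
    .for 29 43 (.asg 28 (.r 28 + (.r 27 - .r 27 / .r 41 * .r 41) * .r 26) ;; .asg 27 (.r 27 / .r 41) ;;
      .asg 26 (.r 26 * .r 40)) ;;
    .asg 28 ((.r 49 * .r 48 + .r 53) * .r 13 + (.r 28 - .r 28 / .r 13 * .r 13)) ;;
    .sto 6 (.r 28) (.ld 6 (.r 28) + .ld 11 (.r 51 + .r 20)))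

def fast (p : Prog) (R A : ℕ) : Stmt :=
  .for 49 10 (evalAll p R A ;; .for 53 48 (.asg 51 (.r 53 * .r 44) ;; .for 52 43 pass ;; addS))

section
variable {I : Inst} {B D r Z q : ℕ} {V : ℕ → ℕ → ℤ} {d : ℤ} {σ : State}

lemma Grid.addS_run (mc : Mach) (h : Grid I B D r Z q V d σ) (hBD : 2 * D ≤ B + 1) (hD : 1 ≤ D)
    (hq : 1 ≤ q) {g c b : ℕ} (hg : g < I.P) (hc : c < I.n * I.n)
    (h49 : σ.reg 49 = g) (h53 : σ.reg 53 = c) (h51 : σ.reg 51 = b) {F : ℕ → ℤ} {U : ℕ}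
    (hF : ∀ y < B ^ r, σ.arr 11 (b + y) = F y) (hU : ∀ y, |F y| ≤ U)
    (h6 : ∀ u, σ.arr 6 ((g * (I.n * I.n) + c) * q + u) = 0 ∨ q ≤ u)
    (hNX : B ^ r ≤ mc.X) (hUX : B ^ r * U ≤ mc.X) (hbM : b + B ^ r ≤ mc.M)
    (hM6 : I.P * (I.n * I.n) * q ≤ mc.M) (hX6 : I.P * (I.n * I.n) * q ≤ mc.X) :
    Run mc addS σ (B ^ r * (161 * r + 500) + 8) fun σ' => ∀ a, σ'.arr 6 a = σ.arr 6 a +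
      if a / q = g * (I.n * I.n) + c then
        ∑ y ∈ Finset.range (B ^ r), if dec B D r y % q = a % q then F y else 0 else 0 := by
  have hB : 1 ≤ B := by omega
  have hDB : D ≤ B := by omega
  have hidx : g * (I.n * I.n) + c < I.P * (I.n * I.n) := mul_add_lt hg hc
  obtain ⟨e, he⟩ : ∃ e, e = g * (I.n * I.n) + c := ⟨_, rfl⟩
  rw [← he] at hidx
  rw [← he]
  have part : ∀ k ≤ B ^ r, ∀ u, |∑ y ∈ Finset.range k, if dec B D r y % q = u then F y else 0| ≤ mc.X := by
    intro k hk u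
    refine (Finset.abs_sum_le_sum_abs _ _).trans ((Finset.sum_le_card_nsmul _ _ (U : ℤ)
      fun y hy => ?_).trans ?_)
    · split_ifs
      · exact hU y
      · simp
    · rw [Finset.card_range, nsmul_eq_mul]
      exact_mod_cast (Nat.mul_le_mul_right _ hk).trans hUX
  refine Run.forC (B ^ r) (161 * r + 480) (fun k (σ' : State) => ∀ a, σ'.arr 6 a = σ.arr 6 a +
      if a / q = e then ∑ y ∈ Finset.range k, if dec B D r y % q = a % q then F y else 0 else 0)
    h.r44 (by simp) ?_ (fun σ' h _ _ _ => h) (by lia)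
  intro y hy σ1 I1 r20 fr1 g1
  have G1 := h.fr fr1
  have s49 : σ1.reg 49 = g := by rw [fr1.r 49, h49]
  have s53 : σ1.reg 53 = c := by rw [fr1.r 53, h53]
  have s51 : σ1.reg 51 = b := by rw [fr1.r 51, h51]
  have s11 : σ1.arr 11 = σ.arr 11 := by rw [fr1.a 11]
  refine Run.asg_seq (y : ℤ) (abs_cast_le (by omega)) (by simp [r20]) ?_
  refine Run.asg_seq 0 (by simp) rfl (Run.asg_seq 1 (by simp; omega) rfl ?_)
  refine Run.forC_seq r 150 (fun t (σ' : State) => ∃ y' acc : ℕ, y' ≤ y ∧ σ'.reg 27 = y' ∧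
    σ'.reg 28 = acc ∧ σ'.reg 26 = (D ^ t : ℕ) ∧ acc + D ^ t * dec B D (r - t) y' = dec B D r y)
    (by simp [G1.r43]) ⟨y, 0, le_rfl, by simp, by simp, by simp, by simp⟩ ?_ ?_
  · rintro t ht σ2 ⟨y', acc, hy', s27, s28, s26, hacc⟩ - fr2 g2
    have t41 : σ2.reg 41 = B := by rw [fr2.r 41]; simp [G1.r41]
    have t40 : σ2.reg 40 = D := by rw [fr2.r 40]; simp [G1.r40]
    obtain ⟨u, hu⟩ : ∃ u, r - t = u + 1 := ⟨r - t - 1, by omega⟩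
    rw [hu, dec] at hacc
    have hnew : acc + y' % B * D ^ t + D ^ (t + 1) * dec B D u (y' / B) = dec B D r y := by
      rw [← hacc, pow_succ]; ring
    have hle := dec_le hDB r y
    have hpow : D ^ (t + 1) ≤ B ^ r :=
      (Nat.pow_le_pow_left hDB _).trans (Nat.pow_le_pow_right hB ht)
    refine Run.asg_seq (x := 28) ((acc + y' % B * D ^ t : ℕ) : ℤ) ?_ ?_ ?_
    · rw [Nat.abs_cast]; norm_cast; generalize D ^ (t + 1) * dec B D u (y' / B) = w at *; omega
    · simp only [Ex.eval_add, Ex.eval_sub, Ex.eval_mul, Ex.eval_div, Ex.eval_r, s27, s28, s26, t41]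
      rw [sub_div_mul]; push_cast; ring
    · refine Run.asg_seq ((y' / B : ℕ) : ℤ) ?_ (by simp [s27, t41]) ?_
      · rw [Nat.abs_cast]; have := Nat.div_le_self y' B; norm_cast; omega
      refine Run.asg_last ((D ^ (t + 1) : ℕ) : ℤ) (abs_cast_le (by omega))
        (by simp [s26, t40, pow_succ]) ?_
      refine ⟨y' / B, acc + y' % B * D ^ t, (Nat.div_le_self _ _).trans hy', by simp, by simp, by simp, ?_⟩
      rw [show r - (t + 1) = u by omega]; exact hnew
  · rintro σ2 ⟨y', acc, -, s27, s28, -, hacc⟩ fr2 g2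
    rw [Nat.sub_self, dec, mul_zero, add_zero] at hacc
    subst hacc
    have G2 := (((G1.set 27 _).set 28 _).set 26 _).fr fr2
    have t49 : σ2.reg 49 = g := by rw [fr2.r 49]; simp [s49]
    have t53 : σ2.reg 53 = c := by rw [fr2.r 53]; simp [s53]
    have t51 : σ2.reg 51 = b := by rw [fr2.r 51]; simp [s51]
    have t20 : σ2.reg 20 = y := by rw [fr2.r 20]; simp [r20]
    have t11 : σ2.arr 11 = σ.arr 11 := by rw [fr2.a 11]; simp [s11]
    have t6 : σ2.arr 6 = σ1.arr 6 := by rw [fr2.a 6]; simp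
    have hu : dec B D r y % q < q := Nat.mod_lt _ hq
    have had : e * q + dec B D r y % q < I.P * (I.n * I.n) * q := mul_add_lt hidx hu
    have hdm : (e * q + dec B D r y % q) / q = e ∧ (e * q + dec B D r y % q) % q = dec B D r y % q := by
      constructor
      · rw [add_comm, Nat.add_mul_div_right _ _ (by omega), Nat.div_eq_of_lt hu, zero_add]
      · rw [add_comm, Nat.add_mul_mod_self_right, Nat.mod_eq_of_lt hu]
    obtain ⟨a0, ha0⟩ : ∃ a0, a0 = e * q + dec B D r y % q := ⟨_, rfl⟩
    rw [← ha0] at hdm had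
    have hFy := hF y hy
    have hstep : ∀ a, σ1.arr 6 a + (if a = a0 then F y else 0) = σ.arr 6 a +
        if a / q = e then ∑ y ∈ Finset.range (y + 1), if dec B D r y % q = a % q then F y else 0
        else 0 := by
      intro a
      rw [I1 a, Finset.sum_range_succ]
      by_cases haa : a = a0
      · subst haa; rw [if_pos hdm.1, if_pos rfl, if_pos hdm.2.symm, if_pos hdm.1, add_assoc]
      · rw [if_neg haa, add_zero]
        by_cases h1 : a / q = e
        · rw [if_pos h1, if_pos h1, if_neg, add_zero]
          intro h2
          apply haa
          rw [ha0, h2, ← h1, Nat.div_add_mod']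
        · rw [if_neg h1, if_neg h1]
    refine Run.asg_seq (a0 : ℤ) (abs_cast_le (by omega)) ?_ ?_
    · simp only [Ex.eval_add, Ex.eval_sub, Ex.eval_mul, Ex.eval_div, Ex.eval_r, s28, t49, t53,
        G2.r13, G2.r48]
      rw [sub_div_mul, ha0, he]; push_cast; rfl
    · refine Run.sto_last a0 (σ1.arr 6 a0 + F y) (by omega) ?_ (by simp) ?_ ?_ ?_ ?_
      · have h7 := hstep a0
        rw [if_pos rfl, if_pos hdm.1] at h7
        have h8 : σ.arr 6 a0 = 0 := by
          rw [ha0, he]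
          exact (h6 _).resolve_right (by omega)
        rw [h7, h8, zero_add]
        exact part _ hy _
      · simp only [Ex.eval_add, Ex.eval_ld, Ex.eval_r, State.reg_setReg, State.arr_setReg, if_true]
        norm_num [t51, t20, t6, t11]
        norm_cast
      · intro a
        rw [← hstep a]
        simp only [State.arr_setReg, State.arr_setArr, if_true, t6]
        by_cases haa : a = a0
        · subst haa; simp
        · rw [Function.update_of_ne haa]; simp [haa]
      · simp
      · simp only [Ex.ok_add, Ex.ok_ld, Ex.ok_r, Ex.eval_add, Ex.eval_r, State.reg_setReg, if_true]
        norm_num [t51, t20]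
        norm_cast; omega

lemma Inst.res_add (I : Inst) {q : ℕ} (hq : 1 ≤ q) (i j k : ℕ) :
    (I.resA q i k + I.resB q j k) % q = res q (I.tot i j k) := by
  have : (((I.resA q i k + I.resB q j k) % q : ℕ) : ℤ) = (res q (I.tot i j k) : ℤ) := by
    rw [cast_res hq]; push_cast
    rw [Inst.resA, Inst.resB, cast_res hq, cast_res hq, ← Int.add_emod, Inst.tot]
  exact_mod_cast this

lemma Inst.sum_data (I : Inst) (hBD : 2 * D ≤ B + 1) (hD : 1 ≤ D) (hq : 1 ≤ q) (hqD : q ≤ D ^ r)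
    (g c u : ℕ) :
    ∑ y ∈ Finset.range (B ^ r), (if dec B D r y % q = u then I.data B D r q g c r y else 0) =
      I.cnt q g (c / I.n) (c % I.n) u := by
  unfold Inst.data
  rw [sum_stage hBD hD (fun k _ => ?_) (fun k _ => ?_)]
  rotate_left
  · exact (res_lt hq _).trans_le hqD
  · exact (res_lt hq _).trans_le hqD
  rw [Inst.cnt, Inst.chunk, Finset.filter_filter]
  simp only [I.res_add hq]

lemma Grid.fast_run (mc : Mach) (h : Grid I B D r Z q V d σ) {p : Prog} {R A Y : ℕ}
    (hbox : Box mc I p R A Z Y) (hO : Outer R A Z σ) (hBD : 2 * D ≤ B + 1) (hD : 1 ≤ D)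
    (hd : d ≠ 0)
    (hV : ∀ c < B, ∀ e < B, ∑ x ∈ Finset.range B, V c x * (x : ℤ) ^ e = if c = e then d else 0)
    {v : ℕ} (hv : ∀ c < B, ∀ x < B, |V c x| ≤ v)
    (hq : 1 ≤ q) (hqD : q ≤ D ^ r) (h6 : ∀ a, σ.arr 6 a = 0)
    (hX : (B * v + 1) * (B ^ r * I.dataBound B D r) ≤ mc.X)
    (hY : (B ^ r) ^ D ≤ Y) (hIY : I.Y ≤ mc.X) (hnmX : I.n * I.m ≤ mc.X)
    (hBM : B * B ≤ mc.M) (hNM : I.n * I.n * B ^ r ≤ mc.M)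
    (hNX : I.n * I.n * B ^ r ≤ mc.X)
    (hM6 : I.P * (I.n * I.n) * q ≤ mc.M) (hX6 : I.P * (I.n * I.n) * q ≤ mc.X) :
    Run mc (fast p R A) σ (I.P * (B ^ r * ((111 * A + 2000) * (r + 1) * (10 * A + R + B + 10) * Z)) + 8)
      (Counted I q) := by
  have hn := I.hn
  have hm := I.hm
  have hB : 1 ≤ B := by omega
  have hn1 : 1 ≤ I.n * I.n := Nat.mul_pos hn hn
  have hN1 : 1 ≤ B ^ r := Nat.one_le_pow _ _ hB
  have hnnZ : I.n * I.n ≤ Z := (Nat.mul_le_mul_left _ I.hnm).trans hbox.nm_le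
  have hpow1 : 1 ≤ (B ^ r) ^ D := Nat.one_le_pow _ _ hN1
  have hDB1 : (B ^ r) ^ D ≤ I.dataBound B D r := by
    unfold Inst.dataBound
    calc (B ^ r) ^ D ≤ (B ^ r) ^ D * (B ^ r) ^ D := Nat.le_mul_of_pos_left _ hpow1
      _ ≤ _ := Nat.le_mul_of_pos_left _ hm
  obtain ⟨U, hU⟩ : ∃ U, U = I.dataBound B D r := ⟨_, rfl⟩
  rw [← hU] at hDB1 hX
  have hUX : B ^ r * U ≤ mc.X := le_trans (Nat.le_mul_of_pos_left _ (by omega)) hX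
  have hUX1 : U ≤ mc.X := (Nat.le_mul_of_pos_left _ hN1).trans hUX
  have hvX : B * (v * U) ≤ mc.X := by
    refine le_trans ?_ hX
    calc B * (v * U) = B * v * U := by ring
      _ ≤ (B * v + 1) * (B ^ r * U) := Nat.mul_le_mul (by omega) (Nat.le_mul_of_pos_left _ hN1)
  have hNX1 : B ^ r ≤ mc.X := (Nat.le_mul_of_pos_left _ hn1).trans hNX
  have hqX : q ≤ mc.X := le_trans (Nat.le_mul_of_pos_left _ (Nat.mul_pos I.one_le_P hn1)) hX6
  have hPX : I.P ≤ mc.X := by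
    refine le_trans ?_ hX6
    rw [mul_assoc]; exact Nat.le_mul_of_pos_right _ (Nat.mul_pos hn1 hq)
  have hBD' : B * D ≤ mc.M := (Nat.mul_le_mul_left _ (by omega)).trans hBM
  have hT : B ^ r * ((111 * A + 322 * r + 1700) * Z + (10 * A + R)) + 8 +
      (I.n * I.n * (50 + (r * (B ^ r * (61 * B + 400) + 11) + 8) + (B ^ r * (161 * r + 500) + 8) + 11) + 8)
      + 11 ≤ B ^ r * ((111 * A + 2000) * (r + 1) * (10 * A + R + B + 10) * Z) := by
    have hZ1 : 1 ≤ Z := hn1.trans hnnZ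
    generalize B ^ r = N at *
    have h1 : (10 * A + R) ≤ (10 * A + R) * Z := Nat.le_mul_of_pos_right _ hZ1
    have h2 : I.n * I.n * (50 + (r * (N * (61 * B + 400) + 11) + 8) + (N * (161 * r + 500) + 8) + 11) ≤
        Z * (N * (77 + (r * (61 * B + 411)) + (161 * r + 500))) := by
      refine Nat.mul_le_mul hnnZ ?_
      have : r * (N * (61 * B + 400) + 11) ≤ N * (r * (61 * B + 411)) := by
        have : r * 11 ≤ r * 11 * N := Nat.le_mul_of_pos_right _ hN1
        calc _ = N * (r * (61 * B + 400)) + r * 11 := by ring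
          _ ≤ N * (r * (61 * B + 400)) + r * 11 * N := by omega
          _ = _ := by ring
      have e : N * (77 + (r * (61 * B + 411)) + (161 * r + 500)) =
        N * 77 + N * (r * (61 * B + 411)) + N * (161 * r + 500) := by ring
      omega
    have hNZ : 1 ≤ N * Z := Nat.mul_pos hN1 hZ1
    calc _ ≤ N * ((111 * A + 322 * r + 1700) * Z + (10 * A + R) * Z) + 8 +
        (Z * (N * (77 + (r * (61 * B + 411)) + (161 * r + 500))) + 8) + 11 := by gcongr
      _ = (N * Z) * ((111 * A + 322 * r + 1700) + (10 * A + R) +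
          (77 + (r * (61 * B + 411)) + (161 * r + 500))) + 27 := by ring
      _ ≤ (N * Z) * ((111 * A + 322 * r + 1700) + (10 * A + R) +
          (77 + (r * (61 * B + 411)) + (161 * r + 500)) + 27) := by
        rw [Nat.mul_add (N * Z) _ 27]; omega
      _ ≤ (N * Z) * ((111 * A + 2000) * (r + 1) * (10 * A + R + B + 10)) := by
        refine Nat.mul_le_mul_left _ ?_
        nlinarith [Nat.zero_le (A * r), Nat.zero_le (A * R), Nat.zero_le (A * B), Nat.zero_le (r * B),
          Nat.zero_le (r * R), Nat.zero_le (A * A), Nat.zero_le (A * A * r), Nat.zero_le (A * B * r),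
          Nat.zero_le (A * R * r)]
      _ = _ := by ring
  have safeP : Stmt.safeG (.for 53 48 (.asg 51 (.r 53 * .r 44) ;; .for 52 43 pass ;; addS)) = true :=
    rfl
  have safeF : (fast p R A).safeG = true := by
    have := @safeG_evalAll p R A
    simp only [Stmt.safeG, Stmt.safe, Bool.and_eq_true, Bool.not_eq_true', Bool.or_eq_false_iff] at this
    simp [fast, Stmt.safeG, Stmt.safe, Stmt.for, Stmt.wrR, Stmt.wrA, this, pass, addS]
  obtain ⟨tgt, htgt⟩ : ∃ tgt : ℕ → ℕ → ℤ, tgt = fun idx u => (I.cnt q (idx / (I.n * I.n))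
    (idx % (I.n * I.n) / I.n) (idx % (I.n * I.n) % I.n) u : ℤ) := ⟨_, rfl⟩
  refine Run.forC I.P (B ^ r * ((111 * A + 322 * r + 1700) * Z + (10 * A + R)) + 8 +
      (I.n * I.n * (50 + (r * (B ^ r * (61 * B + 400) + 11) + 8) + (B ^ r * (161 * r + 500) + 8) + 11) + 8))
    (fun g (σ' : State) => Outer R A Z σ' ∧ ∀ a, σ'.arr 6 a =
      if a / q < g * (I.n * I.n) then tgt (a / q) (a % q) else 0) h.r10
    ⟨hO.fr (s := .asg 49 0) ⟨fun y _ hy => by simp [Stmt.wrR] at hy; simp [hy], fun _ _ => rfl⟩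
      (fun y => by simp [Stmt.wrR]; omega) (fun _ => rfl), by simp [h6]⟩ ?_ ?_
    (Nat.add_le_add_right (Nat.mul_le_mul_left _ hT) _) (hsx := ?_) (hsy := ?_)
  · intro g hg σ1 I1 r49 fr1 g1
    have G1 := h.fr fr1 safeF
    refine Run.seqB _ (G1.evalAll_run mc hbox I1.1 hB hD hq r49 hNX1 (by omega) hqX hBD' hY
      (hDB1.trans hUX1) hIY hnmX hNM (by omega)) fun σ2 I2 fr2 g2 => ?_
    have G2 := G1.fr fr2 safeG_evalAll
    have s49 : σ2.reg 49 = g := by rw [fr2.r 49 wr_evalAll.1, r49]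
    have s6 : σ2.arr 6 = σ1.arr 6 := fr2.a 6 wr_evalAll.2
    refine Run.forC (I.n * I.n) (50 + (r * (B ^ r * (61 * B + 400) + 11) + 8) +
        (B ^ r * (161 * r + 500) + 8))
      (fun c (σ' : State) => Outer R A Z σ' ∧ (∀ a, σ'.arr 6 a =
        if a / q < g * (I.n * I.n) + c then tgt (a / q) (a % q) else 0) ∧
        ∀ c' < I.n * I.n, c ≤ c' → ∀ x < B ^ r,
          σ'.arr 11 (c' * B ^ r + x) = I.data B D r q g c' 0 x) G2.r48
      ⟨I2.1.fr (s := .asg 53 0) ⟨fun y _ hy => by simp [Stmt.wrR] at hy; simp [hy], fun _ _ => rfl⟩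
        (fun y => by simp [Stmt.wrR]; omega) (fun _ => rfl), by simpa [s6] using I1.2,
        fun c' hc' _ x hx => by rw [State.arr_setReg]; exact I2.2 c' hc' x hx⟩ ?_ ?_ (by omega)
    · intro c hc σ3 I3 r53 fr3 g3
      have G3 := G2.fr fr3
      have hcN : c * B ^ r + B ^ r ≤ I.n * I.n * B ^ r := by
        rw [← Nat.succ_mul]; exact Nat.mul_le_mul_right _ hc
      obtain ⟨b, hb⟩ : ∃ b, b = c * B ^ r := ⟨_, rfl⟩
      have hbM : b + B ^ r ≤ mc.M := by rw [hb]; exact hcN.trans hNM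
      have hd0 := I3.2.2 c hc le_rfl
      rw [← hb] at hd0
      refine Run.asg_seq (b : ℤ) (abs_cast_le (by omega))
        (by simp [r53, G3.r44, hb]) ?_
      refine Run.forC_seq r (B ^ r * (61 * B + 400)) (fun t (σ' : State) =>
        (∀ y < B ^ r, σ'.arr 11 (b + y) = I.data B D r q g c t y) ∧
        ∀ a, a < b ∨ b + B ^ r ≤ a → σ'.arr 11 a = σ3.arr 11 a) (by simp [G3.r43])
        (by simpa using hd0) ?_ ?_
      · intro t ht σ4 I4 _ fr4 g4
        have G4 := (G3.set 51 b).fr fr4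
        refine Run.mono (G4.pass_run mc hBD hD hd hV hv (g := g) (c := c) ht (by rw [← hU]; exact hvX)
          (by omega) hbM hBM (by rw [fr4.r 51]; simp) I4.1) le_rfl fun σ5 I5 => ⟨I5.1, fun a ha => ?_⟩
        rw [State.arr_setReg, I5.2 a ha, I4.2 a ha]
      · intro σ4 I4 fr4 g4
        have G4 := (G3.set 51 b).fr fr4
        have t6 : σ4.arr 6 = σ3.arr 6 := by rw [fr4.a 6]; simp
        refine Run.le (Run.mono (Run.frame (G4.addS_run mc hBD hD hq hg hc
          (by rw [fr4.r 49]; simp [fr3.r 49, s49]) (by rw [fr4.r 53]; simp [r53])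
          (by rw [fr4.r 51]; simp) I4.1 (fun y => I.abs_data_le hB hD)
          (fun u => ?_) hNX1 (by rw [← hU]; exact hUX) hbM hM6 hX6)) le_rfl ?_) (by omega)
        · by_cases hu : u < q
          · left
            rw [t6, I3.2.1, if_neg]
            rw [add_comm, Nat.add_mul_div_right _ _ (by omega), Nat.div_eq_of_lt hu]; omega
          · right; omega
        · rintro σ5 ⟨I5, fr5, -⟩
          refine ⟨(I3.1.fr (σ' := σ4) (s := .seq (.asg 51 0) (.for 52 43 pass)) ⟨fun y hy hw => ?_, fun a ha => ?_⟩
            (fun y => by simp [Stmt.wrR, Stmt.for, pass]; omega)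
            (fun a => by simp [Stmt.wrA, Stmt.for, pass]; omega)).fr (s := .seq (.asg 53 0) addS)
            ⟨fun y hy hw => ?_, fun a ha => ?_⟩ (fun y => by simp [Stmt.wrR, Stmt.for, addS]; omega)
            (fun a => by simp [Stmt.wrA, Stmt.for, addS]; omega), fun a => ?_, fun c' hc' hcc x hx => ?_⟩
          · simp only [Stmt.wrR, Bool.or_eq_false_iff, decide_eq_false_iff_not] at hw
            rw [fr4.reg y hy hw.2]; simp [hw.1]
          · rw [fr4.arr a ha]; simp
          · simp only [Stmt.wrR, Bool.or_eq_false_iff, decide_eq_false_iff_not] at hw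
            rw [State.reg_setReg, if_neg hw.1, fr5.reg y hy hw.2]
          · rw [State.arr_setReg, fr5.arr a ha]
          · rw [State.arr_setReg, I5, t6, I3.2.1, I.sum_data hBD hD hq hqD]
            by_cases h1 : a / q = g * (I.n * I.n) + c
            · rw [if_neg (by omega), if_pos h1, if_pos (by omega), zero_add, htgt]
              simp only [h1]
              rw [add_comm (g * (I.n * I.n)) c, Nat.add_mul_div_right _ _ (by omega),
                Nat.div_eq_of_lt hc, Nat.add_mul_mod_self_right, Nat.mod_eq_of_lt hc, zero_add]
            · rw [if_neg h1, add_zero]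
              exact if_congr (by omega) rfl rfl
          · rw [State.arr_setReg, fr5.a 11, I4.2 _ (Or.inr ?_)]
            · exact I3.2.2 c' hc' (by omega) x hx
            · have : (c + 1) * B ^ r ≤ c' * B ^ r := Nat.mul_le_mul_right _ hcc
              rw [Nat.succ_mul] at this
              omega
    · intro σ3 I3 _ _ _
      refine ⟨I3.1.fr (s := .asg 49 0) ⟨fun y _ hy => by simp [Stmt.wrR] at hy; simp [hy], fun _ _ => rfl⟩
        (fun y => by simp [Stmt.wrR]; omega) (fun _ => rfl), fun a => ?_⟩
      rw [State.arr_setReg, I3.2.1, Nat.succ_mul]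
  · rintro σ1 ⟨-, I1⟩ _ _ _
    refine ⟨fun a => ?_, fun g hg i hi j hj u hu => ?_⟩
    · rw [I1]
      split_ifs
      · rw [htgt, Nat.abs_cast]
        exact_mod_cast (I.cnt_le _ _ _ _ _).trans (Nat.le_mul_of_pos_left _ hn1)
      · rw [abs_zero]; positivity
    · have hij : i * I.n + j < I.n * I.n := mul_add_lt hi hj
      have e1 : adr I.n q g i j u / q = g * (I.n * I.n) + (i * I.n + j) := by
        rw [adr, add_comm, Nat.add_mul_div_right _ _ hq, Nat.div_eq_of_lt hu]; ring
      have e2 : adr I.n q g i j u % q = u := by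
        rw [adr, add_comm, Nat.add_mul_mod_self_right, Nat.mod_eq_of_lt hu]
      have e3 : g * (I.n * I.n) + (i * I.n + j) < I.P * (I.n * I.n) := mul_add_lt hg hij
      rw [I1, e1, if_pos e3, e2, htgt]
      simp only
      rw [add_comm (g * (I.n * I.n)), Nat.add_mul_div_right _ _ (by omega),
        Nat.div_eq_of_lt hij, Nat.add_mul_mod_self_right, Nat.mod_eq_of_lt hij, zero_add,
        add_comm (i * I.n), Nat.add_mul_div_right _ _ hn, Nat.div_eq_of_lt hj,
        Nat.add_mul_mod_self_right, Nat.mod_eq_of_lt hj, zero_add]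
  · have := @safeG_evalAll p R A
    simp [wr_evalAll, Stmt.for, Stmt.wrR, pass, addS]
  · have := @safeG_evalAll p R A
    simp only [Stmt.safeG, Bool.and_eq_true, Bool.not_eq_true', Bool.or_eq_false_iff] at this
    simp [this, Stmt.for, Stmt.wrR, pass, addS]

end


/-- Write the constants `F 0, …, F (k - 1)` into array `a`. -/
def tab (a : ℕ) (F : ℕ → ℤ) : ℕ → Stmt
  | 0 => .skip
  | k + 1 => tab a F k ;; .asgc 20 k ;; .asgc 21 (F k) ;; .sto a (.r 20) (.r 21)

@[simp] lemma wrR_tab {a : ℕ} {F : ℕ → ℤ} {k y : ℕ} :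
    (tab a F k).wrR y = (decide (0 < k) && (decide (y = 20) || decide (y = 21))) := by
  induction k with
  | zero => simp [tab, Stmt.wrR]
  | succ k ih => rw [tab]; simp only [Stmt.wrR, ih]; by_cases h : 0 < k <;> simp [h]

@[simp] lemma wrA_tab {a : ℕ} {F : ℕ → ℤ} {k y : ℕ} :
    (tab a F k).wrA y = (decide (0 < k) && decide (y = a)) := by
  induction k with
  | zero => simp [tab, Stmt.wrA]
  | succ k ih => rw [tab]; simp only [Stmt.wrA, ih]; by_cases h : 0 < k <;> simp [h]

lemma tab_run (mc : Mach) (a : ℕ) (F : ℕ → ℤ) {K : ℕ} (hKM : K ≤ mc.M) (hKX : K ≤ mc.X)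
    (hF : ∀ i < K, |F i| ≤ mc.X) (k : ℕ) (hk : k ≤ K) {σ : State} :
    Run mc (tab a F k) σ (102 * k + 1) fun σ' => ∀ i < k, σ'.arr a i = F i := by
  induction k with
  | zero => exact Run.skip_last (by simp)
  | succ k ih =>
    refine Run.seqB _ (ih (by omega)) fun σ1 I1 fr1 g1 => ?_
    refine Run.seqB 1 (Run.asgc (Q := fun σ' => σ' = σ1.setReg 20 k)
      (abs_cast_le (by omega)) rfl) ?_
    rintro _ rfl - -
    refine Run.seqB 1 (Run.asgc (Q := fun σ' => σ' = (σ1.setReg 20 k).setReg 21 (F k))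
      (hF k hk) rfl) ?_
    rintro _ rfl - -
    refine Run.sto_last k (F k) (by omega) (hF k hk) (by simp) (by simp) fun i hi => ?_
    simp only [State.arr_setArr, State.arr_setReg, if_true]
    by_cases h : i = k
    · subst h; simp
    · rw [Function.update_of_ne h]; exact I1 i (by omega)

/-- Compile-time data of fast counting: bases, interpolation coefficients and their denominator,
the exponent `a / e` and the constant `C` of the multiplication program. -/
structure FastData where
  D : ℕ
  B : ℕ
  V : ℕ → ℕ → ℤ
  d : ℤ
  v : ℕ
  a : ℕ
  e : ℕ
  C : ℕ
  hD : 2 ≤ D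
  hBD : B + 1 = 2 * D
  hd : d ≠ 0
  hV : ∀ c < B, ∀ e < B, ∑ x ∈ Finset.range B, V c x * (x : ℤ) ^ e = if c = e then d else 0
  hv : ∀ c < B, ∀ x < B, |V c x| ≤ v
  he : 1 ≤ e

namespace FastData

def r (K : FastData) (q : ℕ) : ℕ := Nat.clog K.D q
/-- Exponent of the power of two that replaces `n ^ (a / e)`. -/
def u (K : FastData) (n : ℕ) : ℕ := Nat.clog (2 ^ K.e) (n ^ K.a)
def Z (K : FastData) (n : ℕ) : ℕ := K.C * 2 ^ K.u n

def setup (K : FastData) : Stmt :=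
  tab 13 (fun i => K.V (i / K.B) (i % K.B)) (K.B * K.B) ;;
  tab 14 (fun i => ((i / K.D) ^ (i % K.D) : ℕ)) (K.B * K.D) ;;
  .asgc 40 K.D ;; .asgc 41 K.B ;; .asgc 42 K.d ;;
  .asg 43 0 ;; .asg 44 1 ;; .asg 45 1 ;; .asg 55 1 ;;
  .whl (.r 13 - .r 55)
    (.asg 45 (.r 44) ;; .asg 44 (.r 44 * .r 41) ;; .asg 55 (.r 55 * .r 40) ;; .asg 43 (.r 43 + 1)) ;;
  powS 56 0 K.a ;; .asg 54 1 ;; powS 57 54 K.e ;;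
  .whl (.r 56 - .r 57) (.asg 54 (.r 54 + .r 54) ;; powS 57 54 K.e) ;;
  .asgc 58 K.C ;; .asg 46 (.r 58 * .r 54) ;; .asg 47 (.r 0 * .r 1) ;; .asg 48 (.r 0 * .r 0)

/-- Fast counting if the memory suffices, direct counting otherwise. -/
def choose (K : FastData) (p : Prog) (R A : ℕ) : Stmt :=
  K.setup ;; .ite (.r 1 - .r 44 * .r 2 + 1)
    (.ite (.r 48 * .r 1 - .r 46 * .r 2 + 1) (fast p R A) countAll) countAll

lemma u_spec (K : FastData) (n : ℕ) {t : ℕ} : n ^ K.a ≤ (2 ^ t) ^ K.e ↔ K.u n ≤ t := by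
  have h2 : 1 < 2 ^ K.e := Nat.one_lt_two_pow (by have := K.he; omega)
  rw [u, ← pow_mul, mul_comm, pow_mul, Nat.clog_le_iff_le_pow h2]

lemma r_spec (K : FastData) (q : ℕ) {t : ℕ} : q ≤ K.D ^ t ↔ K.r q ≤ t := by
  rw [r, Nat.clog_le_iff_le_pow K.hD]

variable (K : FastData) {mc : Mach} {I : Inst} {q : ℕ} {σ : State}

lemma setup_run (hE : Env I σ) (h10 : σ.reg 10 = I.P) (h13 : σ.reg 13 = q)
    (hCX : K.B * K.B + K.v + K.B ^ K.D + K.C ≤ mc.X) (hdX : |K.d| ≤ mc.X) (hBM : K.B * K.B ≤ mc.M)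
    (hrX : K.B * K.B ^ K.r q * K.D ^ (K.r q + 1) ≤ mc.X)
    (huX : (K.C + 1) * (2 ^ (K.u I.n + 1)) ^ K.e ≤ mc.X) (hnX : I.n ^ (K.a + 1) ≤ mc.X)
    (hnmX : I.n * I.m ≤ mc.X) :
    Run mc K.setup σ (300 * (K.B * K.B) + 251 * K.r q + (K.u I.n + 2) * (50 * K.e + 200) + 50 * K.a + 1000)
      fun σ' => Grid I K.B K.D (K.r q) (K.Z I.n) q K.V K.d σ' := by
  have hD := K.hD
  have hBD := K.hBD
  have hDB : K.D ≤ K.B := by omega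
  have hB : 1 ≤ K.B := by omega
  have hn := I.hn
  have hnn : I.n * I.n ≤ I.n * I.m := Nat.mul_le_mul_left _ I.hnm
  have hBDle : K.B * K.D ≤ K.B * K.B := Nat.mul_le_mul_left _ hDB
  have hnX1 : I.n ≤ mc.X := (Nat.le_self_pow (by omega) _).trans hnX
  have hBB : K.B ≤ K.B * K.B := Nat.le_mul_of_pos_left _ hB
  have hT : 102 * (K.B * K.B) + 1 + (102 * (K.B * K.D) + 1) + 1 + 1 + 1 + 50 + 50 + 50 + 50 +
      (K.r q * (200 + 51) + 51) + 50 * (K.a + 1) + 50 + 50 * (K.e + 1) +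
      (K.u I.n * (50 * (K.e + 1) + 50 + 51) + 51) + 1 + 150 ≤
      300 * (K.B * K.B) + 251 * K.r q + (K.u I.n + 2) * (50 * K.e + 200) + 50 * K.a + 1000 := by
    have : (K.u I.n + 2) * (50 * K.e + 200) = K.u I.n * (50 * (K.e + 1) + 50 + 51) + K.u I.n * 49 +
      100 * K.e + 400 := by ring
    omega
  refine Run.le ?_ hT
  clear hT
  refine Run.seqB _ (tab_run mc 13 _ hBM (by omega) (fun i hi => ?_) _ le_rfl) fun σ1 I1 fr1 g1 => ?_
  · exact (K.hv _ (Nat.div_lt_of_lt_mul hi) _ (Nat.mod_lt _ hB)).trans (by norm_cast; omega)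
  have E1 := hE.fr fr1 (by simp [Stmt.safe])
  refine Run.seqB _ (tab_run mc 14 _ (K := K.B * K.D) (by omega) (by omega) (fun i hi => ?_) _ le_rfl)
    fun σ2 I2 fr2 g2 => ?_
  · rw [Nat.abs_cast]
    have h1 : i / K.D < K.B := Nat.div_lt_of_lt_mul (by rwa [mul_comm])
    have h2 : (i / K.D) ^ (i % K.D) ≤ K.B ^ K.D := (Nat.pow_le_pow_left h1.le _).trans
      (Nat.pow_le_pow_right hB (Nat.mod_lt _ (by omega)).le)
    norm_cast; omega
  have E2 := E1.fr fr2 (by simp [Stmt.safe])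
  have s10 : σ2.reg 10 = I.P := by rw [fr2.r 10 (by simp), fr1.r 10 (by simp), h10]
  have s13 : σ2.reg 13 = q := by rw [fr2.r 13 (by simp), fr1.r 13 (by simp), h13]
  have a13 : ∀ c < K.B, ∀ x < K.B, σ2.arr 13 (c * K.B + x) = K.V c x := by
    intro c hc x hx
    rw [fr2.a 13 (by simp), I1 _ (mul_add_lt hc hx)]
    rw [add_comm, Nat.add_mul_div_right _ _ hB, Nat.div_eq_of_lt hx, zero_add,
      Nat.add_mul_mod_self_right, Nat.mod_eq_of_lt hx]
  have a14 : ∀ x < K.B, ∀ e < K.D, σ2.arr 14 (x * K.D + e) = (x ^ e : ℕ) := by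
    intro x hx e he
    rw [I2 _ (mul_add_lt hx he)]
    rw [add_comm, Nat.add_mul_div_right _ _ (by omega), Nat.div_eq_of_lt he, zero_add,
      Nat.add_mul_mod_self_right, Nat.mod_eq_of_lt he]
  refine Run.seqB 1 (Run.asgc (Q := fun σ' => σ' = σ2.setReg 40 K.D)
    (abs_cast_le (by omega)) rfl) ?_
  rintro _ rfl - -
  refine Run.seqB 1 (Run.asgc (Q := fun σ' => σ' = (σ2.setReg 40 K.D).setReg 41 K.B)
    (abs_cast_le (by omega)) rfl) ?_
  rintro _ rfl - -
  refine Run.seqB 1 (Run.asgc (Q := fun σ' => σ' = ((σ2.setReg 40 K.D).setReg 41 K.B).setReg 42 K.d)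
    hdX rfl) ?_
  rintro _ rfl - -
  refine Run.asg_seq 0 (by simp) rfl (Run.asg_seq 1 (by simp; omega) rfl (Run.asg_seq 1 (by simp; omega)
    rfl (Run.asg_seq 1 (by simp; omega) rfl ?_)))
  have E3 := ((((((E2.set 40 K.D).set 41 K.B).set 42 K.d).set 43 0).set 44 1).set 45 1).set 55 1
  set σ3 := ((((((σ2.setReg 40 K.D).setReg 41 K.B).setReg 42 K.d).setReg 43 0).setReg 44 1).setReg 45
    1).setReg 55 1 with hσ3
  refine Run.whl_seq (K.r q) 200 (fun f (σ' : State) => ∃ t, f + t = K.r q ∧ σ'.reg 43 = t ∧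
    σ'.reg 44 = (K.B ^ t : ℕ) ∧ σ'.reg 45 = (K.B ^ (t - 1) : ℕ) ∧ σ'.reg 55 = (K.D ^ t : ℕ))
    ⟨0, by simp, by simp [hσ3], by simp [hσ3], by simp [hσ3], by simp [hσ3]⟩ (fun _ _ _ _ _ => by simp)
    ?_ ?_
  · rintro f σ4 ⟨t, hft, h43, h44, h45, h55⟩ fr4 g4 htest
    simp only [Ex.eval_sub, Ex.eval_r, h55, fr4.r 13] at htest
    have hlt : t < K.r q := by
      by_contra hge
      rw [not_lt, ← K.r_spec] at hge
      simp [hσ3, s13] at htest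
      have : (q : ℤ) ≤ (K.D : ℤ) ^ t := by exact_mod_cast hge
      omega
    refine ⟨f - 1, by omega, ?_⟩
    have t40 : σ4.reg 40 = K.D := by rw [fr4.r 40]; simp [hσ3]
    have t41 : σ4.reg 41 = K.B := by rw [fr4.r 41]; simp [hσ3]
    have hBp : K.B ^ (t + 1) ≤ mc.X := by
      refine le_trans ?_ hrX
      calc K.B ^ (t + 1) ≤ K.B ^ K.r q := Nat.pow_le_pow_right hB hlt
        _ ≤ K.B * K.B ^ K.r q := Nat.le_mul_of_pos_left _ hB
        _ ≤ _ := Nat.le_mul_of_pos_right _ (by positivity)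
    have hDp : K.D ^ (t + 1) ≤ mc.X :=
      (Nat.pow_le_pow_left hDB _).trans hBp
    have hBp' : K.B ^ t ≤ mc.X := (Nat.pow_le_pow_right hB (by omega)).trans hBp
    have htX : t + 1 ≤ mc.X := (Nat.lt_pow_self hD).le.trans hDp
    refine Run.asg_seq ((K.B ^ t : ℕ) : ℤ) (abs_cast_le hBp') (by simp [h44]) ?_
    refine Run.asg_seq ((K.B ^ (t + 1) : ℕ) : ℤ) (abs_cast_le hBp)
      (by simp [h44, t41, pow_succ]) ?_
    refine Run.asg_seq ((K.D ^ (t + 1) : ℕ) : ℤ) (abs_cast_le hDp)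
      (by simp [h55, t40, pow_succ]) ?_
    refine Run.asg_last ((t + 1 : ℕ) : ℤ) (abs_cast_le htX) (by simp [h43]) ?_
    exact ⟨t + 1, by omega, by simp, by simp, by simp, by simp⟩
  · rintro f σ4 ⟨t, hft, h43, h44, h45, h55⟩ htest fr4 g4
    have ht : t = K.r q := by
      refine le_antisymm (by omega) (K.r_spec q |>.1 ?_)
      simp only [Ex.eval_sub, Ex.eval_r, h55, fr4.r 13] at htest
      simp [hσ3, s13] at htest
      exact_mod_cast htest
    subst ht
    have E4 := E3.fr fr4
    refine powS_seq mc I.n E4.r0 K.a ((Nat.pow_le_pow_right hn (by omega)).trans hnX) hnX1 ?_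
    intro σ5 s56 fr5 g5
    have hpu : ∀ t ≤ K.u I.n + 1, ∀ k ≤ K.e, (2 ^ t) ^ k ≤ mc.X := by
      intro t ht k hk
      refine le_trans ?_ huX
      calc (2 ^ t) ^ k ≤ (2 ^ (K.u I.n + 1)) ^ k :=
            Nat.pow_le_pow_left (Nat.pow_le_pow_right (by norm_num) ht) _
        _ ≤ (2 ^ (K.u I.n + 1)) ^ K.e := Nat.pow_le_pow_right (by positivity) hk
        _ ≤ _ := Nat.le_mul_of_pos_left _ (by omega)
    have hp1 : ∀ t ≤ K.u I.n + 1, 2 ^ t ≤ mc.X := fun t ht => by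
      simpa using hpu t ht 1 K.he
    refine Run.asg_seq 1 (by simp; omega) rfl ?_
    refine powS_seq mc 1 (by simp) K.e (by simp; omega) (by omega) ?_
    intro σ6 s57 fr6 g6
    refine Run.whl_seq (K.u I.n) (50 * (K.e + 1) + 50) (fun f (σ' : State) => ∃ t, f + t = K.u I.n ∧
      σ'.reg 54 = (2 ^ t : ℕ) ∧ σ'.reg 57 = ((2 ^ t) ^ K.e : ℕ))
      ⟨0, by simp, by rw [fr6.r 54]; simp, by simp [s57]⟩ (fun _ _ _ _ _ => by simp) ?_ ?_
      (hw := rfl) (hc := by decide)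
    · rintro f σ7 ⟨t, hft, h54, h57⟩ fr7 g7 htest
      have h56 : σ7.reg 56 = (I.n ^ K.a : ℕ) := by
        rw [fr7.r 56 (by simp [Stmt.wrR]), fr6.r 56]; simp [s56]
      have hlt : t < K.u I.n := by
        by_contra hge
        rw [not_lt, ← K.u_spec] at hge
        simp only [Ex.eval_sub, Ex.eval_r, h56, h57] at htest
        omega
      refine ⟨f - 1, by omega, ?_⟩
      refine Run.asg_seq ((2 ^ (t + 1) : ℕ) : ℤ) (abs_cast_le (hp1 _ (by omega)))
        (by simp [h54, pow_succ]; ring) ?_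
      refine Run.le ((powS_run mc (2 ^ (t + 1)) (by simp) K.e (hpu _ (by omega) _ le_rfl)
        (hp1 _ (by omega))).frame.post ?_) (by omega)
      rintro σ8 ⟨s57', fr8, -⟩
      exact ⟨t + 1, by omega, by rw [fr8.r 54 (by simp)]; simp, s57'⟩
    · rintro f σ7 ⟨t, hft, h54, h57⟩ htest fr7 g7
      have h56 : σ7.reg 56 = (I.n ^ K.a : ℕ) := by
        rw [fr7.r 56 (by simp [Stmt.wrR]), fr6.r 56]; simp [s56]
      have ht : t = K.u I.n := by
        refine le_antisymm (by omega) (K.u_spec I.n |>.1 ?_)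
        simp only [Ex.eval_sub, Ex.eval_r, h56, h57] at htest
        omega
      subst ht
      have E7 := (((E4.fr fr5).set 54 1).fr fr6).fr fr7 (by simp [Stmt.safe, Stmt.wrR, Stmt.wrA])
      refine Run.seqB 1 (Run.asgc (Q := fun σ' => σ' = σ7.setReg 58 K.C)
        (abs_cast_le (by omega)) rfl) ?_
      rintro _ rfl - -
      have hZX : K.Z I.n ≤ mc.X := by
        have h1 := Nat.mul_le_mul_left K.C (Nat.le_self_pow (n := K.e) (by have := K.he; omega)
          (2 ^ (K.u I.n + 1)))
        have h2 : K.Z I.n ≤ K.C * 2 ^ (K.u I.n + 1) :=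
          Nat.mul_le_mul_left _ (Nat.pow_le_pow_right (by norm_num) (by omega))
        rw [Nat.add_mul] at huX; omega
      refine Run.asg_seq (K.Z I.n : ℤ) (abs_cast_le hZX)
        (by simp [h54, Z]) ?_
      refine Run.asg_seq ((I.n * I.m : ℕ) : ℤ) (abs_cast_le hnmX)
        (by simp [E7.r0, E7.r1]) ?_
      refine Run.asg_last ((I.n * I.n : ℕ) : ℤ) (abs_cast_le (hnn.trans hnmX))
        (by simp [E7.r0]) ?_
      have keep : ∀ y, y < 60 → y ≠ 54 → y ≠ 56 → y ≠ 57 → σ7.reg y = σ4.reg y := by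
        intro y h0 h1 h2 h3
        rw [fr7.reg y (tmp_of_lt h0) (by simp [Stmt.wrR, h1, h3]),
          fr6.reg y (tmp_of_lt h0) (by simp [Stmt.wrR, h3]), State.reg_setReg, if_neg h1,
          fr5.reg y (tmp_of_lt h0) (by simp [Stmt.wrR, h2])]
      have keepA : σ7.arr = σ2.arr := by
        funext a
        rw [fr7.arr a (by simp [Stmt.wrA]), fr6.arr a (by simp [Stmt.wrA]), State.arr_setReg,
          fr5.arr a (by simp [Stmt.wrA]), fr4.arr a (by simp [Stmt.wrA])]
        rfl
      refine ⟨(((E7.set 58 _).set 46 _).set 47 _).set 48 _, ?_, ?_, ?_, ?_, ?_, ?_, ?_, ?_, by simp,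
        by simp, by simp, ?_, ?_⟩
      · simp; rw [keep 10, fr4.r 10] <;> simp [hσ3, s10]
      · simp; rw [keep 13, fr4.r 13] <;> simp [hσ3, s13]
      · simp; rw [keep 40, fr4.r 40] <;> simp [hσ3]
      · simp; rw [keep 41, fr4.r 41] <;> simp [hσ3]
      · simp; rw [keep 42, fr4.r 42] <;> simp [hσ3]
      · simp; rw [keep 43] <;> simp [h43]
      · simp; rw [keep 44] <;> simp [h44]
      · simp; rw [keep 45] <;> simp [h45]
      · simpa [keepA] using a13
      · simpa [keepA] using a14

end FastData


namespace FastData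

/-- Fast counting fits into the memory. -/
def Fits (K : FastData) (I : Inst) (q : ℕ) : Prop :=
  K.B ^ K.r q * I.Δ ≤ I.m ∧ K.Z I.n * I.Δ ≤ I.n * I.n * I.m

/-- Time for the computation of the grid data. -/
def setupTime (K : FastData) (n q : ℕ) : ℕ :=
  300 * (K.B * K.B) + 251 * K.r q + (K.u n + 2) * (50 * K.e + 200) + 50 * K.a + 1000

def fastTime (K : FastData) (R A : ℕ) (I : Inst) (q : ℕ) : ℕ :=
  I.P * (K.B ^ K.r q * ((111 * A + 2000) * (K.r q + 1) * (10 * A + R + K.B + 10) * K.Z I.n)) + 8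

instance (K : FastData) (I : Inst) (q : ℕ) : Decidable (K.Fits I q) :=
  inferInstanceAs (Decidable (_ ∧ _))

def chooseTime (K : FastData) (R A : ℕ) (I : Inst) (q : ℕ) : ℕ :=
  K.setupTime I.n q + 120 + if K.Fits I q then K.fastTime R A I q else 400 * (I.n * I.n * I.m)

lemma safe_fast {p : Prog} {R A : ℕ} : (fast p R A).safe = true ∧ (fast p R A).wrR 10 = false ∧
    (fast p R A).wrR 13 = false ∧ (fast p R A).wrR 15 = false ∧ (∀ a, a < 50 → a ≠ 6 → a ≠ 11 → a ≠ 12 →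
    (fast p R A).wrA a = false) := by
  refine ⟨?_, ?_, ?_, ?_, fun a h1 h2 h3 h4 => ?_⟩
  rotate_right
  · have h50 : a ≠ 50 := by omega
    have h51 : a ≠ 51 := by omega
    simp [fast, evalAll, evalAt, fill, monomS, pass, addS, Stmt.for, Stmt.wrA, wrA_zeroA h1, wrA_zeroR,
      h1, h2, h3, h4, h50, h51]
  all_goals simp [Stmt.safe, fast, evalAll, evalAt, fill, monomS, pass, addS, Stmt.for, Stmt.wrR,
    Stmt.wrA, wrR_zeroA, wrA_zeroA, wrR_zeroR, wrA_zeroR]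

lemma safe_choose (K : FastData) {p : Prog} {R A : ℕ} : (K.choose p R A).safe = true ∧
    (K.choose p R A).wrR 10 = false ∧ (K.choose p R A).wrR 13 = false ∧
    (K.choose p R A).wrR 15 = false ∧ (∀ a, a < 50 → a ≠ 6 → a ≠ 11 → a ≠ 12 → a ≠ 13 → a ≠ 14 →
    (K.choose p R A).wrA a = false) := by
  obtain ⟨h0, h1, h2, h3, h4⟩ := @safe_fast p R A
  simp only [Stmt.safe, Bool.not_eq_true', Bool.or_eq_false_iff] at h0
  refine ⟨?_, ?_, ?_, ?_, fun a g1 g2 g3 g4 g5 g6 => ?_⟩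
  · simp [Stmt.safe, choose, setup, countAll, bump, Stmt.for, Stmt.wrR, Stmt.wrA, h0]
  · simp [choose, setup, countAll, bump, Stmt.for, Stmt.wrR, h1]
  · simp [choose, setup, countAll, bump, Stmt.for, Stmt.wrR, h2]
  · simp [choose, setup, countAll, bump, Stmt.for, Stmt.wrR, h3]
  · simp [choose, setup, countAll, bump, Stmt.for, Stmt.wrA, h4 a g1 g2 g3 g4, g2, g5, g6]

variable (K : FastData) {mc : Mach} {I : Inst} {q : ℕ} {σ : State}

lemma choose_run (hE : Env I σ) (h10 : σ.reg 10 = I.P) (h13 : σ.reg 13 = q)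
    (h6 : ∀ a, σ.arr 6 a = 0) (hreg : ∀ y, σ.reg (61 + 2 * y) = 0) (harr : ∀ a i, σ.arr (50 + a) i = 0)
    {p : Prog} {R A Y : ℕ} (hbox : K.Z I.n ≤ mc.M → Box mc I p R A (K.Z I.n) Y)
    (hCX : K.B * K.B + K.v + K.B ^ K.D + K.C ≤ mc.X) (hdX : |K.d| ≤ mc.X) (hBM : K.B * K.B ≤ mc.M)
    (hrX : K.B * K.B ^ K.r q * K.D ^ (K.r q + 1) ≤ mc.X) (hq : 1 ≤ q)
    (huX : (K.C + 1) * (2 ^ (K.u I.n + 1)) ^ K.e ≤ mc.X) (hnX : I.n ^ (K.a + 1) ≤ mc.X)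
    (hmY : I.m ^ K.D ≤ Y) (hX : (K.B * K.v + 1) * (I.m * (I.m * (I.m ^ K.D * I.m ^ K.D))) ≤ mc.X)
    (hYX : 2 * I.Y ≤ mc.X) (hMd : I.n * I.n * I.m ≤ mc.M * I.Δ) (hM : I.n * I.m ≤ mc.M)
    (hX3 : 2 * (K.Z I.n * I.Δ) + 2 * (K.B ^ K.r q * I.Δ) + 2 * (I.n * I.n * I.m) + 1 ≤ mc.X)
    (hM6 : I.P * I.n * I.n * q ≤ mc.M) (hX6 : I.P * I.n * I.n * q ≤ mc.X) :
    Run mc (K.choose p R A) σ (K.chooseTime R A I q) (Counted I q) := by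
  have hn := I.hn
  have hΔ := I.hΔ
  have hqX : q ≤ mc.X := le_trans (Nat.le_mul_of_pos_left _ (Nat.mul_pos (Nat.mul_pos I.one_le_P hn) hn)) hX6
  have hnm : I.n * I.m ≤ I.n * I.n * I.m := by
    rw [mul_assoc]; exact Nat.le_mul_of_pos_left _ hn
  have hnmX : I.n * I.m ≤ mc.X := by omega
  have hE6 : I.P * I.n * I.n * q = I.P * (I.n * I.n) * q := by ring
  refine Run.seqB (K.setupTime I.n q) (K.setup_run hE h10 h13 hCX hdX hBM hrX huX hnX hnmX)
    fun σ1 G fr g => ?_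
  have s6 : ∀ a, σ1.arr 6 a = 0 := by
    intro a; rw [fr.a 6 (by simp [setup, Stmt.wrA]), h6]
  have hO : Outer R A (K.Z I.n) σ1 := by
    have h1 : ∀ y, σ1.reg (61 + 2 * y) = 0 := fun y => by
      rw [fr.reg _ (by simp [tmp]) (by simp [setup, Stmt.wrR]; omega), hreg]
    have h2 : ∀ a i, σ1.arr (50 + a) i = 0 := fun a i => by
      rw [fr.a _ (by simp [setup, Stmt.wrA]; omega), harr]
    exact ⟨fun y _ => h1 y, fun a _ i => h2 a i, fun a i _ => h2 a i⟩
  have slow : ∀ T, 400 * (I.n * I.n * I.m) ≤ T → Run mc countAll σ1 T (Counted I q) := fun T hT =>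
    (countAll_run mc I q hq σ1 G.env G.r13 s6 hM hM6 hX6 hYX (by omega)).le hT
  have t1 : 0 < (.r 1 - .r 44 * .r 2 + 1 : Ex).eval σ1 ↔ K.B ^ K.r q * I.Δ ≤ I.m := by
    simp only [Ex.eval_add, Ex.eval_sub, Ex.eval_mul, Ex.eval_r, Ex.eval_one, G.env.r1, G.r44, G.env.r2]
    rw [← Nat.cast_mul]; omega
  have t2 : 0 < (.r 48 * .r 1 - .r 46 * .r 2 + 1 : Ex).eval σ1 ↔
      K.Z I.n * I.Δ ≤ I.n * I.n * I.m := by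
    simp only [Ex.eval_add, Ex.eval_sub, Ex.eval_mul, Ex.eval_r, Ex.eval_one, G.env.r1, G.r48, G.r46,
      G.env.r2]
    rw [← Nat.cast_mul, ← Nat.cast_mul]; omega
  unfold chooseTime
  refine Run.iteB (fun c1 => Run.iteB (fun c2 => ?_) fun c2 => slow _ ?_) fun c1 => slow _ ?_
  · rw [t1] at c1
    rw [t2] at c2
    rw [if_pos ⟨c1, c2⟩]
    have hZM : K.Z I.n ≤ mc.M := Nat.le_of_mul_le_mul_right (c2.trans hMd) hΔ
    have hBm : K.B ^ K.r q ≤ I.m := (Nat.le_mul_of_pos_right _ hΔ).trans c1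
    have hD := K.hD
    have hNM : I.n * I.n * K.B ^ K.r q ≤ mc.M := by
      refine Nat.le_of_mul_le_mul_right (le_trans ?_ hMd) hΔ
      rw [mul_assoc]; exact Nat.mul_le_mul_left _ c1
    refine Run.le (G.fast_run mc (hbox hZM) hO K.hBD.ge (by omega) K.hd K.hV K.hv hq (K.r_spec q |>.2 le_rfl)
      s6 ?_ ((Nat.pow_le_pow_left hBm _).trans hmY) (by omega) hnmX hBM hNM ?_ (by omega) (by omega)) ?_
    · refine le_trans (Nat.mul_le_mul_left _ (Nat.mul_le_mul hBm (Nat.mul_le_mul_left _ ?_))) hX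
      exact Nat.mul_le_mul (Nat.pow_le_pow_left hBm _) (Nat.pow_le_pow_left hBm _)
    · exact (Nat.mul_le_mul_left _ hBm).trans (by omega)
    · unfold fastTime; omega
  · rw [if_neg fun h => c2 (t2.2 h.2)]; omega
  · rw [if_neg fun h => c1 (t1.2 h.1)]; omega

end FastData

def prep (K : FastData) (p : Prog) (R A E : ℕ) : Stmt :=
  .asg 9 ((.r 0 - 1) / .r 2 + 1) ;; .asg 10 ((.r 1 - 1) / .r 4 + 1) ;; thresholds ;;
  .ite (.r 4 - .r 1) (.asg 10 1 ;; .asg 11 (0 - 1) ;; .asg 12 1)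
    (modulus E ;; .asg 13 (8 * .r 3 * .r 15) ;; K.choose p R A ;; correct ;; lists)

/-- The numbers that describe the lists fit into the storage. -/
structure Fit (mc : Mach) (I : Inst) (P LS : ℕ) (win : ℤ) : Prop where
  div_lt : ∀ k < I.m, k / I.L < P
  win_ge : -1 ≤ win
  M_le : I.n * I.n * LS ≤ mc.M
  X_le : I.n * I.n * LS ≤ mc.X
  PX : P * I.L ≤ mc.X
  wM : (win + 1) * P ≤ mc.M
  wX : (win + 1) * P ≤ mc.X


namespace FastData

variable (K : FastData)

lemma B_le (K : FastData) : K.B ≤ K.D * K.D := by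
  have := K.hBD; have := K.hD
  nlinarith

lemma D_pow_r_le {q : ℕ} (hq : 1 ≤ q) : K.D ^ K.r q ≤ K.D * q := by
  have hD := K.hD
  by_cases h : K.r q = 0
  · rw [h, pow_zero]; exact Nat.mul_pos (by omega) hq
  · have h1 : ¬ q ≤ K.D ^ (K.r q - 1) := by rw [K.r_spec]; omega
    calc K.D ^ K.r q = K.D * K.D ^ (K.r q - 1) := by rw [← pow_succ']; congr 1; omega
      _ ≤ K.D * q := Nat.mul_le_mul_left _ (by omega)

lemma B_pow_r_le (q : ℕ) : K.B ^ K.r q ≤ K.D ^ K.r q * K.D ^ K.r q := by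
  rw [← mul_pow]; exact Nat.pow_le_pow_left K.B_le _

lemma two_pow_u_le {n : ℕ} (hn : 1 ≤ n) : (2 ^ K.u n) ^ K.e ≤ 2 ^ K.e * n ^ K.a := by
  by_cases h : K.u n = 0
  · rw [h, pow_zero, one_pow]; exact Nat.mul_pos (by positivity) (by positivity)
  · have h1 : ¬ n ^ K.a ≤ (2 ^ (K.u n - 1)) ^ K.e := by rw [K.u_spec]; omega
    calc (2 ^ K.u n) ^ K.e = 2 ^ K.e * (2 ^ (K.u n - 1)) ^ K.e := by
          rw [← mul_pow, ← pow_succ']; congr 2; omega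
      _ ≤ 2 ^ K.e * n ^ K.a := Nat.mul_le_mul_left _ (by omega)

end FastData

structure Init (I : Inst) (σ : State) : Prop where
  r0 : σ.reg 0 = I.n
  r1 : σ.reg 1 = I.m
  r2 : σ.reg 2 = I.Δ
  r3 : σ.reg 3 = I.W
  r4 : σ.reg 4 = I.L
  a0 : σ.arr 0 = I.f
  a1 : σ.arr 1 = I.g
  reg : ∀ y, 5 ≤ y → σ.reg y = 0
  arr : ∀ a, 2 ≤ a → ∀ i, σ.arr a i = 0

/-- All numbers are bounded by `G`, and the storage admits a large power of `G`. -/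
structure Sizes (mc : Mach) (I : Inst) (K : FastData) (E l G : ℕ) : Prop where
  hE : 1 ≤ E
  G16 : 16 ≤ G
  m : I.m ≤ G
  W : I.W ≤ G
  L : I.L ≤ G
  Y : I.Y ≤ G
  cst : K.B * K.B + K.v + K.B ^ K.D + K.C + 4 ^ K.e ≤ G
  d : |K.d| ≤ G
  fac : factorBase E l ^ (E + 1) ≤ G
  l₁ : 4 * I.Y + 2 * I.W + 1 < 2 ^ l
  l₂ : 4 * I.Y + 4 ≤ 2 ^ l
  X : G ^ (4 * E + 2 * K.D + K.a + 40) ≤ mc.X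

/-- Time for the modulus, without counting. -/
def mainTime (K : FastData) (R A E l : ℕ) (I : Inst) (p : ℕ) : ℕ :=
  (2 * Nat.log 2 I.n + 3) * (factorBase E l ^ (E + 1) + 2) * (600 * (I.n * I.nb * I.m) + 100 * E + 2000) +
    K.chooseTime R A I (8 * I.W * p) + 1100 * (I.n * I.nb * I.m) +
    800 * (I.n * I.n * ((4 * I.W + 1) * I.P + 1)) + 50

lemma le_sq_mul {p p₀ d Δ E F : ℕ} (hE : 1 ≤ E) (hΔ : 1 ≤ Δ) (hp : p = p₀ * d) (hd : d ≤ F)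
    (h : p₀ ^ E ≤ Δ ^ (E + 1)) : p ≤ Δ ^ 2 * F := by
  have : p₀ ≤ Δ ^ 2 := by
    by_contra hlt
    push Not at hlt
    have h1 : (Δ ^ 2) ^ E < p₀ ^ E := Nat.pow_lt_pow_left hlt (by omega)
    rw [← pow_mul] at h1
    have h2 : Δ ^ (E + 1) ≤ Δ ^ (2 * E) := Nat.pow_le_pow_right hΔ (by omega)
    omega
  rw [hp]; exact Nat.mul_le_mul this hd

section
variable {mc : Mach} {I : Inst} {K : FastData} {E l G : ℕ} {σ : State} {p : Prog} {R A Y T : ℕ}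

set_option maxHeartbeats 800000 in
lemma Sizes.main_run (hS : Sizes mc I K E l G) (hsm : I.Smooth) (hE : Env I σ) (h10 : σ.reg 10 = I.P)
    (hthr : ∀ i < I.n, ∀ J < I.nb, ThrAt I σ i J) (hreg : ∀ y, σ.reg (61 + 2 * y) = 0)
    (harr : ∀ a, 6 ≤ a → ∀ i, σ.arr a i = 0)
    (hbox : K.Z I.n ≤ mc.M → Box mc I p R A (K.Z I.n) Y) (hmY : I.m ^ K.D ≤ Y)
    (hM1 : I.n * I.nb * I.m ≤ mc.M) (hMd : I.n * I.n * I.m ≤ mc.M * I.Δ) (hBM : K.B * K.B ≤ mc.M)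
    (hM3 : I.P * I.n * I.n * (8 * I.W * (I.Δ ^ 2 * factorBase E l ^ (E + 1))) ≤ mc.M)
    (hT : ∀ p p₀ d, 1 ≤ p → p = p₀ * d → d ≤ factorBase E l ^ (E + 1) → p₀ ^ E ≤ I.Δ ^ (E + 1) →
      mainTime K R A E l I p ≤ T) :
    Run mc (modulus E ;; .asg 13 (8 * .r 3 * .r 15) ;; K.choose p R A ;; correct ;; lists) σ T fun σ' =>
      Ready I I.P ((4 * I.W + 1) * I.P + 1) (4 * I.W : ℕ) σ' ∧
        Fit mc I I.P ((4 * I.W + 1) * I.P + 1) (4 * I.W : ℕ) := by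
  have hn := I.hn
  have hm := I.hm
  have hΔ := I.hΔ
  have hΔn := I.hΔn
  have hnm := I.hnm
  have hnb := I.nb_le
  have hnb1 := I.one_le_nb
  have hP := I.P_le
  have hP1 := I.one_le_P
  have hW1 : 1 ≤ I.W := hΔ.trans I.hΔW
  obtain ⟨hE1, hG, Gm, GW, GLL, GY, Gc, Gd, Gf, hl1, hl2, hX⟩ := hS
  obtain ⟨GBB, Gv, GBD, GC, G4⟩ : K.B * K.B ≤ G ∧ K.v ≤ G ∧ K.B ^ K.D ≤ G ∧ K.C ≤ G ∧ 4 ^ K.e ≤ G := by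
    have key : ∀ x y z u v : ℕ, x + y + z + u + v ≤ G → x ≤ G ∧ y ≤ G ∧ z ≤ G ∧ u ≤ G ∧ v ≤ G := by omega
    exact key _ _ _ _ _ Gc
  clear Gc
  have GP : I.P ≤ G := hP.trans Gm
  have Gn : I.n ≤ G := hnm.trans Gm
  have GΔ : I.Δ ≤ G := hΔn.trans Gn
  have Gnb : I.nb ≤ G := hnb.trans Gn
  have hp : ∀ {x : ℕ} (k : ℕ), x ≤ G ^ k → k ≤ 4 * E + 2 * K.D + K.a + 40 → x ≤ mc.X := fun k h hk =>
    h.trans ((Nat.pow_le_pow_right (by omega) hk).trans hX)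
  have mulG : ∀ {x y : ℕ} (a b : ℕ), x ≤ G ^ a → y ≤ G ^ b → x * y ≤ G ^ (a + b) := fun a b h1 h2 => by
    rw [pow_add]; exact Nat.mul_le_mul h1 h2
  have G1 : ∀ {x : ℕ}, x ≤ G → x ≤ G ^ 1 := fun h => by simpa using h
  have upG : ∀ {x : ℕ} (a b : ℕ), x ≤ G ^ a → a ≤ b → x ≤ G ^ b := fun a b h hab =>
    h.trans (Nat.pow_le_pow_right (by omega) hab)
  have upS : ∀ {x : ℕ} (a : ℕ), x ≤ 16 * G ^ a → x ≤ G ^ (a + 1) := fun a h => by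
    rw [pow_succ, mul_comm]; exact h.trans (Nat.mul_le_mul_right _ hG)
  have gnbm : I.n * I.nb * I.m ≤ G ^ 3 := mulG 2 1 (mulG 1 1 (G1 Gn) (G1 Gnb)) (G1 Gm)
  have gnnm : I.n * I.n * I.m ≤ G ^ 3 := mulG 2 1 (mulG 1 1 (G1 Gn) (G1 Gn)) (G1 Gm)
  have GG3 : G ≤ G ^ 3 := Nat.le_self_pow (by norm_num) G
  have hX4 : ∀ {x}, x ≤ 16 * G ^ 3 → x ≤ mc.X := fun h => hp 4 (upS 3 h) (by omega)
  have hM : I.n * I.m ≤ mc.M := by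
    refine le_trans ?_ hM1
    exact Nat.mul_le_mul_right _ (Nat.le_mul_of_pos_right _ hnb1)
  have hnbM : I.n * I.nb ≤ mc.M := (Nat.le_mul_of_pos_right _ hm).trans hM1
  have hh : ∀ i < I.n, ∀ J < I.nb, |σ.arr 3 (i * I.nb + J)| ≤ 2 * I.Y + 1 := fun i hi J hJ =>
    (hthr i hi J hJ).1
  have hF : I.Δ ^ 2 ≤ 2 ^ (2 * Nat.log 2 I.n + 2) := by
    have : I.Δ ≤ 2 ^ (Nat.log 2 I.n + 1) :=
      hΔn.trans (Nat.lt_pow_succ_log_self (by norm_num) _).le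
    calc I.Δ ^ 2 ≤ (2 ^ (Nat.log 2 I.n + 1)) ^ 2 := Nat.pow_le_pow_left this 2
      _ = _ := by rw [← pow_mul]; congr 1; ring
  have hfac1 : 1 ≤ factorBase E l ^ (E + 1) := Nat.one_le_pow _ _ (by unfold factorBase; positivity)
  have hBD := K.hBD
  have hmod := modulus_run mc I (σ.arr 3) E (factorBase E l ^ (E + 1)) (2 * Nat.log 2 I.n + 2) hE1
    hfac1 hF (fun p _ => I.exists_step _ E l hh hl1) hh σ hE rfl hM1 hM (hX4 (by omega))
    (hp (4 * (E + 1)) (by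
      rw [pow_mul]
      exact Nat.pow_le_pow_left (mulG 3 1 gnbm (G1 Gf)) _) (by omega))
    (hp 3 (mulG 2 1 (Nat.pow_le_pow_left GΔ 2) (G1 Gf)) (by omega))
  obtain ⟨C, hC⟩ : ∃ C, C = 2 * Nat.log 2 I.n + 3 := ⟨_, rfl⟩
  have eC : 2 * Nat.log 2 I.n + 2 + 1 = C := by omega
  rw [eC] at hmod
  refine Run.seqB _ hmod ?_
  rintro σ1 ⟨p', p₀, d, h15, hp1, hpd, hdK, hp0, hbad⟩ fr1 g1
  have hTp := hT p' p₀ d hp1 hpd hdK hp0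
  have hpΔ := le_sq_mul hE1 hΔ hpd hdK hp0
  obtain ⟨q, hq⟩ : ∃ q, q = 8 * I.W * p' := ⟨_, rfl⟩
  have hq1 : 1 ≤ q := by rw [hq]; exact Nat.mul_pos (by omega) hp1
  have gp : p' ≤ G ^ 3 := hpΔ.trans (mulG 2 1 (Nat.pow_le_pow_left GΔ 2) (G1 Gf))
  have gq : q ≤ G ^ 5 := by
    rw [hq]
    exact mulG 2 3 (mulG 1 1 (G1 (by omega)) (G1 GW)) gp
  have hM6 : I.P * I.n * I.n * q ≤ mc.M := by
    refine le_trans (Nat.mul_le_mul_left _ ?_) hM3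
    rw [hq]; exact Nat.mul_le_mul_left _ hpΔ
  have hX6 : I.P * I.n * I.n * q ≤ mc.X :=
    hp 8 (mulG 3 5 (mulG 2 1 (mulG 1 1 (G1 GP) (G1 Gn)) (G1 Gn)) gq) (by omega)
  have hWP : (4 * I.W + 1) * I.P + 1 ≤ 8 * (I.W * I.P) := by
    have h1 : I.P ≤ I.W * I.P := Nat.le_mul_of_pos_left _ hW1
    have h2 : (4 * I.W + 1) * I.P = 4 * (I.W * I.P) + I.P := by ring
    omega
  have hM7 : I.n * I.n * ((4 * I.W + 1) * I.P + 1) ≤ mc.M := by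
    refine le_trans (Nat.mul_le_mul_left _ hWP) (le_trans ?_ hM3)
    have h1 : 1 ≤ I.Δ ^ 2 * factorBase E l ^ (E + 1) := Nat.mul_pos (by positivity) hfac1
    calc I.n * I.n * (8 * (I.W * I.P)) = I.P * I.n * I.n * (8 * I.W * 1) := by ring
      _ ≤ _ := Nat.mul_le_mul_left _ (Nat.mul_le_mul_left _ h1)
  have hX7 : I.n * I.n * ((4 * I.W + 1) * I.P + 1) ≤ mc.X := by
    refine (Nat.mul_le_mul_left _ hWP).trans (hp 5 ?_ (by omega))
    exact mulG 2 3 (mulG 1 1 (G1 Gn) (G1 Gn)) (mulG 1 2 (G1 (by omega)) (mulG 1 1 (G1 GW) (G1 GP)))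
  have E1 := hE.fr fr1 (by simp [modulus, Stmt.safe, Stmt.wrR, Stmt.wrA, countBad, Stmt.for])
  refine Run.asg_seq (q : ℤ) ?_ (by simp [E1.r3, h15, hq]) ?_
  · exact abs_cast_le (hp 5 gq (by omega))
  have hBB : K.B ≤ K.B * K.B := Nat.le_mul_of_pos_left _ (by omega)
  have GB : K.B ≤ G := hBB.trans GBB
  have GD : K.D ≤ G := by omega
  have gD : K.D ^ K.r q ≤ G ^ 6 := (K.D_pow_r_le hq1).trans (mulG 1 5 (G1 GD) gq)
  have gB : K.B ^ K.r q ≤ G ^ 12 := (K.B_pow_r_le q).trans (mulG 6 6 gD gD)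
  have gu : (2 ^ (K.u I.n + 1)) ^ K.e ≤ G ^ (1 + K.a) := by
    calc (2 ^ (K.u I.n + 1)) ^ K.e = 2 ^ K.e * (2 ^ K.u I.n) ^ K.e := by rw [pow_succ, mul_pow, mul_comm]
      _ ≤ 2 ^ K.e * (2 ^ K.e * I.n ^ K.a) := Nat.mul_le_mul_left _ (K.two_pow_u_le hn)
      _ = (2 * 2) ^ K.e * I.n ^ K.a := by rw [← mul_assoc, ← mul_pow]
      _ ≤ _ := mulG 1 K.a (G1 G4) (Nat.pow_le_pow_left Gn _)
  have gZ : K.Z I.n ≤ G ^ (1 + (1 + K.a)) := by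
    refine mulG 1 (1 + K.a) (G1 GC) (le_trans ?_ gu)
    exact (Nat.pow_le_pow_right (by norm_num) (by omega)).trans
      (Nat.le_self_pow (by have := K.he; omega) _)
  refine Run.seqB (K.chooseTime R A I q) (K.choose_run (E1.set 13 _) ?_ (by simp) ?_ ?_ ?_ hbox ?_ ?_
    hBM ?_ hq1 ?_ ?_ hmY ?_ ?_ hMd hM ?_ hM6 hX6) ?_
  · simp; rw [fr1.r 10 (by simp [modulus, Stmt.wrR, countBad, Stmt.for]), h10]
  · intro a; rw [State.arr_setReg, fr1.a 6 (by simp [modulus, Stmt.wrA, countBad, Stmt.for])]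
    exact harr 6 le_rfl a
  · intro y
    rw [State.reg_setReg, if_neg (by omega), fr1.reg _ (by simp [tmp])
      (by simp [modulus, Stmt.wrR, countBad, Stmt.for]; omega), hreg]
  · intro a i
    rw [State.arr_setReg, fr1.arr _ (by simp [modulus, Stmt.wrA, countBad, Stmt.for])]
    exact harr _ (by omega) i
  · exact hX4 (by omega)
  · exact Gd.trans (by exact_mod_cast hX4 (by omega))
  · refine hp 20 ?_ (by omega)
    rw [pow_succ]
    exact mulG 13 7 (mulG 1 12 (G1 (by omega)) gB) (mulG 6 1 gD (G1 GD))
  · exact hp (2 + (1 + K.a)) (mulG 2 (1 + K.a) (upS 1 (by rw [pow_one]; omega)) gu) (by omega)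
  · exact hp (K.a + 1) (Nat.pow_le_pow_left Gn _) (by omega)
  · refine hp (3 + (1 + (1 + (K.D + K.D)))) ?_ (by omega)
    refine mulG 3 _ (upS 2 ?_) (mulG 1 _ (G1 Gm) (mulG 1 _ (G1 Gm) (mulG _ _ (Nat.pow_le_pow_left Gm _)
      (Nat.pow_le_pow_left Gm _))))
    have h1 : K.B * K.v ≤ G ^ 2 := mulG 1 1 (G1 GB) (G1 Gv)
    have h2 : 1 ≤ G ^ 2 := Nat.one_le_pow _ _ (by omega)
    omega
  · exact hX4 (by omega)
  · refine hp (K.a + 15 + 1) (upS _ ?_) (by omega)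
    have h1 := upG _ (K.a + 15) (mulG _ 1 gZ (G1 GΔ)) (by omega)
    have h2 := upG _ (K.a + 15) (mulG _ 1 gB (G1 GΔ)) (by omega)
    have h3 := upG _ (K.a + 15) gnnm (by omega)
    have h4 : 1 ≤ G ^ (K.a + 15) := Nat.one_le_pow _ _ (by omega)
    omega
  intro σ2 hcnt fr2 g2
  obtain ⟨c0, c1, c2, c3, c4⟩ := K.safe_choose (p := p) (R := R) (A := A)
  have E2 := (E1.set 13 (q : ℤ)).fr fr2 c0
  have keep12 : ∀ a, a < 50 → a ≠ 6 → a ≠ 11 → a ≠ 12 → a ≠ 13 → a ≠ 14 → σ2.arr a = σ.arr a := by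
    intro a h1 h2 h3 h4 h5 h6
    rw [fr2.a a (c4 a h1 h2 h3 h4 h5 h6), State.arr_setReg,
      fr1.a a (by simp [modulus, Stmt.wrA, countBad, Stmt.for])]
  have s3 : σ2.arr 3 = σ.arr 3 := by apply keep12 <;> norm_num
  have s13 : σ2.reg 13 = q := by rw [fr2.r 13 c2]; simp
  have s10 : σ2.reg 10 = I.P := by
    rw [fr2.r 10 c1]; simp
    rw [fr1.r 10 (by simp [modulus, Stmt.wrR, countBad, Stmt.for]), h10]
  refine Run.seqB _ (correct_run mc I (σ.arr 3) p' q hp1 hq1 hh σ2 E2 s3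
    (by rw [fr2.r 15 c3]; simp [h15]) s13 hcnt hbad hM1 hM (hp 3 gp (by omega)) hM6 hX6
    (hX4 (by omega)) ?_) fun σ3 hfix fr3 g3 => ?_
  · refine hp 5 (upS 4 ?_) (by omega)
    have h1 := upG 3 4 gnnm (by omega)
    have h2 : I.n * (I.nb * (I.m * I.Δ)) ≤ G ^ 4 :=
      mulG 1 3 (G1 Gn) (mulG 1 2 (G1 Gnb) (mulG 1 1 (G1 Gm) (G1 GΔ)))
    have h4 : 1 ≤ G ^ 4 := Nat.one_le_pow _ _ (by omega)
    omega
  have E3 := E2.fr fr3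
  refine Run.le (Run.mono (lists_run mc I hsm (σ.arr 3) p' q hp1 hq hh σ3 E3 (by rw [fr3.a 3, s3])
    (by rw [fr3.r 13, s13]) (by rw [fr3.r 10, s10]) hfix hnbM hM6 hX6 (hX4 (by omega)) hM7
    hX7).frame le_rfl ?_) ?_
  · rintro σ4 ⟨⟨r11, r12, hl⟩, fr4, -⟩
    have keep : ∀ a, a < 50 → a ≠ 6 → a ≠ 7 → a ≠ 8 → a ≠ 11 → a ≠ 12 → a ≠ 13 → a ≠ 14 →
        σ4.arr a = σ.arr a := by
      intro a h1 h2 h3 h4 h5 h6 h7 h8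
      rw [fr4.arr a (by simp [lists, Stmt.wrA, Stmt.for, h3, h4]),
        fr3.arr a (by simp [correct, bump, Stmt.wrA, Stmt.for, h2]), keep12 a h1 h2 h5 h6 h7 h8]
    have k3 : σ4.arr 3 = σ.arr 3 := by apply keep <;> norm_num
    refine ⟨⟨E3.fr fr4, by rw [fr4.r 10, fr3.r 10, s10], r11, r12, fun a => ?_, fun a => ?_,
      fun i hi J hJ => (hthr i hi J hJ).congr ?_ ?_ ?_, fun i hi j hj => ?_, Or.inl rfl⟩, ?_⟩
    · rw [keep 9] <;> first | exact harr 9 (by norm_num) a | norm_num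
    · rw [keep 10] <;> first | exact harr 10 (by norm_num) a | norm_num
    · rw [k3]
    · rw [keep 4] <;> norm_num
    · intro t _; rw [keep 5] <;> norm_num
    · obtain ⟨ls, h1, h2⟩ := hl i hi j hj
      exact ⟨ls, by omega, by rw [k3]; exact h2⟩
    · have hnn : 1 ≤ I.n * I.n := Nat.mul_pos hn hn
      refine ⟨fun k hk => I.div_lt_P hk, by omega, hM7, hX7,
        hp 2 (mulG 1 1 (G1 GP) (G1 GLL)) (by omega), ?_, ?_⟩
      · have := (Nat.le_mul_of_pos_left ((4 * I.W + 1) * I.P + 1) hnn).trans hM7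
        have h2 : (((4 * I.W + 1) * I.P : ℕ) : ℤ) ≤ mc.M := by exact_mod_cast (by omega)
        push_cast at h2 ⊢; exact h2
      · have := (Nat.le_mul_of_pos_left ((4 * I.W + 1) * I.P + 1) hnn).trans hX7
        have h2 : (((4 * I.W + 1) * I.P : ℕ) : ℤ) ≤ mc.X := by exact_mod_cast (by omega)
        push_cast at h2 ⊢; exact h2
  · rw [mainTime, ← hC, ← hq] at hTp
    omega

lemma Sizes.prep_run (hS : Sizes mc I K E l G) (hsm : I.Smooth) (hI : Init I σ)
    (hbox : K.Z I.n ≤ mc.M → Box mc I p R A (K.Z I.n) Y) (hmY : I.m ^ K.D ≤ Y)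
    (hM1 : I.n * I.nb * I.m ≤ mc.M) (hMd : I.n * I.n * I.m ≤ mc.M * I.Δ) (hBM : K.B * K.B ≤ mc.M)
    (hM3 : I.L ≤ I.m →
      I.P * I.n * I.n * (8 * I.W * (I.Δ ^ 2 * factorBase E l ^ (E + 1))) ≤ mc.M)
    (hT : 2100 * (l + 1) * (I.n * I.nb * I.m) + 310 ≤ T)
    (hT' : I.L ≤ I.m → ∀ p p₀ d, 1 ≤ p → p = p₀ * d → d ≤ factorBase E l ^ (E + 1) →
      p₀ ^ E ≤ I.Δ ^ (E + 1) →
      2100 * (l + 1) * (I.n * I.nb * I.m) + 310 + mainTime K R A E l I p ≤ T) :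
    Run mc (prep K p R A E) σ T fun σ' => ∃ (P LS : ℕ) (win : ℤ),
      Ready I P LS win σ' ∧ Fit mc I P LS win := by
  have hn := I.hn
  have hm := I.hm
  have hnb := I.nb_le
  have hnb1 := I.one_le_nb
  have hP := I.P_le
  have hG := hS.G16
  have hGX : 16 * G ≤ mc.X := by
    refine le_trans ?_ hS.X
    calc 16 * G ≤ G * G := Nat.mul_le_mul_right _ hG
      _ = G ^ 2 := (sq G).symm
      _ ≤ _ := Nat.pow_le_pow_right (by omega) (by omega)
  have hX2 : I.n * I.n ≤ mc.X := by
    refine le_trans ?_ hS.X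
    calc I.n * I.n ≤ G * G := Nat.mul_le_mul (I.hnm.trans hS.m) (I.hnm.trans hS.m)
      _ = G ^ 2 := (sq G).symm
      _ ≤ _ := Nat.pow_le_pow_right (by omega) (by omega)
  have Gm := hS.m
  have GY := hS.Y
  have GLL := hS.L
  have Gn := I.hnm.trans hS.m
  have hM : I.n * I.m ≤ mc.M := by
    refine le_trans ?_ hM1
    exact Nat.mul_le_mul_right _ (Nat.le_mul_of_pos_right _ hnb1)
  refine Run.asg_seq (I.nb : ℤ) (abs_cast_le (by omega)) ?_ ?_
  · simp only [Ex.eval_add, Ex.eval_div, Ex.eval_sub, Ex.eval_r, Ex.eval_one, hI.r0, hI.r2, Inst.nb]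
    push_cast [Nat.cast_sub hn]; rfl
  refine Run.asg_seq (I.P : ℤ) (abs_cast_le (by omega)) ?_ ?_
  · simp only [Ex.eval_add, Ex.eval_div, Ex.eval_sub, Ex.eval_r, Ex.eval_one]
    norm_num [hI.r1, hI.r4, Inst.P]
    push_cast [Nat.cast_sub hm]; rfl
  set σ0 := (σ.setReg 9 I.nb).setReg 10 I.P with hσ0
  have E0 : Env I σ0 := by
    constructor <;> simp [hσ0, hI.r0, hI.r1, hI.r2, hI.r3, hI.r4, hI.a0, hI.a1]
  refine Run.seqB _ (thresholds_run mc I l hS.l₂ σ0 E0 hM hM1 (by omega)) fun σ1 hthr fr1 g1 => ?_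
  have E1 := E0.fr fr1
  have z : ∀ a, 6 ≤ a → ∀ i, σ1.arr a i = 0 := by
    intro a ha i
    rw [fr1.arr a (by simp [thresholds, Stmt.wrA, Stmt.for]; omega)]
    exact hI.arr a (by omega) i
  refine Run.iteB (fun hc => ?_) fun hc => ?_
  · have hLm : I.m < I.L := by
      simp only [Ex.eval_sub, Ex.eval_r, E1.r4, E1.r1] at hc; omega
    refine Run.asg_seq 1 (by simp; omega) rfl (Run.asg_seq (-1) (by simp; omega) rfl
      (Run.asg_last 1 (by simp; omega) rfl ?_))
    refine ⟨1, 1, -1, ⟨((E1.set 10 1).set 11 _).set 12 1, by simp, by simp, by simp,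
      by simpa using z 9 (by norm_num), by simpa using z 10 (by norm_num),
      fun i hi J hJ => (hthr i hi J hJ).congr rfl rfl fun _ _ => rfl, fun i hi j hj => ⟨[], by simp, ?_⟩,
      Or.inr fun i hi J hJ => ?_⟩, ⟨fun k hk => ?_, le_rfl, ?_, by omega, by omega, by simp, by simp⟩⟩
    · refine ⟨by simp, by simp, ?_, List.Pairwise.nil, fun s => ?_⟩
      · simpa using z 7 (by norm_num) _
      · simp only [List.not_mem_nil, false_iff, Inst.num_pos, not_exists, not_and]
        rintro k hk ⟨⟨h1, h2⟩, -⟩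
        omega
    · obtain ⟨-, e, he, ht⟩ := hthr i hi J hJ
      rcases ht.cov with h | h
      · exact h
      · have := (Finset.card_filter_le (Finset.range I.m)
          (fun k => I.val i J k ≤ σ1.arr 3 (i * I.nb + J)))
        rw [Finset.card_range] at this; omega
    · rw [Nat.div_eq_of_lt (by omega)]; norm_num
    · have : I.n ≤ I.m := I.hnm
      have := Nat.mul_le_mul_left I.n this
      omega
  · have hLm : I.L ≤ I.m := by
      simp only [Ex.eval_sub, Ex.eval_r, E1.r4, E1.r1] at hc; omega
    refine Run.mono (hS.main_run hsm E1 (by rw [fr1.r 10]; simp [hσ0]) hthr (fun y => ?_) z hbox hmY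
      hM1 hMd hBM (hM3 hLm) (T := T - 100 - 2100 * (l + 1) * (I.n * I.nb * I.m) - 60)
      fun p p₀ d h1 h2 h3 h4 => by have := hT' hLm p p₀ d h1 h2 h3 h4; omega) (by omega)
      fun σ' h => ⟨_, _, _, h⟩
    rw [fr1.reg _ (by simp [tmp]) (by simp [thresholds, Stmt.wrR, Stmt.for]; omega)]
    simp only [hσ0, State.reg_setReg]
    rw [if_neg (by omega), if_neg (by omega)]
    exact hI.reg _ (by omega)

end


lemma Ready.putQuery {I : Inst} {P LS : ℕ} {win : ℤ} {σ : State} {n m : ℕ} (h : Ready I P LS win σ)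
    (q : Query n m) : Ready I P LS win (σ.putQuery q) := by
  have hr : ∀ y, y ≠ 5 → y ≠ 6 → y ≠ 7 → (σ.putQuery q).reg y = σ.reg y := fun y h1 h2 h3 => by
    simp [State.putQuery, h1, h2, h3]
  have ha : ∀ a, a ≠ 2 → (σ.putQuery q).arr a = σ.arr a := fun a h1 => by
    simp [State.putQuery, h1]
  obtain ⟨⟨e0, e1, e2, e3, e4, e9, ea, eb⟩, r10, r11, r12, z9, z10, thr, lst, mode⟩ := h
  constructor
  · constructor <;> first
      | (rw [hr] <;> first | assumption | norm_num)
      | (rw [ha] <;> first | assumption | norm_num)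
  · rw [hr] <;> first | assumption | norm_num
  · rw [hr] <;> first | assumption | norm_num
  · rw [hr] <;> first | assumption | norm_num
  · rw [ha 9 (by norm_num)]; exact z9
  · rw [ha 10 (by norm_num)]; exact z10
  · refine fun i hi J hJ => (thr i hi J hJ).congr ?_ ?_ ?_
    · rw [ha 3 (by norm_num)]
    · rw [ha 4 (by norm_num)]
    · intro t _; rw [ha 5 (by norm_num)]
  · rw [ha 3 (by norm_num), ha 7 (by norm_num), ha 8 (by norm_num)]; exact lst
  · rw [ha 3 (by norm_num)]; exact mode

lemma Eqv.putQuery {σ τ : State} (h : Eqv σ τ) {n m : ℕ} (q : Query n m) :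
    Eqv (σ.putQuery q) (τ.putQuery q) := by
  refine ⟨fun y hy => ?_, ?_⟩
  · simp [State.putQuery, h.reg y hy]
  · simp [State.putQuery, h.arr]

lemma Query.length_le {n m : ℕ} (q : Query n m) : q.S.length ≤ m := by
  simpa using q.nodup.length_le_card

lemma Good.putQuery {X : ℕ} {σ : State} (h : Good X σ) {n m : ℕ} (hn : n ≤ X) (hm : m ≤ X)
    (q : Query n m) : Good X (σ.putQuery q) := by
  have hl := q.length_le
  refine ⟨fun y hy => ?_, fun a c => ?_⟩
  · simp only [State.putQuery]
    split_ifs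
    · exact abs_cast_le (by omega)
    · exact abs_cast_le (by omega)
    · exact abs_cast_le (by omega)
    · exact h.reg y hy
  · simp only [State.putQuery]
    split_ifs with h1 h2
    · have := (q.S[c]).2
      exact abs_cast_le (by omega)
    · exact h.arr _ _
    · exact h.arr _ _

lemma serves {mc : Mach} {I : Inst} {P LS : ℕ} {win : ℤ} (hF : Fit mc I P LS win) (hsm : I.Smooth)
    {A : Matrix (Fin I.n) (Fin I.m) ℤ} {B : Matrix (Fin I.m) (Fin I.n) ℤ}
    (htot : ∀ (i j : Fin I.n) (k : Fin I.m), I.tot i j k = A i k + B k j)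
    (hM : I.n * I.nb * I.m ≤ mc.M) (hX : 4 * I.Y + I.W + 1 ≤ mc.X) (hmX : 3 * I.m + 1 ≤ mc.X)
    (hnX : I.n * I.nb ≤ mc.X) {T : ℝ} (hT : ((3500 * I.L : ℕ) : ℝ) ≤ T) (qs : List (Query I.n I.m)) :
    ∀ {σ τ : State}, Ready I P LS win σ → Eqv σ τ → Good mc.X τ →
      (∀ q ∈ qs, q.S.length < I.L ∧ ∃ k : Fin I.m, k ∉ q.S) →
      Serves mc.w mc.M query.compile A B T τ qs := by
  induction qs with
  | nil => intro σ τ _ _ _ _; trivial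
  | cons q qs ih =>
    intro σ τ hR he hg hq
    have hnm := I.hnm
    obtain ⟨hl, k₀, hk₀⟩ := hq q (List.mem_cons_self ..)
    have hM' : I.n * I.m ≤ mc.M := by
      refine le_trans ?_ hM
      exact Nat.mul_le_mul_right _ (Nat.le_mul_of_pos_right _ I.one_le_nb)
    have hmem : ∀ k : Fin I.m, (k : ℕ) ∈ q.S.map Fin.val ↔ k ∈ q.S := fun k => by
      rw [List.mem_map_of_injective Fin.val_injective]
    obtain ⟨t, τ', σ', h1, h2, h3, h4, h5, k, hk, h8, hkS, hmin⟩ := query_run (mc := mc)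
      (hR.putQuery q) q.i.2 q.j.2 hsm hF.div_lt hF.win_ge (S := q.S.map Fin.val)
      (q.nodup.map Fin.val_injective) (by simp) (by simpa using hl)
      ⟨k₀, k₀.2, by rwa [hmem]⟩ (by simp [State.putQuery]) (by simp [State.putQuery])
      (by simp [State.putQuery]) (fun t ht => by
        simp only [List.length_map] at ht
        simp [State.putQuery, ht]) hM hM' hF.M_le hF.X_le hX hmX hnX hF.PX hF.wM hF.wX
      (τ.putQuery q) (he.putQuery q) (hg.putQuery (by omega) (by omega) q)
    refine ⟨t, τ', h1, le_trans (by exact_mod_cast h2) hT, ⟨⟨k, hk⟩, ?_, ?_, ?_⟩,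
      ih h5 h4 h3 fun q' hq' => hq q' (List.mem_cons_of_mem _ hq')⟩
    · rw [← h4.reg 8 rfl, h8]
    · rw [← hmem]; exact hkS
    · intro k' hk'
      have := hmin k' k'.2 (by rwa [hmem])
      rw [htot q.i q.j k'] at this
      rw [← htot q.i q.j ⟨k, hk⟩]; exact this


lemma le_mul_rpow_of_pow_le {x z n s : ℝ} {h : ℕ} (hh : h ≠ 0) (hx : 0 ≤ x) (hz : 0 ≤ z) (hn : 0 ≤ n)
    (H : x ^ h ≤ z ^ h * n ^ s) : x ≤ z * n ^ (s / h) := by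
  rw [← pow_le_pow_iff_left₀ hx (by positivity) hh, mul_pow, ← Real.rpow_mul_natCast hn,
    div_mul_cancel₀ _ (by exact_mod_cast hh)]
  exact H

/-- The quantities in the bounds for time and memory: `Λ` and `Φ` absorb constants and logarithms. -/
structure Est (K : FastData) (R A E h l c Λ Φ : ℕ) (I : Inst) (s y : ℝ) : Prop where
  hs : 1 ≤ s
  hE : 1 ≤ E
  hh : 1 ≤ h
  hc : 1 ≤ c
  cst : 20000 * (K.B * K.B + K.a + K.e + E + K.D + A + R + K.C + 1) * c ≤ Λ
  l_le : l ≤ 4 * c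
  log_le : Nat.log 2 I.n + 1 ≤ c
  WΔ : I.W * I.Δ ^ 2 ≤ 2 ^ (3 * c)
  fac : factorBase E l ^ (E + 1) ≤ Φ
  Φ1 : 1 ≤ Φ
  hD : K.D = 2 ^ h
  hm : (I.m : ℝ) ≤ 2 * (I.n : ℝ) ^ s
  y₁ : (I.n : ℝ) ^ 2 ≤ y
  y₂ : (I.n : ℝ) ^ (s / h) * (I.n : ℝ) ^ ((K.a : ℝ) / K.e) ≤ y
  y₃ : (I.n : ℝ) ^ 2 * ((I.n : ℝ) ^ (s / h) * (I.n : ℝ) ^ ((1 : ℝ) / E)) ≤ y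

namespace Est

variable {K : FastData} {R A E h l c Λ Φ : ℕ} {I : Inst} {s y : ℝ}

lemma cst_le (H : Est K R A E h l c Λ Φ I s y) {x : ℕ}
    (hx : x ≤ 20000 * (K.B * K.B + K.a + K.e + E + K.D + A + R + K.C + 1)) : x * c ≤ Λ :=
  (Nat.mul_le_mul_right _ hx).trans H.cst

lemma cst_le' (H : Est K R A E h l c Λ Φ I s y) {x : ℕ}
    (hx : x ≤ 20000 * (K.B * K.B + K.a + K.e + E + K.D + A + R + K.C + 1)) : x ≤ Λ :=
  (Nat.le_mul_of_pos_right _ H.hc).trans (H.cst_le hx)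

lemma r_le (H : Est K R A E h l c Λ Φ I s y) {p q : ℕ} (hp : 1 ≤ p) (hq : q = 8 * I.W * p)
    (hpΔ : p ≤ I.Δ ^ 2 * factorBase E l ^ (E + 1)) : K.r q ≤ Λ * Φ := by
  have hW : 1 ≤ I.W := I.hΔ.trans I.hΔW
  have hq1 : 1 ≤ q := by rw [hq]; exact Nat.mul_pos (by omega) hp
  have h1 : 2 ^ K.r q ≤ 2 ^ (K.D + (3 + (3 * c + Φ))) := by
    calc 2 ^ K.r q ≤ K.D ^ K.r q := Nat.pow_le_pow_left K.hD _
      _ ≤ K.D * q := K.D_pow_r_le hq1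
      _ ≤ K.D * (8 * I.W * (I.Δ ^ 2 * Φ)) := by
          rw [hq]; gcongr; exact hpΔ.trans (Nat.mul_le_mul_left _ H.fac)
      _ = K.D * (2 ^ 3 * ((I.W * I.Δ ^ 2) * Φ)) := by ring
      _ ≤ 2 ^ K.D * (2 ^ 3 * (2 ^ (3 * c) * 2 ^ Φ)) := by
          gcongr
          · exact Nat.lt_two_pow_self.le
          · exact H.WΔ
          · exact Nat.lt_two_pow_self.le
      _ = _ := by rw [pow_add, pow_add, pow_add]
  have h2 := (Nat.pow_le_pow_iff_right (by norm_num)).1 h1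
  have h3 : (K.D + 7) * c ≤ Λ := H.cst_le (by omega)
  have hc := H.hc
  have hΦ := H.Φ1
  have : (K.D + 7) * c * Φ ≤ Λ * Φ := Nat.mul_le_mul_right _ h3
  have : K.D + (3 + (3 * c + Φ)) ≤ (K.D + 7) * c * Φ := by
    have h4 : 1 ≤ c * Φ := Nat.mul_pos hc hΦ
    have h5 : K.D ≤ K.D * (c * Φ) := Nat.le_mul_of_pos_right _ h4
    have h6 : c ≤ c * Φ := Nat.le_mul_of_pos_right _ hΦ
    have h7 : Φ ≤ c * Φ := Nat.le_mul_of_pos_left _ hc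
    have h8 : (K.D + 7) * c * Φ = K.D * (c * Φ) + 7 * (c * Φ) := by ring
    omega
  omega

lemma u_le (H : Est K R A E h l c Λ Φ I s y) : K.u I.n + 2 ≤ Λ := by
  have h1 : 2 ^ (K.u I.n * K.e) ≤ 2 ^ (K.e + c * K.a) := by
    rw [pow_mul, pow_add, pow_mul]
    refine (K.two_pow_u_le I.hn).trans (Nat.mul_le_mul_left _ (Nat.pow_le_pow_left ?_ _))
    exact (Nat.lt_pow_succ_log_self (by norm_num) _).le.trans
      (Nat.pow_le_pow_right (by norm_num) H.log_le)
  have h2 := (Nat.pow_le_pow_iff_right (by norm_num)).1 h1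
  have h3 : K.u I.n ≤ K.u I.n * K.e := Nat.le_mul_of_pos_right _ K.he
  have h4 : (K.e + K.a + 2) * c ≤ Λ := H.cst_le (by omega)
  have hc := H.hc
  have h5 : K.e ≤ K.e * c := Nat.le_mul_of_pos_right _ hc
  have h6 : (K.e + K.a + 2) * c = K.e * c + c * K.a + 2 * c := by ring
  omega

lemma setup_le (H : Est K R A E h l c Λ Φ I s y) {q : ℕ} (hr : K.r q ≤ Λ * Φ) :
    K.setupTime I.n q + 128 ≤ 3 * (Λ * Λ * Φ) := by
  have hΦ := H.Φ1
  have h1 : 300 * (K.B * K.B) + 50 * K.a + 1128 ≤ Λ := H.cst_le' (by omega)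
  have h2 : 251 ≤ Λ := H.cst_le' (by omega)
  have h3 : 50 * K.e + 200 ≤ Λ := H.cst_le' (by omega)
  have h4 := Nat.mul_le_mul H.u_le h3
  have h5 : 251 * K.r q ≤ Λ * (Λ * Φ) := Nat.mul_le_mul h2 hr
  have h6 : Λ * Λ ≤ Λ * Λ * Φ := Nat.le_mul_of_pos_right _ hΦ
  have h7 : Λ ≤ Λ * Λ := Nat.le_mul_of_pos_right _ (by omega)
  rw [← mul_assoc] at h5
  unfold FastData.setupTime
  omega

lemma one_le_ratio (H : Est K R A E h l c Λ Φ I s y) (hL : I.L ≤ I.m) :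
    1 ≤ 2 * ((I.n : ℝ) ^ s / I.L) := by
  have h0 : (0 : ℝ) < I.L := by exact_mod_cast I.hL
  have h1 : (I.L : ℝ) ≤ I.m := by exact_mod_cast hL
  rw [← mul_div_assoc, le_div_iff₀ h0]
  linarith [H.hm]

lemma P_le (H : Est K R A E h l c Λ Φ I s y) (hL : I.L ≤ I.m) :
    (I.P : ℝ) ≤ 4 * ((I.n : ℝ) ^ s / I.L) := by
  have h0 : (0 : ℝ) < I.L := by exact_mod_cast I.hL
  have h1 : I.P * I.L ≤ 2 * I.m := by
    have := Nat.div_mul_le_self (I.m - 1) I.L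
    rw [Inst.P, add_mul, one_mul]; omega
  have h2 : (I.P : ℝ) * I.L ≤ 2 * I.m := by exact_mod_cast h1
  rw [← mul_div_assoc, le_div_iff₀ h0]
  linarith [H.hm]

lemma nb_le (I : Inst) : I.nb * I.Δ ≤ 2 * I.n := by
  have := Nat.div_mul_le_self (I.n - 1) I.Δ
  have := I.hΔn
  rw [Inst.nb, add_mul, one_mul]; omega

lemma cells_le (H : Est K R A E h l c Λ Φ I s y) :
    ((I.n * I.nb * I.m : ℕ) : ℝ) ≤ 4 * ((I.n : ℝ) ^ (2 + s) / I.Δ) := by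
  have h0 : (0 : ℝ) < I.Δ := by exact_mod_cast I.hΔ
  have h1 : (I.nb : ℝ) * I.Δ ≤ 2 * I.n := by exact_mod_cast nb_le I
  have hn : (0 : ℝ) < I.n := by exact_mod_cast I.hn
  rw [← mul_div_assoc, le_div_iff₀ h0, Real.rpow_add hn, Real.rpow_two]
  push_cast
  calc (I.n : ℝ) * I.nb * I.m * I.Δ = I.n * (I.nb * I.Δ) * I.m := by ring
    _ ≤ I.n * (2 * I.n) * (2 * (I.n : ℝ) ^ s) := by gcongr; exact H.hm
    _ = _ := by ring

lemma two_pow_r_le (H : Est K R A E h l c Λ Φ I s y) {q : ℕ} (hq : K.D ^ K.r q ≤ I.m) :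
    (2 : ℝ) ^ K.r q ≤ 2 * (I.n : ℝ) ^ (s / h) := by
  have hh := H.hh
  refine le_mul_rpow_of_pow_le (by omega) (by positivity) (by norm_num) (by positivity) ?_
  rw [← pow_mul, mul_comm, pow_mul]
  have h1 : ((2 : ℝ) ^ h) ^ K.r q ≤ I.m := by
    have := hq; rw [H.hD] at this; exact_mod_cast this
  refine h1.trans (H.hm.trans ?_)
  gcongr
  exact le_self_pow₀ (by norm_num) (by omega)

lemma two_pow_u_le (K : FastData) (I : Inst) :
    (2 : ℝ) ^ K.u I.n ≤ 2 * (I.n : ℝ) ^ ((K.a : ℝ) / K.e) := by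
  have he := K.he
  refine le_mul_rpow_of_pow_le (by omega) (by positivity) (by norm_num) (by positivity) ?_
  rw [Real.rpow_natCast]
  exact_mod_cast K.two_pow_u_le I.hn

lemma B_pow_le (K : FastData) {q : ℕ} (hq : 1 ≤ q) : K.B ^ K.r q ≤ 2 ^ K.r q * (K.D * q) := by
  have hB : K.B ≤ 2 * K.D := by have := K.hBD; omega
  calc K.B ^ K.r q ≤ (2 * K.D) ^ K.r q := Nat.pow_le_pow_left hB _
    _ = 2 ^ K.r q * K.D ^ K.r q := mul_pow _ _ _
    _ ≤ _ := Nat.mul_le_mul_left _ (K.D_pow_r_le hq)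

section
variable {p p₀ d q : ℕ} (H : Est K R A E h l c Λ Φ I s y) (hL : I.L ≤ I.m) (hp : 1 ≤ p)
  (hpd : p = p₀ * d) (hd : d ≤ factorBase E l ^ (E + 1)) (h₀ : p₀ ^ E ≤ I.Δ ^ (E + 1))
  (hq : q = 8 * I.W * p)
include H hL hp hpd hd h₀ hq

lemma fast_le (hf : K.Fits I q) :
    (I.P : ℝ) * (K.B ^ K.r q) * 2 ^ K.u I.n ≤
      128 * (K.D * Φ) * ((I.Δ : ℝ) ^ 2 * ((I.n : ℝ) ^ s / I.L) * I.W * y) := by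
  have hW : 1 ≤ I.W := I.hΔ.trans I.hΔW
  have hq1 : 1 ≤ q := by rw [hq]; exact Nat.mul_pos (by omega) hp
  have hDB : K.D ≤ K.B := by have := K.hBD; have := K.hD; omega
  have hDm : K.D ^ K.r q ≤ I.m := (Nat.pow_le_pow_left hDB _).trans
    ((Nat.le_mul_of_pos_right _ I.hΔ).trans hf.1)
  have h1 := H.two_pow_r_le hDm
  have h2 := two_pow_u_le K I
  have h3 : (K.B : ℝ) ^ K.r q ≤ 2 ^ K.r q * (K.D * q) := by exact_mod_cast B_pow_le K hq1
  have h4 : q ≤ 8 * I.W * (I.Δ ^ 2 * Φ) := by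
    rw [hq]
    exact Nat.mul_le_mul_left _ ((le_sq_mul H.hE I.hΔ hpd hd h₀).trans (Nat.mul_le_mul_left _ H.fac))
  have h4' : (q : ℝ) ≤ 8 * I.W * (I.Δ ^ 2 * Φ) := by exact_mod_cast h4
  have hy : (2 : ℝ) ^ K.r q * 2 ^ K.u I.n ≤ 4 * y := by
    calc _ ≤ (2 * (I.n : ℝ) ^ (s / h)) * (2 * (I.n : ℝ) ^ ((K.a : ℝ) / K.e)) := by gcongr
      _ = 4 * ((I.n : ℝ) ^ (s / h) * (I.n : ℝ) ^ ((K.a : ℝ) / K.e)) := by ring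
      _ ≤ _ := by linarith [H.y₂]
  calc (I.P : ℝ) * (K.B ^ K.r q) * 2 ^ K.u I.n
      ≤ (4 * ((I.n : ℝ) ^ s / I.L)) * (2 ^ K.r q * (K.D * (8 * I.W * (I.Δ ^ 2 * Φ)))) * 2 ^ K.u I.n := by
        gcongr
        · exact H.P_le hL
        · exact h3.trans (by gcongr)
    _ = (4 * ((I.n : ℝ) ^ s / I.L)) * (K.D * (8 * I.W * (I.Δ ^ 2 * Φ))) * (2 ^ K.r q * 2 ^ K.u I.n) := by
        ring
    _ ≤ (4 * ((I.n : ℝ) ^ s / I.L)) * (K.D * (8 * I.W * (I.Δ ^ 2 * Φ))) * (4 * y) := by gcongr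
    _ = _ := by ring

lemma slow_le (hf : ¬ K.Fits I q) :
    (I.n : ℝ) * I.n * I.m ≤
      (4 * K.C + 32 * K.D) * Φ * ((I.Δ : ℝ) ^ 2 * ((I.n : ℝ) ^ s / I.L) * I.W * y) := by
  have hW : 1 ≤ I.W := I.hΔ.trans I.hΔW
  have hq1 : 1 ≤ q := by rw [hq]; exact Nat.mul_pos (by omega) hp
  have hξ := H.one_le_ratio hL
  have hn : (1 : ℝ) ≤ I.n := by exact_mod_cast I.hn
  have hΔ1 : (1 : ℝ) ≤ I.Δ := by exact_mod_cast I.hΔ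
  have hW1 : (1 : ℝ) ≤ I.W := by exact_mod_cast hW
  have hΦ1 : (1 : ℝ) ≤ Φ := by exact_mod_cast H.Φ1
  have hy0 : 0 ≤ y := le_trans (by positivity) H.y₁
  obtain ⟨ξ, eξ⟩ : ∃ ξ, ξ = (I.n : ℝ) ^ s / I.L := ⟨_, rfl⟩
  rw [← eξ] at hξ ⊢
  have hξ0 : 0 ≤ ξ := by linarith
  have hC : (0 : ℝ) ≤ K.C := by positivity
  have hDp : (0 : ℝ) ≤ K.D := by positivity
  have base : (I.W : ℝ) * I.Δ ^ 2 * y ≤ 2 * ((I.Δ : ℝ) ^ 2 * ξ * I.W * y) := by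
    calc (I.W : ℝ) * I.Δ ^ 2 * y = (I.W * I.Δ ^ 2 * y) * 1 := (mul_one _).symm
      _ ≤ (I.W * I.Δ ^ 2 * y) * (2 * ξ) := by gcongr
      _ = _ := by ring
  obtain ⟨T, hT⟩ : ∃ T, T = (I.Δ : ℝ) ^ 2 * ξ * I.W * y := ⟨_, rfl⟩
  rw [← hT] at base ⊢
  have hT0 : 0 ≤ T := by rw [hT]; positivity
  have low : ∀ {z : ℝ}, z ≤ 4 * K.C * T → z ≤ (4 * K.C + 32 * K.D) * Φ * T := fun hz => by
    refine hz.trans (mul_le_mul_of_nonneg_right ?_ hT0)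
    calc (4 * K.C : ℝ) = 4 * K.C * 1 := (mul_one _).symm
      _ ≤ (4 * K.C + 32 * K.D) * Φ := by gcongr; linarith
  have high : ∀ {z : ℝ}, z ≤ 32 * (K.D * Φ) * T → z ≤ (4 * K.C + 32 * K.D) * Φ * T := fun hz => by
    refine hz.trans (mul_le_mul_of_nonneg_right ?_ hT0)
    calc (32 * (K.D * Φ) : ℝ) = 32 * K.D * Φ := by ring
      _ ≤ (4 * K.C + 32 * K.D) * Φ := by gcongr; linarith
  by_cases hZ : K.Z I.n * I.Δ ≤ I.n * I.n * I.m
  · have hB : I.m < K.B ^ K.r q * I.Δ := by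
      by_contra hlt; exact hf ⟨by omega, hZ⟩
    apply high
    by_cases hDm : K.D ^ K.r q ≤ I.m
    · have h1 := H.two_pow_r_le hDm
      have h2 : (p₀ : ℝ) ≤ I.Δ * (I.n : ℝ) ^ ((1 : ℝ) / E) := by
        have hE := H.hE
        refine le_mul_rpow_of_pow_le (by omega) (by positivity) (by positivity) (by positivity) ?_
        rw [Real.rpow_one]
        have : p₀ ^ E ≤ I.Δ ^ E * I.n := h₀.trans (by rw [pow_succ]; exact Nat.mul_le_mul_left _ I.hΔn)
        exact_mod_cast this
      have h3 : I.m ≤ 2 ^ K.r q * (K.D * (8 * I.W * (p₀ * Φ))) * I.Δ := by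
        refine hB.le.trans (Nat.mul_le_mul_right _ ((B_pow_le K hq1).trans ?_))
        rw [hq, hpd]; gcongr; exact hd.trans H.fac
      have h4 : (I.m : ℝ) ≤ 2 ^ K.r q * (K.D * (8 * I.W * (p₀ * Φ))) * I.Δ := by exact_mod_cast h3
      calc (I.n : ℝ) * I.n * I.m ≤ I.n * I.n * ((2 * (I.n : ℝ) ^ (s / h)) *
            (K.D * (8 * I.W * ((I.Δ * (I.n : ℝ) ^ ((1 : ℝ) / E)) * Φ))) * I.Δ) := by
            gcongr
            exact h4.trans (by gcongr)
        _ = 16 * (K.D * Φ) * (I.W * I.Δ ^ 2 *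
            ((I.n : ℝ) ^ 2 * ((I.n : ℝ) ^ (s / h) * (I.n : ℝ) ^ ((1 : ℝ) / E)))) := by ring
        _ ≤ 16 * (K.D * Φ) * (I.W * I.Δ ^ 2 * y) := by gcongr; exact H.y₃
        _ ≤ 16 * (K.D * Φ) * (2 * T) := by gcongr
        _ = _ := by ring
    · have h1 : I.m ≤ K.D * (8 * I.W * (I.Δ ^ 2 * Φ)) := by
        refine (not_le.1 hDm).le.trans ((K.D_pow_r_le hq1).trans (Nat.mul_le_mul_left _ ?_))
        rw [hq]
        exact Nat.mul_le_mul_left _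
          ((le_sq_mul H.hE I.hΔ hpd hd h₀).trans (Nat.mul_le_mul_left _ H.fac))
      have h2 : (I.m : ℝ) ≤ K.D * (8 * I.W * (I.Δ ^ 2 * Φ)) := by exact_mod_cast h1
      calc (I.n : ℝ) * I.n * I.m ≤ (I.n * I.n) * (K.D * (8 * I.W * (I.Δ ^ 2 * Φ))) := by gcongr
        _ = 8 * (K.D * Φ) * (I.W * I.Δ ^ 2 * (I.n : ℝ) ^ 2) := by ring
        _ ≤ 8 * (K.D * Φ) * (I.W * I.Δ ^ 2 * y) := by gcongr; exact H.y₁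
        _ ≤ 8 * (K.D * Φ) * (2 * T) := by gcongr
        _ ≤ 32 * (K.D * Φ) * T := by
          have : 0 ≤ K.D * Φ * T := by positivity
          linarith
  · apply low
    have h1 : ((I.n * I.n * I.m : ℕ) : ℝ) ≤ (K.C * 2 ^ K.u I.n * I.Δ : ℕ) := by
      exact_mod_cast (not_le.1 hZ).le
    have h2 : (2 : ℝ) ^ K.u I.n ≤ 2 * y := by
      refine (two_pow_u_le K I).trans (mul_le_mul_of_nonneg_left (le_trans ?_ H.y₂) (by norm_num))
      refine le_mul_of_one_le_left (by positivity) (Real.one_le_rpow hn ?_)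
      have := H.hs; positivity
    push_cast at h1
    calc (I.n : ℝ) * I.n * I.m ≤ K.C * (2 * y) * I.Δ := h1.trans (by gcongr)
      _ = 2 * K.C * (1 * I.Δ * y) := by ring
      _ ≤ 2 * K.C * (I.W * I.Δ ^ 2 * y) := by
          gcongr; exact le_self_pow₀ hΔ1 (by norm_num)
      _ ≤ 2 * K.C * (2 * T) := by gcongr
      _ = _ := by ring

lemma time_le : ((2100 * (l + 1) * (I.n * I.nb * I.m) + 310 + mainTime K R A E l I p : ℕ) : ℝ) ≤
    ((Λ ^ 6 * Φ ^ 2 : ℕ) : ℝ) * ((I.Δ : ℝ) ^ 2 * ((I.n : ℝ) ^ s / I.L) * I.W * y +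
      (I.n : ℝ) ^ (2 + s) / I.Δ) := by
  have hr := H.r_le hp hq (le_sq_mul H.hE I.hΔ hpd hd h₀)
  have hset := H.setup_le hr
  have hW : 1 ≤ I.W := I.hΔ.trans I.hΔW
  have hP1 := I.one_le_P
  have hΦ := H.Φ1
  have hfac := H.fac
  have hc1 := H.hc
  have hy0 : 0 ≤ y := le_trans (by positivity) H.y₁
  have Λ2 : 20000 ≤ Λ := H.cst_le' (by omega)
  have hN1 : 1 ≤ I.n * I.nb * I.m := Nat.mul_pos (Nat.mul_pos I.hn I.one_le_nb) I.hm
  obtain ⟨N, hN⟩ : ∃ N, N = I.n * I.nb * I.m := ⟨_, rfl⟩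
  have hNr := H.cells_le
  rw [← hN] at hN1 hNr
  obtain ⟨T₁, hT₁⟩ : ∃ T, T = (I.Δ : ℝ) ^ 2 * ((I.n : ℝ) ^ s / I.L) * I.W * y := ⟨_, rfl⟩
  obtain ⟨T₂, hT₂⟩ : ∃ T, T = (I.n : ℝ) ^ (2 + s) / I.Δ := ⟨_, rfl⟩
  have hT₁0 : 0 ≤ T₁ := by rw [hT₁]; positivity
  have hT₂0 : 0 ≤ T₂ := by rw [hT₂]; positivity
  have hl : ((800 * (I.n * I.n * ((4 * I.W + 1) * I.P + 1)) : ℕ) : ℝ) ≤ Λ * T₁ := by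
    have h1 : (4 * I.W + 1) * I.P + 1 ≤ 6 * (I.W * I.P) := by
      have h1 : I.P ≤ I.W * I.P := Nat.le_mul_of_pos_left _ hW
      have h2 : (4 * I.W + 1) * I.P = 4 * (I.W * I.P) + I.P := by ring
      omega
    have h2 : ((800 * (I.n * I.n * ((4 * I.W + 1) * I.P + 1)) : ℕ) : ℝ) ≤
        (800 * (I.n * I.n * (6 * (I.W * I.P))) : ℕ) := by
      exact_mod_cast Nat.mul_le_mul_left _ (Nat.mul_le_mul_left _ h1)
    refine h2.trans ?_
    push_cast
    have h3 : (1 : ℝ) ≤ (I.Δ : ℝ) ^ 2 := one_le_pow₀ (by exact_mod_cast I.hΔ)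
    have h4 : (19200 : ℝ) ≤ Λ := by exact_mod_cast (by omega : 19200 ≤ Λ)
    calc (800 : ℝ) * (I.n * I.n * (6 * (I.W * I.P))) = 4800 * ((I.n : ℝ) ^ 2 * (I.W * I.P)) := by ring
      _ ≤ 4800 * (y * (I.W * (4 * ((I.n : ℝ) ^ s / I.L)))) := by
          gcongr
          · exact H.y₁
          · exact H.P_le hL
      _ = 19200 * (1 * ((I.n : ℝ) ^ s / I.L) * I.W * y) := by ring
      _ ≤ Λ * ((I.Δ : ℝ) ^ 2 * ((I.n : ℝ) ^ s / I.L) * I.W * y) := by gcongr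
      _ = _ := by rw [hT₁]
  have hcount : ((K.chooseTime R A I q : ℕ) : ℝ) ≤
      ((3 * (Λ * Λ * Φ) : ℕ) : ℝ) + ((Λ ^ 5 * Φ ^ 2 : ℕ) : ℝ) * T₁ := by
    unfold FastData.chooseTime
    split_ifs with hf
    · have h1 := H.fast_le hL hp hpd hd h₀ hq hf
      rw [← hT₁] at h1
      have h2 : (111 * A + 2000) * (K.r q + 1) * (10 * A + R + K.B + 10) * K.C * (128 * (K.D * Φ)) ≤
          Λ ^ 5 * Φ ^ 2 := by
        have e1 : 111 * A + 2000 ≤ Λ := H.cst_le' (by omega)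
        have hBB : K.B ≤ K.B * K.B := Nat.le_mul_self _
        have e2 : 10 * A + R + K.B + 10 ≤ Λ := H.cst_le' (by omega)
        have e3 : K.C ≤ Λ := H.cst_le' (by omega)
        have e4 : 256 * K.D ≤ Λ := H.cst_le' (by omega)
        have e5 : K.r q + 1 ≤ 2 * (Λ * Φ) := by
          have : 1 ≤ Λ * Φ := Nat.mul_pos (by omega) hΦ
          omega
        calc _ ≤ Λ * (2 * (Λ * Φ)) * Λ * Λ * (128 * (K.D * Φ)) := by gcongr
          _ = Λ ^ 4 * Φ ^ 2 * (256 * K.D) := by ring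
          _ ≤ Λ ^ 4 * Φ ^ 2 * Λ := Nat.mul_le_mul_left _ e4
          _ = _ := by ring
      have h2' : (((111 * A + 2000) * (K.r q + 1) * (10 * A + R + K.B + 10) * K.C *
          (128 * (K.D * Φ)) : ℕ) : ℝ) ≤ ((Λ ^ 5 * Φ ^ 2 : ℕ) : ℝ) := by exact_mod_cast h2
      have h3 : K.setupTime I.n q + 120 + K.fastTime R A I q ≤ 3 * (Λ * Λ * Φ) +
          (111 * A + 2000) * (K.r q + 1) * (10 * A + R + K.B + 10) * K.C *
            (I.P * K.B ^ K.r q * 2 ^ K.u I.n) := by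
        have : K.fastTime R A I q = (111 * A + 2000) * (K.r q + 1) * (10 * A + R + K.B + 10) * K.C *
            (I.P * K.B ^ K.r q * 2 ^ K.u I.n) + 8 := by
          unfold FastData.fastTime FastData.Z; ring
        rw [this]; omega
      have h3' : ((K.setupTime I.n q + 120 + K.fastTime R A I q : ℕ) : ℝ) ≤ ((3 * (Λ * Λ * Φ) : ℕ) : ℝ) +
          (((111 * A + 2000) * (K.r q + 1) * (10 * A + R + K.B + 10) * K.C : ℕ) : ℝ) *
            (I.P * K.B ^ K.r q * 2 ^ K.u I.n) := by exact_mod_cast h3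
      refine h3'.trans (add_le_add le_rfl ((mul_le_mul_of_nonneg_left h1 (Nat.cast_nonneg _)).trans ?_))
      calc _ = (((111 * A + 2000) * (K.r q + 1) * (10 * A + R + K.B + 10) * K.C *
          (128 * (K.D * Φ)) : ℕ) : ℝ) * T₁ := by push_cast; ring
        _ ≤ _ := by gcongr
    · have h1 := H.slow_le hL hp hpd hd h₀ hq hf
      rw [← hT₁] at h1
      have h2 : 400 * ((4 * K.C + 32 * K.D) * Φ) ≤ Λ ^ 5 * Φ ^ 2 := by
        have e1 : 400 * (4 * K.C + 32 * K.D) ≤ Λ := H.cst_le' (by omega)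
        calc _ = 400 * (4 * K.C + 32 * K.D) * Φ := by ring
          _ ≤ Λ * Φ := Nat.mul_le_mul_right _ e1
          _ ≤ Λ ^ 5 * Φ ^ 2 := Nat.mul_le_mul (Nat.le_self_pow (by norm_num) _)
              (Nat.le_self_pow (by norm_num) _)
      have h2' : ((400 * ((4 * K.C + 32 * K.D) * Φ) : ℕ) : ℝ) ≤ ((Λ ^ 5 * Φ ^ 2 : ℕ) : ℝ) := by
        exact_mod_cast h2
      have h3 : ((K.setupTime I.n q + 120 : ℕ) : ℝ) ≤ ((3 * (Λ * Λ * Φ) : ℕ) : ℝ) := by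
        exact_mod_cast (by omega)
      rw [Nat.cast_add]
      refine add_le_add h3 ?_
      calc ((400 * (I.n * I.n * I.m) : ℕ) : ℝ) = 400 * ((I.n : ℝ) * I.n * I.m) := by push_cast; ring
        _ ≤ 400 * ((4 * K.C + 32 * K.D) * Φ * T₁) := by gcongr
        _ = ((400 * ((4 * K.C + 32 * K.D) * Φ) : ℕ) : ℝ) * T₁ := by push_cast; ring
        _ ≤ _ := by gcongr
  have hrest : 2100 * (l + 1) * N + 310 +
      (2 * Nat.log 2 I.n + 3) * (factorBase E l ^ (E + 1) + 2) * (600 * N + 100 * E + 2000) +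
      3 * (Λ * Λ * Φ) + 1100 * N + 50 ≤ 6 * (Λ * Λ * Φ) * N := by
    have hl4 := H.l_le
    have e1 : 2100 * (l + 1) + 310 ≤ Λ := by
      have : 10810 * c ≤ Λ := H.cst_le (by omega)
      omega
    have e2 : 2 * Nat.log 2 I.n + 3 ≤ Λ := by
      have := H.log_le
      have : 5 * c ≤ Λ := H.cst_le (by omega)
      omega
    obtain ⟨k, hk⟩ : ∃ k, k = 600 + 100 * E + 2000 := ⟨_, rfl⟩
    have e3 : 3 * k ≤ Λ := H.cst_le' (by omega)
    have e4 : 600 * N + 100 * E + 2000 ≤ k * N := by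
      have : E ≤ E * N := Nat.le_mul_of_pos_right _ hN1
      have : k * N = 600 * N + 100 * (E * N) + 2000 * N := by rw [hk]; ring
      omega
    have e5 : (2 * Nat.log 2 I.n + 3) * (factorBase E l ^ (E + 1) + 2) * (600 * N + 100 * E + 2000) ≤
        Λ * Λ * Φ * N := by
      calc _ ≤ Λ * (3 * Φ) * (k * N) := by
            refine Nat.mul_le_mul (Nat.mul_le_mul e2 ?_) e4
            omega
        _ = Λ * Φ * N * (3 * k) := by ring
        _ ≤ Λ * Φ * N * Λ := Nat.mul_le_mul_left _ e3
        _ = _ := by ring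
    obtain ⟨Q, hQ⟩ : ∃ Q, Q = Λ * Λ * Φ := ⟨_, rfl⟩
    have e6 : Λ ≤ Q := by
      rw [hQ, mul_assoc]; exact Nat.le_mul_of_pos_right _ (Nat.mul_pos (by omega) hΦ)
    rw [← hQ] at e5 ⊢
    have e7 : Q ≤ Q * N := Nat.le_mul_of_pos_right _ hN1
    have e8 : Λ * N ≤ Q * N := Nat.mul_le_mul_right _ e6
    obtain ⟨k', hk'⟩ : ∃ k', k' = 2100 * (l + 1) + 310 := ⟨_, rfl⟩
    rw [← hk'] at e1
    have e9 : k' * N ≤ Λ * N := Nat.mul_le_mul_right _ e1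
    have e10 : 1150 * N ≤ Λ * N := Nat.mul_le_mul_right _ (by omega)
    have e11 : k' * N = 2100 * (l + 1) * N + 310 * N := by rw [hk']; ring
    have e12 : 6 * Q * N = 6 * (Q * N) := by ring
    omega
  have hrest' : ((2100 * (l + 1) * N + 310 + (2 * Nat.log 2 I.n + 3) *
      (factorBase E l ^ (E + 1) + 2) * (600 * N + 100 * E + 2000) +
      3 * (Λ * Λ * Φ) + 1100 * N + 50 : ℕ) : ℝ) ≤ ((6 * (Λ * Λ * Φ) * N : ℕ) : ℝ) := by
    exact_mod_cast hrest
  have h24 : 24 * (Λ * Λ * Φ) ≤ Λ ^ 6 * Φ ^ 2 := by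
    calc 24 * (Λ * Λ * Φ) ≤ Λ ^ 4 * (Λ * Λ * Φ ^ 2) := Nat.mul_le_mul
          (le_trans (by omega) (Nat.le_self_pow (by norm_num) _))
          (Nat.mul_le_mul_left _ (Nat.le_self_pow (by norm_num) _))
      _ = _ := by ring
  have h24' : ((24 * (Λ * Λ * Φ) : ℕ) : ℝ) ≤ ((Λ ^ 6 * Φ ^ 2 : ℕ) : ℝ) := by exact_mod_cast h24
  have h25 : Λ ^ 5 * Φ ^ 2 + Λ ≤ Λ ^ 6 * Φ ^ 2 := by
    have h1 : Λ ≤ Λ ^ 5 * Φ ^ 2 := (Nat.le_self_pow (by norm_num : 5 ≠ 0) Λ).trans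
      (Nat.le_mul_of_pos_right _ (by positivity))
    calc _ ≤ Λ ^ 5 * Φ ^ 2 * 2 := by omega
      _ ≤ Λ ^ 5 * Φ ^ 2 * Λ := Nat.mul_le_mul_left _ (by omega)
      _ = _ := by ring
  have h25' : ((Λ ^ 5 * Φ ^ 2 : ℕ) : ℝ) + Λ ≤ ((Λ ^ 6 * Φ ^ 2 : ℕ) : ℝ) := by exact_mod_cast h25
  rw [← hT₁, ← hT₂]
  rw [← hT₂] at hNr
  rw [mainTime, ← hN, ← hq]
  have f1 : ((6 * (Λ * Λ * Φ) * N : ℕ) : ℝ) ≤ ((24 * (Λ * Λ * Φ) : ℕ) : ℝ) * T₂ := by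
    calc ((6 * (Λ * Λ * Φ) * N : ℕ) : ℝ) = 6 * (Λ * Λ * Φ) * (N : ℝ) := by push_cast; ring
      _ ≤ 6 * (Λ * Λ * Φ) * (4 * T₂) := by gcongr
      _ = _ := by push_cast; ring
  have f2 := mul_le_mul_of_nonneg_right h24' hT₂0
  have f3 := mul_le_mul_of_nonneg_right h25' hT₁0
  push_cast at hrest' hl hcount f1 f2 f3 ⊢
  linarith

end

end Est


namespace Est

variable {K : FastData} {R A E h l c Λ Φ : ℕ} {I : Inst} {s y : ℝ}

lemma base_le (H : Est K R A E h l c Λ Φ I s y) :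
    ((2100 * (l + 1) * (I.n * I.nb * I.m) + 310 + I.n * I.nb * I.m + K.B * K.B : ℕ) : ℝ) ≤
      ((Λ ^ 6 * Φ ^ 2 : ℕ) : ℝ) * ((I.n : ℝ) ^ (2 + s) / I.Δ) := by
  have hN1 : 1 ≤ I.n * I.nb * I.m := Nat.mul_pos (Nat.mul_pos I.hn I.one_le_nb) I.hm
  obtain ⟨N, hN⟩ : ∃ N, N = I.n * I.nb * I.m := ⟨_, rfl⟩
  have hNr := H.cells_le
  have hl := H.l_le
  have hΦ := H.Φ1
  rw [← hN] at hN1 hNr ⊢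
  obtain ⟨k, hk⟩ : ∃ k, k = 2100 * (l + 1) + 310 := ⟨_, rfl⟩
  have e1 : 10810 * c ≤ Λ := H.cst_le (by omega)
  have e2 : K.B * K.B + 100 ≤ Λ := H.cst_le' (by omega)
  have hc := H.hc
  have e3 : k * N ≤ Λ * N := Nat.mul_le_mul_right _ (by omega)
  have e4 : k * N = 2100 * (l + 1) * N + 310 * N := by rw [hk]; ring
  have e5 : Λ ≤ Λ * N := Nat.le_mul_of_pos_right _ hN1
  have e7 : 2100 * (l + 1) * N + 310 + N + K.B * K.B ≤ 3 * Λ * N := by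
    have : 3 * Λ * N = 3 * (Λ * N) := by ring
    omega
  have e8 : 12 * Λ ≤ Λ ^ 6 * Φ ^ 2 := by
    calc 12 * Λ ≤ Λ ^ 5 * Λ * 1 := by
          rw [mul_one]; exact Nat.mul_le_mul_right _ (le_trans (by omega) (Nat.le_self_pow (by norm_num) _))
      _ ≤ Λ ^ 5 * Λ * Φ ^ 2 := Nat.mul_le_mul_left _ (Nat.one_le_pow _ _ hΦ)
      _ = _ := by ring
  have e7' : ((2100 * (l + 1) * N + 310 + N + K.B * K.B : ℕ) : ℝ) ≤ ((3 * Λ * N : ℕ) : ℝ) := by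
    exact_mod_cast e7
  refine e7'.trans ?_
  calc ((3 * Λ * N : ℕ) : ℝ) = 3 * Λ * (N : ℝ) := by push_cast; ring
    _ ≤ 3 * Λ * (4 * ((I.n : ℝ) ^ (2 + s) / I.Δ)) := by gcongr
    _ = ((12 * Λ : ℕ) : ℝ) * ((I.n : ℝ) ^ (2 + s) / I.Δ) := by push_cast; ring
    _ ≤ _ := by gcongr

lemma counters_le (H : Est K R A E h l c Λ Φ I s y) (hL : I.L ≤ I.m) :
    ((I.P * I.n * I.n * (8 * I.W * (I.Δ ^ 2 * factorBase E l ^ (E + 1))) : ℕ) : ℝ) ≤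
      ((Λ ^ 6 * Φ ^ 2 : ℕ) : ℝ) * ((I.Δ : ℝ) ^ 2 * I.W * (I.n : ℝ) ^ (2 + s) / I.L) := by
  have hn : (0 : ℝ) < I.n := by exact_mod_cast I.hn
  have hF : ((factorBase E l ^ (E + 1) : ℕ) : ℝ) ≤ Φ := by exact_mod_cast H.fac
  have e2 : 32 ≤ Λ := H.cst_le' (by omega)
  have e3 : 32 * Φ ≤ Λ ^ 6 * Φ ^ 2 := Nat.mul_le_mul (e2.trans (Nat.le_self_pow (by norm_num) _))
    (Nat.le_self_pow (by norm_num) _)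
  calc _ = (I.P : ℝ) * I.n * I.n * (8 * I.W * (I.Δ ^ 2 * ((factorBase E l ^ (E + 1) : ℕ) : ℝ))) := by
        push_cast; ring
    _ ≤ (4 * ((I.n : ℝ) ^ s / I.L)) * I.n * I.n * (8 * I.W * (I.Δ ^ 2 * Φ)) := by
        gcongr; exact H.P_le hL
    _ = ((32 * Φ : ℕ) : ℝ) * ((I.Δ : ℝ) ^ 2 * I.W * (I.n : ℝ) ^ (2 + s) / I.L) := by
        rw [Real.rpow_add hn, Real.rpow_two]; push_cast; ring
    _ ≤ _ := by gcongr

end Est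

lemma Multiplies.box {s τ : ℝ} {d C : ℕ} {p : Prog} (hp : Multiplies s τ d p C) {K : FastData}
    (hC : K.C = C) (hτ : τ = K.a / K.e) {mc : Mach} {I : Inst} {R A : ℕ}
    (hR : ∀ y, R ≤ y → ¬ p.wrR y) (hA : ∀ a, A ≤ a → ¬ p.wrA a) (R2 : 2 ≤ R) (A3 : 3 ≤ A)
    (hm : I.m = ⌈(I.n : ℝ) ^ s⌉₊) (hw : C * (Nat.log 2 I.n + 1) ≤ mc.w)
    (hX : 2 ^ (C * (Nat.log 2 I.n + 1)) ≤ mc.X) (hM : K.Z I.n ≤ mc.M) :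
    Box mc I p R A (K.Z I.n) (I.n ^ d) := by
  have he := K.he
  have h1 : (I.n : ℝ) ^ τ ≤ 2 ^ K.u I.n := by
    rw [← pow_le_pow_iff_left₀ (by positivity) (by positivity) (by omega : K.e ≠ 0), hτ,
      ← Real.rpow_mul_natCast (by positivity), div_mul_cancel₀ _ (by exact_mod_cast (by omega)),
      Real.rpow_natCast]
    exact_mod_cast (K.u_spec I.n).2 le_rfl
  have hZ : (C : ℝ) * (I.n : ℝ) ^ τ ≤ (K.Z I.n : ℕ) := by
    rw [FastData.Z, hC]; push_cast; gcongr
  refine ⟨hR, hA, R2, A3, ?_, hM, fun A B hA hB => ?_⟩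
  · exact_mod_cast (Multiplies.mul_le hp I.hn hm).trans hZ
  · obtain ⟨t, σ, h1, h2, h3⟩ := hp I.n I.m I.hn hm A B (by exact_mod_cast hA) (by exact_mod_cast hB)
    exact ⟨_, _, t, σ, h1, hw, Nat.floor_le_of_le hZ, hX, by exact_mod_cast h2.trans hZ, h3⟩

lemma Inst.tot_eq {I : Inst} {A : Matrix (Fin I.n) (Fin I.m) ℤ} {B : Matrix (Fin I.m) (Fin I.n) ℤ}
    (hf : I.f = rowMajor A) (hg : I.g = rowMajor B) (i j : Fin I.n) (k : Fin I.m) :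
    I.tot i j k = A i k + B k j := by
  rw [Inst.tot, hf, hg, rowMajor_apply, rowMajor_apply]

lemma Inst.smooth {I : Inst} {A : Matrix (Fin I.n) (Fin I.m) ℤ} {B : Matrix (Fin I.m) (Fin I.n) ℤ}
    (hf : I.f = rowMajor A) (hg : I.g = rowMajor B) (hB : BoundedDiff B I.Δ I.W) : I.Smooth := by
  intro i hi j hj k hk
  have hJ := I.mul_lt_of_lt_nb (I.div_lt_nb hj)
  have h1 := Inst.tot_eq hf hg ⟨i, hi⟩ ⟨j, hj⟩ ⟨k, hk⟩
  have h2 := Inst.tot_eq hf hg ⟨i, hi⟩ ⟨_, hJ⟩ ⟨k, hk⟩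
  simp only at h1 h2
  rw [Inst.val, h1, h2, add_sub_add_left_eq_sub]
  exact hB _ _ _ (Nat.mul_div_cancel _ I.hΔ).symm

lemma Init.inputState {I : Inst} {A : Matrix (Fin I.n) (Fin I.m) ℤ} {B : Matrix (Fin I.m) (Fin I.n) ℤ}
    (hf : I.f = rowMajor A) (hg : I.g = rowMajor B) :
    Init I (inputState [(I.n : ℤ), (I.m : ℤ), (I.Δ : ℤ), (I.W : ℤ), (I.L : ℤ)] A B) := by
  refine ⟨rfl, rfl, rfl, rfl, rfl, hf.symm, hg.symm, fun y hy => ?_, fun a ha i => ?_⟩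
  · exact List.getD_eq_default _ _ hy
  · simp only [MinPlusQuery.inputState]
    rw [if_neg (by omega), if_neg (by omega)]

lemma exists_fastData {s ε : ℝ} (hs : 1 ≤ s) (hε : 0 < ε) (a : ℕ) {e : ℕ} (he : 1 ≤ e) :
    ∃ h E : ℕ, 1 ≤ h ∧ 1 ≤ E ∧ s / h ≤ ε / 2 ∧ (1 : ℝ) / E ≤ ε / 2 ∧
      ∀ C, ∃ K : FastData, K.D = 2 ^ h ∧ K.a = a ∧ K.e = e ∧ K.C = C := by
  have key : ∀ x : ℝ, 0 < x → ∃ h : ℕ, 1 ≤ h ∧ x / h ≤ ε / 2 := fun x hx => by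
    have h0 : 0 < 2 * x / ε := by positivity
    have h1 : 1 ≤ ⌈2 * x / ε⌉₊ := Nat.one_le_ceil_iff.2 h0
    refine ⟨_, h1, ?_⟩
    have h2 : (0 : ℝ) < ⌈2 * x / ε⌉₊ := by exact_mod_cast h1
    have h3 := Nat.le_ceil (2 * x / ε)
    rw [div_le_iff₀ hε] at h3
    rw [div_le_iff₀ h2]; linarith
  obtain ⟨h, hh, hsh⟩ := key s (by linarith)
  obtain ⟨E, hE, hE2⟩ := key 1 one_pos
  have hD : 2 ≤ 2 ^ h := Nat.le_self_pow (by omega) 2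
  obtain ⟨V, d, hd, hV⟩ := exists_interpolation (2 * 2 ^ h - 1)
  obtain ⟨v, hv⟩ : ∃ v : ℕ, ∀ c < 2 * 2 ^ h - 1, ∀ x < 2 * 2 ^ h - 1, |V c x| ≤ v := by
    refine ⟨(Finset.range (2 * 2 ^ h - 1) ×ˢ Finset.range (2 * 2 ^ h - 1)).sup
      (fun x => (V x.1 x.2).natAbs), fun c hc x hx => ?_⟩
    rw [Int.abs_eq_natAbs]
    exact_mod_cast Finset.le_sup (f := fun x : ℕ × ℕ => (V x.1 x.2).natAbs) (b := (c, x))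
      (Finset.mem_product.2 ⟨Finset.mem_range.2 hc, Finset.mem_range.2 hx⟩)
  exact ⟨h, E, hh, hE, hsh, hE2, fun C =>
    ⟨⟨2 ^ h, 2 * 2 ^ h - 1, V, d, v, a, e, C, hD, by omega, hd, hV, hv, he⟩, rfl, rfl, rfl, rfl⟩⟩


section
variable {K : FastData} {R A E h b c c₀ : ℕ} {I : Inst} {s w : ℝ}

lemma Est.of_le (hs : 1 ≤ s) (hE : 1 ≤ E) (hh : 1 ≤ h) (hD : K.D = 2 ^ h)
    (hc : c = b + Nat.log 2 I.n + 1) (hW : I.W ≤ 2 ^ b) (hm : I.m = ⌈(I.n : ℝ) ^ s⌉₊)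
    (h₀ : 20000 * (K.B * K.B + K.a + K.e + E + K.D + A + R + K.C + 1) ≤ c₀) (w₁ : 2 ≤ w)
    (w₂ : s / h + (K.a : ℝ) / K.e ≤ w) (w₃ : 2 + (s / h + (1 : ℝ) / E) ≤ w) :
    Est K R A E h (b + 3) c (c₀ * c) ((c₀ * c) ^ (2 * (E + 1))) I s ((I.n : ℝ) ^ w) := by
  have hn : (1 : ℝ) ≤ I.n := by exact_mod_cast I.hn
  have hn0 : (0 : ℝ) < I.n := by linarith
  have hc1 : 1 ≤ c := by omega
  have hΔ : I.Δ ≤ 2 ^ c := I.hΔn.trans ((Nat.lt_pow_succ_log_self (by norm_num) _).le.trans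
    (Nat.pow_le_pow_right (by norm_num) (by omega)))
  have h1 : 1 ≤ c₀ * c := Nat.mul_pos (by omega) hc1
  refine ⟨hs, hE, hh, hc1, Nat.mul_le_mul_right _ h₀, by omega, by omega, ?_, ?_, Nat.one_le_pow _ _ h1,
    hD, ?_, ?_, ?_, ?_⟩
  · calc I.W * I.Δ ^ 2 ≤ 2 ^ c * (2 ^ c) ^ 2 :=
        Nat.mul_le_mul (hW.trans (Nat.pow_le_pow_right (by norm_num) (by omega))) (Nat.pow_le_pow_left hΔ 2)
      _ = 2 ^ (3 * c) := by rw [← pow_mul, ← pow_add]; congr 1; ring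
  · rw [pow_mul]
    refine Nat.pow_le_pow_left ((factorBase_le _ _).trans ?_) _
    have h2 : 4 * ((E + 1) * (b + 3 + 2)) ≤ c₀ * c := by
      calc 4 * ((E + 1) * (b + 3 + 2)) ≤ 4 * ((E + 1) * (5 * c)) := by gcongr; omega
        _ = 20 * (E + 1) * c := by ring
        _ ≤ _ := Nat.mul_le_mul_right _ (by omega)
    calc 16 * ((E + 1) * (b + 3 + 2)) ^ 2 = (4 * ((E + 1) * (b + 3 + 2))) ^ 2 := by ring
      _ ≤ _ := Nat.pow_le_pow_left h2 2
  · rw [hm]; exact ceil_rpow_le_two_mul I.hn (by linarith)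
  · rw [← Real.rpow_two]; exact Real.rpow_le_rpow_of_exponent_le hn w₁
  · rw [← Real.rpow_add hn0]; exact Real.rpow_le_rpow_of_exponent_le hn w₂
  · rw [← Real.rpow_two, ← Real.rpow_add hn0, ← Real.rpow_add hn0]
    exact Real.rpow_le_rpow_of_exponent_le hn w₃

lemma Sizes.of_le {mc : Mach} {u : ℕ} (hE : 1 ≤ E) (hc : c = b + Nat.log 2 I.n + 1) (hY : I.Y = 2 ^ b)
    (hW : I.W ≤ 2 ^ b) (hL : I.L ≤ 2 ^ b) (hm : I.m ≤ I.n ^ u)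
    (h₀ : K.B * K.B + K.v + K.B ^ K.D + K.C + 4 ^ K.e + K.d.natAbs + u + 16 ≤ c₀)
    (hfac : factorBase E (b + 3) ^ (E + 1) ≤ (c₀ * c) ^ (2 * (E + 1)))
    (hX : (2 ^ (c * ((c₀ + 1) * (2 * (E + 1))))) ^ (4 * E + 2 * K.D + K.a + 40) ≤ mc.X) :
    Sizes mc I K E (b + 3) (2 ^ (c * ((c₀ + 1) * (2 * (E + 1))))) := by
  have hc1 : 1 ≤ c := by omega
  have hpow : (2 ^ (c * (c₀ + 1))) ^ (2 * (E + 1)) = 2 ^ (c * ((c₀ + 1) * (2 * (E + 1)))) := by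
    rw [← pow_mul, mul_assoc]
  rw [← hpow] at hX ⊢
  have h1 : c₀ * c ≤ 2 ^ (c * (c₀ + 1)) := by
    calc c₀ * c ≤ 2 ^ c₀ * 2 ^ c := Nat.mul_le_mul Nat.lt_two_pow_self.le Nat.lt_two_pow_self.le
      _ = 2 ^ (c₀ * 1 + c) := by rw [← pow_add, mul_one]
      _ ≤ 2 ^ (c₀ * c + c) := Nat.pow_le_pow_right (by norm_num)
          (Nat.add_le_add_right (Nat.mul_le_mul_left _ hc1) _)
      _ = _ := by congr 1; ring
  have h2 : 2 ^ (c * (c₀ + 1)) ≤ (2 ^ (c * (c₀ + 1))) ^ (2 * (E + 1)) := Nat.le_self_pow (by omega) _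
  have h3 : c₀ ≤ (2 ^ (c * (c₀ + 1))) ^ (2 * (E + 1)) :=
    (Nat.le_mul_of_pos_right _ hc1).trans (h1.trans h2)
  have h4 : ∀ {k x}, x ≤ 2 ^ (c * k) → k ≤ c₀ + 1 → x ≤ (2 ^ (c * (c₀ + 1))) ^ (2 * (E + 1)) :=
    fun hx hk => hx.trans ((Nat.pow_le_pow_right (by norm_num) (Nat.mul_le_mul_left _ hk)).trans h2)
  have hb : 2 ^ b ≤ (2 ^ (c * (c₀ + 1))) ^ (2 * (E + 1)) :=
    h4 (k := 1) (Nat.pow_le_pow_right (by norm_num) (by omega)) (by omega)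
  obtain ⟨G, hG⟩ : ∃ G, G = (2 ^ (c * (c₀ + 1))) ^ (2 * (E + 1)) := ⟨_, rfl⟩
  rw [← hG] at hX h2 h3 h4 hb ⊢
  have h₀' : K.B * K.B + K.v + K.B ^ K.D + K.C + 4 ^ K.e ≤ c₀ ∧ K.d.natAbs ≤ c₀ ∧ u ≤ c₀ ∧ 16 ≤ c₀ := by
    generalize K.B * K.B + K.v + K.B ^ K.D + K.C + 4 ^ K.e = x at h₀ ⊢
    omega
  have hb1 := Nat.one_le_two_pow (n := b)
  have e3 : 2 ^ (b + 3) = 8 * 2 ^ b := by rw [pow_add]; ring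
  refine ⟨hE, by omega, ?_, by omega, by omega, by omega, h₀'.1.trans h3, ?_, ?_, ?_, ?_, hX⟩
  · refine h4 (k := u) (hm.trans ?_) (by omega)
    rw [pow_mul]
    exact Nat.pow_le_pow_left ((Nat.lt_pow_succ_log_self (by norm_num) _).le.trans
      (Nat.pow_le_pow_right (by norm_num) (by omega))) _
  · rw [Int.abs_eq_natAbs]; exact_mod_cast h₀'.2.1.trans h3
  · refine hfac.trans ?_
    rw [hG]; exact Nat.pow_le_pow_left h1 _
  · rw [hY, e3]; omega
  · rw [hY, e3]; omega

end

end MinPlusQuery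

open MinPlusQuery in

theorem mainTheorem3 (s : ℝ) (hs : 1 ≤ s) (ε : ℝ) (hε : 0 < ε) (c : ℝ) (hc : 0 < c) :
    ∃ (prep query : MinPlusQuery.Prog) (C κ : ℕ),
      ∀ (n m : ℕ), m = ⌈(n : ℝ) ^ s⌉₊ →
      ∀ (Δ W L b : ℕ), 1 ≤ Δ → Δ ≤ min n W → c * (Δ : ℝ) ≤ (L : ℝ) →
        W ≤ 2 ^ b → L ≤ 2 ^ b →
      ∀ (A : Matrix (Fin n) (Fin m) ℤ) (B : Matrix (Fin m) (Fin n) ℤ),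
        (∀ i k, |A i k| ≤ 2 ^ b) → (∀ k j, |B k j| ≤ 2 ^ b) →
        MinPlusQuery.BoundedDiff B Δ W →
        MinPlusQuery.SolvesQueryWitness
          (C * (b + Nat.log 2 n + 1))
          ⌊(C : ℝ) * ((b + Nat.log 2 n + 1 : ℕ) : ℝ) ^ κ *
            ((Δ : ℝ) ^ 2 * W * (n : ℝ) ^ (2 + s) / L
              + (Δ : ℝ) ^ 2 * (n : ℝ) ^ (1 + 2 * s) / L
              + (n : ℝ) ^ (2 + s) / Δ)⌋₊
          prep query [(Δ : ℤ), (W : ℤ), (L : ℤ)] A B L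
          ((C : ℝ) * ((b + Nat.log 2 n + 1 : ℕ) : ℝ) ^ κ *
            ((Δ : ℝ) ^ 2 * ((n : ℝ) ^ s / L) * W * (n : ℝ) ^ (MinPlusQuery.omega s + ε)
              + (n : ℝ) ^ (2 + s) / Δ))
          ((C : ℝ) * ((b + Nat.log 2 n + 1 : ℕ) : ℝ) ^ κ * L) := by
  obtain ⟨τ, hτ, hmul⟩ := MinPlusQuery.exists_matMulInTime hs (half_pos hε)
  have hτ1 := hmul.one_add_le
  have hω := MinPlusQuery.one_add_le_omega hs
  have hτ0 : 0 ≤ τ := by exact_mod_cast (by linarith : (0 : ℝ) ≤ τ)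
  have hτe : (τ : ℝ) = (τ.num.toNat : ℕ) / (τ.den : ℕ) := by
    have h1 : ((τ.num.toNat : ℕ) : ℤ) = τ.num := Int.toNat_of_nonneg (Rat.num_nonneg.2 hτ0)
    have h2 : ((τ.num.toNat : ℕ) : ℝ) = (τ.num : ℝ) := by exact_mod_cast congrArg (Int.cast : ℤ → ℝ) h1
    rw [h2]; exact Rat.cast_def τ
  obtain ⟨h, E, hh, hE, hsh, hE2, hK⟩ := exists_fastData hs hε τ.num.toNat τ.pos
  obtain ⟨p, C₁, hp⟩ := hmul (⌈s⌉₊ * 2 ^ h)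
  obtain ⟨K, KD, Ka, Ke, KC⟩ := hK C₁
  rw [← Ka, ← Ke] at hτe
  rw [← KD] at hp
  obtain ⟨R₀, hR₀⟩ := exists_forall_not_wrR p
  obtain ⟨A₀, hA₀⟩ := exists_forall_not_wrA p
  obtain ⟨R, hR⟩ : ∃ R, R = max R₀ 2 := ⟨_, rfl⟩
  obtain ⟨a₀, ha₀⟩ : ∃ a, a = max A₀ 3 := ⟨_, rfl⟩
  obtain ⟨c₀, hc₀⟩ : ∃ c₀, c₀ = 20000 * (K.B * K.B + K.a + K.e + E + K.D + a₀ + R + K.C + 1) +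
      (K.B * K.B + K.v + K.B ^ K.D + K.C + 4 ^ K.e + K.d.natAbs + ⌈s⌉₊ + 16) := ⟨_, rfl⟩
  have hc₁ : 20000 * (K.B * K.B + K.a + K.e + E + K.D + a₀ + R + K.C + 1) ≤ c₀ := by
    rw [hc₀]; exact Nat.le_add_right _ _
  have hc₂ : K.B * K.B + K.v + K.B ^ K.D + K.C + 4 ^ K.e + K.d.natAbs + ⌈s⌉₊ + 16 ≤ c₀ := by
    rw [hc₀]; exact Nat.le_add_left _ _
  clear hc₀
  obtain ⟨g, hg⟩ : ∃ g, g = (c₀ + 1) * (2 * (E + 1)) := ⟨_, rfl⟩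
  obtain ⟨J, hJ⟩ : ∃ J, J = 4 * E + 2 * K.D + K.a + 40 := ⟨_, rfl⟩
  have hg1 : c₀ + 1 ≤ g := by rw [hg]; exact Nat.le_mul_of_pos_right _ (by omega)
  obtain ⟨κ, hκ⟩ : ∃ κ, κ = 6 + 2 * (E + 1) * 2 := ⟨_, rfl⟩
  refine ⟨(MinPlusQuery.prep K p R a₀ E).compile, MinPlusQuery.query.compile,
    c₀ ^ κ + 17 * (g * J) + 3500, κ, ?_⟩
  obtain ⟨C, hC⟩ : ∃ C, C = c₀ ^ κ + 17 * (g * J) + 3500 := ⟨_, rfl⟩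
  rw [← hC]
  intro n m hm Δ W L b hΔ hΔ' hL hWb hLb A B hA hB hbd
  obtain ⟨q, hq⟩ : ∃ q, q = b + Nat.log 2 n + 1 := ⟨_, rfl⟩
  rw [← hq]
  obtain ⟨hΔn, hΔW⟩ := le_min_iff.1 hΔ'
  have hn : 1 ≤ n := hΔ.trans hΔn
  have hq1 : 1 ≤ q := by omega
  have hL1 : 1 ≤ L := by
    have h1 : (0 : ℝ) < c * Δ := mul_pos hc (by exact_mod_cast hΔ)
    exact_mod_cast h1.trans_le hL
  have hnm : n ≤ m := by
    rw [hm]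
    have : (n : ℝ) ≤ (n : ℝ) ^ s := by
      simpa using Real.rpow_le_rpow_of_exponent_le (by exact_mod_cast hn : (1 : ℝ) ≤ n) hs
    exact_mod_cast this.trans (Nat.le_ceil _)
  let I : Inst :=
    { n := n, m := m, Δ := Δ, W := W, L := L, f := rowMajor A, g := rowMajor B, Y := 2 ^ b, hn := hn
      hm := hn.trans hnm, hnm := hnm, hΔ := hΔ, hΔn := hΔn, hΔW := hΔW, hL := hL1
      hf := fun a => by push_cast; exact abs_rowMajor_le (by positivity) hA a
      hg := fun a => by push_cast; exact abs_rowMajor_le (by positivity) hB a }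
  have hest : Est K R a₀ E h (b + 3) q (c₀ * q) ((c₀ * q) ^ (2 * (E + 1))) I s
      ((n : ℝ) ^ (omega s + ε)) :=
    Est.of_le (I := I) hs hE hh KD hq hWb hm hc₁ (by linarith) (by rw [← hτe]; linarith)
      (by linarith)
  have hΩ : (c₀ * q) ^ 6 * ((c₀ * q) ^ (2 * (E + 1))) ^ 2 = c₀ ^ κ * q ^ κ := by
    rw [← pow_mul, ← pow_add, ← hκ, mul_pow]
  have hΩ' : ((c₀ ^ κ * q ^ κ : ℕ) : ℝ) ≤ (C : ℝ) * (q : ℝ) ^ κ := by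
    have : c₀ ^ κ * q ^ κ ≤ C * q ^ κ := Nat.mul_le_mul_right _ (by omega)
    exact_mod_cast this
  obtain ⟨k, hk⟩ : ∃ k, k = (C : ℝ) * (q : ℝ) ^ κ := ⟨_, rfl⟩
  rw [← hk] at hΩ' ⊢
  have hk0 : 0 ≤ k := le_trans (Nat.cast_nonneg _) hΩ'
  obtain ⟨T₁, hT₁⟩ : ∃ T, T = (Δ : ℝ) ^ 2 * ((n : ℝ) ^ s / L) * W * (n : ℝ) ^ (omega s + ε) := ⟨_, rfl⟩
  obtain ⟨T₂, hT₂⟩ : ∃ T, T = (n : ℝ) ^ (2 + s) / Δ := ⟨_, rfl⟩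
  obtain ⟨S₁, hS₁⟩ : ∃ T, T = (Δ : ℝ) ^ 2 * W * (n : ℝ) ^ (2 + s) / L := ⟨_, rfl⟩
  obtain ⟨S₂, hS₂⟩ : ∃ T, T = (Δ : ℝ) ^ 2 * (n : ℝ) ^ (1 + 2 * s) / L := ⟨_, rfl⟩
  have hT₁0 : 0 ≤ T₁ := by rw [hT₁]; positivity
  have hT₂0 : 0 ≤ T₂ := by rw [hT₂]; positivity
  have hS₁0 : 0 ≤ S₁ := by rw [hS₁]; positivity
  have hS₂0 : 0 ≤ S₂ := by rw [hS₂]; positivity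
  rw [← hT₁, ← hT₂, ← hS₁, ← hS₂]
  have hX16 : 16 ≤ 2 ^ (q * g * J) := by
    calc 16 = 2 ^ 4 := by norm_num
      _ ≤ _ := Nat.pow_le_pow_right (by norm_num)
        (le_trans (by omega) (Nat.le_mul_of_pos_left J (Nat.mul_pos hq1 (by omega))))
  let mc : Mach :=
    { w := C * q, M := ⌊k * (S₁ + S₂ + T₂)⌋₊, X := 2 ^ (q * g * J), hX := hX16
      hw := by
        rw [← pow_mul]
        refine Nat.pow_lt_pow_right (by norm_num) ?_
        have h1 : C * q = (c₀ ^ κ + 3500) * q + 17 * (q * g * J) := by rw [hC]; ring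
        have h2 : 1 ≤ (c₀ ^ κ + 3500) * q := Nat.mul_pos (by omega) hq1
        omega }
  have base : ((2100 * (b + 3 + 1) * (I.n * I.nb * I.m) + 310 + I.n * I.nb * I.m + K.B * K.B : ℕ) : ℝ) ≤
      k * T₂ := by
    have := hest.base_le
    rw [hΩ] at this
    rw [hT₂]
    exact this.trans (mul_le_mul_of_nonneg_right hΩ' (hT₂ ▸ hT₂0))
  have hkS : k * T₂ ≤ k * (S₁ + S₂ + T₂) := mul_le_mul_of_nonneg_left (by linarith) hk0
  have hkT : k * T₂ ≤ k * (T₁ + T₂) := mul_le_mul_of_nonneg_left (by linarith) hk0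
  have hMb : 2100 * (b + 3 + 1) * (I.n * I.nb * I.m) + 310 + I.n * I.nb * I.m + K.B * K.B ≤ mc.M :=
    Nat.le_floor (base.trans hkS)
  have hTb : 2100 * (b + 3 + 1) * (I.n * I.nb * I.m) + 310 + I.n * I.nb * I.m + K.B * K.B ≤
    ⌊k * (T₁ + T₂)⌋₊ := Nat.le_floor (base.trans hkT)
  have hM1 : I.n * I.nb * I.m ≤ mc.M := by omega
  have hmn : m ≤ n ^ ⌈s⌉₊ := hm ▸ ceil_rpow_le hn s
  have hXe : (2 ^ (q * g)) ^ J = 2 ^ (q * g * J) := (pow_mul _ _ _).symm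
  have hS : Sizes mc I K E (b + 3) (2 ^ (q * g)) := by
    rw [hg]
    refine Sizes.of_le (I := I) (u := ⌈s⌉₊) hE hq rfl hWb hLb hmn hc₂ hest.fac ?_
    rw [← hg, ← hJ, hXe]
  have hGX : 16 * 2 ^ (q * g) ≤ mc.X := by
    change _ ≤ 2 ^ (q * g * J)
    rw [show 16 = 2 ^ 4 by norm_num, ← pow_add]
    refine Nat.pow_le_pow_right (by norm_num) ?_
    have h1 : 1 ≤ q * g := Nat.mul_pos hq1 (by omega)
    have h2 : q * g * 40 ≤ q * g * J := Nat.mul_le_mul_left _ (by omega)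
    omega
  have hbox : K.Z I.n ≤ mc.M → Box mc I p R a₀ (K.Z I.n) (I.n ^ (⌈s⌉₊ * K.D)) := fun hZ => by
    have hw : C₁ * (Nat.log 2 n + 1) ≤ g * q := Nat.mul_le_mul (by omega) (by omega)
    refine Multiplies.box hp KC hτe (fun y hy => hR₀ y (by omega)) (fun a ha => hA₀ a (by omega)) (by omega)
      (by omega) hm (hw.trans (Nat.mul_le_mul_right _ ?_)) ?_ hZ
    · have : g ≤ g * J := Nat.le_mul_of_pos_right _ (by omega)
      omega
    · refine (Nat.pow_le_pow_right (by norm_num) hw).trans (le_trans ?_ hGX)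
      rw [mul_comm]; omega
  have hM3 : I.L ≤ I.m → I.P * I.n * I.n *
      (8 * I.W * (I.Δ ^ 2 * factorBase E (b + 3) ^ (E + 1))) ≤ mc.M := fun hLm => by
    have := hest.counters_le hLm
    rw [hΩ] at this
    refine Nat.le_floor (this.trans ?_)
    calc _ ≤ k * S₁ := by rw [hS₁]; exact mul_le_mul_of_nonneg_right hΩ' (hS₁ ▸ hS₁0)
      _ ≤ _ := mul_le_mul_of_nonneg_left (by linarith) hk0
  have hsm : I.Smooth := Inst.smooth (I := I) (A := A) (B := B) rfl rfl hbd
  have hgood := inputState_good (X := mc.X) (l := [(n : ℤ), (m : ℤ), (Δ : ℤ), (W : ℤ), (L : ℤ)])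
    (A := A) (B := B) (by
      intro z hz
      have g1 : m ≤ 2 ^ (q * g) := hS.m
      have g2 : W ≤ 2 ^ (q * g) := hS.W
      have g3 : L ≤ 2 ^ (q * g) := hS.L
      simp only [List.mem_cons, List.not_mem_nil, or_false] at hz
      rcases hz with rfl | rfl | rfl | rfl | rfl <;> rw [Nat.abs_cast] <;> norm_cast <;> omega)
    (fun i k => (hA i k).trans (by
      have g1 : 2 ^ b ≤ 2 ^ (q * g) := hS.Y
      exact_mod_cast g1.trans (by omega)))
    (fun i k => (hB i k).trans (by
      have g1 : 2 ^ b ≤ 2 ^ (q * g) := hS.Y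
      exact_mod_cast g1.trans (by omega)))
  obtain ⟨t, τ', σ', h1, h2, h3, h4, P, LS, win, hready, hfit⟩ := hS.prep_run hsm
    (Init.inputState (I := I) (A := A) (B := B) rfl rfl) hbox
    (by rw [pow_mul]; exact Nat.pow_le_pow_left hmn _) hM1
    (by
      have h1 : I.n ≤ I.nb * I.Δ := by
        have := Nat.lt_div_mul_add (a := n - 1) hΔ
        change n ≤ ((n - 1) / Δ + 1) * Δ
        rw [add_mul, one_mul]; omega
      calc I.n * I.n * I.m ≤ I.n * (I.nb * I.Δ) * I.m := by gcongr
        _ = I.n * I.nb * I.m * I.Δ := by ring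
        _ ≤ _ := Nat.mul_le_mul_right _ hM1)
    (by omega) hM3 (T := ⌊k * (T₁ + T₂)⌋₊) (by omega)
    (fun hLm p' p₀ d hp1 hpd hd hp0 => by
      have := hest.time_le hLm hp1 hpd hd hp0 rfl
      rw [hΩ] at this
      refine Nat.le_floor (this.trans ?_)
      rw [hT₁, hT₂]
      exact mul_le_mul_of_nonneg_right hΩ' (hT₁ ▸ hT₂ ▸ add_nonneg hT₁0 hT₂0))
    _ (Eqv.refl _) ⟨fun y _ => hgood.1 y, hgood.2⟩
  refine ⟨t, τ', h1, ?_, fun qs hqs => ?_⟩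
  · exact (Nat.le_floor_iff (by positivity)).1 h2
  have g1 : I.m ≤ 2 ^ (q * g) := hS.m
  have g2 : I.W ≤ 2 ^ (q * g) := hS.W
  have g3 : I.Y ≤ 2 ^ (q * g) := hS.Y
  have g4 := Nat.one_le_two_pow (n := q * g)
  refine serves (mc := mc) (I := I) hfit hsm (fun i j k => Inst.tot_eq (I := I) rfl rfl i j k) hM1
    (le_trans (by omega) hGX) (le_trans (by omega) hGX) ?_ ?_ qs hready h4 h3 hqs
  · refine le_trans (Nat.mul_le_mul (I.hnm.trans g1) (I.nb_le.trans (I.hnm.trans g1))) ?_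
    rw [← sq]
    change _ ≤ 2 ^ (q * g * J)
    rw [← pow_mul]
    exact Nat.pow_le_pow_right (by norm_num) (Nat.mul_le_mul_left _ (by omega))
  · rw [Nat.cast_mul]
    refine mul_le_mul_of_nonneg_right ?_ (Nat.cast_nonneg _)
    rw [hk]
    have : 3500 ≤ C * q ^ κ :=
      le_trans (by omega) (Nat.le_mul_of_pos_right C (Nat.pow_pos hq1))
    exact_mod_cast this
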